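/- **Conventions.** For $i=1,2$ let $V_i$ be a finite dimensional complex vector space, $G_i\subset \mathrm{GL}(V_i)$ a finite group generated by complex reflections (elements whose fixed space is a hyperplane), $\mathcal H_i$ the set of fixed hyperplanes of the complex reflections in $G_i$, and $D_i=\bigcup_{H\in\mathcal H_i}H$. The orbit space $G_i\backslash V_i$ is regarded as a complex-analytic space (its holomorphic functions are the $G_i$-invariant holomorphic functions), with orbit map $q_i:V_i\to G_i\backslash V_i$; the discriminant $G_i\backslash D_i=q_i(D_i)$ is a reduced analytic subspace. If $m_i$ is the order of the group of scalars in $G_i$, the effective action of $\mathbb C^\times$ on $G_i\backslash V_i$ is the one for which $t$ sends $q_i(z)$ to $q_i(cz)$, where $c$ is any $m_i$-th root of $t$ (if $V_i=0$ the action is trivial). A *Dunkl connection* on $V_1-D_1$ is a flat, torsion free, holomorphic connection on its tangent bundle of the form $\nabla=\nabla^0-\sum_{H\in\mathcal H_1}\omega_H\otimes\kappa_H\pi_H$, where $\nabla^0$ is the translation invariant connection, $\omega_H=d\phi_H/\phi_H$ for a linear equation $\phi_H$ of $H$, $\kappa_H\in\mathbb C$, and $\pi_H$ is the projection with kernel $H$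 that is orthogonal with respect to a positive definite hermitian inner product on $V_1$ not depending on $H$. Holomorphic functions whose differential is flat for the dual connection are called *affine-linear*. The *holonomy cover* $p:E\to V_1-D_1$ is the minimal connected covering on which the local system of affine-linear functions is generated by its global sections; let $\mathrm{Aff}(E)$ be the space of these global sections, $A\subset \mathrm{Aff}(E)^*$ the affine space of linear forms that take the value $1$ on the constant function $1$, and $\mathrm{ev}:E\to A$, $e\mapsto (F\mapsto F(e))$ the *developing map*. We say that a map $f:G_1\backslash V_1\to G_2\backslash V_2$ *is obtained from the developing map* of $\nabla$ if there is an affine isomorphism $\psi:A\cong V_2$ such that $f\circ q_1\circ p=q_2\circ\psi\circ\mathrm{ev}$ on $E$. The same terms are used with the roles of $1$ and $2$ interchanged. **Theorem.** Let $f:G_1\backslash V_1\to G_2\backslash V_2$ be an isomorphism of analytic spaces which maps $G_1\backslash D_1$ onto $G_2\backslash D_2$ and is equivariant for the effective $\mathbb C^\times$-actions. Then $f$ is obtained from the developing map of a $G_1$-invariant Dunkl connection on $V_1-D_1$, and likewise $f^{-1}$ is obtained from the developing map of a $G_2$-invariant Dunkl connection on $V_2-D_2$. **Corollary.** Suppose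 in addition that for $i=1,2$ the arrangement $\mathcal H_i$ is nonempty and irreducible (it is not a union of two nonempty subsets whose intersections $L,L'$ satisfy $L+L'=V_i$), and that its members have intersection $\{0\}$. If the germs of $G_1\backslash D_1$ and $G_2\backslash D_2$ at their origins $q_1(0)$, $q_2(0)$ are isomorphic as germs of (reduced) analytic spaces, then there is an isomorphism $f:G_1\backslash V_1\to G_2\backslash V_2$ of analytic spaces which maps $G_1\backslash D_1$ onto $G_2\backslash D_2$, is equivariant for the effective $\mathbb C^\times$-actions, and is obtained from the developing map of a $G_1$-invariant Dunkl connection on $V_1-D_1$, while $f^{-1}$ is obtained from the developing map of a $G_2$-invariant Dunkl connection on $V_2-D_2$. -/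

import Mathlib

open Filter Topology

universe u v w

noncomputable section

namespace DunklDuality

variable {V : Type u} [NormedAddCommGroup V] [NormedSpace ℂ V]

/-! ## Linear arrangements -/

/-- The complement `V°` of the union of the members of a collection of hyperplanes. -/
def arrComplement (ℋ : Set (Submodule ℂ V)) : Set V := {z | ∀ H ∈ ℋ, z ∉ H}

/-- An arrangement is irreducible and essential: it is nonempty, its members have intersection
`0`, and it has no splitting, that is, it is not the union of two nonempty subsets whose
intersections `L`, `L'` satisfy `L + L' = V`.  (The two subsets are then automatically disjoint,
and consist of the members containing `L`, respectively `L'`.) -/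
def IsIrreducibleEssential (ℋ : Set (Submodule ℂ V)) : Prop :=
  ℋ.Nonempty ∧ sInf ℋ = ⊥ ∧
    ∀ 𝒜 ℬ : Set (Submodule ℂ V), 𝒜.Nonempty → ℬ.Nonempty → 𝒜 ∪ ℬ = ℋ → sInf 𝒜 ⊔ sInf ℬ ≠ ⊤

/-! ## Complex reflection groups and their orbit spaces -/

/-- The fixed space of a linear automorphism. -/
def fixedSpace (g : V ≃ₗ[ℂ] V) : Submodule ℂ V :=
  LinearMap.ker ((g : V →ₗ[ℂ] V) - LinearMap.id)

/-- A complex reflection: an element of finite order whose fixed space is a hyperplane. -/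
def IsComplexReflection (g : V ≃ₗ[ℂ] V) : Prop :=
  IsOfFinOrder g ∧ Module.finrank ℂ (V ⧸ fixedSpace g) = 1

/-- `G` is generated by the complex reflections that it contains. -/
def IsReflectionGroup (G : Subgroup (V ≃ₗ[ℂ] V)) : Prop :=
  Subgroup.closure {g | g ∈ G ∧ IsComplexReflection g} = G

/-- The arrangement of the reflection hyperplanes of `G`. -/
def reflHyperplanes (G : Subgroup (V ≃ₗ[ℂ] V)) : Set (Submodule ℂ V) :=
  {H | ∃ g ∈ G, IsComplexReflection g ∧ fixedSpace g = H}

theorem reflHyperplanes_finite (G : Subgroup (V ≃ₗ[ℂ] V)) [Finite G] :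
    (reflHyperplanes G).Finite := by
  refine ((Set.toFinite (G : Set (V ≃ₗ[ℂ] V))).image fixedSpace).subset ?_
  rintro H ⟨g, hg, -, rfl⟩
  exact ⟨g, hg, rfl⟩

/-- The orbit space `G \ V`, with the quotient topology. -/
abbrev OrbitSpace (G : Subgroup (V ≃ₗ[ℂ] V)) : Type u := MulAction.orbitRel.Quotient G V

/-- The orbit map `V → G \ V`. -/
def orbitMk (G : Subgroup (V ≃ₗ[ℂ] V)) (z : V) : OrbitSpace G := Quotient.mk'' z

/-- The discriminant: the image `G \ D` in `G \ V` of the union `D` of the reflection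
hyperplanes. -/
def discriminant (G : Subgroup (V ≃ₗ[ℂ] V)) : Set (OrbitSpace G) :=
  orbitMk G '' (arrComplement (reflHyperplanes G))ᶜ

/-- The structure sheaf of the analytic space `G \ V`: a function is holomorphic at `x` (and hence
near `x`) if its pull-back to `V` is holomorphic at all the points of the orbit `x`. -/
def HolAt (G : Subgroup (V ≃ₗ[ℂ] V)) (h : OrbitSpace G → ℂ) (x : OrbitSpace G) : Prop :=
  ∀ z : V, orbitMk G z = x → AnalyticAt ℂ (fun y => h (orbitMk G y)) z

/-- The structure sheaf of the discriminant, as a reduced analytic subspace of `G \ V`: a function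
is holomorphic at `x` if near `x` it is the restriction of a holomorphic function on `G \ V`. -/
def DiscrHolAt (G : Subgroup (V ≃ₗ[ℂ] V)) (h : discriminant G → ℂ) (x : discriminant G) : Prop :=
  ∃ k : OrbitSpace G → ℂ, HolAt G k x ∧ ∀ᶠ y in 𝓝 x, h y = k y

/-- The order of the group of scalars in `G`, which is the kernel of the action of `ℂˣ` on `G \ V`
induced by scalar multiplication (for `V ≠ 0`). -/
def scalarOrder (G : Subgroup (V ≃ₗ[ℂ] V)) : ℕ :=
  Nat.card {c : ℂˣ // LinearEquiv.smulOfUnit c ∈ G}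

/-- The connection form `Ω` is invariant under the linear group `G`. -/
def IsInvariantForm (G : Subgroup (V ≃ₗ[ℂ] V)) (ℋ : Set (Submodule ℂ V))
    (Ω : V → V →L[ℂ] V →L[ℂ] V) : Prop :=
  ∀ g ∈ G, ∀ z ∈ arrComplement ℋ, ∀ u w : V, Ω (g z) (g u) (g w) = g (Ω z u w)

/-! ## Dunkl connections

A connection on the tangent bundle of `V°` is written as `∇ = ∇⁰ - Ω`, where `∇⁰` is the standard
flat connection of the vector space `V` and `Ω` is an `End V`-valued holomorphic differential on
`V°`; `Ω z u w` is its value at `z` on the tangent vector `u`, applied to `w`. -/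

/-- The connection `∇⁰ - Ω` is holomorphic, flat and torsion free on the open set `S`. -/
structure IsFlatTorsionFree (S : Set V) (Ω : V → V →L[ℂ] V →L[ℂ] V) : Prop where
  holomorphic : AnalyticOnNhd ℂ Ω S
  flat : ∀ z ∈ S, ∀ u v w : V,
    fderiv ℂ Ω z u v w - fderiv ℂ Ω z v u w = Ω z u (Ω z v w) - Ω z v (Ω z u w)
  torsion_free : ∀ z ∈ S, ∀ u v : V, Ω z u v = Ω z v u

/-- `P` is the projection with kernel `H` that is orthogonal for the inner product `c`. -/
def IsOrthProjAlong (c : InnerProductSpace.Core ℂ V) (H : Submodule ℂ V) (P : V →L[ℂ] V) : Prop :=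
  (∀ v, v - P v ∈ H) ∧ ∀ v, ∀ h ∈ H, c.inner h (P v) = 0

/-- `∇⁰ - Ω` is a Dunkl connection on the complement of the (finite) arrangement `ℋ`: it is flat,
and `Ω = ∑_H ω_H ⊗ κ_H π_H`, where `ω_H = d φ_H / φ_H` for an equation `φ_H` of `H` (the choice of
which is immaterial), `π_H` is the projection with kernel `H` that is orthogonal for one and the
same positive definite hermitian inner product, and `κ_H ∈ ℂ`. -/
def IsDunkl (ℋ : Set (Submodule ℂ V)) (Ω : V → V →L[ℂ] V →L[ℂ] V) : Prop :=
  IsFlatTorsionFree (arrComplement ℋ) Ω ∧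
  ∃ (c : InnerProductSpace.Core ℂ V) (φ : Submodule ℂ V → Module.Dual ℂ V)
    (π : Submodule ℂ V → V →L[ℂ] V) (κ : Submodule ℂ V → ℂ),
    (∀ H ∈ ℋ, LinearMap.ker (φ H) = H ∧ IsOrthProjAlong c H (π H)) ∧
    ∀ z ∈ arrComplement ℋ, ∀ u : V,
      Ω z u = ∑ᶠ H ∈ ℋ, (φ H u / φ H z * κ H) • π H

/-! ## The holonomy cover and the developing map -/

/-- `f` is affine-linear near `z` for the affine structure defined by `∇⁰ - Ω`: it is holomorphic
and its differential is flat for the dual connection (with connection form `-Ω*`) on the cotangent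
bundle. -/
def IsAffineAt (Ω : V → V →L[ℂ] V →L[ℂ] V) (f : V → ℂ) (z : V) : Prop :=
  AnalyticAt ℂ f z ∧
    ∀ᶠ y in 𝓝 z, ∀ u w : V, fderiv ℂ (fderiv ℂ f) y u w + fderiv ℂ f y (Ω y u w) = 0

theorem isAffineAt_const (Ω : V → V →L[ℂ] V →L[ℂ] V) (a : ℂ) (z : V) :
    IsAffineAt Ω (fun _ => a) z := by
  refine ⟨analyticAt_const, Eventually.of_forall fun y u w => ?_⟩
  have h : fderiv ℂ (fun _ : V => a) = fun _ => 0 := by ext y; simp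
  simp [h]

theorem IsAffineAt.add {Ω : V → V →L[ℂ] V →L[ℂ] V} {f g : V → ℂ} {z : V}
    (hf : IsAffineAt Ω f z) (hg : IsAffineAt Ω g z) : IsAffineAt Ω (fun y => f y + g y) z := by
  refine ⟨hf.1.add hg.1, ?_⟩
  filter_upwards [hf.2, hg.2, hf.1.eventually_analyticAt.eventually_nhds,
    hg.1.eventually_analyticAt.eventually_nhds] with y h1 h2 h3 h4 u w
  have h : fderiv ℂ (fun y => f y + g y) =ᶠ[𝓝 y] fun x => fderiv ℂ f x + fderiv ℂ g x := by
    filter_upwards [h3, h4] with x h5 h6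
    exact fderiv_add h5.differentiableAt h6.differentiableAt
  have e : fderiv ℂ (fderiv ℂ (fun y => f y + g y)) y
      = fderiv ℂ (fderiv ℂ f) y + fderiv ℂ (fderiv ℂ g) y := by
    rw [h.fderiv_eq]
    exact fderiv_add h3.self_of_nhds.fderiv.differentiableAt
      h4.self_of_nhds.fderiv.differentiableAt
  rw [e, h.self_of_nhds]
  simp only [add_apply]
  linear_combination h1 u w + h2 u w

theorem IsAffineAt.smul {Ω : V → V →L[ℂ] V →L[ℂ] V} {f : V → ℂ} {z : V} (a : ℂ)
    (hf : IsAffineAt Ω f z) : IsAffineAt Ω (fun y => a * f y) z := by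
  refine ⟨analyticAt_const.mul hf.1, ?_⟩
  filter_upwards [hf.2, hf.1.eventually_analyticAt.eventually_nhds] with y h1 h3 u w
  have h : fderiv ℂ (fun y => a * f y) =ᶠ[𝓝 y] fun x => a • fderiv ℂ f x := by
    filter_upwards [h3] with x h5
    exact fderiv_const_mul h5.differentiableAt a
  have e : fderiv ℂ (fderiv ℂ (fun y => a * f y)) y = a • fderiv ℂ (fderiv ℂ f) y := by
    rw [h.fderiv_eq]
    exact fderiv_fun_const_smul h3.self_of_nhds.fderiv.differentiableAt a
  rw [e, h.self_of_nhds]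
  simp only [smul_apply, smul_eq_mul]
  linear_combination a * h1 u w

variable {S : Set V} {E : Type w} [TopologicalSpace E]

/-- For a covering `p : E → S` of an open subset of `V`, the space of affine-linear functions on
`E` for the pull-back of the affine structure defined by `∇⁰ - Ω`. -/
def affFunctions (Ω : V → V →L[ℂ] V →L[ℂ] V) (p : E → S) : Submodule ℂ (E → ℂ) where
  carrier := {F | ∀ e, ∃ f : V → ℂ, IsAffineAt Ω f (p e) ∧ ∀ᶠ e' in 𝓝 e, F e' = f (p e')}
  zero_mem' e := ⟨fun _ => 0, isAffineAt_const Ω 0 _, by simp⟩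
  add_mem' {F F'} hF hF' e := by
    obtain ⟨f, hf, h⟩ := hF e
    obtain ⟨f', hf', h'⟩ := hF' e
    refine ⟨_, hf.add hf', ?_⟩
    filter_upwards [h, h'] with x hx hx'
    simp [hx, hx']
  smul_mem' a F hF e := by
    obtain ⟨f, hf, h⟩ := hF e
    refine ⟨_, hf.smul a, ?_⟩
    filter_upwards [h] with x hx
    simp [hx]

/-- The constant function `1`, as an affine-linear function on `E`. -/
def affOne (Ω : V → V →L[ℂ] V →L[ℂ] V) (p : E → S) : affFunctions Ω p :=
  ⟨fun _ => 1, fun _ => ⟨fun _ => 1, isAffineAt_const Ω 1 _, by simp⟩⟩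

/-- `p : E → S` is a holonomy cover of the affine structure on `S` defined by `∇⁰ - Ω`: a connected
covering on which the local system of affine-linear functions is generated by its global sections
(`trivial`) and which is minimal as such, i.e. on which distinct points of a fibre are separated by
the germs of the global sections (`minimal`). -/
structure IsHolonomyCover (Ω : V → V →L[ℂ] V →L[ℂ] V) (p : E → S) : Prop where
  connected : ConnectedSpace E
  covering : IsCoveringMap p
  surjective : Function.Surjective p
  trivial : ∀ e, ∀ f : V → ℂ, IsAffineAt Ω f (p e) →
    ∃ F ∈ affFunctions Ω p, ∀ᶠ e' in 𝓝 e, F e' = f (p e')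
  minimal : ∀ e₁ e₂, p e₁ = p e₂ →
    (∀ F ∈ affFunctions Ω p, ∀ f : V → ℂ, IsAffineAt Ω f (p e₁) →
      (∀ᶠ e' in 𝓝 e₁, F e' = f (p e')) → ∀ᶠ e' in 𝓝 e₂, F e' = f (p e')) → e₁ = e₂

/-- The affine space `A` of linear forms on the space of affine-linear functions on `E` that are
the identity on the constants. -/
def devTarget (Ω : V → V →L[ℂ] V →L[ℂ] V) (p : E → S) :
    AffineSubspace ℂ (Module.Dual ℂ (affFunctions Ω p)) where
  carrier := {l | l (affOne Ω p) = 1}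
  smul_vsub_vadd_mem' a l₁ l₂ l₃ h₁ h₂ h₃ := by
    simp only [Set.mem_ofPred_eq] at *
    simp [h₁, h₂, h₃]

/-- The developing map `ev : E → A`, sending `e` to the evaluation at `e`. -/
def dev (Ω : V → V →L[ℂ] V →L[ℂ] V) (p : E → S) (e : E) : devTarget Ω p :=
  ⟨(LinearMap.proj e : (E → ℂ) →ₗ[ℂ] ℂ) ∘ₗ (affFunctions Ω p).subtype, rfl⟩

instance devTarget_nonempty [h : Nonempty E] (Ω : V → V →L[ℂ] V →L[ℂ] V) (p : E → S) :
    Nonempty (devTarget Ω p) := h.map (dev Ω p)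

/-! ## Isomorphisms of orbit spaces -/

variable {V₁ : Type u} [NormedAddCommGroup V₁] [NormedSpace ℂ V₁]
  {V₂ : Type v} [NormedAddCommGroup V₂] [NormedSpace ℂ V₂]

/-- `f` is an isomorphism of the analytic spaces `G₁ \ V₁` and `G₂ \ V₂`. -/
def IsAnalyticIso (G₁ : Subgroup (V₁ ≃ₗ[ℂ] V₁)) (G₂ : Subgroup (V₂ ≃ₗ[ℂ] V₂))
    (f : OrbitSpace G₁ ≃ₜ OrbitSpace G₂) : Prop :=
  ∀ (x : OrbitSpace G₁) (h : OrbitSpace G₂ → ℂ), HolAt G₂ h (f x) ↔ HolAt G₁ (fun y => h (f y)) x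

/-- `f` is equivariant for the effective `ℂˣ`-actions on `G₁ \ V₁` and `G₂ \ V₂`.  If the group of
scalars in `G` has order `m`, then in the effective action `t` sends the orbit of `z` to that of
`c • z`, where `c` is any `m`-th root of `t`. -/
def IsEffEquivariant (G₁ : Subgroup (V₁ ≃ₗ[ℂ] V₁)) (G₂ : Subgroup (V₂ ≃ₗ[ℂ] V₂))
    (f : OrbitSpace G₁ → OrbitSpace G₂) : Prop :=
  ∀ (t c₁ c₂ : ℂˣ), c₁ ^ scalarOrder G₁ = t → c₂ ^ scalarOrder G₂ = t →
    ∀ (z₁ : V₁) (z₂ : V₂), f (orbitMk G₁ z₁) = orbitMk G₂ z₂ →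
      f (orbitMk G₁ ((c₁ : ℂ) • z₁)) = orbitMk G₂ ((c₂ : ℂ) • z₂)

/-- `f : G₁ \ V₁ → G₂ \ V₂` is an isomorphism of orbit spaces that takes the discriminant onto the
discriminant and is equivariant for the effective `ℂˣ`-actions. -/
structure IsDiscriminantIso (G₁ : Subgroup (V₁ ≃ₗ[ℂ] V₁)) (G₂ : Subgroup (V₂ ≃ₗ[ℂ] V₂))
    (f : OrbitSpace G₁ ≃ₜ OrbitSpace G₂) : Prop where
  analytic : IsAnalyticIso G₁ G₂ f
  discriminant : f '' discriminant G₁ = discriminant G₂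
  equivariant : IsEffEquivariant G₁ G₂ f

/-- `f : G₁ \ V₁ → G₂ \ V₂` is obtained from the developing map of a `G₁`-invariant Dunkl
connection on the complement of the reflection hyperplanes of `G₁`: the target `A` of the developing
map `ev` can be identified with `V₂`, as an affine space, in such a manner that the square formed by
`ev`, the projection of the holonomy cover to `G₁ \ V₁`, the orbit map of `G₂`, and `f`,
commutes. -/
def FromDevelopingMap (G₁ : Subgroup (V₁ ≃ₗ[ℂ] V₁)) (G₂ : Subgroup (V₂ ≃ₗ[ℂ] V₂))
    (f : OrbitSpace G₁ → OrbitSpace G₂) : Prop :=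
  ∃ Ω : V₁ → V₁ →L[ℂ] V₁ →L[ℂ] V₁,
    IsDunkl (reflHyperplanes G₁) Ω ∧ IsInvariantForm G₁ (reflHyperplanes G₁) Ω ∧
    ∃ (E : Type (max u v)) (_ : TopologicalSpace E) (_ : Nonempty E)
      (p : E → arrComplement (reflHyperplanes G₁)), IsHolonomyCover Ω p ∧
      ∃ ψ : devTarget Ω p ≃ᵃ[ℂ] V₂,
        ∀ e, f (orbitMk G₁ (p e)) = orbitMk G₂ (ψ (dev Ω p e))

/-- The germs at the origin of the discriminants of `G₁` and `G₂` are isomorphic, as germs of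
reduced analytic spaces. -/
def DiscriminantGermsIso (G₁ : Subgroup (V₁ ≃ₗ[ℂ] V₁)) (G₂ : Subgroup (V₂ ≃ₗ[ℂ] V₂)) : Prop :=
  ∃ (φ : OpenPartialHomeomorph (discriminant G₁) (discriminant G₂)) (o : discriminant G₁),
    o ∈ φ.source ∧ (o : OrbitSpace G₁) = orbitMk G₁ 0 ∧ (φ o : OrbitSpace G₂) = orbitMk G₂ 0 ∧
    ∀ x ∈ φ.source, ∀ h : discriminant G₂ → ℂ,
      DiscrHolAt G₂ h (φ x) ↔ DiscrHolAt G₁ (fun y => h (φ y)) x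

end DunklDuality

end

/-! Off the reflection hyperplanes a reflection group acts freely (Steinberg), so there the orbit
map of `G₂` has local holomorphic sections and `f ∘ q₁` has local holomorphic lifts `W` to `V₂`,
unique up to an element of `G₂`. A discriminant-preserving isomorphism makes every such `W` a local
biholomorphism. Declaring the lifts affine-linear therefore defines a connection on the complement
in `V₁`, with form `Ω = -(DW)⁻¹ D²W`. Linearity of `G₂` makes it independent of the lift, symmetry
of second and third derivatives makes it torsion free and flat. A connected component of the fibre
product of the complement and `V₂` over `G₂ \ V₂` is its holonomy cover, and the projection of this
component to `V₂` is the developing map.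

It remains to see that `Ω` is a Dunkl form (`IsDiscriminantIso.isDunkl`). At a generic point of a
hyperplane `H` the stabilizer in `G₁` is cyclic of some order `m`, and the same holds on the side of
`G₂` with an order `m'`. Comparing the local invariants shows that in suitable coordinates the lifts
are `(φ, h) ↦ (φ ^ (m / m'), h)` (`IsLocalDiscIso.exists_localModel`), so `φ Ω` tends to `(1 - m /
m') φ ⊗ π_H`. The order `m'` depends on `H` only. Subtract from `Ω` the sum of these polar parts.
What is left is bounded near a dense set of points of the hyperplanes, hence extends holomorphically
over the origin by the theorems of Riemann and Hartogs. Equivariance of `f` makes it homogeneous of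
negative degree, and so it vanishes.

For the corollary, the theorem of Chevalley, Shephard and Todd identifies the orbit spaces with
affine spaces on which scalars act with positive weights. An isomorphism of germs of discriminants
and its inverse are restrictions of holomorphic maps of the ambient germs. A function vanishing on
the discriminant has no linear part at the origin when the dimension is at least two, since
otherwise there would be an equivariant vector field on `V` that is nonzero at `0`; so these maps
are biholomorphic. In dimension one the discriminant is a point and a linear isomorphism does.

The resulting local isomorphism `Φ` need not be equivariant, and is replaced by its leading part.
Pull the Euler field of `V₂` back by the lifts of `Φ`. It is `G₁`-invariant and bounded near the
generic points of the hyperplanes, hence it extends to a holomorphic field on a neighbourhood of `0`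
in `V₁`. Its linear part commutes with `G₁` and so is a scalar `γ` by irreducibility; comparing
traces on the orbit spaces shows that `γ` is the quotient of the sums of the degrees, in particular
positive. The components of `Φ ∘ q₁` are eigenfunctions of this field, so the degrees `r j` of their
leading parts satisfy `γ * r j = d j` for the degrees `d j` of the invariants of `G₂`. Hence the
rescalings of `Φ` and of its inverse converge, and the limits are inverse to each other, preserve
the discriminants and intertwine the scalings. To this isomorphism the first part applies. -/

noncomputable section

namespace DunklDuality

set_option linter.unusedSectionVars false
set_option linter.style.haveILetI false

/-! ## Holomorphic functions of several variables -/

section SeveralVariables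

open Metric Set MeasureTheory

variable {E : Type*} [NormedAddCommGroup E] [NormedSpace ℂ E]
  {Y : Type*} [NormedAddCommGroup Y] [NormedSpace ℂ Y]

/-- Cauchy estimate for the derivative. -/
theorem norm_fderiv_le_of_norm_le {f : E → Y} {c : E} {r M : ℝ} (hr : 0 < r)
    (hd : DifferentiableOn ℂ f (ball c r)) (hM : ∀ x ∈ ball c r, ‖f x‖ ≤ M) :
    ‖fderiv ℂ f c‖ ≤ 2 * M / r := by
  refine Complex.norm_fderiv_le_div_of_mapsTo_ball hd (fun x hx => ?_) hr
  rw [mem_closedBall, dist_eq_norm]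
  linarith [norm_sub_le (f x) (f c), hM x hx, hM c (mem_ball_self hr)]

theorem line_sphere_compact (z₀ e : E) (r : ℝ) :
    IsCompact ((fun ζ : ℂ => z₀ + ζ • e) '' sphere 0 r) :=
  (isCompact_sphere 0 r).image (by fun_prop)

/-- Differentiability of a circle integral depending on a parameter. -/
theorem differentiableAt_circleIntegral [FiniteDimensional ℂ E] [FiniteDimensional ℂ Y]
    {F : E → Y} {w : ℂ → ℂ} {U : Set E} (hU : IsOpen U) (hF : DifferentiableOn ℂ F U) {r : ℝ}
    (hr : 0 ≤ r) (hw : ContinuousOn w (sphere 0 r)) {z₀ e : E}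
    (hz : ∀ ζ ∈ sphere (0 : ℂ) r, z₀ + ζ • e ∈ U) :
    DifferentiableAt ℂ (fun z => ∮ ζ in C(0, r), w ζ • F (z + ζ • e)) z₀ := by
  have : ProperSpace E := FiniteDimensional.proper ℂ E
  have : CompleteSpace Y := FiniteDimensional.complete ℂ Y
  have hK := line_sphere_compact z₀ e r
  -- On a compact neighbourhood of the circle inside `U` the function is bounded, and Cauchy's
  -- estimate on balls of radius `δ / 2` bounds its derivative. This is the domination needed to
  -- differentiate under the integral.
  obtain ⟨δ, hδ, hδU⟩ := hK.exists_cthickening_subset_open hU (by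
    rintro _ ⟨ζ, hζ, rfl⟩; exact hz ζ hζ)
  have hKc : IsCompact (cthickening δ ((fun ζ : ℂ => z₀ + ζ • e) '' sphere 0 r)) :=
    hK.cthickening
  obtain ⟨M, hM⟩ := hKc.exists_bound_of_continuousOn (hF.continuousOn.mono hδU)
  obtain ⟨W, hW⟩ := (isCompact_sphere (0 : ℂ) r).exists_bound_of_continuousOn hw
  have hcirc : ∀ θ : ℝ, circleMap 0 r θ ∈ sphere (0 : ℂ) r := fun θ =>
    circleMap_mem_sphere 0 hr θ
  have hmem : ∀ θ : ℝ, ∀ z ∈ ball z₀ δ, z + circleMap 0 r θ • e ∈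
      cthickening δ ((fun ζ : ℂ => z₀ + ζ • e) '' sphere 0 r) := by
    intro θ z hz'
    refine mem_cthickening_of_dist_le _ (z₀ + circleMap 0 r θ • e) δ _ ⟨_, hcirc θ, rfl⟩ ?_
    rw [dist_add_right]; exact (mem_ball.1 hz').le
  have hwc : Continuous (fun θ : ℝ => w (circleMap 0 r θ)) :=
    hw.comp_continuous (continuous_circleMap 0 r) hcirc
  have hFc : ∀ z ∈ ball z₀ δ, Continuous (fun θ : ℝ => F (z + circleMap 0 r θ • e)) := by
    intro z hz'
    refine (hF.continuousOn.mono hδU).comp_continuous (by fun_prop) fun θ => hmem θ z hz'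
  have hdc : Continuous (deriv (circleMap 0 r)) := by
    have : deriv (circleMap 0 r) = fun θ => circleMap 0 r θ * Complex.I := by
      funext θ; simp
    rw [this]; fun_prop
  let : MeasurableSpace E := borel E
  have : BorelSpace E := ⟨rfl⟩
  have key := hasFDerivAt_integral_of_dominated_of_fderiv_le (𝕜 := ℂ)
    (μ := volume.restrict (Ioc 0 (2 * Real.pi)))
    (F := fun z θ => deriv (circleMap 0 r) θ • w (circleMap 0 r θ) • F (z + circleMap 0 r θ • e))
    (F' := fun z θ => deriv (circleMap 0 r) θ • w (circleMap 0 r θ) •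
      fderiv ℂ F (z + circleMap 0 r θ • e))
    (bound := fun _ => r * (W * (2 * M / (δ / 2))))
    (x₀ := z₀) (s := ball z₀ (δ / 2)) (ball_mem_nhds _ (half_pos hδ)) ?_ ?_ ?_ ?_ ?_ ?_
  · have h2 := key.differentiableAt
    refine h2.congr_of_eventuallyEq (Eventually.of_forall fun z => ?_)
    simp only [circleIntegral]
    rw [intervalIntegral.integral_of_le Real.two_pi_pos.le]
  · filter_upwards [ball_mem_nhds z₀ hδ] with z hz'
    exact (hdc.smul (hwc.smul (hFc z hz'))).aestronglyMeasurable
  · have : Continuous fun θ => deriv (circleMap 0 r) θ • w (circleMap 0 r θ) •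
      F (z₀ + circleMap 0 r θ • e) := hdc.smul (hwc.smul (hFc z₀ (mem_ball_self hδ)))
    exact (this.integrableOn_Icc).mono_set Ioc_subset_Icc_self
  · refine hdc.aestronglyMeasurable.smul (hwc.aestronglyMeasurable.smul ?_)
    have hm : Measurable fun θ : ℝ => fderiv ℂ F (z₀ + circleMap 0 r θ • e) :=
      (measurable_fderiv ℂ F).comp (Continuous.measurable (by fun_prop))
    have : ProperSpace (E →L[ℂ] Y) := FiniteDimensional.proper ℂ _
    exact hm.aestronglyMeasurable
  · refine Eventually.of_forall fun θ z hz' => ?_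
    have h1 : ‖fderiv ℂ F (z + circleMap 0 r θ • e)‖ ≤ 2 * M / (δ / 2) := by
      have hsub : ∀ x ∈ ball (z + circleMap 0 r θ • e) (δ / 2), x ∈
          cthickening δ ((fun ζ : ℂ => z₀ + ζ • e) '' sphere 0 r) := by
        intro x hx
        have := hmem θ (x - circleMap 0 r θ • e) (by
          rw [mem_ball, dist_eq_norm] at *
          calc ‖x - circleMap 0 r θ • e - z₀‖ = ‖(x - (z + circleMap 0 r θ • e)) + (z - z₀)‖ := by
                congr 1; abel
            _ ≤ _ := norm_add_le _ _
            _ < δ := by linarith)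
        simpa using this
      exact norm_fderiv_le_of_norm_le (half_pos hδ)
        (hF.mono fun x hx => hδU (hsub x hx)) fun x hx => hM x (hsub x hx)
    rw [norm_smul, norm_smul]
    have h2 : ‖deriv (circleMap 0 r) θ‖ = r := by simp [abs_of_nonneg hr]
    rw [h2]
    have := hW _ (hcirc θ)
    have h3 : 0 ≤ W := (norm_nonneg _).trans this
    gcongr
  · exact integrable_const _
  · refine Eventually.of_forall fun θ z hz' => ?_
    have h0 : z + circleMap 0 r θ • e ∈ U :=
      hδU (hmem θ z (ball_subset_ball (by linarith) hz'))
    have h1 := ((hF.differentiableAt (hU.mem_nhds h0)).hasFDerivAt).comp z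
      ((hasFDerivAt_id z).add_const (circleMap 0 r θ • e))
    exact (h1.const_smul _).const_smul _

/-- Cauchy's formula on a small disc in the direction `v` writes the directional derivative as a
circle integral of `f`, which depends holomorphically on the base point. -/
theorem differentiableOn_fderiv_apply [FiniteDimensional ℂ E] [FiniteDimensional ℂ Y]
    {f : E → Y} {U : Set E} (hU : IsOpen U) (hf : DifferentiableOn ℂ f U) (v : E) :
    DifferentiableOn ℂ (fun x => fderiv ℂ f x v) U := by
  have : CompleteSpace Y := FiniteDimensional.complete ℂ Y
  intro x₀ hx₀
  obtain ⟨ρ, hρ, hρU⟩ := Metric.isOpen_iff.1 hU x₀ hx₀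
  obtain ⟨r, hr, hrv⟩ : ∃ r : ℝ, 0 < r ∧ r * ‖v‖ < ρ / 2 := by
    refine ⟨ρ / 2 / (‖v‖ + 1), by positivity, ?_⟩
    rw [div_mul_eq_mul_div, div_lt_iff₀ (by positivity)]
    nlinarith [norm_nonneg v]
  have hin : ∀ x ∈ ball x₀ (ρ / 2), ∀ ζ ∈ closedBall (0 : ℂ) r, x + ζ • v ∈ U := by
    intro x hx ζ hζ
    apply hρU
    rw [mem_ball, dist_eq_norm] at *
    rw [mem_closedBall, dist_zero_right] at hζ
    calc ‖x + ζ • v - x₀‖ = ‖(x - x₀) + ζ • v‖ := by congr 1; abel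
      _ ≤ ‖x - x₀‖ + ‖ζ • v‖ := norm_add_le _ _
      _ ≤ ‖x - x₀‖ + r * ‖v‖ := by rw [norm_smul]; gcongr
      _ < ρ := by linarith
  have hcau : ∀ x ∈ ball x₀ (ρ / 2), fderiv ℂ f x v =
      (2 * Real.pi * Complex.I : ℂ)⁻¹ • ∮ ζ in C(0, r), ((ζ - 0) ^ 2)⁻¹ • f (x + ζ • v) := by
    intro x hx
    have hV : IsOpen ((fun ζ : ℂ => x + ζ • v) ⁻¹' U) := hU.preimage (by fun_prop)
    have hd : DifferentiableOn ℂ (fun ζ : ℂ => f (x + ζ • v)) ((fun ζ : ℂ => x + ζ • v) ⁻¹' U) :=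
      hf.comp (by fun_prop) fun ζ hζ => hζ
    rw [Complex.two_pi_I_inv_smul_circleIntegral_sub_sq_inv_smul_of_differentiable hV
      (fun ζ hζ => hin x hx ζ hζ) hd (mem_ball_self hr)]
    have hxU : x ∈ U := by simpa using hin x hx 0 (by simp [hr.le])
    have h1 : HasFDerivAt f (fderiv ℂ f x) (x + (0 : ℂ) • v) := by
      simpa using (hf.differentiableAt (hU.mem_nhds hxU)).hasFDerivAt
    have h2 : HasDerivAt (fun ζ : ℂ => x + ζ • v) v 0 := by
      simpa using ((hasDerivAt_id (0 : ℂ)).smul_const v).const_add x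
    exact ((h1.comp_hasDerivAt (0 : ℂ) h2).deriv).symm
  have hint := differentiableAt_circleIntegral hU hf hr.le (w := fun ζ => ((ζ - 0) ^ 2)⁻¹)
    (z₀ := x₀) (e := v) (by
      refine ContinuousOn.inv₀ (by fun_prop) fun ζ hζ => ?_
      simp only [sub_zero]
      exact pow_ne_zero _ (ne_of_mem_sphere hζ hr.ne'))
    (fun ζ hζ => hin x₀ (mem_ball_self (half_pos hρ)) ζ (sphere_subset_closedBall hζ))
  refine DifferentiableAt.differentiableWithinAt ?_
  refine (hint.const_smul ((2 * Real.pi * Complex.I : ℂ)⁻¹)).congr_of_eventuallyEq ?_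
  filter_upwards [ball_mem_nhds x₀ (half_pos hρ)] with x hx
  simpa using hcau x hx

theorem contDiffOn_of_differentiableOn [FiniteDimensional ℂ E] [FiniteDimensional ℂ Y]
    {U : Set E} (hU : IsOpen U) (n : ℕ) :
    ∀ {f : E → Y}, DifferentiableOn ℂ f U → ContDiffOn ℂ n f U := by
  induction n with
  | zero => intro f hf; simpa using hf.continuousOn
  | succ n ih =>
    intro f hf
    have : ((n + 1 : ℕ) : WithTop ℕ∞) = (n : WithTop ℕ∞) + 1 := by norm_cast
    rw [this, contDiffOn_succ_iff_fderiv_of_isOpen hU]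
    refine ⟨hf, by simp, ?_⟩
    rw [contDiffOn_clm_apply]
    exact fun v => ih (differentiableOn_fderiv_apply hU hf v)

/-- Each differentiation uses up a margin `δ` and costs a factor `2 / δ`. The margin is left free so
that it can be taken to be `R / k` for the `k`-th derivative. -/
theorem norm_iteratedFDeriv_le_of_norm_le [FiniteDimensional ℂ E] [FiniteDimensional ℂ Y]
    {f : E → Y} {c : E} {R M δ : ℝ} (hδ : 0 < δ)
    (hf : DifferentiableOn ℂ f (ball c R)) (hM : ∀ x ∈ ball c R, ‖f x‖ ≤ M) (k : ℕ) :
    ∀ x, ball x (k * δ) ⊆ ball c R → x ∈ ball c R →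
      ‖iteratedFDeriv ℂ k f x‖ ≤ (2 / δ) ^ k * M := by
  induction k with
  | zero => intro x _ hx; simpa using hM x hx
  | succ k ih =>
    intro x hx hxR
    rw [← norm_fderiv_iteratedFDeriv]
    have hsub : ∀ y ∈ ball x δ, ball y (k * δ) ⊆ ball c R := by
      intro y hy
      refine Subset.trans (ball_subset_ball' ?_) hx
      push_cast; linarith [mem_ball.1 hy]
    have hmem : ∀ y ∈ ball x δ, y ∈ ball c R := by
      intro y hy
      refine hx ?_
      rw [mem_ball] at *
      push_cast
      have : (0 : ℝ) ≤ k * δ := by positivity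
      linarith
    have hcd : ContDiffOn ℂ (k + 1 : ℕ) f (ball c R) :=
      contDiffOn_of_differentiableOn isOpen_ball (k + 1) hf
    have := norm_fderiv_le_of_norm_le (f := iteratedFDeriv ℂ k f) (c := x) (M := (2 / δ) ^ k * M) hδ
      (fun y hy => ?_) (fun y hy => ih y (hsub y hy) (hmem y hy))
    · refine this.trans (le_of_eq ?_)
      rw [pow_succ]; ring
    · have h1 : ContDiffAt ℂ (k + 1 : ℕ) f y := hcd.contDiffAt (isOpen_ball.mem_nhds (hmem y hy))
      exact (h1.differentiableAt_iteratedFDeriv (by norm_cast; exact Nat.lt_succ_self k)).differentiableWithinAt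

theorem iteratedDeriv_line [FiniteDimensional ℂ E] [FiniteDimensional ℂ Y]
    {f : E → Y} {c v : E} {U : Set E} (hU : IsOpen U)
    (hf : DifferentiableOn ℂ f U) (k : ℕ) :
    ∀ ζ : ℂ, c + ζ • v ∈ U → iteratedDeriv k (fun ζ : ℂ => f (c + ζ • v)) ζ =
      iteratedFDeriv ℂ k f (c + ζ • v) (fun _ => v) := by
  induction k with
  | zero => intro ζ _; simp
  | succ k ih =>
    intro ζ hζ
    rw [iteratedDeriv_succ]
    have hev : ∀ᶠ ξ : ℂ in 𝓝 ζ, c + ξ • v ∈ U :=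
      (show Continuous fun ξ : ℂ => c + ξ • v by fun_prop).continuousAt.eventually
        (hU.mem_nhds hζ)
    have heq : iteratedDeriv k (fun ζ : ℂ => f (c + ζ • v)) =ᶠ[𝓝 ζ]
        fun ξ => iteratedFDeriv ℂ k f (c + ξ • v) (fun _ => v) := by
      filter_upwards [hev] with ξ hξ using ih ξ hξ
    rw [heq.deriv_eq]
    have h1 : ContDiffAt ℂ (k + 1 : ℕ) f (c + ζ • v) :=
      (contDiffOn_of_differentiableOn hU (k + 1) hf).contDiffAt (hU.mem_nhds hζ)
    have h2 := (h1.differentiableAt_iteratedFDeriv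
      (by norm_cast; exact Nat.lt_succ_self k)).hasFDerivAt
    have h3 : HasDerivAt (fun ζ : ℂ => c + ζ • v) v ζ := by
      simpa using ((hasDerivAt_id ζ).smul_const v).const_add c
    have h4 := h2.comp_hasDerivAt ζ h3
    have h5 := (ContinuousMultilinearMap.apply ℂ (fun _ : Fin k => E) Y
      (fun _ => v)).hasFDerivAt.comp_hasDerivAt ζ h4
    rw [iteratedFDeriv_succ_apply_left]
    exact h5.deriv

/-- **Osgood's lemma**: a holomorphic function of several variables is analytic. -/
theorem analyticAt_of_differentiableOn [FiniteDimensional ℂ E] [FiniteDimensional ℂ Y]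
    {f : E → Y} {U : Set E} (hU : IsOpen U) (hf : DifferentiableOn ℂ f U) {c : E} (hc : c ∈ U) :
    AnalyticAt ℂ f c := by
  have : CompleteSpace Y := FiniteDimensional.complete ℂ Y
  obtain ⟨ρ, hρ, hρU⟩ := Metric.isOpen_iff.1 hU c hc
  have hcont : ∀ᶠ x in 𝓝 c, ‖f x‖ < ‖f c‖ + 1 :=
    ((hf.continuousOn.continuousAt (hU.mem_nhds hc)).norm).eventually_lt_const (by linarith)
  obtain ⟨ρ', hρ', hb⟩ := Metric.eventually_nhds_iff_ball.1 hcont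
  set R := min ρ ρ' with hRdef
  have hR : 0 < R := lt_min hρ hρ'
  set M := ‖f c‖ + 1 with hMdef
  have hMpos : 0 < M := by positivity
  have hfR : DifferentiableOn ℂ f (ball c R) :=
    hf.mono ((ball_subset_ball (min_le_left _ _)).trans hρU)
  have hMR : ∀ x ∈ ball c R, ‖f x‖ ≤ M := fun x hx =>
    (hb x (ball_subset_ball (min_le_right _ _) hx)).le
  have hbound : ∀ k : ℕ, ‖iteratedFDeriv ℂ k f c‖ ≤ (k.factorial : ℝ) * ((2 * Real.exp 1 / R) ^ k * M) := by
    intro k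
    rcases Nat.eq_zero_or_pos k with rfl | hk
    · simpa using hMR c (mem_ball_self hR)
    · have hk' : (0 : ℝ) < k := by exact_mod_cast hk
      -- The `k` differentiations share the radius `R` equally. The resulting factor `k ^ k` is
      -- absorbed by `k! * e ^ k`, which leaves a geometric bound for the Taylor coefficients.
      have := norm_iteratedFDeriv_le_of_norm_le (δ := R / k) (by positivity) hfR hMR k c
        (by rw [mul_div_cancel₀ _ hk'.ne']) (mem_ball_self hR)
      refine this.trans ?_
      have h1 : (k : ℝ) ^ k ≤ k.factorial * Real.exp 1 ^ k := by
        have := Real.pow_div_factorial_le_exp k hk'.le k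
        rw [div_le_iff₀ (by positivity)] at this
        rw [← Real.exp_nat_mul, mul_one, mul_comm]
        exact this
      calc (2 / (R / k)) ^ k * M = (2 / R) ^ k * (k : ℝ) ^ k * M := by
            rw [← mul_pow]; congr 2; field_simp
        _ ≤ (2 / R) ^ k * (k.factorial * Real.exp 1 ^ k) * M := by gcongr
        _ = _ := by
            rw [show 2 * Real.exp 1 / R = (2 / R) * Real.exp 1 by ring, mul_pow]; ring
  let p : FormalMultilinearSeries ℂ E Y := fun k => (k.factorial : ℂ)⁻¹ • iteratedFDeriv ℂ k f c
  have hp : ∀ k, ‖p k‖ ≤ (2 * Real.exp 1 / R) ^ k * M := by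
    intro k
    simp only [p]
    rw [norm_smul, norm_inv, Complex.norm_natCast, inv_mul_le_iff₀ (by positivity)]
    exact hbound k
  set s : ℝ := R / (2 * Real.exp 1) with hs
  have hspos : 0 < s := by positivity
  have hsR : s ≤ R := by
    rw [hs, div_le_iff₀ (by positivity)]
    nlinarith [Real.add_one_le_exp 1]
  have hrad : ENNReal.ofReal s ≤ p.radius := by
    refine p.le_radius_of_bound (r := s.toNNReal) M fun k => ?_
    rw [Real.coe_toNNReal s hspos.le]
    have hsk : (2 * Real.exp 1 / R) ^ k * s ^ k = 1 := by
      rw [← mul_pow, hs]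
      have : 2 * Real.exp 1 / R * (R / (2 * Real.exp 1)) = 1 := by field_simp
      rw [this, one_pow]
    calc ‖p k‖ * s ^ k ≤ (2 * Real.exp 1 / R) ^ k * M * s ^ k := by
          gcongr; exact hp k
      _ = ((2 * Real.exp 1 / R) ^ k * s ^ k) * M := by ring
      _ = M := by rw [hsk, one_mul]
  refine ⟨p, ENNReal.ofReal s, hrad, ENNReal.ofReal_pos.2 hspos, fun {y} hy => ?_⟩
  have hy' : ‖y‖ < s := by
    rw [Metric.eball_ofReal, mem_ball_zero_iff] at hy; exact hy
  -- On the complex line through `c` and `c + y` the function is holomorphic on a disc of radius `t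
  -- > 1`. Its one-variable Taylor series at `ζ = 1` is the series `p` at `y`.
  obtain ⟨t, ht1, ht2⟩ : ∃ t : ℝ, 1 < t ∧ t * ‖y‖ < R := by
    rcases eq_or_lt_of_le (norm_nonneg y) with h | h
    · exact ⟨2, by norm_num, by rw [← h]; simpa using hR⟩
    · obtain ⟨t, h1, h2⟩ := exists_between (show (1 : ℝ) < R / ‖y‖ by
        rw [one_lt_div h]; linarith)
      exact ⟨t, h1, by rwa [lt_div_iff₀ h] at h2⟩
  have hline : ∀ ζ ∈ ball (0 : ℂ) t, c + ζ • y ∈ ball c R := by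
    intro ζ hζ
    rw [mem_ball_zero_iff] at hζ
    rw [mem_ball, dist_eq_norm, add_sub_cancel_left, norm_smul]
    exact (mul_le_mul_of_nonneg_right hζ.le (norm_nonneg y)).trans_lt ht2
  have hg : DifferentiableOn ℂ (fun ζ : ℂ => f (c + ζ • y)) (ball 0 t) :=
    hfR.comp (by fun_prop) hline
  have hsum := Complex.hasSum_taylorSeries_on_ball hg
    (show (1 : ℂ) ∈ ball (0 : ℂ) t by simpa using ht1)
  simp only [one_smul] at hsum
  convert! hsum using 2 with k
  rw [iteratedDeriv_line isOpen_ball hfR k 0 (by simpa using hR)]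
  simp [p]

end SeveralVariables

/-! ### Extension theorems, division by a linear form, zero sets -/

section Extension

open Metric Set

variable {E : Type*} [NormedAddCommGroup E] [NormedSpace ℂ E]
  {Y : Type*} [NormedAddCommGroup Y]

/-- The complement of a finite union of proper subspaces is dense. -/
theorem dense_compl_iUnion_submodule [FiniteDimensional ℂ E] {𝒮 : Set (Submodule ℂ E)}
    (hfin : 𝒮.Finite) (hne : ∀ L ∈ 𝒮, L ≠ ⊤) : Dense {z : E | ∀ L ∈ 𝒮, z ∉ L} := by
  have : CompleteSpace E := FiniteDimensional.complete ℂ E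
  have h : {z : E | ∀ L ∈ 𝒮, z ∉ L} = ⋂ L ∈ 𝒮, (L : Set E)ᶜ := by ext; simp
  rw [h]
  refine dense_biInter_of_isOpen (fun L _ => ?_) hfin.countable fun L hL => ?_
  · exact (L.closed_of_finiteDimensional).isOpen_compl
  · rw [← interior_eq_empty_iff_dense_compl]
    by_contra hcon
    exact hne L hL (L.eq_top_of_nonempty_interior' (nonempty_iff_ne_empty.2 hcon))

theorem isOpen_compl_iUnion_submodule [FiniteDimensional ℂ E] {𝒮 : Set (Submodule ℂ E)}
    (hfin : 𝒮.Finite) : IsOpen {z : E | ∀ L ∈ 𝒮, z ∉ L} := by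
  have h : {z : E | ∀ L ∈ 𝒮, z ∉ L} = ⋂ L ∈ 𝒮, (L : Set E)ᶜ := by ext; simp
  rw [h]
  exact hfin.isOpen_biInter fun L _ => (L.closed_of_finiteDimensional).isOpen_compl

/-- `F` is bounded near `z`, off the hyperplanes `φ j = 0`. -/
def BddNear {ι : Type*} (φ : ι → E →L[ℂ] ℂ) (F : E → Y) (z : E) : Prop :=
  ∃ M : ℝ, ∀ᶠ y in 𝓝 z, (∀ j, φ j y ≠ 0) → ‖F y‖ ≤ M

theorem isOpen_bddNear {ι : Type*} (φ : ι → E →L[ℂ] ℂ) (F : E → Y) :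
    IsOpen {z | BddNear φ F z} := by
  rw [isOpen_iff_mem_nhds]
  rintro z ⟨M, hM⟩
  filter_upwards [hM.eventually_nhds] with y hy using ⟨M, hy⟩

variable [NormedSpace ℂ Y]

/-- If Cauchy's formula on a circle in a fixed direction holds on a dense set of points, then the
function extends analytically. -/
theorem exists_analyticAt_of_cauchy [FiniteDimensional ℂ E] [FiniteDimensional ℂ Y]
    {F : E → Y} {z₀ e : E} {r : ℝ} (hr : 0 < r)
    (hc : ∀ ζ ∈ sphere (0 : ℂ) r, AnalyticAt ℂ F (z₀ + ζ • e)) {T : Set E}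
    (hT : ∀ᶠ z in 𝓝 z₀, z ∈ closure T)
    (hF : ∀ᶠ z in 𝓝 z₀, z ∈ T →
      (2 * Real.pi * Complex.I : ℂ)⁻¹ • ∮ ζ in C(0, r), ζ⁻¹ • F (z + ζ • e) = F z) :
    ∃ G : E → Y, AnalyticAt ℂ G z₀ ∧ ∀ᶠ z in 𝓝 z₀, ContinuousAt F z → F z = G z := by
  have : CompleteSpace Y := FiniteDimensional.complete ℂ Y
  set U : Set E := {x | AnalyticAt ℂ F x} with hUdef
  have hU : IsOpen U := isOpen_analyticAt ℂ F
  have hFU : DifferentiableOn ℂ F U := fun x hx =>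
    (show AnalyticAt ℂ F x from hx).differentiableAt.differentiableWithinAt
  set G : E → Y := fun z =>
    (2 * Real.pi * Complex.I : ℂ)⁻¹ • ∮ ζ in C(0, r), ζ⁻¹ • F (z + ζ • e) with hG
  have hN : ∀ᶠ z in 𝓝 z₀, ∀ ζ ∈ sphere (0 : ℂ) r, z + ζ • e ∈ U := by
    refine (isCompact_sphere (0 : ℂ) r).eventually_forall_of_forall_eventually fun ζ hζ => ?_
    exact (show Continuous fun p : E × ℂ => p.1 + p.2 • e by fun_prop).continuousAt.eventually
      (hU.mem_nhds (hc ζ hζ))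
  have hGd : ∀ z, (∀ ζ ∈ sphere (0 : ℂ) r, z + ζ • e ∈ U) → DifferentiableAt ℂ G z := by
    intro z hz
    refine (differentiableAt_circleIntegral hU hFU hr.le ?_ hz).const_smul _
    exact continuousOn_id.inv₀ fun ζ hζ => ne_of_mem_sphere hζ hr.ne'
  obtain ⟨N, hNsub, hNo, hzN⟩ := _root_.mem_nhds_iff.1 hN
  have hGa : AnalyticAt ℂ G z₀ := analyticAt_of_differentiableOn hNo
    (fun z hz => (hGd z (hNsub hz)).differentiableWithinAt) hzN
  refine ⟨G, hGa, ?_⟩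
  filter_upwards [hT, hF.eventually_nhds, hGa.eventually_analyticAt] with z h1 h2 h3 h4
  have hne : (𝓝[T] z).NeBot := mem_closure_iff_nhdsWithin_neBot.1 h1
  have h5 : Tendsto F (𝓝[T] z) (𝓝 (F z)) := h4.tendsto.mono_left nhdsWithin_le_nhds
  have h6 : Tendsto G (𝓝[T] z) (𝓝 (G z)) := h3.continuousAt.tendsto.mono_left nhdsWithin_le_nhds
  have h7 : G =ᶠ[𝓝[T] z] F := eventually_nhdsWithin_iff.2 h2
  exact tendsto_nhds_unique h5 (h6.congr' h7)

/-- Removal of finitely many singularities of a function of one variable. -/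
theorem exists_removable_extension [CompleteSpace Y] {g : ℂ → Y} {S U : Set ℂ} (hS : S.Finite)
    (hU : IsOpen U) (hd : ∀ ζ ∈ U, ζ ∉ S → DifferentiableAt ℂ g ζ)
    (hb : ∀ s ∈ S, s ∈ U → Tendsto (fun ζ => (ζ - s) • g ζ) (𝓝[≠] s) (𝓝 0)) :
    ∃ G : ℂ → Y, (∀ ζ ∈ U, DifferentiableAt ℂ G ζ) ∧ ∀ ζ ∈ U, ζ ∉ S → G ζ = g ζ := by
  have hreg : ∀ ζ ∈ U, ζ ∉ S → limUnder (𝓝[≠] ζ) g = g ζ := fun ζ hζ hζS =>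
    ((hd ζ hζ hζS).continuousAt.tendsto.mono_left nhdsWithin_le_nhds).limUnder_eq
  refine ⟨fun ζ => limUnder (𝓝[≠] ζ) g, fun s hs => ?_, hreg⟩
  have hev : ∀ᶠ ζ in 𝓝[≠] s, ζ ∈ U ∧ ζ ∉ S := by
    have h1 : (S \ {s})ᶜ ∈ 𝓝 s := (hS.subset sdiff_subset).isClosed.isOpen_compl.mem_nhds (by simp)
    filter_upwards [nhdsWithin_le_nhds h1, nhdsWithin_le_nhds (hU.mem_nhds hs),
      self_mem_nhdsWithin] with ζ h2 h3 h4
    exact ⟨h3, fun h => h2 ⟨h, h4⟩⟩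
  by_cases hsS : s ∈ S
  · rw [eventually_nhdsWithin_iff] at hev
    have hlo : (fun z => g z - g s) =o[𝓝[≠] s] fun z => (z - s)⁻¹ := by
      rw [Asymptotics.isLittleO_iff]
      intro c hc
      have h0 := hb s hsS hs
      have h1 : Tendsto (fun ζ => (ζ - s) • g s) (𝓝[≠] s) (𝓝 0) := by
        have : Tendsto (fun ζ => (ζ - s) • g s) (𝓝 s) (𝓝 ((s - s) • g s)) :=
          (show Continuous fun ζ : ℂ => (ζ - s) • g s by fun_prop).tendsto s
        simpa using this.mono_left nhdsWithin_le_nhds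
      have h2 := (h0.sub h1).norm
      simp only [sub_zero, norm_zero] at h2
      filter_upwards [h2.eventually_le_const hc, self_mem_nhdsWithin] with z hz hne
      rw [← smul_sub, norm_smul] at hz
      have : 0 < ‖z - s‖ := norm_pos_iff.2 (sub_ne_zero.2 hne)
      rw [norm_inv, ← div_eq_mul_inv, le_div_iff₀ this, mul_comm]
      exact hz
    have hD : DifferentiableOn ℂ g ({z | z ∈ ({s}ᶜ : Set ℂ) → z ∈ U ∧ z ∉ S} \ {s}) := fun z hz =>
      (hd z (hz.1 hz.2).1 (hz.1 hz.2).2).differentiableWithinAt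
    have H := Complex.differentiableOn_update_limUnder_of_isLittleO hev hD hlo
    refine (H.differentiableAt hev).congr_of_eventuallyEq ?_
    filter_upwards [hev] with z hz
    by_cases hzs : z = s
    · subst hzs; simp
    · rw [Function.update_of_ne hzs]
      exact hreg z (hz hzs).1 (hz hzs).2
  · refine (hd s hs hsS).congr_of_eventuallyEq ?_
    have : Sᶜ ∈ 𝓝 s := hS.isClosed.isOpen_compl.mem_nhds hsS
    filter_upwards [this, hU.mem_nhds hs] with z h1 h2 using hreg z h2 h1

/-- Cauchy's formula for the extension over the removable singularities. Keeping `S` off the circle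
and off the centre allows the formula to be stated for `g` itself. -/
theorem cauchy_formula_of_removable [CompleteSpace Y] {g : ℂ → Y} {S U : Set ℂ} (hS : S.Finite)
    (hU : IsOpen U) (hd : ∀ ζ ∈ U, ζ ∉ S → DifferentiableAt ℂ g ζ)
    (hb : ∀ s ∈ S, s ∈ U → Tendsto (fun ζ => (ζ - s) • g ζ) (𝓝[≠] s) (𝓝 0))
    {r : ℝ} (hr : 0 < r) (hrU : closedBall 0 r ⊆ U) (hSr : ∀ s ∈ S, ‖s‖ ≠ r) (h0 : (0 : ℂ) ∉ S) :
    (2 * Real.pi * Complex.I : ℂ)⁻¹ • ∮ ζ in C(0, r), ζ⁻¹ • g ζ = g 0 := by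
  obtain ⟨G, hG, hGg⟩ := exists_removable_extension hS hU hd hb
  have h1 := Complex.two_pi_I_inv_smul_circleIntegral_sub_inv_smul_of_differentiable_on_off_countable
    (f := G) (s := ∅) countable_empty (mem_ball_self hr : (0 : ℂ) ∈ ball 0 r)
    (fun ζ hζ => (hG ζ (hrU hζ)).continuousAt.continuousWithinAt)
    (fun ζ hζ => hG ζ (hrU (ball_subset_closedBall hζ.1)))
  rw [hGg 0 (hrU (by simp [hr.le])) h0] at h1
  rw [← h1]
  congr 1
  refine circleIntegral.integral_congr hr.le fun ζ hζ => ?_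
  have hn : ‖ζ‖ = r := by simpa using hζ
  rw [hGg ζ (hrU (sphere_subset_closedBall hζ)) fun h => hSr ζ h hn, sub_zero]

/-- Riemann and Hartogs extension: a function that is analytic off a central arrangement extends
analytically near the centre if it is bounded near the points of a dense subset of the union of the
hyperplanes. -/
theorem exists_analyticAt_of_bddNear [FiniteDimensional ℂ E] [FiniteDimensional ℂ Y]
    {ι : Type*} [Finite ι] {φ : ι → E →L[ℂ] ℂ} (hφ : ∀ i, φ i ≠ 0) {F : E → Y} {z₀ : E}
    (h0 : ∀ i, φ i z₀ = 0) (ha : ∀ᶠ z in 𝓝 z₀, (∀ i, φ i z ≠ 0) → AnalyticAt ℂ F z)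
    (hb : ∀ i, ∀ᶠ z in 𝓝 z₀, φ i z = 0 → z ∈ closure {y | φ i y = 0 ∧ BddNear φ F y}) :
    ∃ G : E → Y, AnalyticAt ℂ G z₀ ∧ ∀ᶠ z in 𝓝 z₀, (∀ i, φ i z ≠ 0) → F z = G z := by
  have : CompleteSpace Y := FiniteDimensional.complete ℂ Y
  have : CompleteSpace E := FiniteDimensional.complete ℂ E
  -- A direction transverse to all the hyperplanes: each line in this direction meets each
  -- hyperplane exactly once, the `i`-th one at `pr i z` below.
  obtain ⟨e, he⟩ : ∃ e : E, ∀ i, φ i e ≠ 0 := by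
    have hd := dense_compl_iUnion_submodule (E := E)
      (𝒮 := range fun i => LinearMap.ker (φ i : E →ₗ[ℂ] ℂ)) (finite_range _) (by
        rintro _ ⟨i, rfl⟩ h
        exact hφ i (by ext z; simpa using LinearMap.congr_fun (LinearMap.ker_eq_top.1 h) z))
    obtain ⟨e, he⟩ := hd.nonempty
    exact ⟨e, fun i hi => he _ ⟨i, rfl⟩ hi⟩
  -- a ball on which all the hypotheses hold
  obtain ⟨ε, hε, hball⟩ := Metric.eventually_nhds_iff_ball.1 (ha.and (eventually_all.2 hb))
  obtain ⟨r, hr, hre⟩ : ∃ r : ℝ, 0 < r ∧ 2 * r * ‖e‖ < ε / 2 := by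
    refine ⟨ε / 4 / (‖e‖ + 1), by positivity, ?_⟩
    have : 2 * (ε / 4 / (‖e‖ + 1)) * ‖e‖ = (ε / 2) * (‖e‖ / (‖e‖ + 1)) := by field_simp; ring
    rw [this]
    have h2 : ‖e‖ / (‖e‖ + 1) < 1 := by rw [div_lt_one (by positivity)]; linarith
    nlinarith
  let pr : ι → E → E := fun i z => z - (φ i z / φ i e) • e
  have hprc : ∀ i, Continuous (pr i) := fun i => by fun_prop
  have hpr0 : ∀ i z, φ i (pr i z) = 0 := fun i z => by
    simp only [pr, map_sub, map_smul, smul_eq_mul]; field_simp [he i]; simp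
  have hprz : ∀ i, pr i z₀ = z₀ := fun i => by simp [pr, h0 i]
  -- points near `z₀` with small parameters
  have hNev : ∀ᶠ z in 𝓝 z₀, z ∈ ball z₀ (ε / 2) ∧ ∀ i, pr i z ∈ ball z₀ ε ∧ ‖φ i z / φ i e‖ < r := by
    refine (eventually_mem_set.2 (ball_mem_nhds z₀ (half_pos hε))).and (eventually_all.2 fun i => ?_)
    refine ((hprc i).continuousAt.eventually (by rw [hprz i]; exact ball_mem_nhds z₀ hε)).and ?_
    have : Continuous fun z => ‖φ i z / φ i e‖ := by fun_prop
    exact this.continuousAt.eventually_lt_const (by simp [h0 i, hr])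
  obtain ⟨N, hNsub, hNo, hzN⟩ := _root_.mem_nhds_iff.1 hNev
  -- For `z` in all the sets `A i`, the line through `z` in the direction `e` meets the hyperplanes
  -- only at points where `F` is bounded. There the singularities on the line are removable, so
  -- Cauchy's formula holds at `z`.
  let A : ι → Set E := fun i => {z | φ i z ≠ 0 ∧ BddNear φ F (pr i z)}
  have hAo : ∀ i, IsOpen (A i) := fun i =>
    (isOpen_ne_fun (φ i).continuous continuous_const).inter
      ((isOpen_bddNear φ F).preimage (hprc i))
  have hAd : ∀ i, N ⊆ closure (A i) := by
    intro i z hz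
    have h1 := (hball _ ((hNsub hz).2 i).1).2 i (hpr0 i z)
    rw [mem_closure_iff_nhds] at h1 ⊢
    intro O hO
    have hcont : ContinuousAt (fun p : E × ℂ => p.1 + p.2 • e) (pr i z, φ i z / φ i e) := by fun_prop
    have h2 : ∀ᶠ p in 𝓝 (pr i z, φ i z / φ i e), p.1 + p.2 • e ∈ O :=
      hcont.eventually (by simpa [pr] using hO)
    rw [nhds_prod_eq] at h2
    obtain ⟨P, hP, Q, hQ, hPQ⟩ := Filter.mem_prod_iff.1 h2
    obtain ⟨y, hyP, hy0, hyb⟩ := h1 P hP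
    obtain ⟨c, hcQ, hc0⟩ : ∃ c ∈ Q, c ≠ 0 :=
      ((dense_compl_singleton (0 : ℂ)).inter_nhds_nonempty hQ).imp fun c hc => ⟨hc.2, hc.1⟩
    refine ⟨y + c • e, hPQ (show (y, c) ∈ P ×ˢ Q from ⟨hyP, hcQ⟩), ?_, ?_⟩
    · simp [hy0, hc0, he i]
    · have : pr i (y + c • e) = y := by simp [pr, hy0, he i]
      rw [this]; exact hyb
  set T : Set E := ⋂ i, A i with hTdef
  have hTd : N ⊆ closure T := by
    -- The `A i` are dense only in `N`. Adding the exterior of `N` makes them dense everywhere, so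
    -- that their intersection can be handled by Baire's theorem.
    have hd : Dense (⋂ i, (A i ∪ (closure N)ᶜ)) := by
      refine dense_iInter_of_isOpen (fun i => (hAo i).union isClosed_closure.isOpen_compl)
        fun i => ?_
      intro z
      by_cases hz : z ∈ closure N
      · exact closure_mono subset_union_left (closure_minimal (hAd i) isClosed_closure hz)
      · exact subset_closure (Or.inr hz)
    intro z hz
    rw [mem_closure_iff_nhds]
    intro O hO
    obtain ⟨y, hy1, hy2, hy3⟩ := hd.inter_nhds_nonempty (inter_mem hO (hNo.mem_nhds hz))
    refine ⟨y, hy2, mem_iInter.2 fun i => ?_⟩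
    exact ((mem_iInter.1 hy1) i).resolve_right fun h => h (subset_closure hy3)
  have hin : ∀ z ∈ N, ∀ ζ ∈ ball (0 : ℂ) (2 * r), z + ζ • e ∈ ball z₀ ε := by
    intro z hz ζ hζ
    have h1 := (hNsub hz).1
    rw [mem_ball, dist_eq_norm] at *
    rw [sub_zero] at hζ
    calc ‖z + ζ • e - z₀‖ = ‖(z - z₀) + ζ • e‖ := by congr 1; abel
      _ ≤ ‖z - z₀‖ + ‖ζ‖ * ‖e‖ := by rw [← norm_smul]; exact norm_add_le _ _
      _ ≤ ‖z - z₀‖ + 2 * r * ‖e‖ := by gcongr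
      _ < ε := by linarith
  obtain ⟨G, hGa, hGF⟩ := exists_analyticAt_of_cauchy (F := F) (z₀ := z₀) (e := e) hr (T := T)
    (fun ζ hζ => by
      have hζ' : ‖ζ‖ = r := by simpa using hζ
      refine (hball _ (hin z₀ hzN ζ (by simp [hζ']; linarith))).1 fun i => ?_
      have : ζ ≠ 0 := ne_of_mem_sphere hζ hr.ne'
      simp [h0 i, this, he i])
    (by filter_upwards [hNo.mem_nhds hzN] with z hz using hTd hz)
    (by
      filter_upwards [hNo.mem_nhds hzN] with z hz hzT
      have hlin : ∀ ζ : ℂ, ∀ i, φ i (z + ζ • e) = 0 ↔ ζ = -(φ i z / φ i e) := by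
        intro ζ i
        have hei := he i
        simp only [map_add, map_smul, smul_eq_mul]
        constructor
        · intro h
          field_simp
          linear_combination h
        · rintro rfl; field_simp; simp
      have := cauchy_formula_of_removable (g := fun ζ => F (z + ζ • e))
        (S := range fun i => -(φ i z / φ i e)) (U := ball 0 (2 * r)) (finite_range _) isOpen_ball
        (fun ζ hζ hζS => by
          have h1 : AnalyticAt ℂ F (z + ζ • e) := (hball _ (hin z hz ζ hζ)).1 fun i h =>
            hζS ⟨i, ((hlin ζ i).1 h).symm⟩
          exact h1.differentiableAt.comp ζ (by fun_prop))
        (by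
          rintro _ ⟨i, rfl⟩ _
          obtain ⟨M, hM⟩ := (mem_iInter.1 hzT i).2
          have hb1 : ∀ᶠ ζ in 𝓝[≠] (-(φ i z / φ i e)), ‖F (z + ζ • e)‖ ≤ M := by
            have hc1 : Tendsto (fun ζ : ℂ => z + ζ • e) (𝓝 (-(φ i z / φ i e))) (𝓝 (pr i z)) := by
              have : Continuous fun ζ : ℂ => z + ζ • e := by fun_prop
              convert! this.tendsto (-(φ i z / φ i e)) using 2
              simp [pr, sub_eq_add_neg]
            have hfin : ((range fun j => -(φ j z / φ j e)) \ {-(φ i z / φ i e)})ᶜ ∈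
                𝓝 (-(φ i z / φ i e)) :=
              ((finite_range _).subset sdiff_subset).isClosed.isOpen_compl.mem_nhds (by simp)
            filter_upwards [nhdsWithin_le_nhds (hc1.eventually hM), nhdsWithin_le_nhds hfin,
              self_mem_nhdsWithin] with ζ h1 h2 h3
            exact h1 fun j hj => h2 ⟨⟨j, ((hlin ζ j).1 hj).symm⟩, h3⟩
          have hz0 : Tendsto (fun ζ : ℂ => ζ - -(φ i z / φ i e)) (𝓝[≠] (-(φ i z / φ i e)))
              (𝓝 0) := by
            have : Continuous fun ζ : ℂ => ζ - -(φ i z / φ i e) := by fun_prop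
            simpa using (this.tendsto (-(φ i z / φ i e))).mono_left nhdsWithin_le_nhds
          exact hz0.zero_smul_isBoundedUnder_le ⟨M, by simpa using hb1⟩)
        hr (closedBall_subset_ball (by linarith))
        (by rintro _ ⟨i, rfl⟩; rw [norm_neg]; exact (((hNsub hz).2 i).2).ne)
        (by
          rintro ⟨i, hi⟩
          have h2 := (mem_iInter.1 hzT i).1
          simp only [neg_eq_zero, div_eq_zero_iff, he i, or_false] at hi
          exact h2 hi)
      simpa using this)
  refine ⟨G, hGa, ?_⟩
  filter_upwards [hGF, ha] with z h1 h2 h3 using h1 (h2 h3).continuousAt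

/-- Division of an analytic function that vanishes on a hyperplane by an equation. -/
theorem exists_analyticAt_eq_mul [FiniteDimensional ℂ E] [FiniteDimensional ℂ Y]
    {φ : E →L[ℂ] ℂ} (hφ : φ ≠ 0) {F : E → Y} {z₀ : E}
    (h0 : φ z₀ = 0) (hF : AnalyticAt ℂ F z₀) (hv : ∀ᶠ z in 𝓝 z₀, φ z = 0 → F z = 0) :
    ∃ C : E → Y, AnalyticAt ℂ C z₀ ∧ ∀ᶠ z in 𝓝 z₀, F z = φ z • C z := by
  have : CompleteSpace Y := FiniteDimensional.complete ℂ Y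
  obtain ⟨e, he⟩ : ∃ e, φ e ≠ 0 := by
    by_contra h; push Not at h; exact hφ (by ext z; simpa using h z)
  let pr : E → E := fun z => z - (φ z / φ e) • e
  have hprc : Continuous pr := by fun_prop
  have hpr0 : ∀ z, φ (pr z) = 0 := fun z => by
    simp only [pr, map_sub, map_smul, smul_eq_mul]; field_simp [he]; simp
  have hbdd : ∀ z₁, AnalyticAt ℂ F z₁ → (∀ᶠ z in 𝓝 z₁, φ z = 0 → F z = 0) → φ z₁ = 0 →
      BddNear (fun _ : Unit => φ) (fun z => (φ z)⁻¹ • F z) z₁ := by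
    intro z₁ h1 h2 h3
    -- The function is Lipschitz near `z₁` and vanishes at the projection of `y` to the hyperplane
    -- along `e`, at a distance proportional to `φ y`. Hence the quotient by `φ` is bounded.
    obtain ⟨K, s, hs, hL⟩ := (h1.contDiffAt (n := 1)).exists_lipschitzOnWith
    have hpr1 : pr z₁ = z₁ := by simp [pr, h3]
    refine ⟨K * (‖e‖ / ‖φ e‖), ?_⟩
    filter_upwards [hs, hprc.continuousAt.eventually (by rw [hpr1]; exact hs),
      hprc.continuousAt.eventually (by rw [hpr1]; exact h2)] with y hy1 hy2 hy3 hy4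
    have hy5 : φ y ≠ 0 := hy4 ()
    have h4 := hL.dist_le_mul y hy1 (pr y) hy2
    rw [hy3 (hpr0 y), dist_zero_right, dist_eq_norm] at h4
    have h5 : y - pr y = (φ y / φ e) • e := by simp [pr]
    rw [h5, norm_smul, norm_div] at h4
    rw [norm_smul, norm_inv, inv_mul_le_iff₀ (norm_pos_iff.2 hy5)]
    refine h4.trans (le_of_eq ?_)
    ring
  have hall : ∀ᶠ z in 𝓝 z₀, φ z = 0 → BddNear (fun _ : Unit => φ) (fun z => (φ z)⁻¹ • F z) z := by
    filter_upwards [hF.eventually_analyticAt, hv.eventually_nhds] with z h1 h2 h3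
      using hbdd z h1 h2 h3
  obtain ⟨G, hG, hGF⟩ := exists_analyticAt_of_bddNear (φ := fun _ : Unit => φ) (fun _ => hφ)
    (F := fun z => (φ z)⁻¹ • F z) (z₀ := z₀) (fun _ => h0)
    (by
      filter_upwards [hF.eventually_analyticAt] with z h1 h2
      exact ((φ.analyticAt z).inv (h2 ())).smul h1)
    (fun _ => by
      filter_upwards [hall] with z hz h
      exact subset_closure ⟨h, hz h⟩)
  refine ⟨G, hG, ?_⟩
  filter_upwards [hv, hGF] with z h1 h2
  by_cases hz : φ z = 0
  · rw [h1 hz, hz, zero_smul]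
  · rw [← h2 fun _ => hz, smul_smul, mul_inv_cancel₀ hz, one_smul]

/-- On the line from `x₀` to a nearby point where `Δ` is nonzero, the identity theorem isolates the
zero at `x₀`, if it is one. The radius is then shrunk to make the disc short. -/
theorem exists_isolated_direction {Δ : E → ℂ} {x₀ : E} (hΔ : AnalyticAt ℂ Δ x₀)
    {P : E → Prop} (hP : ∃ᶠ x in 𝓝 x₀, Δ x ≠ 0 ∧ P (x - x₀)) {ε : ℝ} (hε : 0 < ε) :
    ∃ e : E, P e ∧ ∃ r : ℝ, 0 < r ∧ r * ‖e‖ < ε ∧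
      ∀ ζ ∈ closedBall (0 : ℂ) r, ζ ≠ 0 → Δ (x₀ + ζ • e) ≠ 0 := by
  obtain ⟨ρ, hρ, hball⟩ := Metric.eventually_nhds_iff_ball.1 hΔ.eventually_analyticAt
  obtain ⟨x₁, ⟨hx1, hx2⟩, hx3⟩ := (hP.and_eventually (ball_mem_nhds x₀ hρ)).exists
  refine ⟨x₁ - x₀, hx2, ?_⟩
  set e := x₁ - x₀
  have hen : ‖e‖ < ρ := by simpa [dist_eq_norm, e] using hx3
  have hV : IsOpen ((fun ζ : ℂ => x₀ + ζ • e) ⁻¹' ball x₀ ρ) := isOpen_ball.preimage (by fun_prop)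
  have hconv : IsPreconnected (ball (0 : ℂ) (1 + 1) ∩ (fun ζ : ℂ => x₀ + ζ • e) ⁻¹' ball x₀ ρ) := by
    refine Convex.isPreconnected (Convex.inter (convex_ball _ _) ?_)
    intro a ha b hb s t hs ht hst
    simp only [mem_preimage, mem_ball, dist_eq_norm, add_sub_cancel_left, norm_smul] at *
    calc ‖s • a + t • b‖ * ‖e‖ ≤ (s * ‖a‖ + t * ‖b‖) * ‖e‖ := by
          gcongr
          refine (norm_add_le _ _).trans ?_
          rw [norm_smul, norm_smul, Real.norm_of_nonneg hs, Real.norm_of_nonneg ht]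
      _ = s * (‖a‖ * ‖e‖) + t * (‖b‖ * ‖e‖) := by ring
      _ < ρ := by
          rcases eq_or_lt_of_le hs with h | h
          · have : t = 1 := by linarith
            subst this; rw [← h]; linarith
          · nlinarith
  have hg : AnalyticOnNhd ℂ (fun ζ : ℂ => Δ (x₀ + ζ • e))
      (ball (0 : ℂ) (1 + 1) ∩ (fun ζ : ℂ => x₀ + ζ • e) ⁻¹' ball x₀ ρ) := fun ζ hζ =>
    (hball _ hζ.2).comp (f := fun ζ : ℂ => x₀ + ζ • e) (by fun_prop)
  have hmem0 : (0 : ℂ) ∈ ball (0 : ℂ) (1 + 1) ∩ (fun ζ : ℂ => x₀ + ζ • e) ⁻¹' ball x₀ ρ := by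
    simp [hρ]
  have hmem1 : (1 : ℂ) ∈ ball (0 : ℂ) (1 + 1) ∩ (fun ζ : ℂ => x₀ + ζ • e) ⁻¹' ball x₀ ρ := by
    simp [dist_eq_norm, hen]
  have hne : ∀ᶠ ζ in 𝓝[≠] (0 : ℂ), Δ (x₀ + ζ • e) ≠ 0 := by
    by_contra hcon
    have h1 := hg.eqOn_zero_of_preconnected_of_frequently_eq_zero hconv hmem0
      (by simpa [Filter.not_eventually] using hcon) hmem1
    exact hx1 (by simpa [e] using h1)
  rw [eventually_nhdsWithin_iff] at hne
  obtain ⟨r, hr, hrb⟩ := Metric.eventually_nhds_iff_ball.1 hne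
  refine ⟨min (r / 2) (ε / 2 / (‖e‖ + 1)), by positivity, ?_, fun ζ hζ h0 => hrb ζ ?_ h0⟩
  · calc min (r / 2) (ε / 2 / (‖e‖ + 1)) * ‖e‖ ≤ (ε / 2 / (‖e‖ + 1)) * ‖e‖ := by
          gcongr; exact min_le_right _ _
      _ = (ε / 2) * (‖e‖ / (‖e‖ + 1)) := by ring
      _ ≤ (ε / 2) * 1 := by
          gcongr; rw [div_le_one (by positivity)]; linarith
      _ < ε := by linarith
  · rw [mem_closedBall] at hζ
    rw [mem_ball]
    exact hζ.trans_lt ((min_le_left _ _).trans_lt (by linarith))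

/-- A continuous function that is analytic off the zero set of an analytic function is analytic. -/
theorem analyticAt_of_continuous_of_ne_zero [FiniteDimensional ℂ E] [FiniteDimensional ℂ Y]
    {Δ : E → ℂ} {x₀ : E} (hΔ : AnalyticAt ℂ Δ x₀) (hne : ∃ᶠ x in 𝓝 x₀, Δ x ≠ 0) {K : E → Y}
    (hc : ∀ᶠ x in 𝓝 x₀, ContinuousAt K x) (ha : ∀ᶠ x in 𝓝 x₀, Δ x ≠ 0 → AnalyticAt ℂ K x) :
    AnalyticAt ℂ K x₀ := by
  have : CompleteSpace Y := FiniteDimensional.complete ℂ Y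
  obtain ⟨ε, hε, hball⟩ := Metric.eventually_nhds_iff_ball.1
    (hΔ.eventually_analyticAt.and (hc.and ha))
  obtain ⟨e, -, r, hr, hre, hrΔ⟩ := exists_isolated_direction (P := fun _ => True) hΔ (by simpa)
    (half_pos hε)
  have hin : ∀ z ∈ ball x₀ (ε / 2), ∀ ζ ∈ closedBall (0 : ℂ) r, z + ζ • e ∈ ball x₀ ε := by
    intro z h1 ζ hζ
    rw [mem_ball, dist_eq_norm] at *
    rw [mem_closedBall, dist_zero_right] at hζ
    calc ‖z + ζ • e - x₀‖ = ‖(z - x₀) + ζ • e‖ := by congr 1; abel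
      _ ≤ ‖z - x₀‖ + ‖ζ‖ * ‖e‖ := by rw [← norm_smul]; exact norm_add_le _ _
      _ ≤ ‖z - x₀‖ + r * ‖e‖ := by gcongr
      _ < ε := by linarith
  have hz0 : x₀ ∈ ball x₀ (ε / 2) := mem_ball_self (half_pos hε)
  have hsph : ∀ ζ ∈ sphere (0 : ℂ) r, Δ (x₀ + ζ • e) ≠ 0 := fun ζ hζ =>
    hrΔ ζ (sphere_subset_closedBall hζ) (ne_of_mem_sphere hζ hr.ne')
  have hN : ∀ᶠ z in 𝓝 x₀, z ∈ ball x₀ (ε / 2) ∧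
      ∀ ζ ∈ sphere (0 : ℂ) r, Δ (z + ζ • e) ≠ 0 := by
    refine (eventually_mem_set.2 (ball_mem_nhds x₀ (half_pos hε))).and ?_
    refine (isCompact_sphere (0 : ℂ) r).eventually_forall_of_forall_eventually fun ζ hζ => ?_
    have h1 : ContinuousAt (fun p : E × ℂ => Δ (p.1 + p.2 • e)) (x₀, ζ) :=
      ContinuousAt.comp (f := fun p : E × ℂ => p.1 + p.2 • e) (g := Δ)
        (hball _ (hin x₀ hz0 ζ (sphere_subset_closedBall hζ))).1.continuousAt (by fun_prop)
    exact h1.eventually_ne (hsph ζ hζ)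
  obtain ⟨G, hG, hGK⟩ := exists_analyticAt_of_cauchy (F := K) (z₀ := x₀) (e := e) hr (T := univ)
    (fun ζ hζ => (hball _ (hin x₀ hz0 ζ (sphere_subset_closedBall hζ))).2.2 (hsph ζ hζ))
    (by simp)
    (by
      filter_upwards [hN] with z ⟨hz1, hz2⟩ _
      have hΔa : AnalyticOnNhd ℂ (fun ζ : ℂ => Δ (z + ζ • e)) (closedBall 0 r) := fun ζ hζ =>
        (hball _ (hin z hz1 ζ hζ)).1.comp (f := fun ζ : ℂ => z + ζ • e) (by fun_prop)
      -- An accumulation point of zeros would make `Δ` vanish on the whole disc, including its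
      -- boundary circle. So there are finitely many zeros, and Cauchy's formula for a continuous
      -- function tolerates such exceptional points.
      have hfin : (closedBall (0 : ℂ) r ∩ {ζ | Δ (z + ζ • e) = 0}).Finite := by
        by_contra hinf
        obtain ⟨p, hp, hacc⟩ := Set.Infinite.exists_accPt_of_subset_isCompact hinf
          (isCompact_closedBall (0 : ℂ) r) inter_subset_left
        have hfr : ∃ᶠ ζ in 𝓝[≠] p, Δ (z + ζ • e) = 0 :=
          ((accPt_iff_frequently_nhdsNE).1 hacc).mono fun ζ hζ => hζ.2
        have := hΔa.eqOn_zero_of_preconnected_of_frequently_eq_zero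
          (convex_closedBall _ _).isPreconnected hp hfr
        have hrs : (r : ℂ) ∈ sphere (0 : ℂ) r := by simp [abs_of_pos hr]
        exact hz2 r hrs (this (sphere_subset_closedBall hrs))
      have := Complex.two_pi_I_inv_smul_circleIntegral_sub_inv_smul_of_differentiable_on_off_countable
        (f := fun ζ => K (z + ζ • e)) hfin.countable (mem_ball_self hr : (0 : ℂ) ∈ ball 0 r)
        (fun ζ hζ => ContinuousAt.continuousWithinAt (ContinuousAt.comp
          (f := fun ζ : ℂ => z + ζ • e) (g := K) (hball _ (hin z hz1 ζ hζ)).2.1 (by fun_prop)))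
        (fun ζ hζ => by
          have h1 : Δ (z + ζ • e) ≠ 0 := fun h => hζ.2 ⟨ball_subset_closedBall hζ.1, h⟩
          exact ((hball _ (hin z hz1 ζ (ball_subset_closedBall hζ.1))).2.2 h1).differentiableAt.comp
            ζ (by fun_prop))
      simpa using this)
  refine hG.congr ?_
  filter_upwards [hGK, hc] with z h1 h2 using (h1 h2).symm

/-- The zero set of an analytic function is not contained in a union of finitely many subspaces of
codimension at least two, unless it is empty. -/
theorem ne_zero_of_zeros_subset [FiniteDimensional ℂ E] {J : E → ℂ} {z₀ : E}
    (hJ : AnalyticAt ℂ J z₀) {𝒮 : Set (Submodule ℂ E)} (hfin : 𝒮.Finite)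
    (hcod : ∀ L ∈ 𝒮, ∀ e : E, L ⊔ Submodule.span ℂ {e} ≠ ⊤)
    (hzero : ∀ᶠ z in 𝓝 z₀, J z = 0 → ∃ L ∈ 𝒮, z ∈ L) : J z₀ ≠ 0 := by
  intro hJ0
  obtain ⟨ε, hε, hball⟩ := Metric.eventually_nhds_iff_ball.1 (hJ.eventually_analyticAt.and hzero)
  have hcod' : ∀ L ∈ 𝒮, L ≠ ⊤ := fun L hL h => hcod L hL 0 (by simp [h])
  have hne : ∃ᶠ x in 𝓝 z₀, J x ≠ 0 ∧ True := by
    have h1 : ∃ᶠ x in 𝓝 z₀, ∀ L ∈ 𝒮, x ∉ L :=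
      mem_closure_iff_frequently.1 (dense_compl_iUnion_submodule hfin hcod' z₀)
    refine (h1.and_eventually hzero).mono fun x hx => ⟨fun h => ?_, trivial⟩
    obtain ⟨L, hL, hxL⟩ := hx.2 h
    exact hx.1 L hL hxL
  obtain ⟨e, -, r, hr, hre, hrJ⟩ := exists_isolated_direction (P := fun _ => True) hJ hne
    (half_pos hε)
  have hin : ∀ z ∈ ball z₀ (ε / 2), ∀ ζ ∈ closedBall (0 : ℂ) r, z + ζ • e ∈ ball z₀ ε := by
    intro z h1 ζ hζ
    rw [mem_ball, dist_eq_norm] at *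
    rw [mem_closedBall, dist_zero_right] at hζ
    calc ‖z + ζ • e - z₀‖ = ‖(z - z₀) + ζ • e‖ := by congr 1; abel
      _ ≤ ‖z - z₀‖ + ‖ζ‖ * ‖e‖ := by rw [← norm_smul]; exact norm_add_le _ _
      _ ≤ ‖z - z₀‖ + r * ‖e‖ := by gcongr
      _ < ε := by linarith
  have hz0 : z₀ ∈ ball z₀ (ε / 2) := mem_ball_self (half_pos hε)
  have hsph : ∀ ζ ∈ sphere (0 : ℂ) r, J (z₀ + ζ • e) ≠ 0 := fun ζ hζ =>
    hrJ ζ (sphere_subset_closedBall hζ) (ne_of_mem_sphere hζ hr.ne')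
  have hcont : ContinuousOn (fun ζ : ℂ => ‖J (z₀ + ζ • e)‖) (sphere 0 r) := fun ζ hζ =>
    (ContinuousAt.comp (f := fun ζ : ℂ => z₀ + ζ • e) (g := J)
      (hball _ (hin z₀ hz0 ζ (sphere_subset_closedBall hζ))).1.continuousAt
      (by fun_prop)).norm.continuousWithinAt
  obtain ⟨ζ₁, hζ₁, hmin⟩ := (isCompact_sphere (0 : ℂ) r).exists_isMinOn
    (NormedSpace.sphere_nonempty.2 hr.le) hcont
  set m := ‖J (z₀ + ζ₁ • e)‖ with hm
  have hmpos : 0 < m := norm_pos_iff.2 (hsph ζ₁ hζ₁)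
  have hN : ∀ᶠ z in 𝓝 z₀, z ∈ ball z₀ (ε / 2) ∧
      ∀ ζ ∈ sphere (0 : ℂ) r, m / 2 < ‖J (z + ζ • e)‖ := by
    refine (eventually_mem_set.2 (ball_mem_nhds z₀ (half_pos hε))).and ?_
    refine (isCompact_sphere (0 : ℂ) r).eventually_forall_of_forall_eventually fun ζ hζ => ?_
    have h1 : ContinuousAt (fun p : E × ℂ => ‖J (p.1 + p.2 • e)‖) (z₀, ζ) :=
      (ContinuousAt.comp (f := fun p : E × ℂ => p.1 + p.2 • e) (g := J)
        (hball _ (hin z₀ hz0 ζ (sphere_subset_closedBall hζ))).1.continuousAt (by fun_prop)).norm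
    refine h1.eventually_const_lt ?_
    have : m ≤ ‖J (z₀ + ζ • e)‖ := hmin hζ
    linarith
  have hsmall : ∀ᶠ z in 𝓝 z₀, ‖J z‖ < m / 2 :=
    hJ.continuousAt.norm.eventually_lt_const (by simpa [hJ0] using half_pos hmpos)
  -- A line in the direction `e` through a point outside `L + ℂ e` misses `L`, and `L + ℂ e` is a
  -- proper subspace by the condition on the codimension. So `J` has no zero on the disc around such
  -- a point.
  have hfr : ∃ᶠ z in 𝓝 z₀, ∀ L ∈ (fun L => L ⊔ Submodule.span ℂ {e}) '' 𝒮, z ∉ L :=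
    mem_closure_iff_frequently.1 (dense_compl_iUnion_submodule (hfin.image _) (by
      rintro _ ⟨L, hL, rfl⟩; exact hcod L hL e) z₀)
  obtain ⟨z, hz, ⟨hz1, hz2⟩, hz3⟩ := (hfr.and_eventually (hN.and hsmall)).exists
  have hnz : ∀ ζ ∈ closedBall (0 : ℂ) r, J (z + ζ • e) ≠ 0 := by
    intro ζ hζ h
    obtain ⟨L, hL, hzL⟩ := (hball _ (hin z hz1 ζ hζ)).2 h
    refine hz _ ⟨L, hL, rfl⟩ ?_
    have : z = (z + ζ • e) + (-ζ) • e := by rw [neg_smul]; abel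
    rw [this]
    exact Submodule.add_mem_sup hzL (Submodule.smul_mem _ _ (Submodule.mem_span_singleton_self e))
  have hd : DiffContOnCl ℂ (fun ζ : ℂ => (J (z + ζ • e))⁻¹) (ball 0 r) := by
    refine DifferentiableOn.diffContOnCl ?_
    rw [closure_ball _ hr.ne']
    intro ζ hζ
    exact (((hball _ (hin z hz1 ζ hζ)).1.differentiableAt.comp (f := fun ζ : ℂ => z + ζ • e) ζ
      (by fun_prop)).inv (hnz ζ hζ)).differentiableWithinAt
  -- The maximum principle for `1 / J`: it is at most `2 / m` on the circle but larger at the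
  -- centre, a contradiction.
  have := Complex.norm_le_of_forall_mem_frontier_norm_le isBounded_ball hd (C := (m / 2)⁻¹)
    (fun ζ hζ => by
      rw [frontier_ball _ hr.ne'] at hζ
      rw [norm_inv]
      exact inv_anti₀ (half_pos hmpos) (hz2 ζ hζ).le)
    (subset_closure (mem_ball_self hr))
  simp only [zero_smul, add_zero, norm_inv] at this
  have hJz : 0 < ‖J z‖ := norm_pos_iff.2 (by simpa using hnz 0 (by simp [hr.le]))
  rw [inv_le_inv₀ hJz (half_pos hmpos)] at this
  linarith

end Extension


/-! ### Orbit spaces of finite linear groups -/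

section Orbits

variable {V : Type*} [NormedAddCommGroup V] [NormedSpace ℂ V] [FiniteDimensional ℂ V]

theorem continuous_linearEquiv (g : V ≃ₗ[ℂ] V) : Continuous g :=
  LinearMap.continuous_of_finiteDimensional (g : V →ₗ[ℂ] V)

/-- A linear automorphism as a continuous linear map. -/
def toCLM (g : V ≃ₗ[ℂ] V) : V →L[ℂ] V := LinearMap.toContinuousLinearMap (g : V →ₗ[ℂ] V)

@[simp] theorem toCLM_apply (g : V ≃ₗ[ℂ] V) (z : V) : toCLM g z = g z := rfl

theorem analyticAt_linearEquiv (g : V ≃ₗ[ℂ] V) (z : V) : AnalyticAt ℂ g z :=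
  (toCLM g).analyticAt z

instance (G : Subgroup (V ≃ₗ[ℂ] V)) : ContinuousConstSMul G V :=
  ⟨fun g => continuous_linearEquiv (g : V ≃ₗ[ℂ] V)⟩

variable {G : Subgroup (V ≃ₗ[ℂ] V)}

theorem orbitMk_eq_iff {z z' : V} : orbitMk G z = orbitMk G z' ↔ ∃ g ∈ G, z' = g z := by
  unfold orbitMk
  rw [Quotient.eq'', MulAction.orbitRel_apply, MulAction.mem_orbit_iff]
  constructor
  · rintro ⟨g, hg⟩
    refine ⟨(g⁻¹ : G), (g⁻¹).2, ?_⟩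
    rw [← hg]
    change z' = (g⁻¹ • g • z')
    rw [inv_smul_smul]
  · rintro ⟨g, hg, rfl⟩
    refine ⟨⟨g, hg⟩⁻¹, ?_⟩
    exact inv_smul_smul (⟨g, hg⟩ : G) z

theorem orbitMk_map {g : V ≃ₗ[ℂ] V} (hg : g ∈ G) (z : V) : orbitMk G (g z) = orbitMk G z :=
  (orbitMk_eq_iff.2 ⟨g, hg, rfl⟩).symm

theorem orbitMk_surjective : Function.Surjective (orbitMk G) := Quotient.mk''_surjective

theorem continuous_orbitMk : Continuous (orbitMk G) := continuous_quotient_mk'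

theorem isOpenMap_orbitMk : IsOpenMap (orbitMk G) := isOpenMap_quotient_mk'_mul

theorem map_mem_fixedSpace {g : V ≃ₗ[ℂ] V} {z : V} : z ∈ fixedSpace g ↔ g z = z := by
  simp [fixedSpace, sub_eq_zero]

theorem mul_linearEquiv_apply (g h : V ≃ₗ[ℂ] V) (z : V) : (g * h) z = g (h z) := rfl

@[simp] theorem inv_linearEquiv_apply_self (g : V ≃ₗ[ℂ] V) (z : V) : g⁻¹ (g z) = z :=
  g.symm_apply_apply z

@[simp] theorem apply_inv_linearEquiv_self (g : V ≃ₗ[ℂ] V) (z : V) : g (g⁻¹ z) = z :=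
  g.apply_symm_apply z

theorem fixedSpace_conj (g s : V ≃ₗ[ℂ] V) :
    fixedSpace (g * s * g⁻¹) = (fixedSpace s).map (g : V →ₗ[ℂ] V) := by
  ext z
  rw [map_mem_fixedSpace, Submodule.mem_map]
  constructor
  · intro h
    refine ⟨g⁻¹ z, ?_, apply_inv_linearEquiv_self g z⟩
    rw [map_mem_fixedSpace]
    apply g.injective
    rw [apply_inv_linearEquiv_self]
    exact h
  · rintro ⟨y, hy, rfl⟩
    rw [map_mem_fixedSpace] at hy
    change g (s (g⁻¹ (g y))) = g y
    rw [inv_linearEquiv_apply_self, hy]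

theorem isComplexReflection_conj {g s : V ≃ₗ[ℂ] V} (hs : IsComplexReflection s) :
    IsComplexReflection (g * s * g⁻¹) := by
  refine ⟨?_, ?_⟩
  · obtain ⟨n, hn, h⟩ := isOfFinOrder_iff_pow_eq_one.1 hs.1
    exact isOfFinOrder_iff_pow_eq_one.2 ⟨n, hn, by rw [conj_pow, h, mul_one, mul_inv_cancel]⟩
  · rw [← hs.2, fixedSpace_conj]
    exact (Submodule.Quotient.equiv (fixedSpace s) _ g rfl).finrank_eq.symm

theorem reflHyperplanes_map {g : V ≃ₗ[ℂ] V} (hg : g ∈ G) {H : Submodule ℂ V}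
    (hH : H ∈ reflHyperplanes G) : H.map (g : V →ₗ[ℂ] V) ∈ reflHyperplanes G := by
  obtain ⟨s, hs, hr, rfl⟩ := hH
  exact ⟨g * s * g⁻¹, G.mul_mem (G.mul_mem hg hs) (G.inv_mem hg), isComplexReflection_conj hr,
    fixedSpace_conj g s⟩

theorem map_mem_arrComplement {g : V ≃ₗ[ℂ] V} (hg : g ∈ G) {z : V} :
    g z ∈ arrComplement (reflHyperplanes G) ↔ z ∈ arrComplement (reflHyperplanes G) := by
  constructor
  · intro h H hH hz
    exact h _ (reflHyperplanes_map hg hH) ⟨z, hz, rfl⟩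
  · intro h H hH hz
    refine h _ (reflHyperplanes_map (G.inv_mem hg) hH) ⟨g z, hz, ?_⟩
    exact inv_linearEquiv_apply_self g z

theorem orbitMk_mem_discriminant {z : V} :
    orbitMk G z ∈ discriminant G ↔ ∃ H ∈ reflHyperplanes G, z ∈ H := by
  have key : orbitMk G z ∈ discriminant G ↔ z ∉ arrComplement (reflHyperplanes G) := by
    constructor
    · rintro ⟨y, hy, hyz⟩ hz
      obtain ⟨g, hg, rfl⟩ := orbitMk_eq_iff.1 hyz
      exact hy ((map_mem_arrComplement hg).1 hz)
    · intro h; exact ⟨z, h, rfl⟩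
  rw [key]
  simp [arrComplement]

theorem orbitMk_notMem_discriminant {z : V} :
    orbitMk G z ∉ discriminant G ↔ z ∈ arrComplement (reflHyperplanes G) := by
  rw [orbitMk_mem_discriminant]; simp [arrComplement]

theorem hyperplane_ne_top {H : Submodule ℂ V} (hH : H ∈ reflHyperplanes G) : H ≠ ⊤ := by
  rintro rfl
  obtain ⟨g, -, hr, hg⟩ := hH
  have h := hr.2
  rw [hg] at h
  have : Subsingleton (V ⧸ (⊤ : Submodule ℂ V)) := Submodule.Quotient.subsingleton_iff.2 rfl
  rw [Module.finrank_zero_of_subsingleton] at h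
  exact zero_ne_one h

theorem isOpen_arrComplement [Finite G] : IsOpen (arrComplement (reflHyperplanes G)) :=
  isOpen_compl_iUnion_submodule (reflHyperplanes_finite G)

theorem dense_arrComplement [Finite G] : Dense (arrComplement (reflHyperplanes G)) :=
  dense_compl_iUnion_submodule (reflHyperplanes_finite G) fun _ h => hyperplane_ne_top h

/-- A hyperplane of reflection has an equation. -/
theorem exists_equation {H : Submodule ℂ V} (hH : H ∈ reflHyperplanes G) :
    ∃ φ : V →L[ℂ] ℂ, φ ≠ 0 ∧ LinearMap.ker (φ : V →ₗ[ℂ] ℂ) = H := by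
  obtain ⟨φ, hφ0, hφ⟩ := Submodule.exists_le_ker_of_lt_top H (lt_top_iff_ne_top.2 (hyperplane_ne_top hH))
  refine ⟨LinearMap.toContinuousLinearMap φ, fun h => hφ0 ?_, ?_⟩
  · ext z; simpa using DFunLike.congr_fun h z
  · obtain ⟨g, -, hr, rfl⟩ := hH
    symm
    have h1 : Module.finrank ℂ (V ⧸ LinearMap.ker φ) = 1 := by
      rw [(φ.quotKerEquivOfSurjective (LinearMap.surjective hφ0)).finrank_eq]; simp
    refine Submodule.eq_of_le_of_finrank_eq hφ ?_
    have h2 := Submodule.finrank_quotient_add_finrank (fixedSpace g)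
    have h3 := Submodule.finrank_quotient_add_finrank (LinearMap.ker φ)
    have h4 := hr.2
    change Module.finrank ℂ (fixedSpace g) = Module.finrank ℂ (LinearMap.ker φ)
    omega

/-! ### Local structure of the orbit map -/

/-- Near `w`, an element of `G` that does not fix `w` moves points away. -/
theorem exists_separating_nhds [Finite G] (w : V) :
    ∃ U : Set V, IsOpen U ∧ w ∈ U ∧ ∀ g ∈ G, ∀ y ∈ U, g y ∈ U → g w = w := by
  have h : ∀ g : G, ∀ᶠ ε in 𝓝[>] (0 : ℝ), ∀ y ∈ Metric.ball w ε,
      (g : V ≃ₗ[ℂ] V) y ∈ Metric.ball w ε → (g : V ≃ₗ[ℂ] V) w = w := by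
    intro g
    by_cases hg : (g : V ≃ₗ[ℂ] V) w = w
    · simp [hg]
    · have hd : 0 < dist ((g : V ≃ₗ[ℂ] V) w) w / 2 := half_pos (dist_pos.2 hg)
      obtain ⟨δ, hδ, hb⟩ := Metric.eventually_nhds_iff_ball.1
        ((continuous_linearEquiv (g : V ≃ₗ[ℂ] V)).continuousAt.eventually
          (Metric.ball_mem_nhds ((g : V ≃ₗ[ℂ] V) w) hd))
      have hmin : 0 < min δ (dist ((g : V ≃ₗ[ℂ] V) w) w / 2) := lt_min hδ hd
      filter_upwards [Ioo_mem_nhdsGT hmin] with ε hε y hy hgy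
      exfalso
      have h1 : dist ((g : V ≃ₗ[ℂ] V) y) ((g : V ≃ₗ[ℂ] V) w) < _ := hb y (Metric.ball_subset_ball (hε.2.le.trans (min_le_left _ _)) hy)
      have h2 := (Metric.mem_ball.1 hgy).trans_le (hε.2.le.trans (min_le_right _ _))
      rw [dist_comm] at h1
      have := dist_triangle ((g : V ≃ₗ[ℂ] V) w) ((g : V ≃ₗ[ℂ] V) y) w
      linarith
  obtain ⟨ε, hε, hε0⟩ := ((eventually_all.2 h).and self_mem_nhdsWithin).exists
  exact ⟨Metric.ball w ε, Metric.isOpen_ball, Metric.mem_ball_self hε0,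
    fun g hg y hy hgy => hε ⟨g, hg⟩ y hy hgy⟩

variable {Y : Type*} [NormedAddCommGroup Y] [NormedSpace ℂ Y]

theorem analyticAt_orbit_iff (k : OrbitSpace G → Y) {g : V ≃ₗ[ℂ] V} (hg : g ∈ G) (z : V) :
    AnalyticAt ℂ (fun y => k (orbitMk G y)) (g z) ↔ AnalyticAt ℂ (fun y => k (orbitMk G y)) z := by
  have key : ∀ g ∈ G, ∀ z, AnalyticAt ℂ (fun y => k (orbitMk G y)) (g z) →
      AnalyticAt ℂ (fun y => k (orbitMk G y)) z := by
    intro g hg z h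
    have h1 := AnalyticAt.comp (f := g) (g := fun y => k (orbitMk G y)) h
      (analyticAt_linearEquiv g z)
    refine h1.congr (Eventually.of_forall fun y => ?_)
    simp [orbitMk_map hg]
  refine ⟨key g hg z, fun h => key g⁻¹ (G.inv_mem hg) _ ?_⟩
  simpa using h

theorem holAt_orbitMk_iff (k : OrbitSpace G → ℂ) (z : V) :
    HolAt G k (orbitMk G z) ↔ AnalyticAt ℂ (fun y => k (orbitMk G y)) z := by
  refine ⟨fun h => h z rfl, fun h y hy => ?_⟩
  obtain ⟨g, hg, rfl⟩ := orbitMk_eq_iff.1 hy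
  exact (analyticAt_orbit_iff k hg y).1 h

theorem HolAt.congr {k k' : OrbitSpace G → ℂ} {x : OrbitSpace G} (h : HolAt G k x)
    (he : k =ᶠ[𝓝 x] k') : HolAt G k' x := by
  intro z hz
  refine (h z hz).congr ?_
  subst hz
  exact continuous_orbitMk.continuousAt.eventually he

theorem eventually_orbitMk {z : V} {P : OrbitSpace G → Prop} :
    (∀ᶠ x in 𝓝 (orbitMk G z), P x) ↔ ∀ᶠ y in 𝓝 z, P (orbitMk G y) := by
  have h : map (orbitMk G) (𝓝 z) = 𝓝 (orbitMk G z) :=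
    le_antisymm continuous_orbitMk.continuousAt (isOpenMap_orbitMk.nhds_le z)
  rw [← h, eventually_map]

/-- An analytic function that is invariant under the stabilizer of a point descends, near that
point, to the orbit space. -/
theorem exists_descends [Finite G] {F : V → Y} {w : V} (hF : AnalyticAt ℂ F w)
    (hinv : ∀ g ∈ G, g w = w → ∀ᶠ y in 𝓝 w, F (g y) = F y) :
    ∃ k : OrbitSpace G → Y, AnalyticAt ℂ (fun y => k (orbitMk G y)) w ∧
      ∀ᶠ y in 𝓝 w, k (orbitMk G y) = F y := by
  classical
  obtain ⟨U, hU, hwU, hsep⟩ := exists_separating_nhds (G := G) w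
  have hinv' : ∀ᶠ y in 𝓝 w, ∀ g : G, (g : V ≃ₗ[ℂ] V) w = w → F ((g : V ≃ₗ[ℂ] V) y) = F y := by
    refine eventually_all.2 fun g => ?_
    by_cases hg : (g : V ≃ₗ[ℂ] V) w = w
    · filter_upwards [hinv g g.2 hg] with y hy _ using hy
    · exact Eventually.of_forall fun y h => absurd h hg
  obtain ⟨U', hU'sub, hU', hwU'⟩ := mem_nhds_iff.1 (hinv'.and (hU.mem_nhds hwU))
  -- Two points of `U'` in one orbit differ by an element of the stabilizer of `w`, under which `F`
  -- is invariant. So the chosen representative is immaterial; orbits that miss `U'` get the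
  -- irrelevant value `0`.
  let k : OrbitSpace G → Y := fun x =>
    if h : ∃ y ∈ U', orbitMk G y = x then F h.choose else 0
  have hk : ∀ y ∈ U', k (orbitMk G y) = F y := by
    intro y hy
    have h : ∃ y' ∈ U', orbitMk G y' = orbitMk G y := ⟨y, hy, rfl⟩
    simp only [k, dif_pos h]
    obtain ⟨h1, h2⟩ := h.choose_spec
    obtain ⟨g, hg, hgy⟩ := orbitMk_eq_iff.1 h2
    have hgw : g w = w := hsep g hg _ (hU'sub h1).2 (by rw [← hgy]; exact (hU'sub hy).2)
    have := (hU'sub h1).1 ⟨g, hg⟩ hgw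
    exact this.symm.trans (congrArg F hgy.symm)
  have hev : ∀ᶠ y in 𝓝 w, k (orbitMk G y) = F y := by
    filter_upwards [hU'.mem_nhds hwU'] with y hy using hk y hy
  exact ⟨k, hF.congr (hev.mono fun y hy => hy.symm), hev⟩

end Orbits

/-! ## Local isomorphisms of orbit spaces that respect the discriminants -/

section LocalIso

variable {V₁ : Type u} [NormedAddCommGroup V₁] [NormedSpace ℂ V₁] [FiniteDimensional ℂ V₁]
  {V₂ : Type v} [NormedAddCommGroup V₂] [NormedSpace ℂ V₂] [FiniteDimensional ℂ V₂]
  {G₁ : Subgroup (V₁ ≃ₗ[ℂ] V₁)} {G₂ : Subgroup (V₂ ≃ₗ[ℂ] V₂)}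

/-- An isomorphism between open parts of orbit spaces that respects the discriminants. -/
structure IsLocalDiscIso (G₁ : Subgroup (V₁ ≃ₗ[ℂ] V₁)) (G₂ : Subgroup (V₂ ≃ₗ[ℂ] V₂))
    (f : OpenPartialHomeomorph (OrbitSpace G₁) (OrbitSpace G₂)) : Prop where
  hol : ∀ x ∈ f.source, ∀ h : OrbitSpace G₂ → ℂ, HolAt G₂ h (f x) ↔ HolAt G₁ (fun y => h (f y)) x
  disc : ∀ x ∈ f.source, x ∈ discriminant G₁ ↔ f x ∈ discriminant G₂

variable {f : OpenPartialHomeomorph (OrbitSpace G₁) (OrbitSpace G₂)}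

theorem IsLocalDiscIso.symm (hf : IsLocalDiscIso G₁ G₂ f) : IsLocalDiscIso G₂ G₁ f.symm where
  hol x hx h := by
    have h1 := hf.hol (f.symm x) (f.map_target hx) (fun y => h (f.symm y))
    rw [f.right_inv hx] at h1
    rw [h1]
    have he : h =ᶠ[𝓝 (f.symm x)] fun y => h (f.symm (f y)) := by
      filter_upwards [f.open_source.mem_nhds (f.map_target hx)] with y hy
      rw [f.left_inv hy]
    exact ⟨fun H => H.congr he, fun H => H.congr he.symm⟩
  disc x hx := by
    have := hf.disc (f.symm x) (f.map_target hx)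
    rw [f.right_inv hx] at this
    exact this.symm

theorem IsLocalDiscIso.analyticAt_comp (hf : IsLocalDiscIso G₁ G₂ f)
    {Y : Type*} [NormedAddCommGroup Y] [NormedSpace ℂ Y] [FiniteDimensional ℂ Y]
    {k : OrbitSpace G₂ → Y} {z : V₁} {w : V₂} (hz : orbitMk G₁ z ∈ f.source)
    (hw : f (orbitMk G₁ z) = orbitMk G₂ w) (hk : AnalyticAt ℂ (fun y => k (orbitMk G₂ y)) w) :
    AnalyticAt ℂ (fun y => k (f (orbitMk G₁ y))) z := by
  have hscal : ∀ h : OrbitSpace G₂ → ℂ, AnalyticAt ℂ (fun y => h (orbitMk G₂ y)) w →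
      AnalyticAt ℂ (fun y => h (f (orbitMk G₁ y))) z := by
    intro h hh
    have h1 := (hf.hol _ hz h).1 (by rw [hw]; exact (holAt_orbitMk_iff h w).2 hh)
    exact (holAt_orbitMk_iff (fun y => h (f y)) z).1 h1
  let b := Module.finBasis ℂ Y
  have hsum : (fun y => k (f (orbitMk G₁ y))) =
      fun y => ∑ i, b.coord i (k (f (orbitMk G₁ y))) • b i := by
    funext y; exact (b.sum_repr _).symm
  rw [hsum]
  refine Finset.analyticAt_fun_sum _ fun i _ => ?_
  refine (hscal (fun x => b.coord i (k x)) ?_).smul analyticAt_const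
  exact ((LinearMap.toContinuousLinearMap (b.coord i)).analyticAt _).comp hk

/-- The group acts freely on the complement of its reflection hyperplanes. -/
def FreeOnComplement {V : Type*} [NormedAddCommGroup V] [NormedSpace ℂ V]
    (G : Subgroup (V ≃ₗ[ℂ] V)) : Prop :=
  ∀ z ∈ arrComplement (reflHyperplanes G), ∀ g ∈ G, g z = z → g = 1

/-- A local holomorphic lift of `f` near `z`. -/
structure IsLift (f : OrbitSpace G₁ → OrbitSpace G₂) (W : V₁ → V₂) (z : V₁) : Prop where
  analyticAt : AnalyticAt ℂ W z
  lift : ∀ᶠ y in 𝓝 z, f (orbitMk G₁ y) = orbitMk G₂ (W y)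

theorem IsLift.eventually {f : OrbitSpace G₁ → OrbitSpace G₂} {W : V₁ → V₂} {z : V₁}
    (h : IsLift f W z) : ∀ᶠ y in 𝓝 z, IsLift f W y := by
  have : CompleteSpace V₂ := FiniteDimensional.complete ℂ V₂
  filter_upwards [h.analyticAt.eventually_analyticAt, h.lift.eventually_nhds] with y h1 h2
    using ⟨h1, h2⟩

theorem IsLocalDiscIso.mem_arrComplement (hf : IsLocalDiscIso G₁ G₂ f) {z : V₁} {w : V₂}
    (hz : orbitMk G₁ z ∈ f.source) (hw : f (orbitMk G₁ z) = orbitMk G₂ w) :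
    z ∈ arrComplement (reflHyperplanes G₁) ↔ w ∈ arrComplement (reflHyperplanes G₂) := by
  rw [← orbitMk_notMem_discriminant, ← orbitMk_notMem_discriminant, hf.disc _ hz, hw]

/-- At a point with trivial stabilizer the identity map of `V₂` descends to the orbit space. This is
a local section of the orbit map of `G₂`, and the lift is `f` followed by it. -/
theorem IsLocalDiscIso.exists_lift [Finite G₂] (hf : IsLocalDiscIso G₁ G₂ f)
    (hG₂ : FreeOnComplement G₂) {z : V₁} {w : V₂} (hz : orbitMk G₁ z ∈ f.source)
    (hzc : z ∈ arrComplement (reflHyperplanes G₁)) (hw : f (orbitMk G₁ z) = orbitMk G₂ w) :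
    ∃ W : V₁ → V₂, IsLift f W z ∧ W z = w := by
  have hwc := (hf.mem_arrComplement hz hw).1 hzc
  obtain ⟨k, hk, hkid⟩ := exists_descends (G := G₂) (F := fun y : V₂ => y) (w := w) analyticAt_id
    (fun g hg hgw => by rw [hG₂ w hwc g hg hgw]; exact Eventually.of_forall fun y => rfl)
  have hev : ∀ᶠ x in 𝓝 (orbitMk G₂ w), orbitMk G₂ (k x) = x := by
    rw [eventually_orbitMk]
    filter_upwards [hkid] with y hy; rw [hy]
  refine ⟨fun y => k (f (orbitMk G₁ y)), ⟨hf.analyticAt_comp hz hw hk, ?_⟩, ?_⟩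
  · have hc : ContinuousAt (fun y => f (orbitMk G₁ y)) z :=
      (f.continuousAt hz).comp continuous_orbitMk.continuousAt
    have := hc.eventually (show ∀ᶠ x in 𝓝 (f (orbitMk G₁ z)), orbitMk G₂ (k x) = x by rw [hw]; exact hev)
    filter_upwards [this] with y hy using hy.symm
  · change k (f (orbitMk G₁ z)) = w
    rw [hw]; exact hkid.self_of_nhds

/-- Two lifts at a point differ by an element of the group. -/
theorem lift_unique [Finite G₂] (hG₂ : FreeOnComplement G₂) {f : OrbitSpace G₁ → OrbitSpace G₂}
    {W W' : V₁ → V₂} {z : V₁} (h : IsLift f W z) (h' : IsLift f W' z)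
    (hz : W' z ∈ arrComplement (reflHyperplanes G₂)) {g : V₂ ≃ₗ[ℂ] V₂} (hg : g ∈ G₂)
    (hgz : W' z = g (W z)) : ∀ᶠ y in 𝓝 z, W' y = g (W y) := by
  obtain ⟨U, hU, hwU, hsep⟩ := exists_separating_nhds (G := G₂) (W' z)
  have h1 : ∀ᶠ y in 𝓝 z, W' y ∈ U :=
    h'.analyticAt.continuousAt.eventually (hU.mem_nhds hwU)
  have h2 : ∀ᶠ y in 𝓝 z, g (W y) ∈ U :=
    ((continuous_linearEquiv g).continuousAt.comp h.analyticAt.continuousAt).eventually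
      (hU.mem_nhds (by simpa [← hgz] using hwU))
  filter_upwards [h.lift, h'.lift, h1, h2] with y h3 h4 h5 h6
  obtain ⟨a, ha, haw⟩ := orbitMk_eq_iff.1 ((orbitMk_map hg (W y)).trans (h3.symm.trans h4))
  have := hG₂ _ hz a ha (hsep a ha _ h6 (by rw [← haw]; exact h5))
  rw [haw, this]; rfl

/-- Take a lift of `f.symm` that sends `W z` to `z`. After `W` it lifts the identity and fixes `z`,
so it is the identity near `z` by uniqueness of lifts. -/
theorem IsLocalDiscIso.exists_lift_inverse [Finite G₁] (hf : IsLocalDiscIso G₁ G₂ f)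
    (hG₁ : FreeOnComplement G₁) {z : V₁}
    (hz : orbitMk G₁ z ∈ f.source) (hzc : z ∈ arrComplement (reflHyperplanes G₁)) {W : V₁ → V₂}
    (hW : IsLift f W z) :
    ∃ W' : V₂ → V₁, IsLift f.symm W' (W z) ∧ W' (W z) = z ∧ ∀ᶠ y in 𝓝 z, W' (W y) = y := by
  have hw := hW.lift.self_of_nhds
  have hwt : orbitMk G₂ (W z) ∈ f.symm.source := by rw [← hw]; exact f.map_source hz
  have hsw : f.symm (orbitMk G₂ (W z)) = orbitMk G₁ z := by rw [← hw, f.left_inv hz]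
  obtain ⟨W', hW', hW'z⟩ := hf.symm.exists_lift hG₁ hwt ((hf.mem_arrComplement hz hw).1 hzc) hsw
  refine ⟨W', hW', hW'z, ?_⟩
  have hc : IsLift (G₁ := G₁) (G₂ := G₁) (fun x => x) (fun y => W' (W y)) z := by
    refine ⟨AnalyticAt.comp (f := W) hW'.analyticAt hW.analyticAt, ?_⟩
    have h1 := hW.analyticAt.continuousAt.eventually hW'.lift
    have h2 : ∀ᶠ y in 𝓝 z, orbitMk G₁ y ∈ f.source :=
      continuous_orbitMk.continuousAt.eventually (f.open_source.mem_nhds hz)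
    filter_upwards [hW.lift, h1, h2] with y h3 h4 h5
    rw [← h4, ← h3, f.left_inv h5]
  have hid : IsLift (G₁ := G₁) (G₂ := G₁) (fun x => x) (fun y => y) z :=
    ⟨analyticAt_id, Eventually.of_forall fun y => rfl⟩
  have := lift_unique hG₁ hid hc (by rw [hW'z]; exact hzc) G₁.one_mem (by rw [hW'z]; rfl)
  filter_upwards [this] with y hy using hy

/-- The derivative of a lift is invertible. -/
theorem IsLocalDiscIso.exists_fderiv_equiv [Finite G₁] [Finite G₂] (hf : IsLocalDiscIso G₁ G₂ f)
    (hG₁ : FreeOnComplement G₁) (hG₂ : FreeOnComplement G₂) {z : V₁}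
    (hz : orbitMk G₁ z ∈ f.source) (hzc : z ∈ arrComplement (reflHyperplanes G₁)) {W : V₁ → V₂}
    (hW : IsLift f W z) : ∃ e : V₁ ≃L[ℂ] V₂, fderiv ℂ W z = e := by
  obtain ⟨W', hW', hW'z, hWW⟩ := hf.exists_lift_inverse hG₁ hz hzc hW
  have hw := hW.lift.self_of_nhds
  have hwt : orbitMk G₂ (W z) ∈ f.symm.source := by rw [← hw]; exact f.map_source hz
  -- A left inverse `W''` of `W'` is a lift of `f` that agrees with `W` at `z`, hence near `z`. So
  -- `W'` inverts `W` on both sides.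
  obtain ⟨W'', hW'', hW''z, hWW'⟩ := hf.symm.exists_lift_inverse hG₂ hwt
    ((hf.mem_arrComplement hz hw).1 hzc) hW'
  rw [f.symm_symm] at hW''
  rw [hW'z] at hW'' hW''z
  have hEq : ∀ᶠ y in 𝓝 z, W'' y = W y := by
    have := lift_unique hG₂ hW hW'' (by
      rw [hW''z]; exact (hf.mem_arrComplement hz hw).1 hzc) G₂.one_mem (by rw [hW''z]; rfl)
    filter_upwards [this] with y hy using hy
  have hd1 : (fderiv ℂ W' (W z)).comp (fderiv ℂ W z) = ContinuousLinearMap.id ℂ V₁ := by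
    have h1 := (hW'.analyticAt.differentiableAt.hasFDerivAt).comp z
      hW.analyticAt.differentiableAt.hasFDerivAt
    have h2 : HasFDerivAt (fun y : V₁ => y) (ContinuousLinearMap.id ℂ V₁) z := hasFDerivAt_id z
    exact h1.unique (h2.congr_of_eventuallyEq hWW)
  have hd2 : (fderiv ℂ W z).comp (fderiv ℂ W' (W z)) = ContinuousLinearMap.id ℂ V₂ := by
    have hWz : HasFDerivAt W (fderiv ℂ W z) (W' (W z)) := by
      rw [hW'z]; exact hW.analyticAt.differentiableAt.hasFDerivAt
    have h1 := hWz.comp (W z) hW'.analyticAt.differentiableAt.hasFDerivAt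
    have h2 : HasFDerivAt (fun y : V₂ => y) (ContinuousLinearMap.id ℂ V₂) (W z) := hasFDerivAt_id _
    refine h1.unique (h2.congr_of_eventuallyEq ?_)
    have h3 := hW'.analyticAt.continuousAt.eventually (by rw [hW'z]; exact hEq)
    filter_upwards [hWW', h3] with y h4 h5
    simp only [Function.comp]; rw [← h5, h4]
  exact ⟨ContinuousLinearEquiv.equivOfInverse (fderiv ℂ W z) (fderiv ℂ W' (W z))
    (fun x => DFunLike.congr_fun hd1 x) (fun x => DFunLike.congr_fun hd2 x), by ext x; rfl⟩

end LocalIso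

/-! ## Invariants of reflection groups -/

section Invariants

open MvPolynomial

variable {σ : Type*}

/-- A finite group acting on a polynomial ring by graded automorphisms, and generated by elements
that act trivially modulo a linear form. -/
structure IsReflectionAction (Γ : Type*) [Group Γ] [MulSemiringAction Γ (MvPolynomial σ ℂ)] :
    Prop where
  smul_C : ∀ (g : Γ) (a : ℂ), g • (C a : MvPolynomial σ ℂ) = C a
  homogeneous : ∀ (g : Γ) (p : MvPolynomial σ ℂ) (d : ℕ), p.IsHomogeneous d →
    (g • p).IsHomogeneous d
  generated : Subgroup.closure {s : Γ | ∃ l : MvPolynomial σ ℂ, l ≠ 0 ∧ l.IsHomogeneous 1 ∧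
    ∀ p : MvPolynomial σ ℂ, l ∣ s • p - p} = ⊤

theorem homogeneousComponent_eq_of_isHomogeneous {p : MvPolynomial σ ℂ} {e : ℕ}
    (hp : p.IsHomogeneous e) (d : ℕ) : homogeneousComponent d p = if e = d then p else 0 := by
  rw [homogeneousComponent_of_mem hp]; congr 1; simp [eq_comm]

theorem homogeneousComponent_mul_of_isHomogeneous {p q : MvPolynomial σ ℂ} {e : ℕ}
    (hq : q.IsHomogeneous e) (d : ℕ) : homogeneousComponent d (p * q) =
      if e ≤ d then homogeneousComponent (d - e) p * q else 0 := by
  conv_lhs => rw [← sum_homogeneousComponent p, Finset.sum_mul, map_sum]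
  simp_rw [homogeneousComponent_eq_of_isHomogeneous
    ((homogeneousComponent_isHomogeneous _ p).mul hq)]
  split_ifs with h
  · have h1 : ∀ i, i + e = d ↔ i = d - e := fun i => by omega
    simp_rw [h1]
    rw [Finset.sum_ite_eq']
    split_ifs with h2
    · rfl
    · rw [homogeneousComponent_eq_zero _ _ (by simp at h2; omega), zero_mul]
  · exact Finset.sum_eq_zero fun i _ => if_neg (by omega)

variable {Γ : Type*} [Group Γ] [MulSemiringAction Γ (MvPolynomial σ ℂ)]

theorem IsReflectionAction.smul_C_mul (hΓ : IsReflectionAction (σ := σ) Γ) (g : Γ) (a : ℂ)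
    (p : MvPolynomial σ ℂ) : g • (C a * p) = C a * g • p := by
  rw [smul_mul', hΓ.smul_C]

theorem IsReflectionAction.smul_homogeneousComponent (hΓ : IsReflectionAction (σ := σ) Γ) (g : Γ)
    (d : ℕ) (p : MvPolynomial σ ℂ) :
    g • homogeneousComponent d p = homogeneousComponent d (g • p) := by
  conv_rhs => rw [← sum_homogeneousComponent p, Finset.smul_sum, map_sum]
  simp_rw [homogeneousComponent_eq_of_isHomogeneous
    (hΓ.homogeneous g _ _ (homogeneousComponent_isHomogeneous _ p))]
  rw [Finset.sum_ite_eq']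
  split_ifs with h
  · rfl
  · rw [homogeneousComponent_eq_zero _ _ (by simpa using h), smul_zero]

variable (Γ) in
/-- The average of a polynomial over a group. -/
def average [Fintype Γ] (p : MvPolynomial σ ℂ) : MvPolynomial σ ℂ :=
  C (Fintype.card Γ : ℂ)⁻¹ * ∑ g : Γ, g • p

section Average

variable [Fintype Γ]

theorem IsReflectionAction.smul_average (hΓ : IsReflectionAction (σ := σ) Γ) (g : Γ)
    (p : MvPolynomial σ ℂ) : g • average Γ p = average Γ p := by
  rw [average, hΓ.smul_C_mul, Finset.smul_sum]
  congr 1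
  simp_rw [← mul_smul]
  exact Fintype.sum_equiv (Equiv.mulLeft g) _ _ fun h => rfl

theorem average_mul_of_invariant {q : MvPolynomial σ ℂ} (hq : ∀ g : Γ, g • q = q)
    (p : MvPolynomial σ ℂ) : average Γ (p * q) = average Γ p * q := by
  simp_rw [average, smul_mul', hq, ← Finset.sum_mul, mul_assoc]

theorem average_of_invariant {q : MvPolynomial σ ℂ} (hq : ∀ g : Γ, g • q = q) :
    average Γ q = q := by
  have h : (Fintype.card Γ : ℂ) ≠ 0 := Nat.cast_ne_zero.2 Fintype.card_ne_zero
  simp_rw [average, hq, Finset.sum_const, Finset.card_univ, nsmul_eq_mul, ← mul_assoc]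
  rw [← map_natCast (C : ℂ →+* MvPolynomial σ ℂ), ← map_mul, inv_mul_cancel₀ h, map_one, one_mul]

theorem average_sum {ι : Type*} (s : Finset ι) (p : ι → MvPolynomial σ ℂ) :
    average Γ (∑ i ∈ s, p i) = ∑ i ∈ s, average Γ (p i) := by
  simp_rw [average, Finset.smul_sum, ← Finset.mul_sum]
  rw [Finset.sum_comm]

theorem IsReflectionAction.isHomogeneous_average (hΓ : IsReflectionAction (σ := σ) Γ)
    {p : MvPolynomial σ ℂ} {d : ℕ} (hp : p.IsHomogeneous d) : (average Γ p).IsHomogeneous d :=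
  IsHomogeneous.C_mul (IsHomogeneous.sum _ _ _ fun g _ => hΓ.homogeneous g p d hp) _

end Average

variable (σ Γ) in
/-- The ideal generated by the homogeneous invariants of positive degree. -/
def hilbertIdeal : Ideal (MvPolynomial σ ℂ) :=
  Ideal.span {p | (∀ g : Γ, g • p = p) ∧ ∃ d, 0 < d ∧ p.IsHomogeneous d}

theorem smul_mem_hilbertIdeal (g : Γ) {p : MvPolynomial σ ℂ} (hp : p ∈ hilbertIdeal σ Γ) :
    g • p ∈ hilbertIdeal σ Γ := by
  unfold hilbertIdeal at hp
  induction hp using Submodule.span_induction with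
  | mem x hx => rw [hx.1 g]; exact Ideal.subset_span hx
  | zero => rw [smul_zero]; exact zero_mem _
  | add x y _ _ hx hy => rw [smul_add]; exact add_mem hx hy
  | smul a x _ hx => rw [smul_eq_mul, smul_mul']; exact Ideal.mul_mem_left _ _ hx

/-- Being congruent modulo an invariant ideal to all its translates can be tested on generators. -/
theorem IsReflectionAction.smul_sub_mem (hΓ : IsReflectionAction (σ := σ) Γ)
    {p : MvPolynomial σ ℂ} (hp : ∀ s : Γ, ∀ l : MvPolynomial σ ℂ, l ≠ 0 → l.IsHomogeneous 1 →
      (∀ p : MvPolynomial σ ℂ, l ∣ s • p - p) → s • p - p ∈ hilbertIdeal σ Γ) (g : Γ) :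
    g • p - p ∈ hilbertIdeal σ Γ := by
  have hg : g ∈ Subgroup.closure {s : Γ | ∃ l : MvPolynomial σ ℂ, l ≠ 0 ∧ l.IsHomogeneous 1 ∧
    ∀ p : MvPolynomial σ ℂ, l ∣ s • p - p} := hΓ.generated ▸ Subgroup.mem_top g
  induction hg using Subgroup.closure_induction with
  | mem x hx => obtain ⟨l, h1, h2, h3⟩ := hx; exact hp x l h1 h2 h3
  | one => simp
  | mul x y _ _ hx hy =>
    have : (x * y) • p - p = x • (y • p - p) + (x • p - p) := by rw [mul_smul, smul_sub]; abel
    rw [this]; exact add_mem (smul_mem_hilbertIdeal x hy) hx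
  | inv x _ hx =>
    have : x⁻¹ • p - p = -(x⁻¹ • (x • p - p)) := by rw [smul_sub, inv_smul_smul]; abel
    rw [this]; exact neg_mem (smul_mem_hilbertIdeal _ hx)

theorem isHomogeneous_of_mul_left {l p : MvPolynomial σ ℂ} {e d : ℕ} (hl0 : l ≠ 0)
    (hl : l.IsHomogeneous e) (h : (l * p).IsHomogeneous (d + e)) : p.IsHomogeneous d := by
  have h1 := homogeneousComponent_mul_of_isHomogeneous (p := p) hl (d + e)
  rw [if_pos (Nat.le_add_left _ _), Nat.add_sub_cancel, mul_comm p l, mul_comm _ l,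
    homogeneousComponent_eq_of_isHomogeneous h, if_pos rfl] at h1
  rw [mul_left_cancel₀ hl0 h1]
  exact homogeneousComponent_isHomogeneous _ _

/-- Chevalley's lemma. -/
theorem IsReflectionAction.mem_hilbertIdeal [Fintype Γ] (hΓ : IsReflectionAction (σ := σ) Γ)
    {ι : Type*} [DecidableEq ι] (M : Finset ι) (a : ι → MvPolynomial σ ℂ)
    (ha : ∀ i ∈ M, ∀ g : Γ, g • a i = a i) {i₀ : ι} (hi₀ : i₀ ∈ M)
    (hspan : ∀ c : ι → MvPolynomial σ ℂ, (∀ i, ∀ g : Γ, g • c i = c i) →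
      a i₀ ≠ ∑ i ∈ M.erase i₀, c i * a i) (d : ℕ) :
    ∀ b : ι → MvPolynomial σ ℂ, (b i₀).IsHomogeneous d → ∑ i ∈ M, b i * a i = 0 →
      b i₀ ∈ hilbertIdeal σ Γ := by
  induction d with
  | zero =>
    intro b hb hsum
    have hb' := totalDegree_eq_zero_iff_eq_C.1 ((totalDegree_zero_iff_isHomogeneous σ).2 hb)
    set c := coeff 0 (b i₀) with hc
    by_cases hc0 : c = 0
    · rw [hb', hc0, map_zero]; exact zero_mem _
    exfalso
    -- Here `b i₀` is a nonzero constant `c`. Dividing the relation by `-c` and averaging would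
    -- express `a i₀` by the other `a i` with invariant coefficients.
    refine hspan (fun i => average Γ (C (-c⁻¹) * b i)) (fun i g => hΓ.smul_average g _) ?_
    have h2 : ∑ i ∈ M, average Γ (C (-c⁻¹) * b i) * a i = 0 := by
      have h3 : ∑ i ∈ M, (C (-c⁻¹) * b i) * a i = 0 := by
        simp_rw [mul_assoc, ← Finset.mul_sum]; rw [hsum, mul_zero]
      have h4 := congrArg (average Γ) h3
      rw [average_sum] at h4
      rw [Finset.sum_congr rfl fun i hi => (average_mul_of_invariant (ha i hi) _).symm, h4]
      simp [average]
    rw [← Finset.add_sum_erase M _ hi₀] at h2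
    have h5 : average Γ (C (-c⁻¹) * b i₀) = -1 := by
      rw [hb', ← map_mul, neg_mul, inv_mul_cancel₀ hc0, average_of_invariant (fun g => hΓ.smul_C g _)]
      simp
    rw [h5] at h2
    linear_combination -h2
  | succ d ih =>
    intro b hb hsum
    -- The difference of the relation and its transform by a reflection is divisible by the linear
    -- form `l`. The quotient is a relation whose coefficient at `i₀` has degree `d`, to which the
    -- induction hypothesis applies.
    have hΔ : ∀ g : Γ, g • b i₀ - b i₀ ∈ hilbertIdeal σ Γ := by
      refine hΓ.smul_sub_mem fun s l hl0 hl hdvd => ?_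
      choose b' hb' using fun i => hdvd (b i)
      rw [hb']
      refine Ideal.mul_mem_left _ _ (ih b' ?_ ?_)
      · refine isHomogeneous_of_mul_left hl0 hl ?_
        rw [← hb']
        exact (hΓ.homogeneous s _ _ hb).sub hb
      · refine mul_left_cancel₀ hl0 ?_
        rw [mul_zero, Finset.mul_sum]
        have h1 : ∑ i ∈ M, (s • b i) * a i = 0 := by
          have h3 := congrArg (s • ·) hsum
          simp only [Finset.smul_sum, smul_mul', smul_zero] at h3
          rw [← h3]
          exact Finset.sum_congr rfl fun i hi => by rw [ha i hi s]
        calc _ = ∑ i ∈ M, ((s • b i) * a i - b i * a i) :=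
              Finset.sum_congr rfl fun i hi => by rw [← mul_assoc, ← hb']; ring
          _ = 0 := by rw [Finset.sum_sub_distrib, h1, hsum, sub_zero]
    -- Modulo the ideal, `b i₀` is congruent to its average, and the latter is an invariant of
    -- degree `d + 1 > 0`.
    have hav : average Γ (b i₀) - b i₀ ∈ hilbertIdeal σ Γ := by
      have h1 : average Γ (b i₀) - b i₀ =
          C (Fintype.card Γ : ℂ)⁻¹ * ∑ g : Γ, (g • b i₀ - b i₀) := by
        have h : (Fintype.card Γ : ℂ) ≠ 0 := Nat.cast_ne_zero.2 Fintype.card_ne_zero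
        have h2 : C (Fintype.card Γ : ℂ)⁻¹ * (Fintype.card Γ : MvPolynomial σ ℂ) = 1 := by
          rw [← map_natCast (C : ℂ →+* MvPolynomial σ ℂ), ← map_mul, inv_mul_cancel₀ h, map_one]
        rw [average, Finset.sum_sub_distrib, Finset.sum_const, Finset.card_univ, nsmul_eq_mul,
          mul_sub, ← mul_assoc, h2, one_mul]
      rw [h1]
      exact Ideal.mul_mem_left _ _ (sum_mem fun g _ => hΔ g)
    have hav' : average Γ (b i₀) ∈ hilbertIdeal σ Γ :=
      Ideal.subset_span ⟨fun g => hΓ.smul_average g _, d + 1, d.succ_pos, hΓ.isHomogeneous_average hb⟩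
    simpa using sub_mem hav' hav

/-- Homogeneous invariants of positive degree that form a minimal system of generators of the
ideal that they generate. -/
theorem exists_minimal_generators [Finite σ] : ∃ (N : ℕ) (h : Fin N → MvPolynomial σ ℂ) (d : Fin N → ℕ),
    (∀ i, 0 < d i) ∧ (∀ i, (h i).IsHomogeneous (d i)) ∧ (∀ i, ∀ g : Γ, g • h i = h i) ∧
    hilbertIdeal σ Γ = Ideal.span (Set.range h) ∧
    ∀ i, h i ∉ Ideal.span (h '' {i}ᶜ) := by
  classical
  set S : Set (MvPolynomial σ ℂ) := {p | (∀ g : Γ, g • p = p) ∧ ∃ d, 0 < d ∧ p.IsHomogeneous d}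
  have hfg : (Submodule.span (MvPolynomial σ ℂ) S).FG := IsNoetherian.noetherian _
  obtain ⟨s', hs', hspan'⟩ := (Submodule.fg_span_iff_fg_span_finset_subset S).1 hfg
  have hex : ∃ k : ℕ, ∃ s : Finset (MvPolynomial σ ℂ), (s : Set (MvPolynomial σ ℂ)) ⊆ S ∧
      Ideal.span S = Ideal.span (s : Set (MvPolynomial σ ℂ)) ∧ s.card = k :=
    ⟨_, s', hs', hspan', rfl⟩
  obtain ⟨s, hs, hspan, hcard⟩ := Nat.find_spec hex
  have e := s.equivFin.symm
  refine ⟨s.card, fun i => e i, fun i => (hs (e i).2).2.choose, fun i => (hs (e i).2).2.choose_spec.1,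
    fun i => (hs (e i).2).2.choose_spec.2, fun i => (hs (e i).2).1, ?_, ?_⟩
  · have : Set.range (fun i => (e i : MvPolynomial σ ℂ)) = s := by
      ext p; constructor
      · rintro ⟨i, rfl⟩; exact (e i).2
      · intro hp; exact ⟨e.symm ⟨p, hp⟩, by simp⟩
    rw [this]; exact hspan
  · intro i hi
    have hsub : (fun i => (e i : MvPolynomial σ ℂ)) '' {i}ᶜ ⊆ (s.erase (e i) : Finset _) := by
      rintro _ ⟨j, hj, rfl⟩
      simp only [Finset.coe_erase, Set.mem_sdiff, Set.mem_singleton_iff]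
      exact ⟨(e j).2, fun h => hj (e.injective (Subtype.ext h))⟩
    have hi' := Ideal.span_mono hsub hi
    have hlt : (s.erase (e i)).card < Nat.find hex := by
      rw [← hcard]; exact Finset.card_erase_lt_of_mem (e i).2
    refine Nat.find_min hex hlt ⟨s.erase (e i), (Finset.coe_subset.2 (Finset.erase_subset _ _)).trans hs, ?_, rfl⟩
    rw [hspan]
    refine le_antisymm (Ideal.span_le.2 fun p hp => ?_) (Ideal.span_mono (Finset.coe_subset.2 (Finset.erase_subset _ _)))
    by_cases hpe : p = e i
    · rw [hpe]; exact hi'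
    · exact Ideal.subset_span (by simpa [hpe] using hp)

/-- Homogeneous generators of the Hilbert ideal generate the algebra of invariants. -/
theorem IsReflectionAction.mem_adjoin [Fintype Γ] (hΓ : IsReflectionAction (σ := σ) Γ) {N : ℕ}
    {h : Fin N → MvPolynomial σ ℂ} {d : Fin N → ℕ} (hd : ∀ i, 0 < d i)
    (hh : ∀ i, (h i).IsHomogeneous (d i)) (hinv : ∀ i, ∀ g : Γ, g • h i = h i)
    (hspan : hilbertIdeal σ Γ = Ideal.span (Set.range h)) {p : MvPolynomial σ ℂ}
    (hp : ∀ g : Γ, g • p = p) : p ∈ Algebra.adjoin ℂ (Set.range h) := by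
  have key : ∀ e : ℕ, ∀ p : MvPolynomial σ ℂ, p.IsHomogeneous e → (∀ g : Γ, g • p = p) →
      p ∈ Algebra.adjoin ℂ (Set.range h) := by
    intro e
    induction e using Nat.strong_induction_on with
    | _ e ih =>
      intro p hpe hp
      rcases Nat.eq_zero_or_pos e with rfl | he
      · rw [totalDegree_eq_zero_iff_eq_C.1 ((totalDegree_zero_iff_isHomogeneous σ).2 hpe)]
        exact Subalgebra.algebraMap_mem _ _
      have hpI : p ∈ Ideal.span (Set.range h) := by
        rw [← hspan]; exact Ideal.subset_span ⟨hp, e, he, hpe⟩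
      obtain ⟨c, hc⟩ := (Ideal.mem_span_range_iff_exists_fun).1 hpI
      -- Averaging makes the coefficients invariant. In degree `e` only their components of degree
      -- `e - d i < e` enter, and these are covered by the induction.
      have h1 : p = ∑ i, average Γ (c i) * h i := by
        rw [← average_of_invariant hp, ← hc, average_sum]
        exact Finset.sum_congr rfl fun i _ => average_mul_of_invariant (hinv i) _
      have h2 := congrArg (homogeneousComponent e) h1
      rw [homogeneousComponent_eq_of_isHomogeneous hpe, if_pos rfl, map_sum] at h2
      rw [h2]
      refine sum_mem fun i _ => ?_
      rw [homogeneousComponent_mul_of_isHomogeneous (hh i)]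
      split_ifs with hle
      · refine mul_mem (ih (e - d i) (by have := hd i; omega) _ (homogeneousComponent_isHomogeneous _ _)
          fun g => ?_) (Algebra.subset_adjoin ⟨i, rfl⟩)
        rw [hΓ.smul_homogeneousComponent, hΓ.smul_average]
      · exact zero_mem _
  rw [← sum_homogeneousComponent p]
  refine sum_mem fun i _ => key i _ (homogeneousComponent_isHomogeneous _ _) fun g => ?_
  rw [hΓ.smul_homogeneousComponent, hp]

theorem isHomogeneous_aeval_of_isWeightedHomogeneous {N : ℕ} {h : Fin N → MvPolynomial σ ℂ}
    {d : Fin N → ℕ} (hh : ∀ i, (h i).IsHomogeneous (d i)) {P : MvPolynomial (Fin N) ℂ} {e : ℕ}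
    (hP : P.IsWeightedHomogeneous d e) : (aeval h P).IsHomogeneous e := by
  rw [aeval_def, eval₂_eq']
  refine IsHomogeneous.sum _ _ _ fun m hm => ?_
  rw [show e = ∑ i, d i * m i by
    rw [← hP (mem_support_iff.1 hm), Finsupp.weight_apply, Finsupp.sum_fintype _ _ (by simp)]
    simp [mul_comm]]
  refine IsHomogeneous.C_mul (IsHomogeneous.prod _ _ _ fun i _ => (hh i).pow _) _

theorem pderiv_aeval {N : ℕ} (h : Fin N → MvPolynomial σ ℂ) (P : MvPolynomial (Fin N) ℂ) (k : σ) :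
    pderiv k (aeval h P) = ∑ j, pderiv k (h j) * aeval h (pderiv j P) := by
  induction P using MvPolynomial.induction_on with
  | C a => simp
  | add p q hp hq => simp only [map_add, hp, hq, mul_add, Finset.sum_add_distrib]
  | mul_X p i hp =>
    simp only [map_mul, Derivation.leibniz, aeval_X, hp, smul_eq_mul, map_add, mul_add,
      Finset.sum_add_distrib, Finset.mul_sum]
    congr 1
    · rw [Finset.sum_eq_single i]
      · simp; ring
      · intro j _ hj; rw [pderiv_X_of_ne hj.symm]; simp
      · simp
    · exact Finset.sum_congr rfl fun j _ => by ring

end Invariants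

/-! ### Algebraic independence of the basic invariants -/

section Independence

open MvPolynomial

variable {σ : Type*} {Γ : Type*} [Group Γ] [MulSemiringAction Γ (MvPolynomial σ ℂ)]

theorem eq_C_of_pderiv_eq_zero {N : ℕ} {P : MvPolynomial (Fin N) ℂ} (h : ∀ i, pderiv i P = 0) :
    P = C (coeff 0 P) := by
  classical
  ext m
  rw [coeff_C]
  split_ifs with hm
  · rw [← hm]
  · obtain ⟨i, hi⟩ : ∃ i, m i ≠ 0 := by
      by_contra! hc; exact hm (Finsupp.ext fun i => (hc i).symm)
    have h1 := congrArg (coeff (m - Finsupp.single i 1)) (h i)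
    rw [coeff_pderiv, coeff_zero] at h1
    have h2 : m - Finsupp.single i 1 + Finsupp.single i 1 = m := by
      refine tsub_add_cancel_of_le ?_
      rw [Finsupp.single_le_iff]; omega
    rw [h2] at h1
    have h3 : (((m - Finsupp.single i 1 : Fin N →₀ ℕ) i : ℕ) : ℂ) + 1 ≠ 0 := Nat.cast_add_one_ne_zero _
    exact (mul_eq_zero.1 h1).resolve_right (by simpa using h3)

theorem totalDegree_pderiv_lt {N : ℕ} {P : MvPolynomial (Fin N) ℂ} {i : Fin N}
    (h : pderiv i P ≠ 0) : (pderiv i P).totalDegree < P.totalDegree := by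
  classical
  have hne : (pderiv i P).support.Nonempty := support_nonempty.2 h
  obtain ⟨m, hm, hmax⟩ := Finset.exists_mem_eq_sup _ hne fun s : Fin N →₀ ℕ => s.sum fun _ e => e
  have h1 : m + Finsupp.single i 1 ∈ P.support := by
    rw [mem_support_iff] at hm ⊢
    rw [coeff_pderiv] at hm
    exact left_ne_zero_of_mul hm
  have h2 := le_totalDegree h1
  have h3 : (pderiv i P).totalDegree = m.sum fun _ e => e := hmax
  rw [h3]
  rw [Finsupp.sum_add_index' (by simp) (by simp), Finsupp.sum_single_index rfl] at h2
  omega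

theorem totalDegree_weightedHomogeneousComponent_le {N : ℕ} (d : Fin N → ℕ) (e : ℕ)
    (P : MvPolynomial (Fin N) ℂ) : (weightedHomogeneousComponent d e P).totalDegree ≤ P.totalDegree := by
  classical
  refine Finset.sup_le fun m hm => le_totalDegree ?_
  rw [support_weightedHomogeneousComponent] at hm
  exact (Finset.mem_filter.1 hm).1

theorem aeval_weightedHomogeneousComponent {N : ℕ} {h : Fin N → MvPolynomial σ ℂ}
    {d : Fin N → ℕ} (hh : ∀ i, (h i).IsHomogeneous (d i)) (P : MvPolynomial (Fin N) ℂ) (e : ℕ) :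
    aeval h (weightedHomogeneousComponent d e P) = homogeneousComponent e (aeval h P) := by
  classical
  induction P using MvPolynomial.induction_on' with
  | monomial m a =>
    have hm := isWeightedHomogeneous_monomial (w := d) m a rfl
    rw [homogeneousComponent_eq_of_isHomogeneous (isHomogeneous_aeval_of_isWeightedHomogeneous hh hm),
      weightedHomogeneousComponent_of_mem hm]
    by_cases h1 : e = Finsupp.weight d m
    · rw [if_pos h1, if_pos h1.symm]
    · rw [if_neg h1, if_neg (Ne.symm h1), map_zero]
  | add p q hp hq => simp only [map_add, hp, hq]

/-- In a nonzero relation of least total degree, a nonzero partial derivative has smaller degree and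
so is not a relation. If all derivatives vanished the relation would be constant, hence zero.
Passing to a weighted homogeneous component does not raise the total degree. -/
theorem exists_relation_of_minimal {N : ℕ} {h : Fin N → MvPolynomial σ ℂ} {d : Fin N → ℕ}
    (hh : ∀ i, (h i).IsHomogeneous (d i)) (hdep : ¬ AlgebraicIndependent ℂ h) :
    ∃ (P : MvPolynomial (Fin N) ℂ) (e : ℕ), P.IsWeightedHomogeneous d e ∧ aeval h P = 0 ∧
      ∃ i, aeval h (pderiv i P) ≠ 0 := by
  have hex : ∃ k, ∃ P : MvPolynomial (Fin N) ℂ, P ≠ 0 ∧ aeval h P = 0 ∧ P.totalDegree = k := by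
    rw [algebraicIndependent_iff] at hdep
    push Not at hdep
    obtain ⟨P, h1, h2⟩ := hdep
    exact ⟨_, P, h2, h1, rfl⟩
  classical
  obtain ⟨P, hP0, hP, hPdeg⟩ := Nat.find_spec hex
  obtain ⟨e, he⟩ : ∃ e, weightedHomogeneousComponent d e P ≠ 0 := by
    by_contra! hc
    have := finsum_weightedHomogeneousComponent d P
    simp only [hc, finsum_zero] at this
    exact hP0 this.symm
  set Q := weightedHomogeneousComponent d e P
  have hQ : aeval h Q = 0 := by
    rw [aeval_weightedHomogeneousComponent hh, hP, map_zero]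
  refine ⟨Q, e, weightedHomogeneousComponent_isWeightedHomogeneous (w := d) e P, hQ, ?_⟩
  by_contra! hc
  have hz : ∀ i, pderiv i Q = 0 := by
    intro i
    by_contra hne
    refine Nat.find_min hex ?_ ⟨pderiv i Q, hne, hc i, rfl⟩
    rw [← hPdeg]
    exact (totalDegree_pderiv_lt hne).trans_le (totalDegree_weightedHomogeneousComponent_le d e P)
  have hQC := eq_C_of_pderiv_eq_zero hz
  rw [hQC, aeval_C] at hQ
  have : coeff 0 Q = 0 := by simpa using hQ
  rw [this, map_zero] at hQC
  exact he hQC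

/-- Every system of polynomials has a subsystem that generates the same module over the invariants
and is minimal as such. -/
theorem exists_minimal_subsystem {N : ℕ} (A : Subalgebra ℂ (MvPolynomial σ ℂ))
    (a : Fin N → MvPolynomial σ ℂ) : ∃ M : Finset (Fin N),
      (∀ j, ∃ q : Fin N → A, a j = ∑ i ∈ M, (q i : MvPolynomial σ ℂ) * a i) ∧
      ∀ i₀ ∈ M, ∀ c : Fin N → A, a i₀ ≠ ∑ i ∈ M.erase i₀, (c i : MvPolynomial σ ℂ) * a i := by
  classical
  have hex : ∃ k, ∃ M : Finset (Fin N), (∀ j, ∃ q : Fin N → A, a j = ∑ i ∈ M, (q i : MvPolynomial σ ℂ) * a i) ∧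
      M.card = k := by
    refine ⟨_, Finset.univ, fun j => ⟨Pi.single j 1, ?_⟩, rfl⟩
    rw [Finset.sum_eq_single j]
    · simp
    · intro i _ hi; simp [hi]
    · simp
  obtain ⟨M, hM, hcard⟩ := Nat.find_spec hex
  refine ⟨M, hM, fun i₀ hi₀ c hc => ?_⟩
  refine Nat.find_min hex (m := (M.erase i₀).card) ?_ ⟨M.erase i₀, fun j => ?_, rfl⟩
  · rw [← hcard]; exact Finset.card_erase_lt_of_mem hi₀
  · obtain ⟨q, hq⟩ := hM j
    refine ⟨fun i => q i + q i₀ * c i, ?_⟩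
    rw [hq, ← Finset.add_sum_erase _ _ hi₀, hc, Finset.mul_sum, ← Finset.sum_add_distrib]
    exact Finset.sum_congr rfl fun i _ => by push_cast; ring

variable [Fintype σ]

/-- A minimal system of homogeneous generators of the Hilbert ideal of a reflection group is
algebraically independent. -/
theorem IsReflectionAction.algebraicIndependent [Fintype Γ] (hΓ : IsReflectionAction (σ := σ) Γ)
    {N : ℕ} {h : Fin N → MvPolynomial σ ℂ} {d : Fin N → ℕ} (hd : ∀ i, 0 < d i)
    (hh : ∀ i, (h i).IsHomogeneous (d i)) (hinv : ∀ i, ∀ g : Γ, g • h i = h i)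
    (hspan : hilbertIdeal σ Γ = Ideal.span (Set.range h))
    (hmin : ∀ i, h i ∉ Ideal.span (h '' {i}ᶜ)) : AlgebraicIndependent ℂ h := by
  classical
  by_contra hdep
  obtain ⟨P, e, hPe, hP, i₁, hi₁⟩ := exists_relation_of_minimal hh hdep
  set A : Subalgebra ℂ (MvPolynomial σ ℂ) := Algebra.adjoin ℂ (Set.range h) with hA
  have hAinv : ∀ p ∈ A, ∀ g : Γ, g • p = p := by
    intro p hp g
    induction hp using Algebra.adjoin_induction with
    | mem x hx => obtain ⟨i, rfl⟩ := hx; exact hinv i g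
    | algebraMap r => exact hΓ.smul_C g r
    | add x y _ _ hx hy => rw [smul_add, hx, hy]
    | mul x y _ _ hx hy => rw [smul_mul', hx, hy]
  set a : Fin N → MvPolynomial σ ℂ := fun i => aeval h (pderiv i P) with ha
  have haA : ∀ i, a i ∈ A := by
    intro i
    rw [hA, ← aeval_range]
    exact ⟨_, rfl⟩
  have hahom : ∀ i, a i ≠ 0 → d i ≤ e ∧ (a i).IsHomogeneous (e - d i) := by
    intro i hi
    have hne : pderiv i P ≠ 0 := by intro h0; exact hi (by simp only [ha, h0, map_zero])
    obtain ⟨m, hm⟩ := ne_zero_iff.1 hne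
    rw [coeff_pderiv] at hm
    have h1 := hPe (left_ne_zero_of_mul hm)
    rw [map_add, Finsupp.weight_single] at h1
    have hle : d i ≤ e := by rw [← h1]; simp
    exact ⟨hle, isHomogeneous_aeval_of_isWeightedHomogeneous hh (hPe.pderiv (by omega))⟩
  obtain ⟨M, hM, hMmin⟩ := exists_minimal_subsystem A a
  have hMne : ∀ i ∈ M, a i ≠ 0 := by
    intro i hi h0
    refine hMmin i hi 0 ?_
    rw [h0]; simp
  obtain ⟨i₀, hi₀⟩ : M.Nonempty := by
    rw [Finset.nonempty_iff_ne_empty]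
    rintro rfl
    obtain ⟨q, hq⟩ := hM i₁
    exact hi₁ (hq.trans (by simp))
  -- homogeneous coefficients
  have hq : ∀ j, ∃ q : Fin N → MvPolynomial σ ℂ,
      (∀ i ∈ M, q i = 0 ∨ d j ≤ d i ∧ (q i).IsHomogeneous (d i - d j)) ∧
      a j = ∑ i ∈ M, q i * a i := by
    intro j
    by_cases hj0 : a j = 0
    · exact ⟨0, fun i _ => Or.inl rfl, by simp [hj0]⟩
    obtain ⟨hje, hjh⟩ := hahom j hj0
    obtain ⟨q, hq⟩ := hM j
    refine ⟨fun i => if d j ≤ d i then homogeneousComponent (d i - d j) (q i : MvPolynomial σ ℂ) else 0,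
      fun i _ => ?_, ?_⟩
    · by_cases hji : d j ≤ d i
      · right; simp only [if_pos hji]; exact ⟨hji, homogeneousComponent_isHomogeneous _ _⟩
      · left; simp only [if_neg hji]
    · have h1 := congrArg (homogeneousComponent (e - d j)) hq
      rw [homogeneousComponent_eq_of_isHomogeneous hjh, if_pos rfl, map_sum] at h1
      rw [h1]
      refine Finset.sum_congr rfl fun i hi => ?_
      obtain ⟨hie, hih⟩ := hahom i (hMne i hi)
      rw [homogeneousComponent_mul_of_isHomogeneous hih]
      beta_reduce
      by_cases hji : d j ≤ d i
      · rw [if_pos hji, if_pos (by omega), show e - d j - (e - d i) = d i - d j by omega]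
      · rw [if_neg hji, if_neg (by omega), zero_mul]
  choose q hqhom hq using hq
  -- the syzygies
  set b : σ → Fin N → MvPolynomial σ ℂ := fun k i =>
    pderiv k (h i) + ∑ j ∈ Mᶜ, q j i * pderiv k (h j) with hb
  have hbhom : ∀ k, ∀ i ∈ M, (b k i).IsHomogeneous (d i - 1) := by
    intro k i hi
    refine (hh i).pderiv.add (IsHomogeneous.sum _ _ _ fun j _ => ?_)
    rcases hqhom j i hi with h0 | ⟨hle, hhom⟩
    · rw [h0, zero_mul]; exact isHomogeneous_zero _ _ _
    · have := hhom.mul ((hh j).pderiv (i := k))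
      have h1 := hd j
      rwa [show d i - d j + (d j - 1) = d i - 1 by omega] at this
  have hbsum : ∀ k, ∑ i ∈ M, b k i * a i = 0 := by
    intro k
    have h1 := congrArg (pderiv k) hP
    rw [pderiv_aeval, map_zero, ← Finset.sum_add_sum_compl M] at h1
    rw [← h1]
    have h2 : ∑ j ∈ Mᶜ, pderiv k (h j) * aeval h (pderiv j P) =
        ∑ i ∈ M, (∑ j ∈ Mᶜ, q j i * pderiv k (h j)) * a i := by
      simp_rw [Finset.sum_mul]
      rw [Finset.sum_comm]
      refine Finset.sum_congr rfl fun j _ => ?_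
      rw [show aeval h (pderiv j P) = a j from rfl, hq j, Finset.mul_sum]
      exact Finset.sum_congr rfl fun i _ => by ring
    rw [h2, ← Finset.sum_add_distrib]
    exact Finset.sum_congr rfl fun i _ => by rw [hb]; ring
  have hbI : ∀ k, b k i₀ ∈ hilbertIdeal σ Γ := fun k =>
    hΓ.mem_hilbertIdeal M a (fun i _ => hAinv _ (haA i)) hi₀
      (fun c hc => by
        refine hMmin i₀ hi₀ fun i => ⟨c i, ?_⟩
        exact hΓ.mem_adjoin hd hh hinv hspan (hc i)) (d i₀ - 1) (b k) (hbhom k i₀ hi₀) (hbsum k)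
  -- Euler's formula
  choose c hc using fun k => (Ideal.mem_span_range_iff_exists_fun).1 (hspan ▸ hbI k)
  have hE : C (d i₀ : ℂ) * h i₀ + ∑ j ∈ Mᶜ, q j i₀ * (C (d j : ℂ) * h j) =
      ∑ l, (∑ k, X k * c k l) * h l := by
    have h1 : ∀ j, C (d j : ℂ) * h j = ∑ k, X k * pderiv k (h j) := by
      intro j; rw [(hh j).sum_X_mul_pderiv, nsmul_eq_mul, map_natCast]
    calc _ = ∑ k, X k * b k i₀ := by
          simp_rw [h1, hb, mul_add, Finset.sum_add_distrib, Finset.mul_sum]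
          congr 1
          rw [Finset.sum_comm]
          exact Finset.sum_congr rfl fun k _ => Finset.sum_congr rfl fun j _ => by ring
      _ = _ := by
          simp_rw [← hc, Finset.mul_sum, Finset.sum_mul]
          rw [Finset.sum_comm]
          exact Finset.sum_congr rfl fun k _ => Finset.sum_congr rfl fun j _ => by ring
  -- In degree `d i₀` the coefficient of `h i₀` on the right contributes only its constant term,
  -- which is zero because of the factors `X k`. So `h i₀` would lie in the ideal generated by the
  -- other `h j`, against minimality.
  have hE' := congrArg (homogeneousComponent (d i₀)) hE
  rw [map_add, map_sum, map_sum] at hE'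
  rw [homogeneousComponent_eq_of_isHomogeneous ((hh i₀).C_mul _), if_pos rfl] at hE'
  refine hmin i₀ ?_
  have hself : homogeneousComponent (d i₀) ((∑ k, X k * c k i₀) * h i₀) = 0 := by
    rw [homogeneousComponent_mul_of_isHomogeneous (hh i₀), if_pos le_rfl, Nat.sub_self, homogeneousComponent_zero]
    have : coeff 0 (∑ k, X k * c k i₀) = 0 := by
      rw [coeff_sum]
      exact Finset.sum_eq_zero fun k _ => by
        rw [← constantCoeff_eq, map_mul, constantCoeff_X, zero_mul]
    rw [this, map_zero, zero_mul]
  have hmem : C (d i₀ : ℂ) * h i₀ ∈ Ideal.span (h '' {i₀}ᶜ) := by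
    rw [eq_sub_of_add_eq hE']
    refine sub_mem (sum_mem fun l _ => ?_) (sum_mem fun j hj => ?_)
    · by_cases hl : l = i₀
      · rw [hl, hself]; exact zero_mem _
      · rw [homogeneousComponent_mul_of_isHomogeneous (hh l)]
        split_ifs
        · exact Ideal.mul_mem_left _ _ (Ideal.subset_span ⟨l, hl, rfl⟩)
        · exact zero_mem _
    · have hji : j ≠ i₀ := by rintro rfl; exact (Finset.mem_compl.1 hj) hi₀
      rw [← mul_assoc, homogeneousComponent_mul_of_isHomogeneous (hh j)]
      split_ifs
      · exact Ideal.mul_mem_left _ _ (Ideal.subset_span ⟨j, hji, rfl⟩)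
      · exact zero_mem _
  have hd0 : (d i₀ : ℂ) ≠ 0 := Nat.cast_ne_zero.2 (hd i₀).ne'
  have := Ideal.mul_mem_left _ (C (d i₀ : ℂ)⁻¹) hmem
  rwa [← mul_assoc, ← map_mul, inv_mul_cancel₀ hd0, map_one, one_mul] at this

/-- The Chevalley–Shephard–Todd theorem: the invariants of a reflection group form a polynomial
algebra. -/
theorem IsReflectionAction.exists_basic_invariants [Fintype Γ] (hΓ : IsReflectionAction (σ := σ) Γ) :
    ∃ (N : ℕ) (h : Fin N → MvPolynomial σ ℂ) (d : Fin N → ℕ), (∀ i, 0 < d i) ∧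
      (∀ i, (h i).IsHomogeneous (d i)) ∧ (∀ i, ∀ g : Γ, g • h i = h i) ∧
      AlgebraicIndependent ℂ h ∧ N ≤ Fintype.card σ ∧
      ∀ p : MvPolynomial σ ℂ, (∀ g : Γ, g • p = p) → p ∈ Algebra.adjoin ℂ (Set.range h) := by
  obtain ⟨N, h, d, hd, hh, hinv, hspan, hmin⟩ := exists_minimal_generators (σ := σ) (Γ := Γ)
  have hai := hΓ.algebraicIndependent hd hh hinv hspan hmin
  refine ⟨N, h, d, hd, hh, hinv, hai, ?_, fun p hp => hΓ.mem_adjoin hd hh hinv hspan hp⟩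
  -- The number of independent invariants is at most the transcendence degree of the polynomial
  -- ring.
  have h1 := hai.lift_cardinalMk_le_trdeg
  rw [MvPolynomial.trdeg_of_isDomain] at h1
  simp only [Cardinal.mk_fintype, Fintype.card_fin, Cardinal.lift_natCast] at h1
  exact_mod_cast h1

end Independence


/-! ### Polynomial functions on `V` and invariants with prescribed behaviour -/

section PolynomialFunctions

open MvPolynomial Module

variable {V : Type*} [NormedAddCommGroup V] [NormedSpace ℂ V] [FiniteDimensional ℂ V]

variable (V) in
/-- The ring of polynomials in the coordinates of a chosen basis. -/
abbrev Poly : Type := MvPolynomial (Fin (finrank ℂ V)) ℂ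

/-- The value of a polynomial at a vector. -/
def pev (z : V) : Poly V →ₐ[ℂ] ℂ := aeval fun i => (finBasis ℂ V).coord i z

/-- A linear form as a polynomial. -/
def linPoly (φ : Dual ℂ V) : Poly V := ∑ i, C (φ (finBasis ℂ V i)) * X i

@[simp] theorem pev_C (z : V) (a : ℂ) : pev z (C a) = a := by simp [pev]

@[simp] theorem pev_linPoly (z : V) (φ : Dual ℂ V) : pev z (linPoly φ) = φ z := by
  conv_rhs => rw [← (finBasis ℂ V).sum_repr z, map_sum]
  simp [linPoly, pev, mul_comm]

theorem pev_X (z : V) (i : Fin (finrank ℂ V)) : pev z (X i) = (finBasis ℂ V).coord i z := by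
  simp [pev]

theorem isHomogeneous_linPoly (φ : Dual ℂ V) : (linPoly φ).IsHomogeneous 1 :=
  IsHomogeneous.sum _ _ _ fun i _ => isHomogeneous_C_mul_X _ i

theorem exists_pev_eq_eval (x : Fin (finrank ℂ V) → ℂ) : ∃ z : V, ∀ p : Poly V, pev z p = eval x p := by
  refine ⟨∑ i, x i • finBasis ℂ V i, fun p => ?_⟩
  have h : (fun i => (finBasis ℂ V).coord i (∑ i, x i • finBasis ℂ V i)) = x := by
    funext i
    simp [Basis.coord_apply, Finsupp.single_apply]
  rw [pev, h]; rfl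

theorem pev_injective {p q : Poly V} (h : ∀ z : V, pev z p = pev z q) : p = q := by
  refine MvPolynomial.funext fun x => ?_
  obtain ⟨z, hz⟩ := exists_pev_eq_eval (V := V) x
  rw [← hz, ← hz, h]

theorem analyticAt_pev (p : Poly V) (z : V) : AnalyticAt ℂ (fun y => pev y p) z :=
  AnalyticAt.aeval_mvPolynomial
    (fun i => (LinearMap.toContinuousLinearMap ((finBasis ℂ V).coord i)).analyticAt z) p

theorem pev_smul_of_isHomogeneous {p : Poly V} {d : ℕ} (hp : p.IsHomogeneous d) (c : ℂ) (z : V) :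
    pev (c • z) p = c ^ d * pev z p := by
  simp only [pev, aeval_def, eval₂_eq', Finset.mul_sum]
  refine Finset.sum_congr rfl fun m hm => ?_
  have h1 : ∑ i, m i = d := by
    have := hp (mem_support_iff.1 hm)
    rw [Finsupp.weight_apply, Finsupp.sum_fintype _ _ (by simp)] at this
    simpa using this
  simp only [map_smul, smul_eq_mul, mul_pow, Finset.prod_mul_distrib, Finset.prod_pow_eq_pow_sum, h1]
  ring

/-- The derivative of a polynomial function along a basis vector. -/
theorem fderiv_pev_basis (p : Poly V) (z : V) (j : Fin (finrank ℂ V)) :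
    fderiv ℂ (fun y => pev y p) z (finBasis ℂ V j) = pev z (pderiv j p) := by
  induction p using MvPolynomial.induction_on with
  | C a => simp
  | add p q hp hq =>
    simp only [map_add]
    rw [fderiv_fun_add (analyticAt_pev p z).differentiableAt (analyticAt_pev q z).differentiableAt]
    simp [hp, hq]
  | mul_X p i hp =>
    simp only [map_mul, Derivation.leibniz]
    rw [fderiv_fun_mul (analyticAt_pev p z).differentiableAt (analyticAt_pev (X i) z).differentiableAt]
    have h1 : (fun y : V => pev y (X i)) = LinearMap.toContinuousLinearMap ((finBasis ℂ V).coord i) := by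
      funext y; rw [pev_X]; rfl
    simp only [add_apply, smul_apply, hp, smul_eq_mul, map_add, map_mul]
    rw [h1, ContinuousLinearMap.fderiv]
    simp only [LinearMap.coe_toContinuousLinearMap', Basis.coord_apply, Basis.repr_self, pev_X]
    rw [pderiv_X]
    by_cases hij : i = j
    · subst hij; simp
    · simp [hij]

theorem fderiv_pev_mul_of_vanish {p q : Poly V} {z : V} (hp : pev z p = 0) (hq : pev z q = 0) :
    fderiv ℂ (fun y => pev y (p * q)) z = 0 := by
  simp only [map_mul]
  rw [fderiv_fun_mul (analyticAt_pev p z).differentiableAt (analyticAt_pev q z).differentiableAt,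
    hp, hq]
  ext u
  simp

/-- An affine-linear polynomial separates two points. -/
theorem exists_pev_separating {w z : V} (h : w ≠ z) : ∃ m : Poly V, pev w m = 0 ∧ pev z m = 1 := by
  obtain ⟨φ, hφ⟩ : ∃ φ : Dual ℂ V, φ (z - w) ≠ 0 := by
    by_contra! hc
    exact h (sub_eq_zero.1 ((Module.forall_dual_apply_eq_zero_iff ℂ _).1 hc)).symm
  refine ⟨C (φ (z - w))⁻¹ * (linPoly φ - C (φ w)), by simp, ?_⟩
  simp only [map_mul, map_sub, pev_C, pev_linPoly]
  exact inv_mul_cancel₀ (by rwa [map_sub] at hφ)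

/-- Substitution of a linear automorphism. -/
def polySubst (g : V ≃ₗ[ℂ] V) : Poly V →ₐ[ℂ] Poly V :=
  aeval fun i => linPoly ((finBasis ℂ V).coord i ∘ₗ (g : V →ₗ[ℂ] V))

@[simp] theorem pev_polySubst (g : V ≃ₗ[ℂ] V) (z : V) (p : Poly V) :
    pev z (polySubst g p) = pev (g z) p := by
  have : (pev z).comp (polySubst g) = pev (g z) := by
    refine MvPolynomial.algHom_ext fun i => ?_
    simp only [polySubst, AlgHom.comp_apply, aeval_X, pev_linPoly, pev_X]
    rfl
  exact DFunLike.congr_fun this p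

/-- The action of a linear group on polynomials. -/
@[reducible] def polyAction (G : Subgroup (V ≃ₗ[ℂ] V)) : MulSemiringAction G (Poly V) where
  smul g p := polySubst (g : V ≃ₗ[ℂ] V)⁻¹ p
  one_smul p := pev_injective fun z => by
    change pev z (polySubst _ p) = _
    rw [pev_polySubst]; simp
  mul_smul g h p := pev_injective fun z => by
    change pev z (polySubst _ p) = pev z (polySubst _ (polySubst _ p))
    rw [pev_polySubst, pev_polySubst, pev_polySubst, Subgroup.coe_mul, mul_inv_rev]; rfl
  smul_zero g := map_zero _
  smul_add g := map_add _
  smul_one g := map_one _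
  smul_mul g := map_mul _

variable {G : Subgroup (V ≃ₗ[ℂ] V)}

/-- A reflection moves `z` by `φ z` times a fixed vector, where `φ` is an equation of its
hyperplane. Hence it acts trivially on polynomials modulo `φ`, which need only be checked on the
variables. -/
theorem isReflectionAction_polyAction (hG : IsReflectionGroup G) :
    letI := polyAction G
    IsReflectionAction (σ := Fin (finrank ℂ V)) G := by
  let _ := polyAction G
  have hsmul : ∀ (g : G) (p : Poly V) (z : V), pev z (g • p) = pev ((g : V ≃ₗ[ℂ] V)⁻¹ z) p :=
    fun g p z => pev_polySubst _ _ _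
  refine ⟨fun g a => pev_injective fun z => by rw [hsmul]; simp, fun g p d hp => ?_, ?_⟩
  · have h1 := IsHomogeneous.aeval hp
      (fun i => linPoly ((finBasis ℂ V).coord i ∘ₗ (((g : V ≃ₗ[ℂ] V)⁻¹ : V ≃ₗ[ℂ] V) : V →ₗ[ℂ] V)))
      (n := 1) (fun i => isHomogeneous_linPoly _)
    rw [one_mul] at h1
    exact h1
  · refine Subgroup.map_injective G.subtype_injective ?_
    rw [MonoidHom.map_closure, ← MonoidHom.range_eq_map, Subgroup.range_subtype]
    refine le_antisymm ?_ ?_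
    · rw [Subgroup.closure_le]
      rintro _ ⟨s, -, rfl⟩
      exact s.2
    · conv_lhs => rw [← hG]
      refine Subgroup.closure_mono ?_
      rintro s ⟨hs, hr⟩
      refine ⟨⟨s, hs⟩, ?_, rfl⟩
      obtain ⟨φ, hφ0, hφ⟩ := exists_equation (G := G) ⟨s, hs, hr, rfl⟩
      obtain ⟨e, he⟩ : ∃ e, φ e = 1 := by
        obtain ⟨v, hv⟩ : ∃ v, φ v ≠ 0 := by
          by_contra! hc; exact hφ0 (by ext v; simpa using hc v)
        exact ⟨(φ v)⁻¹ • v, by simp [hv]⟩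
      have hfix : ∀ z, s⁻¹ z - z = φ z • (s⁻¹ e - e) := by
        intro z
        have h1 : z - φ z • e ∈ fixedSpace s := by
          rw [← hφ, LinearMap.mem_ker]; simp [he]
        rw [map_mem_fixedSpace] at h1
        have h2 : s⁻¹ (z - φ z • e) = z - φ z • e := by
          conv_lhs => rw [← h1]
          exact inv_linearEquiv_apply_self s _
        rw [map_sub, map_smul] at h2
        rw [smul_sub]
        rw [sub_eq_sub_iff_add_eq_add] at h2 ⊢
        rw [h2, add_comm]
      refine ⟨linPoly (φ : V →ₗ[ℂ] ℂ), ?_, isHomogeneous_linPoly _, fun p => ?_⟩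
      · intro h0
        have := pev_linPoly e (φ : V →ₗ[ℂ] ℂ)
        rw [h0, map_zero] at this
        exact zero_ne_one (this.trans he)
      · set I : Ideal (Poly V) := Ideal.span {linPoly (φ : V →ₗ[ℂ] ℂ)}
        have key : (Ideal.Quotient.mkₐ ℂ I).comp (polySubst s⁻¹) = Ideal.Quotient.mkₐ ℂ I := by
          refine MvPolynomial.algHom_ext fun i => ?_
          rw [AlgHom.comp_apply]
          refine Ideal.Quotient.eq.2 ?_
          rw [Ideal.mem_span_singleton]
          refine ⟨C ((finBasis ℂ V).coord i (s⁻¹ e - e)), pev_injective fun z => ?_⟩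
          rw [map_sub, pev_polySubst, map_mul, pev_linPoly, pev_C, pev_X, pev_X, ← map_sub, hfix z,
            map_smul]
          rfl
        have h2 := DFunLike.congr_fun key p
        exact Ideal.mem_span_singleton.1 (Ideal.Quotient.eq.1 h2)

/-- A polynomial that is a function on the orbit space. -/
def IsInvPoly (G : Subgroup (V ≃ₗ[ℂ] V)) (p : Poly V) : Prop :=
  ∀ g ∈ G, ∀ z : V, pev (g z) p = pev z p

theorem isInvPoly_iff {p : Poly V} :
    letI := polyAction G
    IsInvPoly G p ↔ ∀ g : G, g • p = p := by
  let _ := polyAction G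
  have hsmul : ∀ (g : G) (p : Poly V) (z : V), pev z (g • p) = pev ((g : V ≃ₗ[ℂ] V)⁻¹ z) p :=
    fun g p z => pev_polySubst _ _ _
  constructor
  · intro h g
    exact pev_injective fun z => by rw [hsmul, h _ (G.inv_mem g.2)]
  · intro h g hg z
    have := hsmul (⟨g, hg⟩⁻¹) p z
    rw [h] at this
    rw [this]; simp

/-- Values of polynomials can be prescribed on two orbits, so invariants separate orbits. -/
theorem exists_isInvPoly_separating [Finite G] {z z' : V} (h : ∀ g ∈ G, z' ≠ g z) :
    ∃ p : Poly V, IsInvPoly G p ∧ pev z p ≠ pev z' p := by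
  classical
  have := Fintype.ofFinite G
  have hne : ∀ g k : G, (k : V ≃ₗ[ℂ] V) z ≠ (g : V ≃ₗ[ℂ] V) z' := by
    intro g k he
    refine h ((g : V ≃ₗ[ℂ] V)⁻¹ * k) (G.mul_mem (G.inv_mem g.2) k.2) ?_
    rw [mul_linearEquiv_apply, he, inv_linearEquiv_apply_self]
  choose m hm0 hm1 using fun g k => exists_pev_separating (hne g k)
  -- This polynomial is `0` on the orbit of `z` and `1` on that of `z'`, so its sum over the group
  -- takes the values `0` and `|G|`.
  set p : Poly V := 1 - ∏ g : G, (1 - ∏ k : G, m g k) with hp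
  have hpz : ∀ k : G, pev ((k : V ≃ₗ[ℂ] V) z) p = 0 := by
    intro k
    have : ∀ g, ∏ k' : G, pev ((k : V ≃ₗ[ℂ] V) z) (m g k') = 0 := fun g =>
      Finset.prod_eq_zero (Finset.mem_univ k) (hm0 g k)
    simp [hp, map_prod, this]
  have hpz' : ∀ g : G, pev ((g : V ≃ₗ[ℂ] V) z') p = 1 := by
    intro g
    have h1 : ∏ g' : G, (1 - ∏ k : G, pev ((g : V ≃ₗ[ℂ] V) z') (m g' k)) = 0 := by
      refine Finset.prod_eq_zero (Finset.mem_univ g) ?_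
      simp [hm1]
    simp only [hp, map_sub, map_one, map_prod, h1, sub_zero]
  refine ⟨∑ g : G, polySubst (g : V ≃ₗ[ℂ] V) p, fun g hg y => ?_, ?_⟩
  · simp only [map_sum, pev_polySubst]
    exact Fintype.sum_equiv (Equiv.mulRight ⟨g, hg⟩) _ _ fun k => by
      rw [Equiv.coe_mulRight, Subgroup.coe_mul, mul_linearEquiv_apply]
  · simp only [map_sum, pev_polySubst, hpz, hpz']
    simpa using (Nat.cast_ne_zero (R := ℂ).2 (Fintype.card_ne_zero (α := G))).symm

/-- At points with trivial stabilizer, the differentials of the invariants separate tangent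
vectors. -/
theorem exists_isInvPoly_fderiv_ne_zero [Finite G] {z u : V} (hz : ∀ g ∈ G, g z = z → g = 1)
    (hu : u ≠ 0) : ∃ p : Poly V, IsInvPoly G p ∧ fderiv ℂ (fun y => pev y p) z u ≠ 0 := by
  classical
  have := Fintype.ofFinite G
  obtain ⟨l, hl⟩ : ∃ l : Dual ℂ V, l u ≠ 0 := by
    by_contra! hc
    exact hu ((Module.forall_dual_apply_eq_zero_iff ℂ _).1 hc)
  have hne : ∀ g : G, ∃ m : Poly V, (g ≠ 1 → pev ((g : V ≃ₗ[ℂ] V) z) m = 0) ∧ pev z m = 1 := by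
    intro g
    by_cases hg : g = 1
    · exact ⟨1, fun h => absurd hg h, map_one _⟩
    · obtain ⟨m, h0, h1⟩ := exists_pev_separating (w := (g : V ≃ₗ[ℂ] V) z) (z := z)
        fun he => hg (Subtype.ext (hz g g.2 he))
      exact ⟨m, fun _ => h0, h1⟩
  choose m hm0 hm1 using hne
  set q : Poly V := ∏ g : G, m g with hq
  have hqz : pev z q = 1 := by simp [hq, map_prod, hm1]
  have hqg : ∀ g : G, g ≠ 1 → pev ((g : V ≃ₗ[ℂ] V) z) q = 0 := by
    intro g hg
    rw [hq, map_prod]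
    exact Finset.prod_eq_zero (Finset.mem_univ g) (hm0 g hg)
  -- The factor `q * q` makes `r` vanish to second order at the other points of the orbit, while at
  -- `z`, where `q` is `1`, the differential of `r` is `l`. Only the identity then contributes to
  -- the differential of the sum over the group.
  set r : Poly V := (linPoly l - C (l z)) * (q * q) with hr
  have hr0 : ∀ g : G, g ≠ 1 → fderiv ℂ (fun y => pev y r) ((g : V ≃ₗ[ℂ] V) z) = 0 := by
    intro g hg
    rw [hr, ← mul_assoc]
    exact fderiv_pev_mul_of_vanish (by rw [map_mul, hqg g hg, mul_zero]) (hqg g hg)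
  have hr1 : fderiv ℂ (fun y => pev y r) z u = l u := by
    have h0 : (fun y : V => pev y r) = fun y => pev y (linPoly l - C (l z)) * pev y (q * q) :=
      funext fun y => map_mul _ _ _
    rw [h0, fderiv_fun_mul (analyticAt_pev _ z).differentiableAt
      (analyticAt_pev (q * q) z).differentiableAt]
    have h1 : (fun y : V => pev y (linPoly l - C (l z))) =
        fun y => LinearMap.toContinuousLinearMap l y - l z := by
      funext y; simp
    rw [h1, fderiv_sub_const, ContinuousLinearMap.fderiv]
    simp [hqz]
  refine ⟨∑ g : G, polySubst (g : V ≃ₗ[ℂ] V) r, fun g hg y => ?_, ?_⟩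
  · simp only [map_sum, pev_polySubst]
    exact Fintype.sum_equiv (Equiv.mulRight ⟨g, hg⟩) _ _ fun k => by
      rw [Equiv.coe_mulRight, Subgroup.coe_mul, mul_linearEquiv_apply]
  · simp only [map_sum, pev_polySubst]
    have hcomp : ∀ g : G, HasFDerivAt (fun y => pev ((g : V ≃ₗ[ℂ] V) y) r)
        ((fderiv ℂ (fun y => pev y r) ((g : V ≃ₗ[ℂ] V) z)).comp (toCLM (g : V ≃ₗ[ℂ] V))) z :=
      fun g => HasFDerivAt.comp z (f := toCLM (g : V ≃ₗ[ℂ] V))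
        (analyticAt_pev r _).differentiableAt.hasFDerivAt (toCLM (g : V ≃ₗ[ℂ] V)).hasFDerivAt
    rw [(HasFDerivAt.fun_sum fun g _ => hcomp g).fderiv]
    rw [Finset.sum_eq_single 1]
    · simpa [hr1] using hl
    · intro g _ hg; rw [hr0 g hg, ContinuousLinearMap.zero_comp]
    · simp

theorem exists_free_point (G : Subgroup (V ≃ₗ[ℂ] V)) [Finite G] :
    ∃ z : V, ∀ g ∈ G, g z = z → g = 1 := by
  have hd := dense_compl_iUnion_submodule (𝒮 := fixedSpace '' {g : V ≃ₗ[ℂ] V | g ∈ G ∧ g ≠ 1})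
    (((Set.toFinite (G : Set (V ≃ₗ[ℂ] V))).subset fun g hg => hg.1).image _) (by
      rintro _ ⟨g, ⟨-, hg⟩, rfl⟩ ht
      refine hg (LinearEquiv.ext fun z => ?_)
      have : z ∈ fixedSpace g := ht ▸ Submodule.mem_top
      exact map_mem_fixedSpace.1 this)
  obtain ⟨z, hz⟩ := hd.nonempty
  refine ⟨z, fun g hg hgz => ?_⟩
  by_contra hne
  exact hz _ ⟨g, ⟨hg, hne⟩, rfl⟩ (map_mem_fixedSpace.2 hgz)

end PolynomialFunctions


/-! ### Basic invariants, their Jacobian, and Steinberg's theorem -/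

section BasicInvariants

open MvPolynomial Module

variable {V : Type*} [NormedAddCommGroup V] [NormedSpace ℂ V] [FiniteDimensional ℂ V]
  {G : Subgroup (V ≃ₗ[ℂ] V)}

/-- A system of basic invariants of `G`, with their degrees. -/
structure IsBasicInvariants (G : Subgroup (V ≃ₗ[ℂ] V)) (h : Fin (finrank ℂ V) → Poly V)
    (d : Fin (finrank ℂ V) → ℕ) : Prop where
  deg_pos : ∀ i, 0 < d i
  homogeneous : ∀ i, (h i).IsHomogeneous (d i)
  invariant : ∀ i, IsInvPoly G (h i)
  independent : AlgebraicIndependent ℂ h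
  generates : ∀ p, IsInvPoly G p → p ∈ Algebra.adjoin ℂ (Set.range h)

theorem analyticAt_pev_pi {N : ℕ} (h : Fin N → Poly V) (z : V) :
    AnalyticAt ℂ (fun y i => pev y (h i)) z :=
  AnalyticAt.pi fun i => analyticAt_pev (h i) z

theorem pev_aeval {N : ℕ} (h : Fin N → Poly V) (Q : MvPolynomial (Fin N) ℂ) (y : V) :
    pev y (aeval h Q) = eval (fun i => pev y (h i)) Q := by
  have h1 : (pev y).comp (aeval h) = aeval fun i => pev y (h i) :=
    MvPolynomial.algHom_ext fun i => by rw [AlgHom.comp_apply, aeval_X, aeval_X]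
  exact DFunLike.congr_fun h1 Q

theorem analyticAt_eval {N : ℕ} (Q : MvPolynomial (Fin N) ℂ) (x : Fin N → ℂ) :
    AnalyticAt ℂ (fun x => eval x Q) x :=
  AnalyticOnNhd.eval_mvPolynomial Q x (Set.mem_univ x)

theorem fderiv_pev_aeval_eq_zero {N : ℕ} (h : Fin N → Poly V) (Q : MvPolynomial (Fin N) ℂ) {z u : V}
    (hu : fderiv ℂ (fun y i => pev y (h i)) z u = 0) :
    fderiv ℂ (fun y => pev y (aeval h Q)) z u = 0 := by
  simp only [pev_aeval]
  have h1 := HasFDerivAt.comp z (analyticAt_eval Q _).differentiableAt.hasFDerivAt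
    (analyticAt_pev_pi h z).differentiableAt.hasFDerivAt
  have h2 := DFunLike.congr_fun h1.fderiv u
  rw [ContinuousLinearMap.comp_apply, hu, map_zero] at h2
  exact h2

/-- Every invariant is a polynomial in the `h i`, so its differential kills whatever all the
differentials of the `h i` kill. At a free point the invariants separate tangent vectors. -/
theorem eq_zero_of_fderiv_eq_zero [Finite G] {N : ℕ} {h : Fin N → Poly V}
    (hgen : ∀ p, IsInvPoly G p → p ∈ Algebra.adjoin ℂ (Set.range h)) {z u : V}
    (hz : ∀ g ∈ G, g z = z → g = 1) (hu : fderiv ℂ (fun y i => pev y (h i)) z u = 0) : u = 0 := by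
  by_contra hne
  obtain ⟨p, hp, hpu⟩ := exists_isInvPoly_fderiv_ne_zero hz hne
  have hpm := hgen p hp
  rw [← aeval_range] at hpm
  obtain ⟨Q, hQp⟩ := hpm
  refine hpu ?_
  have h1 := fderiv_pev_aeval_eq_zero h Q hu
  rw [show aeval h Q = p from hQp] at h1
  exact h1

/-- The transcendence degree bounds the number of generators by the dimension. The reverse
inequality holds because their joint differential is injective at a free point. -/
theorem exists_isBasicInvariants [Finite G] (hG : IsReflectionGroup G) :
    ∃ h d, IsBasicInvariants G h d := by
  letI := polyAction G
  have := Fintype.ofFinite G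
  obtain ⟨N, h, d, h1, h2, h3, h4, h5, h6⟩ := (isReflectionAction_polyAction hG).exists_basic_invariants
  rw [Fintype.card_fin] at h5
  have hgen : ∀ p, IsInvPoly G p → p ∈ Algebra.adjoin ℂ (Set.range h) := fun p hp =>
    h6 p (isInvPoly_iff.1 hp)
  obtain ⟨z, hz⟩ := exists_free_point G
  have hle : finrank ℂ V ≤ N := by
    have := LinearMap.finrank_le_finrank_of_injective
      (f := (fderiv ℂ (fun y i => pev y (h i)) z : V →ₗ[ℂ] (Fin N → ℂ)))
      ((injective_iff_map_eq_zero _).2 fun u hu => eq_zero_of_fderiv_eq_zero hgen hz hu)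
    simpa using this
  obtain rfl : N = finrank ℂ V := le_antisymm h5 hle
  exact ⟨h, d, h1, h2, fun i => isInvPoly_iff.2 (h3 i), h4, hgen⟩

variable {h : Fin (finrank ℂ V) → Poly V} {d : Fin (finrank ℂ V) → ℕ}

/-- The Jacobian of a system of polynomials. -/
def jacobian (h : Fin (finrank ℂ V) → Poly V) : Poly V :=
  Matrix.det (Matrix.of fun i j => pderiv j (h i))

theorem pev_jacobian_eq_zero_iff (z : V) : pev z (jacobian h) = 0 ↔
    ∃ u : V, u ≠ 0 ∧ fderiv ℂ (fun y i => pev y (h i)) z u = 0 := by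
  have hdet : pev z (jacobian h) = Matrix.det (Matrix.of fun i j =>
      fderiv ℂ (fun y i => pev y (h i)) z (finBasis ℂ V j) i) := by
    rw [jacobian, AlgHom.map_det]
    congr 1
    ext i j
    simp only [AlgHom.mapMatrix_apply, Matrix.map_apply, Matrix.of_apply]
    rw [← fderiv_pev_basis, fderiv_pi fun i => (analyticAt_pev (h i) z).differentiableAt]
    rfl
  rw [hdet, ← Matrix.exists_mulVec_eq_zero_iff]
  have hmul : ∀ x : Fin (finrank ℂ V) → ℂ, (Matrix.of fun i j =>
      fderiv ℂ (fun y i => pev y (h i)) z (finBasis ℂ V j) i).mulVec x =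
      fderiv ℂ (fun y i => pev y (h i)) z ((finBasis ℂ V).equivFun.symm x) := by
    intro x
    rw [Basis.equivFun_symm_apply, map_sum]
    ext i
    simp [Matrix.mulVec, dotProduct, mul_comm]
  constructor
  · rintro ⟨x, hx, h0⟩
    exact ⟨(finBasis ℂ V).equivFun.symm x, (LinearEquiv.map_ne_zero_iff _).2 hx, by rw [← hmul, h0]⟩
  · rintro ⟨u, hu, h0⟩
    exact ⟨(finBasis ℂ V).equivFun u, (LinearEquiv.map_ne_zero_iff _).2 hu, by
      rw [hmul, LinearEquiv.symm_apply_apply, h0]⟩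

theorem IsBasicInvariants.map_eq (hh : IsBasicInvariants G h d) {g : V ≃ₗ[ℂ] V} (hg : g ∈ G)
    (z : V) : (fun i => pev (g z) (h i)) = fun i => pev z (h i) :=
  funext fun i => hh.invariant i g hg z

/-- The Jacobian vanishes precisely at the points with nontrivial stabilizer. -/
theorem IsBasicInvariants.jacobian_ne_zero_iff [Finite G] (hh : IsBasicInvariants G h d) (z : V) :
    pev z (jacobian h) ≠ 0 ↔ ∀ g ∈ G, g z = z → g = 1 := by
  constructor
  · intro hJ g hg hgz
    refine LinearEquiv.ext fun u => ?_
    change g u = u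
    by_contra hne
    refine hJ ((pev_jacobian_eq_zero_iff z).2 ⟨g u - u, sub_ne_zero.2 hne, ?_⟩)
    have h1 : HasFDerivAt (fun y i => pev (g y) (h i))
        ((fderiv ℂ (fun y i => pev y (h i)) (g z)).comp (toCLM g)) z :=
      HasFDerivAt.comp z (f := toCLM g) (analyticAt_pev_pi h _).differentiableAt.hasFDerivAt
        (toCLM g).hasFDerivAt
    have h2 : (fun (y : V) i => pev (g y) (h i)) = fun y i => pev y (h i) :=
      funext fun y => hh.map_eq hg y
    rw [h2, hgz] at h1
    have h3 := DFunLike.congr_fun h1.fderiv u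
    rw [ContinuousLinearMap.comp_apply, toCLM_apply] at h3
    rw [map_sub, ← h3, sub_self]
  · intro hz h0
    obtain ⟨u, hu, hu0⟩ := (pev_jacobian_eq_zero_iff z).1 h0
    exact hu (eq_zero_of_fderiv_eq_zero hh.generates hz hu0)

/-- Steinberg's theorem: a reflection group acts freely on the complement of its reflection
hyperplanes. -/
theorem freeOnComplement [Finite G] (hG : IsReflectionGroup G) : FreeOnComplement G := by
  obtain ⟨h, d, hh⟩ := exists_isBasicInvariants hG
  intro z hz
  rw [← hh.jacobian_ne_zero_iff]
  -- Near a point off the hyperplanes the Jacobian can vanish only on fixed spaces of nontrivial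
  -- elements that are not reflections. These have codimension at least two, too small for the zero
  -- set of a holomorphic function unless it is empty.
  set 𝒮 : Set (Submodule ℂ V) := fixedSpace '' {g : V ≃ₗ[ℂ] V | g ∈ G ∧ g ≠ 1 ∧ ¬ IsComplexReflection g}
  refine ne_zero_of_zeros_subset (J := fun y => pev y (jacobian h)) (𝒮 := 𝒮) (analyticAt_pev (jacobian h) z)
    (((Set.toFinite (G : Set (V ≃ₗ[ℂ] V))).subset fun g hg => hg.1).image _) ?_ ?_
  · rintro _ ⟨g, ⟨hg, hg1, hgr⟩, rfl⟩ e htop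
    have hfin : IsOfFinOrder g := by
      have := isOfFinOrder_of_finite (⟨g, hg⟩ : G)
      exact Submonoid.isOfFinOrder_coe.2 this
    refine hgr ⟨hfin, ?_⟩
    refine le_antisymm ?_ ?_
    · refine finrank_le_one ((fixedSpace g).mkQ e) fun w => ?_
      obtain ⟨y, rfl⟩ := (fixedSpace g).mkQ_surjective w
      obtain ⟨a, ha, b, hb, rfl⟩ := Submodule.mem_sup.1 (htop ▸ Submodule.mem_top (x := y))
      obtain ⟨c, rfl⟩ := Submodule.mem_span_singleton.1 hb
      refine ⟨c, ?_⟩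
      rw [map_add, map_smul, show (fixedSpace g).mkQ a = 0 from (Submodule.Quotient.mk_eq_zero _).2 ha, zero_add]
    · rw [Nat.one_le_iff_ne_zero]
      intro h0
      have hsub : Subsingleton (V ⧸ fixedSpace g) := finrank_zero_iff.1 h0
      refine hg1 (LinearEquiv.ext fun y => map_mem_fixedSpace.1 ?_)
      rw [Submodule.Quotient.subsingleton_iff.1 hsub]; trivial
  · filter_upwards [isOpen_arrComplement.mem_nhds hz] with y hy hy0
    have h1 : ¬ ∀ g ∈ G, g y = y → g = 1 := fun hc => (hh.jacobian_ne_zero_iff y).2 hc hy0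
    push Not at h1
    obtain ⟨g, hg, hgy, hg1⟩ := h1
    have hmem := map_mem_fixedSpace.2 hgy
    exact ⟨_, ⟨g, ⟨hg, hg1, fun hr => hy _ ⟨g, hg, hr, rfl⟩ hmem⟩, rfl⟩, hmem⟩

/-- A point `c` gives a maximal ideal of the algebra of invariants. The polynomial ring is integral
over that algebra, so a maximal ideal lies over it, and this is a point of `V` by the
Nullstellensatz. -/
theorem IsBasicInvariants.surjective [Finite G] (hh : IsBasicInvariants G h d) :
    Function.Surjective fun (z : V) i => pev z (h i) := by
  letI := polyAction G
  intro c
  set A := Algebra.adjoin ℂ (Set.range h)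
  have hAinv : ∀ p ∈ A, IsInvPoly G p := by
    intro p hp g hg z
    induction hp using Algebra.adjoin_induction with
    | mem x hx => obtain ⟨i, rfl⟩ := hx; exact hh.invariant i g hg z
    | algebraMap r => simp
    | add x y _ _ hx hy => rw [map_add, map_add, hx, hy]
    | mul x y _ _ hx hy => rw [map_mul, map_mul, hx, hy]
  have hI : Algebra.IsInvariant A (Poly V) G :=
    ⟨fun p hp => ⟨⟨p, hh.generates p (isInvPoly_iff.2 hp)⟩, rfl⟩⟩
  have hint : Algebra.IsIntegral A (Poly V) := Algebra.IsInvariant.isIntegral A (Poly V) G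
  set φ : A →ₐ[ℂ] ℂ := (aeval c : MvPolynomial _ ℂ →ₐ[ℂ] ℂ).comp
    (hh.independent.aevalEquiv.symm : A →ₐ[ℂ] _)
  have hsurj : Function.Surjective φ := fun a => ⟨algebraMap ℂ A a, by simp⟩
  have hmax : (RingHom.ker φ).IsMaximal := RingHom.ker_isMaximal_of_surjective _ hsurj
  obtain ⟨Q, hQ, hQc⟩ := Ideal.exists_ideal_over_maximal_of_isIntegral (S := Poly V) (RingHom.ker φ) (by
    intro a ha
    have : a = 0 := Subtype.ext ha
    rw [this]; exact zero_mem _)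
  obtain ⟨x, rfl⟩ := MvPolynomial.isMaximal_iff_eq_vanishingIdeal_singleton.1 hQ
  obtain ⟨z, hz⟩ := exists_pev_eq_eval (V := V) x
  refine ⟨z, funext fun i => ?_⟩
  have hmem : (⟨h i, Algebra.subset_adjoin ⟨i, rfl⟩⟩ - algebraMap ℂ A (c i) : A) ∈ RingHom.ker φ := by
    have h1 : hh.independent.aevalEquiv.symm ⟨h i, Algebra.subset_adjoin ⟨i, rfl⟩⟩ = X i := by
      rw [AlgEquiv.symm_apply_eq]
      exact Subtype.ext (by simp)
    have h2 : φ ⟨h i, Algebra.subset_adjoin ⟨i, rfl⟩⟩ = c i := by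
      change aeval c (hh.independent.aevalEquiv.symm ⟨h i, Algebra.subset_adjoin ⟨i, rfl⟩⟩) = c i
      rw [h1, aeval_X]
    rw [RingHom.mem_ker, map_sub, AlgHom.commutes, h2]
    exact sub_self _
  rw [← hQc, Ideal.mem_comap, mem_vanishingIdeal_iff] at hmem
  have h2 := hmem x rfl
  rw [map_sub, map_sub] at h2
  have h3 : aeval x (h i) = pev z (h i) := (hz _).symm
  change aeval x (h i) - aeval x (C (c i)) = 0 at h2
  rw [h3] at h2
  simpa [sub_eq_zero] using h2

theorem IsBasicInvariants.eq_iff [Finite G] (hh : IsBasicInvariants G h d) (z z' : V) :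
    (fun i => pev z (h i)) = (fun i => pev z' (h i)) ↔ orbitMk G z = orbitMk G z' := by
  rw [orbitMk_eq_iff]
  constructor
  · intro he
    by_contra! hc
    obtain ⟨p, hp, hne⟩ := exists_isInvPoly_separating hc
    have hle : Algebra.adjoin ℂ (Set.range h) ≤ AlgHom.equalizer (pev z) (pev z') :=
      Algebra.adjoin_le (by rintro _ ⟨i, rfl⟩; exact congrFun he i)
    exact hne (hle (hh.generates p hp))
  · rintro ⟨g, hg, rfl⟩
    exact (hh.map_eq hg z).symm

end BasicInvariants


/-! ### The orbit space as an affine space -/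

section OrbitCoordinates

open MvPolynomial Module

variable {V : Type*} [NormedAddCommGroup V] [NormedSpace ℂ V] [FiniteDimensional ℂ V]
  {G : Subgroup (V ≃ₗ[ℂ] V)} {h : Fin (finrank ℂ V) → Poly V} {d : Fin (finrank ℂ V) → ℕ}

/-- Global holomorphic coordinates on the orbit space, given by homogeneous polynomials. -/
structure OrbitCoordinates (G : Subgroup (V ≃ₗ[ℂ] V)) where
  toHomeo : OrbitSpace G ≃ₜ (Fin (finrank ℂ V) → ℂ)
  deg : Fin (finrank ℂ V) → ℕ
  deg_pos : ∀ i, 0 < deg i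
  homogeneous : ∀ (c : ℂ) (z : V) (i), toHomeo (orbitMk G (c • z)) i = c ^ deg i * toHomeo (orbitMk G z) i
  analyticAt : ∀ z : V, AnalyticAt ℂ (fun y => toHomeo (orbitMk G y)) z
  fderiv_equiv : ∀ z ∈ arrComplement (reflHyperplanes G), ∃ e : V ≃L[ℂ] (Fin (finrank ℂ V) → ℂ),
    fderiv ℂ (fun y => toHomeo (orbitMk G y)) z = e
  holAt_iff : ∀ (k : OrbitSpace G → ℂ) (x : OrbitSpace G),
    HolAt G k x ↔ AnalyticAt ℂ (fun y => k (toHomeo.symm y)) (toHomeo x)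

theorem orbitMk_eq_zero_iff {z : V} : orbitMk G z = orbitMk G 0 ↔ z = 0 := by
  constructor
  · intro h
    obtain ⟨g, -, hg⟩ := orbitMk_eq_iff.1 h
    exact g.injective (by rw [← hg, map_zero])
  · rintro rfl; rfl

/-- The basic invariants vanish simultaneously only at `0`, hence are bounded below on the unit
sphere. Since the degrees are positive, their joint norm grows at least linearly. Properness then
makes the inverse on the orbit space continuous. -/
theorem IsBasicInvariants.tendsto_cocompact [Finite G] (hh : IsBasicInvariants G h d) :
    Tendsto (fun (z : V) i => pev z (h i)) (cocompact V) (cocompact _) := by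
  set H : V → Fin (finrank ℂ V) → ℂ := fun z i => pev z (h i) with hH
  have hhom : ∀ (c : ℂ) z i, H (c • z) i = c ^ d i * H z i := fun c z i =>
    pev_smul_of_isHomogeneous (hh.homogeneous i) c z
  have hcont : Continuous H := continuous_iff_continuousAt.2 fun z => (analyticAt_pev_pi h z).continuousAt
  have hH0 : H 0 = 0 := by
    funext i
    have := hhom 0 0 i
    rw [zero_smul, zero_pow (hh.deg_pos i).ne', zero_mul] at this
    exact this
  have hne : ∀ z ∈ Metric.sphere (0 : V) 1, 0 < ‖H z‖ := by
    intro z hz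
    rw [norm_pos_iff]
    intro h0
    have h1 := (hh.eq_iff z 0).1 (h0.trans hH0.symm)
    rw [orbitMk_eq_zero_iff] at h1
    rw [h1] at hz; simp at hz
  have : ProperSpace V := FiniteDimensional.proper ℂ V
  obtain ⟨δ, hδ, hmin⟩ := (isCompact_sphere (0 : V) 1).exists_forall_le' hcont.norm.continuousOn hne
  have hbound : ∀ z : V, 1 ≤ ‖z‖ → δ * ‖z‖ ≤ ‖H z‖ := by
    intro z hz
    have hz0 : ‖z‖ ≠ 0 := by positivity
    set u : V := ((‖z‖ : ℂ)⁻¹) • z with hu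
    have hzu : z = (‖z‖ : ℂ) • u := by
      rw [hu, smul_smul, mul_inv_cancel₀ (by exact_mod_cast hz0), one_smul]
    have hu1 : u ∈ Metric.sphere (0 : V) 1 := by
      rw [mem_sphere_zero_iff_norm, hu, norm_smul, norm_inv, Complex.norm_real, norm_norm,
        inv_mul_cancel₀ hz0]
    obtain ⟨i, hi⟩ : ∃ i, δ ≤ ‖H u i‖ := by
      by_contra! hc
      exact absurd (hmin u hu1) (not_le.2 ((pi_norm_lt_iff hδ).2 hc))
    refine le_trans ?_ (norm_le_pi_norm (H z) i)
    conv_rhs => rw [hzu, hhom, norm_mul, norm_pow, Complex.norm_real, norm_norm]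
    rw [mul_comm]
    exact mul_le_mul (le_self_pow₀ hz (hh.deg_pos i).ne') hi hδ.le (by positivity)
  rw [← Metric.cobounded_eq_cocompact, ← Metric.cobounded_eq_cocompact,
    ← tendsto_norm_atTop_iff_cobounded]
  have h1 : Tendsto (fun z : V => δ * ‖z‖) (Bornology.cobounded V) atTop :=
    tendsto_norm_cobounded_atTop.const_mul_atTop hδ
  refine tendsto_atTop_mono' _ ?_ h1
  filter_upwards [tendsto_norm_cobounded_atTop.eventually_ge_atTop 1] with z hz using hbound z hz

/-- Basic invariants identify the orbit space with an affine space. -/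
def IsBasicInvariants.toHomeo [Finite G] (hh : IsBasicInvariants G h d) :
    OrbitSpace G ≃ₜ (Fin (finrank ℂ V) → ℂ) := by
  have hcont : Continuous fun (z : V) i => pev z (h i) :=
    continuous_iff_continuousAt.2 fun z => (analyticAt_pev_pi h z).continuousAt
  let q : OrbitSpace G → Fin (finrank ℂ V) → ℂ := Quotient.lift (fun z i => pev z (h i)) (by
    intro a b hab
    exact (hh.eq_iff a b).2 (Quotient.sound hab))
  have hq : ∀ z, q (orbitMk G z) = fun i => pev z (h i) := fun z => rfl
  have hbij : Function.Bijective q := by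
    constructor
    · intro x y hxy
      obtain ⟨z, rfl⟩ := orbitMk_surjective x
      obtain ⟨w, rfl⟩ := orbitMk_surjective y
      exact (hh.eq_iff z w).1 hxy
    · intro c
      obtain ⟨z, hz⟩ := hh.surjective c
      exact ⟨orbitMk G z, hz⟩
  refine Equiv.toHomeomorphOfContinuousClosed (Equiv.ofBijective q hbij) (hcont.quotient_lift _) ?_
  have hclosed : IsClosedMap fun (z : V) i => pev z (h i) :=
    (isProperMap_iff_tendsto_cocompact.2 ⟨hcont, hh.tendsto_cocompact⟩).isClosedMap
  intro C hC
  have : q '' C = (fun (z : V) i => pev z (h i)) '' (orbitMk G ⁻¹' C) := by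
    rw [← Set.image_preimage_eq C (orbitMk_surjective (G := G)), Set.image_image,
      Set.preimage_image_preimage]
    rfl
  change IsClosed (q '' C)
  rw [this]
  exact hclosed _ (hC.preimage continuous_orbitMk)

theorem IsBasicInvariants.toHomeo_orbitMk [Finite G] (hh : IsBasicInvariants G h d) (z : V) :
    hh.toHomeo (orbitMk G z) = fun i => pev z (h i) := rfl

theorem IsBasicInvariants.map_nhds [Finite G] (hh : IsBasicInvariants G h d) (z : V) :
    map (fun (z : V) i => pev z (h i)) (𝓝 z) = 𝓝 fun i => pev z (h i) := by
  have h1 : map (orbitMk G) (𝓝 z) = 𝓝 (orbitMk G z) :=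
    le_antisymm continuous_orbitMk.continuousAt (isOpenMap_orbitMk.nhds_le z)
  have h2 := hh.toHomeo.map_nhds_eq (orbitMk G z)
  rw [← h1, map_map] at h2
  exact h2

theorem pev_jacobian_fderiv_equiv {z : V} (hJ : pev z (jacobian h) ≠ 0) :
    ∃ e : V ≃L[ℂ] (Fin (finrank ℂ V) → ℂ), fderiv ℂ (fun (y : V) i => pev y (h i)) z = e := by
  have hinj : Function.Injective (fderiv ℂ (fun (y : V) i => pev y (h i)) z) := by
    refine (injective_iff_map_eq_zero _).2 fun u hu => ?_
    by_contra hne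
    exact hJ ((pev_jacobian_eq_zero_iff z).2 ⟨u, hne, hu⟩)
  let e := LinearEquiv.ofInjectiveOfFinrankEq
    (fderiv ℂ (fun (y : V) i => pev y (h i)) z : V →ₗ[ℂ] (Fin (finrank ℂ V) → ℂ)) hinj
    (finrank_fin_fun ℂ).symm
  exact ⟨e.toContinuousLinearEquiv, by ext u; rfl⟩

/-- The determinant of the differential of the orbit map, raised to the order of the group,
descends. -/
theorem IsBasicInvariants.exists_discriminant [Finite G] (hh : IsBasicInvariants G h d) :
    ∃ Δ : MvPolynomial (Fin (finrank ℂ V)) ℂ, ∀ z : V,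
      eval (fun i => pev z (h i)) Δ = 0 ↔ pev z (jacobian h) = 0 := by
  classical
  have := Fintype.ofFinite G
  -- The product of all transforms of the Jacobian is invariant. It has the same zeros as the
  -- Jacobian, because having a trivial stabilizer is a property of the orbit.
  obtain ⟨Δ, hΔ⟩ : ∃ Δ, aeval h Δ = ∏ g : G, polySubst (g : V ≃ₗ[ℂ] V) (jacobian h) := by
    have := hh.generates (∏ g : G, polySubst (g : V ≃ₗ[ℂ] V) (jacobian h)) (by
      intro g hg z
      simp only [map_prod, pev_polySubst]
      exact Fintype.prod_equiv (Equiv.mulRight ⟨g, hg⟩) _ _ fun k => by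
        rw [Equiv.coe_mulRight, Subgroup.coe_mul, mul_linearEquiv_apply])
    rw [← aeval_range] at this
    exact this
  refine ⟨Δ, fun z => ?_⟩
  have hgz : ∀ g : G, pev ((g : V ≃ₗ[ℂ] V) z) (jacobian h) = 0 → pev z (jacobian h) = 0 := by
    intro g
    contrapose
    intro hz
    rw [← ne_eq, hh.jacobian_ne_zero_iff] at hz ⊢
    intro k hk hkz
    have h1 := hz ((g : V ≃ₗ[ℂ] V)⁻¹ * k * g) (G.mul_mem (G.mul_mem (G.inv_mem g.2) hk) g.2) (by
      rw [mul_linearEquiv_apply, mul_linearEquiv_apply, hkz, inv_linearEquiv_apply_self])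
    have h2 : k = g * ((g : V ≃ₗ[ℂ] V)⁻¹ * k * g) * (g : V ≃ₗ[ℂ] V)⁻¹ := by group
    rw [h2, h1, mul_one, mul_inv_cancel]
  rw [← pev_aeval, hΔ, map_prod, Finset.prod_eq_zero_iff]
  simp only [pev_polySubst]
  constructor
  · rintro ⟨g, -, hg⟩; exact hgz g hg
  · intro hz; exact ⟨1, Finset.mem_univ _, hz⟩

theorem continuousAt_of_continuousAt_orbitMk {Y : Type*} [TopologicalSpace Y] {k : OrbitSpace G → Y}
    {z : V} (hk : ContinuousAt (fun y => k (orbitMk G y)) z) : ContinuousAt k (orbitMk G z) := by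
  have h1 : map (orbitMk G) (𝓝 z) = 𝓝 (orbitMk G z) :=
    le_antisymm continuous_orbitMk.continuousAt (isOpenMap_orbitMk.nhds_le z)
  rw [ContinuousAt, ← h1, tendsto_map'_iff]
  exact hk

/-- Where the Jacobian is nonzero the orbit map has a local holomorphic inverse. Elsewhere the
function is at least continuous in the coordinates, and a continuous function that is analytic off
the zeros of `Δ` is analytic. -/
theorem IsBasicInvariants.analyticAt_iff [Finite G] (hh : IsBasicInvariants G h d)
    (k : OrbitSpace G → ℂ) (z : V) : AnalyticAt ℂ (fun y => k (orbitMk G y)) z ↔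
      AnalyticAt ℂ (fun y => k (hh.toHomeo.symm y)) (fun i => pev z (h i)) := by
  have hkH : ∀ y, k (hh.toHomeo.symm fun i => pev y (h i)) = k (orbitMk G y) := fun y => by
    rw [← hh.toHomeo_orbitMk, Homeomorph.symm_apply_apply]
  constructor
  · intro hk
    obtain ⟨Δ, hΔ⟩ := hh.exists_discriminant
    have hev : ∀ {P : (Fin (finrank ℂ V) → ℂ) → Prop},
        (∀ᶠ y in 𝓝 z, P fun i => pev y (h i)) → ∀ᶠ x in 𝓝 (fun i => pev z (h i)), P x := by
      intro P hP
      rw [← hh.map_nhds z]; exact hP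
    refine analyticAt_of_continuous_of_ne_zero (Δ := fun x => eval x Δ) (analyticAt_eval Δ _) ?_ ?_ ?_
    · rw [← hh.map_nhds z, frequently_map]
      simp_rw [ne_eq, hΔ]
      have hd : Dense {y : V | pev y (jacobian h) ≠ 0} := by
        refine (dense_compl_iUnion_submodule (𝒮 := fixedSpace '' {g : V ≃ₗ[ℂ] V | g ∈ G ∧ g ≠ 1})
          (((Set.toFinite (G : Set (V ≃ₗ[ℂ] V))).subset fun g hg => hg.1).image _) ?_).mono ?_
        · rintro _ ⟨g, ⟨-, hg⟩, rfl⟩ ht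
          refine hg (LinearEquiv.ext fun z => ?_)
          have : z ∈ fixedSpace g := ht ▸ Submodule.mem_top
          exact map_mem_fixedSpace.1 this
        · intro y hy
          refine (hh.jacobian_ne_zero_iff y).2 fun g hg hgy => ?_
          by_contra hne
          exact hy _ ⟨g, ⟨hg, hne⟩, rfl⟩ (map_mem_fixedSpace.2 hgy)
      exact mem_closure_iff_frequently.1 (hd z)
    · refine hev ?_
      filter_upwards [hk.eventually_analyticAt] with y hy
      have h1 := continuousAt_of_continuousAt_orbitMk hy.continuousAt
      refine ContinuousAt.comp (f := hh.toHomeo.symm) (g := k) ?_ hh.toHomeo.symm.continuous.continuousAt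
      rw [← hh.toHomeo_orbitMk, Homeomorph.symm_apply_apply]
      exact h1
    · refine hev ?_
      filter_upwards [hk.eventually_analyticAt] with y hy hyΔ
      obtain ⟨e, he⟩ := pev_jacobian_fderiv_equiv (mt (hΔ y).2 hyΔ)
      have hs : HasStrictFDerivAt (fun (y : V) i => pev y (h i)) (e : V →L[ℂ] _) y := by
        rw [← he]; exact (analyticAt_pev_pi h y).hasStrictFDerivAt
      set Φ := hs.toOpenPartialHomeomorph _
      have hy' : y ∈ Φ.source := hs.mem_toOpenPartialHomeomorph_source
      have hΦ : AnalyticAt ℂ Φ.symm (fun i => pev y (h i)) :=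
        Φ.analyticAt_symm' hy' (analyticAt_pev_pi h y) he
      have hΦy : Φ.symm (fun i => pev y (h i)) = y := Φ.left_inv hy'
      have h2 : AnalyticAt ℂ (fun x => k (orbitMk G (Φ.symm x))) (fun i => pev y (h i)) :=
        AnalyticAt.comp (g := fun y => k (orbitMk G y)) (by rw [hΦy]; exact hy) hΦ
      refine h2.congr ?_
      filter_upwards [Φ.open_target.mem_nhds (Φ.map_source hy')] with x hx
      rw [← hkH]
      congr 2
      exact Φ.right_inv hx
  · intro hk
    have := AnalyticAt.comp (f := fun (y : V) i => pev y (h i)) hk (analyticAt_pev_pi h z)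
    refine this.congr (Eventually.of_forall fun y => ?_)
    exact hkH y

theorem exists_orbitCoordinates [Finite G] (hG : IsReflectionGroup G) :
    Nonempty (OrbitCoordinates G) := by
  obtain ⟨h, d, hh⟩ := exists_isBasicInvariants hG
  refine ⟨⟨hh.toHomeo, d, hh.deg_pos, fun c z i => pev_smul_of_isHomogeneous (hh.homogeneous i) c z,
    fun z => analyticAt_pev_pi h z, fun z hz => ?_, fun k x => ?_⟩⟩
  · exact pev_jacobian_fderiv_equiv ((hh.jacobian_ne_zero_iff z).2 (freeOnComplement hG z hz))
  · obtain ⟨z, rfl⟩ := orbitMk_surjective x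
    rw [holAt_orbitMk_iff]
    exact hh.analyticAt_iff k z

end OrbitCoordinates


/-! ## Roots and generic points of the reflection hyperplanes -/

section InnerProduct

theorem exists_orthogonal_of_core {V : Type*} [AddCommGroup V] [Module ℂ V] [FiniteDimensional ℂ V]
    (c : InnerProductSpace.Core ℂ V) (φ : Module.Dual ℂ V) (hφ : φ ≠ 0) :
    ∃ e : V, φ e = 1 ∧ ∀ h ∈ LinearMap.ker φ, c.inner h e = 0 := by
  let _ : NormedAddCommGroup V := c.toNormedAddCommGroup
  let _ : InnerProductSpace ℂ V := InnerProductSpace.ofCore c.toCore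
  obtain ⟨v, hv⟩ : ∃ v, φ v = 1 := by
    obtain ⟨v, hv⟩ : ∃ v, φ v ≠ 0 := by
      by_contra! hc; exact hφ (by ext v; simpa using hc v)
    exact ⟨(φ v)⁻¹ • v, by simp [hv]⟩
  obtain ⟨y, hy, e, he, rfl⟩ := (LinearMap.ker φ).exists_add_mem_mem_orthogonal v
  refine ⟨e, ?_, fun h hh => (Submodule.mem_orthogonal _ _).1 he h hh⟩
  rw [map_add, LinearMap.mem_ker.1 hy, zero_add] at hv
  exact hv

theorem eq_smul_of_core_orthogonal {V : Type*} [AddCommGroup V] [Module ℂ V]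
    (c : InnerProductSpace.Core ℂ V) (φ : Module.Dual ℂ V) {e x : V} (he : φ e = 1)
    (h1 : ∀ h ∈ LinearMap.ker φ, c.inner h e = 0) (h2 : ∀ h ∈ LinearMap.ker φ, c.inner h x = 0) :
    x = φ x • e := by
  let _ : NormedAddCommGroup V := c.toNormedAddCommGroup
  let _ : InnerProductSpace ℂ V := InnerProductSpace.ofCore c.toCore
  have hm : x - φ x • e ∈ LinearMap.ker φ := by
    rw [LinearMap.mem_ker, map_sub, map_smul, he, smul_eq_mul, mul_one, sub_self]
  have h3 : inner ℂ (x - φ x • e) (x - φ x • e) = 0 := by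
    rw [inner_sub_right, inner_smul_right]
    have h4 : inner ℂ (x - φ x • e) x = 0 := h2 _ hm
    have h5 : inner ℂ (x - φ x • e) e = 0 := h1 _ hm
    rw [h4, h5, mul_zero, sub_zero]
  exact sub_eq_zero.1 (inner_self_eq_zero.1 h3)

variable {V : Type*} [NormedAddCommGroup V] [NormedSpace ℂ V] [FiniteDimensional ℂ V]

/-- A finite linear group leaves an inner product invariant. -/
theorem exists_invariant_core (G : Subgroup (V ≃ₗ[ℂ] V)) [Finite G] :
    ∃ c : InnerProductSpace.Core ℂ V, ∀ g ∈ G, ∀ x y, c.inner (g x) (g y) = c.inner x y := by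
  have := Fintype.ofFinite G
  let b := Module.finBasis ℂ V
  let B : V → V → ℂ := fun x y => ∑ g : G, ∑ i, starRingEnd ℂ (b.coord i ((g : V ≃ₗ[ℂ] V) x)) *
    b.coord i ((g : V ≃ₗ[ℂ] V) y)
  have hself : ∀ x, B x x = ((∑ g : G, ∑ i, ‖b.coord i ((g : V ≃ₗ[ℂ] V) x)‖ ^ 2 : ℝ) : ℂ) := by
    intro x
    push_cast
    exact Finset.sum_congr rfl fun g _ => Finset.sum_congr rfl fun i _ => Complex.conj_mul' _
  let c : InnerProductSpace.Core ℂ V :=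
    { inner := B
      conj_inner_symm := fun x y => by
        simp only [B, map_sum, map_mul, Complex.conj_conj]
        exact Finset.sum_congr rfl fun g _ => Finset.sum_congr rfl fun i _ => mul_comm _ _
      re_inner_nonneg := fun x => by
        rw [hself]
        rw [RCLike.re_eq_complex_re, Complex.ofReal_re]
        positivity
      add_left := fun x y z => by
        change B (x + y) z = B x z + B y z
        simp only [B, map_add, add_mul, Finset.sum_add_distrib]
      smul_left := fun x y r => by
        change B (r • x) y = _ * B x y
        simp only [B, map_smul, smul_eq_mul, map_mul, mul_assoc, Finset.mul_sum]
      definite := fun x hx => by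
        change B x x = 0 at hx
        rw [hself, Complex.ofReal_eq_zero, Finset.sum_eq_zero_iff_of_nonneg (fun _ _ => by positivity)] at hx
        have h1 := hx 1 (Finset.mem_univ _)
        rw [Finset.sum_eq_zero_iff_of_nonneg (fun _ _ => by positivity)] at h1
        refine b.ext_elem fun i => ?_
        have h2 := h1 i (Finset.mem_univ _)
        simpa using h2 }
  refine ⟨c, fun g hg x y => ?_⟩
  change B (g x) (g y) = B x y
  exact Fintype.sum_equiv (Equiv.mulRight ⟨g, hg⟩) _ _ fun k => by
    rw [Equiv.coe_mulRight, Subgroup.coe_mul]; rfl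

end InnerProduct

/-! ### Pointwise stabilizers of hyperplanes and generic points -/

section Roots

variable {V : Type*} [NormedAddCommGroup V] [NormedSpace ℂ V] [FiniteDimensional ℂ V]
  {G : Subgroup (V ≃ₗ[ℂ] V)} {H : Submodule ℂ V} {φ : V →L[ℂ] ℂ} {e : V}

/-- The subgroup of the elements of `G` that fix `H` pointwise. -/
def pointwiseStab (G : Subgroup (V ≃ₗ[ℂ] V)) (H : Submodule ℂ V) : Subgroup (V ≃ₗ[ℂ] V) where
  carrier := {g | g ∈ G ∧ ∀ h ∈ H, g h = h}
  one_mem' := ⟨G.one_mem, fun _ _ => rfl⟩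
  mul_mem' {a b} ha hb := ⟨G.mul_mem ha.1 hb.1, fun h hh => by
    rw [mul_linearEquiv_apply, hb.2 h hh, ha.2 h hh]⟩
  inv_mem' {a} ha := ⟨G.inv_mem ha.1, fun h hh => by
    conv_lhs => rw [← ha.2 h hh]
    exact inv_linearEquiv_apply_self a h⟩

theorem pointwiseStab_le : pointwiseStab G H ≤ G := fun _ h => h.1

instance [Finite G] : Finite (pointwiseStab G H) :=
  Finite.of_injective _ (Subgroup.inclusion_injective pointwiseStab_le)

/-- An equation `φ` of the hyperplane `H`, with a normal vector `e` that is a common eigenvector of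
the elements of `G` fixing `H` pointwise. -/
structure IsRoot (G : Subgroup (V ≃ₗ[ℂ] V)) (H : Submodule ℂ V) (φ : V →L[ℂ] ℂ) (e : V) : Prop where
  mem : H ∈ reflHyperplanes G
  ker : ∀ z, φ z = 0 ↔ z ∈ H
  apply_self : φ e = 1
  eigen : ∀ g ∈ pointwiseStab G H, g e = φ (g e) • e

theorem IsRoot.ne_zero (h : IsRoot G H φ e) : φ ≠ 0 := by
  rintro rfl; exact zero_ne_one h.apply_self

/-- Given an invariant inner product, every reflection hyperplane has a root orthogonal to it. -/
theorem exists_isRoot [Finite G] (c : InnerProductSpace.Core ℂ V)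
    (hc : ∀ g ∈ G, ∀ x y, c.inner (g x) (g y) = c.inner x y) (hH : H ∈ reflHyperplanes G) :
    ∃ φ e, IsRoot G H φ e ∧ ∀ h ∈ H, c.inner h e = 0 := by
  obtain ⟨φ, hφ0, hφ⟩ := exists_equation hH
  have hφ0' : (φ : V →ₗ[ℂ] ℂ) ≠ 0 := fun h => hφ0 (by ext z; exact DFunLike.congr_fun h z)
  obtain ⟨e, he, heo⟩ := exists_orthogonal_of_core c (φ : V →ₗ[ℂ] ℂ) hφ0'
  rw [hφ] at heo
  have hker : ∀ z, φ z = 0 ↔ z ∈ H := fun z => by rw [← hφ]; rfl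
  refine ⟨φ, e, ⟨hH, hker, he, fun g hg => ?_⟩, heo⟩
  have horth : ∀ h ∈ H, c.inner h (g e) = 0 := by
    intro h hh
    rw [← hg.2 h hh, hc g hg.1, heo h hh]
  have hk : ∀ z, z ∈ LinearMap.ker (φ : V →ₗ[ℂ] ℂ) ↔ z ∈ H := fun z => by rw [hφ]
  exact eq_smul_of_core_orthogonal c (φ : V →ₗ[ℂ] ℂ) he (fun h hh => heo h ((hk h).1 hh))
    fun h hh => horth h ((hk h).1 hh)

theorem IsRoot.apply_eq (h : IsRoot G H φ e) {g : V ≃ₗ[ℂ] V} (hg : g ∈ pointwiseStab G H) (v : V) :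
    g v = v + ((φ (g e) - 1) * φ v) • e := by
  have h1 : v - φ v • e ∈ H := by rw [← h.ker, map_sub, map_smul, h.apply_self]; simp
  have h2 := hg.2 _ h1
  rw [map_sub, map_smul, h.eigen g hg] at h2
  have h3 : g v = v - φ v • e + φ v • φ (g e) • e := by rw [← h2, sub_add_cancel]
  rw [h3, smul_smul, sub_mul, sub_smul, one_mul, mul_comm]
  abel

theorem IsRoot.map_apply (h : IsRoot G H φ e) {g : V ≃ₗ[ℂ] V} (hg : g ∈ pointwiseStab G H) (v : V) :
    φ (g v) = φ (g e) * φ v := by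
  rw [h.apply_eq hg v, map_add, map_smul, h.apply_self]; simp; ring

/-- The character by which the pointwise stabilizer of a reflection hyperplane acts on its
normal. -/
def IsRoot.character (h : IsRoot G H φ e) : pointwiseStab G H →* ℂ where
  toFun g := φ ((g : V ≃ₗ[ℂ] V) e)
  map_one' := h.apply_self
  map_mul' a b := by
    change φ ((a : V ≃ₗ[ℂ] V) ((b : V ≃ₗ[ℂ] V) e)) = _
    rw [h.map_apply a.2]

theorem IsRoot.character_apply (h : IsRoot G H φ e) (g : pointwiseStab G H) :
    h.character g = φ ((g : V ≃ₗ[ℂ] V) e) := rfl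

theorem IsRoot.character_injective (h : IsRoot G H φ e) : Function.Injective h.character := by
  intro a b hab
  refine Subtype.ext (LinearEquiv.ext fun v => ?_)
  rw [h.apply_eq a.2, h.apply_eq b.2, ← h.character_apply, ← h.character_apply, hab]

theorem IsRoot.character_pow [Finite G] (h : IsRoot G H φ e) (g : pointwiseStab G H) :
    h.character g ^ Nat.card (pointwiseStab G H) = 1 := by
  rw [← map_pow, pow_card_eq_one', map_one]

/-- The pointwise stabilizer of a reflection hyperplane is cyclic. -/
theorem IsRoot.exists_primitive [Finite G] (h : IsRoot G H φ e) :
    ∃ g : pointwiseStab G H, IsPrimitiveRoot (h.character g) (Nat.card (pointwiseStab G H)) := by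
  have hcyc : IsCyclic (pointwiseStab G H) := isCyclic_of_injective_ringHom h.character h.character_injective
  obtain ⟨g, hg⟩ := hcyc.exists_generator
  refine ⟨g, ?_⟩
  have := IsPrimitiveRoot.orderOf (h.character g)
  rwa [orderOf_injective h.character h.character_injective, orderOf_eq_card_of_forall_mem_zpowers hg] at this

theorem IsRoot.two_le_card [Finite G] (h : IsRoot G H φ e) : 2 ≤ Nat.card (pointwiseStab G H) := by
  obtain ⟨s, hs, hr, hsH⟩ := h.mem
  have h1 : (⟨s, hs, fun y hy => map_mem_fixedSpace.1 (by rw [hsH]; exact hy)⟩ : pointwiseStab G H) ≠ 1 := by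
    intro h1
    have h2 : s = 1 := congrArg Subtype.val h1
    refine hyperplane_ne_top h.mem ?_
    rw [← hsH, h2]
    exact eq_top_iff.2 fun y _ => map_mem_fixedSpace.2 rfl
  have : Nontrivial (pointwiseStab G H) := ⟨_, _, h1⟩
  exact Finite.one_lt_card

theorem IsRoot.map_pow [Finite G] (h : IsRoot G H φ e) {g : V ≃ₗ[ℂ] V} (hg : g ∈ pointwiseStab G H)
    (v : V) : φ (g v) ^ Nat.card (pointwiseStab G H) = φ v ^ Nat.card (pointwiseStab G H) := by
  rw [h.map_apply hg, mul_pow, ← h.character_apply ⟨g, hg⟩, h.character_pow, one_mul]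

theorem IsRoot.projection_map (h : IsRoot G H φ e) {g : V ≃ₗ[ℂ] V} (hg : g ∈ pointwiseStab G H)
    (v : V) : g v - φ (g v) • e = v - φ v • e := by
  rw [h.map_apply hg, h.apply_eq hg, sub_mul, sub_smul, one_mul]; abel

theorem IsRoot.projection_mem (h : IsRoot G H φ e) (v : V) : v - φ v • e ∈ H := by
  rw [← h.ker, map_sub, map_smul, h.apply_self]; simp

/-- A point of `H` whose stabilizer fixes `H` pointwise. -/
structure IsGenericPt (G : Subgroup (V ≃ₗ[ℂ] V)) (H : Submodule ℂ V) (z : V) : Prop where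
  mem : z ∈ H
  stab : ∀ g ∈ G, g z = z → g ∈ pointwiseStab G H

theorem eq_of_le_reflHyperplanes {H H' : Submodule ℂ V} (hH : H ∈ reflHyperplanes G)
    (hH' : H' ∈ reflHyperplanes G) (hle : H ≤ H') : H = H' := by
  refine Submodule.eq_of_le_of_finrank_eq hle ?_
  obtain ⟨g, -, hr, rfl⟩ := hH
  obtain ⟨g', -, hr', rfl⟩ := hH'
  have h2 := Submodule.finrank_quotient_add_finrank (fixedSpace g)
  have h3 := Submodule.finrank_quotient_add_finrank (fixedSpace g')
  have h4 := hr.2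
  have h5 := hr'.2
  omega

/-- Near a generic point of `H`, the only reflection hyperplane is `H`. -/
theorem IsGenericPt.eventually_mem_iff [Finite G] {z : V} (hz : IsGenericPt G H z)
    (hH : H ∈ reflHyperplanes G) :
    ∀ᶠ y in 𝓝 z, y ∈ arrComplement (reflHyperplanes G) ↔ y ∉ H := by
  have h1 : ∀ᶠ y in 𝓝 z, ∀ H' ∈ reflHyperplanes G \ {H}, y ∉ H' := by
    rw [eventually_all_finite ((reflHyperplanes_finite G).subset Set.sdiff_subset)]
    rintro H' ⟨hH', hne⟩
    have hzH' : z ∉ H' := by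
      intro hmem
      obtain ⟨g, hg, hr, rfl⟩ := id hH'
      have h2 := hz.stab g hg (map_mem_fixedSpace.1 hmem)
      exact hne (eq_of_le_reflHyperplanes hH hH' fun y hy => map_mem_fixedSpace.2 (h2.2 y hy)).symm
    exact (Submodule.closed_of_finiteDimensional H').isOpen_compl.mem_nhds hzH'
  filter_upwards [h1] with y hy
  constructor
  · intro h; exact h H hH
  · intro h H' hH'
    by_cases he : H' = H
    · rwa [he]
    · exact hy H' ⟨hH', he⟩

theorem IsGenericPt.eventually [Finite G] {z : V} (hz : IsGenericPt G H z) :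
    ∀ᶠ y in 𝓝 z, y ∈ H → IsGenericPt G H y := by
  obtain ⟨U, hU, hzU, hsep⟩ := exists_separating_nhds (G := G) z
  filter_upwards [hU.mem_nhds hzU] with y hy hyH
  exact ⟨hyH, fun g hg hgy => hz.stab g hg (hsep g hg y hy (by rwa [hgy]))⟩

/-- Generic points are dense in `H`. -/
theorem mem_closure_isGenericPt [Finite G] {z : V} (hz : z ∈ H) :
    z ∈ closure {y | IsGenericPt G H y} := by
  set 𝒮 : Set (Submodule ℂ H) := (fun g : V ≃ₗ[ℂ] V => (fixedSpace g).comap H.subtype) ''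
    {g | g ∈ G ∧ g ∉ pointwiseStab G H}
  have hd := dense_compl_iUnion_submodule (𝒮 := 𝒮)
    (((Set.toFinite (G : Set (V ≃ₗ[ℂ] V))).subset fun g hg => hg.1).image _) (by
      rintro _ ⟨g, ⟨hg, hgK⟩, rfl⟩ ht
      refine hgK ⟨hg, fun y hy => ?_⟩
      have : (⟨y, hy⟩ : H) ∈ (fixedSpace g).comap H.subtype := by
        rw [show (fixedSpace g).comap H.subtype = ⊤ from ht]; trivial
      exact map_mem_fixedSpace.1 this)
  have h1 : z ∈ Subtype.val '' closure {y : H | ∀ L ∈ 𝒮, y ∉ L} := ⟨⟨z, hz⟩, hd _, rfl⟩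
  refine closure_mono ?_ (image_closure_subset_closure_image continuous_subtype_val h1)
  rintro _ ⟨y, hy, rfl⟩
  refine ⟨y.2, fun g hg hgy => ?_⟩
  by_contra hgK
  exact hy _ ⟨g, ⟨hg, hgK⟩, rfl⟩ (map_mem_fixedSpace.2 hgy)

/-- The translate of a generic point is generic. -/
theorem IsGenericPt.map {z : V} (hz : IsGenericPt G H z) {g : V ≃ₗ[ℂ] V} (hg : g ∈ G) :
    IsGenericPt G (H.map (g : V →ₗ[ℂ] V)) (g z) := by
  refine ⟨⟨z, hz.mem, rfl⟩, fun k hk hkz => ⟨hk, ?_⟩⟩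
  have h1 := hz.stab (g⁻¹ * k * g) (G.mul_mem (G.mul_mem (G.inv_mem hg) hk) hg) (by
    rw [mul_linearEquiv_apply, mul_linearEquiv_apply, hkz, inv_linearEquiv_apply_self])
  rintro _ ⟨y, hy, rfl⟩
  have h2 := h1.2 y hy
  rw [mul_linearEquiv_apply, mul_linearEquiv_apply] at h2
  calc k (g y) = g (g⁻¹ (k (g y))) := (apply_inv_linearEquiv_self g _).symm
    _ = g y := by rw [h2]

/-! ### Divisibility of semi-invariants -/

theorem eventually_eq_zero_of_mul {φ : V →L[ℂ] ℂ} (hφ : φ ≠ 0) {F : V → ℂ} {z : V}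
    (hF : ∀ᶠ y in 𝓝 z, ContinuousAt F y) (h : ∀ᶠ y in 𝓝 z, φ y * F y = 0) :
    ∀ᶠ y in 𝓝 z, F y = 0 := by
  have hd : Dense {y : V | φ y ≠ 0} := by
    refine (dense_compl_iUnion_submodule (𝒮 := {LinearMap.ker (φ : V →ₗ[ℂ] ℂ)}) (Set.finite_singleton _) ?_).mono ?_
    · rintro _ rfl ht
      refine hφ (ContinuousLinearMap.ext fun y => ?_)
      have : y ∈ LinearMap.ker (φ : V →ₗ[ℂ] ℂ) := ht ▸ Submodule.mem_top
      exact this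
    · intro y hy; exact hy _ rfl
  filter_upwards [hF, h.eventually_nhds] with y hy1 hy2
  by_contra hne
  have h3 := hy1.eventually_ne hne
  have h4 := mem_closure_iff_frequently.1 (hd y)
  obtain ⟨x, ⟨hx1, hx2⟩, hx3⟩ := ((hy2.and h3).and_frequently h4).exists
  exact hx3 ((mul_eq_zero.1 hx1).resolve_right hx2)

/-- A function that is invariant under the pointwise stabilizer `K` of `H`, and vanishes on `H`, is
divisible by the power `|K|` of the equation of `H`. -/
theorem IsRoot.exists_eq_pow_mul [Finite G] (h : IsRoot G H φ e) {A : V → ℂ} {z : V} (hz : z ∈ H)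
    (hA : AnalyticAt ℂ A z) (hinv : ∀ g ∈ pointwiseStab G H, ∀ᶠ y in 𝓝 z, A (g y) = A y)
    (hv : ∀ᶠ y in 𝓝 z, y ∈ H → A y = 0) :
    ∃ C, AnalyticAt ℂ C z ∧ ∀ᶠ y in 𝓝 z, A y = φ y ^ Nat.card (pointwiseStab G H) * C y := by
  set m := Nat.card (pointwiseStab G H) with hm
  obtain ⟨g, hg⟩ := h.exists_primitive
  have hgz : (g : V ≃ₗ[ℂ] V) z = z := g.2.2 z hz
  have htend : Tendsto (g : V ≃ₗ[ℂ] V) (𝓝 z) (𝓝 z) := by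
    have := (continuous_linearEquiv (g : V ≃ₗ[ℂ] V)).tendsto z
    rwa [hgz] at this
  have hχ0 : h.character g ≠ 0 := hg.ne_zero (by have := h.two_le_card; omega)
  -- Let `g` generate the stabilizer, with eigenvalue `χ` on the normal. The cofactor `C` of `φ ^ (j
  -- + 1)` satisfies `χ ^ (j + 1) * C (g y) = C y`. On `H` the map `g` is the identity and `χ ^ (j +
  -- 1) ≠ 1` as long as `j + 1 < m`, so `C` vanishes on `H` and another factor `φ` splits off.
  have key : ∀ j, j < m → ∃ C, AnalyticAt ℂ C z ∧ (∀ᶠ y in 𝓝 z, A y = φ y ^ (j + 1) * C y) := by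
    intro j
    induction j with
    | zero =>
      intro _
      obtain ⟨C, hC, hAC⟩ := exists_analyticAt_eq_mul h.ne_zero ((h.ker z).2 hz) hA (by
        filter_upwards [hv] with y hy h0 using hy ((h.ker y).1 h0))
      exact ⟨C, hC, by filter_upwards [hAC] with y hy; simpa using hy⟩
    | succ j ih =>
      intro hj
      obtain ⟨C, hC, hAC⟩ := ih (by omega)
      have hF : ∀ᶠ y in 𝓝 z, h.character g ^ (j + 1) * C ((g : V ≃ₗ[ℂ] V) y) - C y = 0 := by
        have hcont : ∀ᶠ y in 𝓝 z, ContinuousAt (fun y => h.character g ^ (j + 1) * C ((g : V ≃ₗ[ℂ] V) y) - C y) y := by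
          filter_upwards [hC.eventually_analyticAt, htend.eventually hC.eventually_analyticAt] with y h1 h2
          exact (continuousAt_const.mul (ContinuousAt.comp h2.continuousAt
            (continuous_linearEquiv (g : V ≃ₗ[ℂ] V)).continuousAt)).sub h1.continuousAt
        have hpow : ∀ k : ℕ, (∀ᶠ y in 𝓝 z, φ y ^ k * (h.character g ^ (j + 1) * C ((g : V ≃ₗ[ℂ] V) y) - C y) = 0) →
            ∀ᶠ y in 𝓝 z, h.character g ^ (j + 1) * C ((g : V ≃ₗ[ℂ] V) y) - C y = 0 := by
          intro k
          induction k with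
          | zero => intro hk; simpa using hk
          | succ k ihk =>
            intro hk
            refine ihk (eventually_eq_zero_of_mul h.ne_zero ?_ (by
              filter_upwards [hk] with y hy; rw [← mul_assoc, ← pow_succ']; exact hy))
            filter_upwards [hcont] with y hy
            exact ((φ.continuous.pow k).continuousAt).mul hy
        refine hpow (j + 1) ?_
        filter_upwards [hAC, htend.eventually hAC, hinv g g.2] with y h1 h2 h3
        rw [h1, h2, h.map_apply g.2, ← h.character_apply, mul_pow] at h3
        linear_combination h3
      have hCv : ∀ᶠ y in 𝓝 z, φ y = 0 → C y = 0 := by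
        filter_upwards [hF] with y hy h0
        rw [g.2.2 y ((h.ker y).1 h0)] at hy
        have h1 : (h.character g ^ (j + 1) - 1) * C y = 0 := by linear_combination hy
        refine (mul_eq_zero.1 h1).resolve_left (sub_ne_zero.2 ?_)
        exact hg.pow_ne_one_of_pos_of_lt (by omega) (by omega)
      obtain ⟨C', hC', hCC'⟩ := exists_analyticAt_eq_mul h.ne_zero ((h.ker z).2 hz) hC hCv
      refine ⟨C', hC', ?_⟩
      filter_upwards [hAC, hCC'] with y h1 h2
      rw [h1, h2, smul_eq_mul]; ring
  have h2 := h.two_le_card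
  obtain ⟨C, hC, hAC⟩ := key (m - 1) (by omega)
  rw [Nat.sub_add_cancel (by omega)] at hAC
  exact ⟨C, hC, hAC⟩

end Roots


/-! ## The local form of an isomorphism of orbit spaces at a generic point of the discriminant -/

section LocalModel

variable {V₁ : Type u} [NormedAddCommGroup V₁] [NormedSpace ℂ V₁] [FiniteDimensional ℂ V₁]
  {V₂ : Type v} [NormedAddCommGroup V₂] [NormedSpace ℂ V₂] [FiniteDimensional ℂ V₂]
  {G₁ : Subgroup (V₁ ≃ₗ[ℂ] V₁)} {G₂ : Subgroup (V₂ ≃ₗ[ℂ] V₂)}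
  {f : OpenPartialHomeomorph (OrbitSpace G₁) (OrbitSpace G₂)}
  {H : Submodule ℂ V₁} {φ : V₁ →L[ℂ] ℂ} {e : V₁} {H' : Submodule ℂ V₂} {φ' : V₂ →L[ℂ] ℂ} {e' : V₂}
  {z₀ : V₁} {w₀ : V₂}

/-- In suitable coordinates, the lifts of `f` near `z₀` have the form
`(φ, h) ↦ (φ ^ (m / m'), h)`. -/
structure IsLocalModel (f : OrbitSpace G₁ → OrbitSpace G₂) (φ : V₁ →L[ℂ] ℂ) (e : V₁) (m : ℕ)
    (φ' : V₂ →L[ℂ] ℂ) (e' : V₂) (m' : ℕ) (z₀ : V₁) (C : V₁ → ℂ) (B : V₁ → V₂) : Prop where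
  analyticAt_C : AnalyticAt ℂ C z₀
  analyticAt_B : AnalyticAt ℂ B z₀
  ne_zero : C z₀ ≠ 0
  fderiv_normal : fderiv ℂ B z₀ e = 0
  fderiv_tangent : ∀ x, φ x = 0 → fderiv ℂ B z₀ x = 0 → x = 0
  lift : ∀ᶠ z in 𝓝 z₀, φ z ≠ 0 → ∃ W, IsLift f W z ∧ φ' (W z) ≠ 0 ∧
    ∀ᶠ y in 𝓝 z, φ' (W y) ^ m' = φ y ^ m * C y ∧ W y - φ' (W y) • e' = B y

/-- Since `f` is continuous and the orbit map of `G₂` is open, images of points near `z₀` are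
represented by points near `w₀`. -/
theorem eventually_exists_target (hz : orbitMk G₁ z₀ ∈ f.source)
    (hw : f (orbitMk G₁ z₀) = orbitMk G₂ w₀) {P : V₂ → Prop} (hP : ∀ᶠ w in 𝓝 w₀, P w) :
    ∀ᶠ y in 𝓝 z₀, orbitMk G₁ y ∈ f.source ∧ ∃ w, f (orbitMk G₁ y) = orbitMk G₂ w ∧ P w := by
  have h1 : ∀ᶠ x in 𝓝 (f (orbitMk G₁ z₀)), ∃ w, x = orbitMk G₂ w ∧ P w := by
    rw [hw, eventually_orbitMk]
    filter_upwards [hP] with w hPw using ⟨w, rfl, hPw⟩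
  have h2 := ((f.continuousAt hz).eventually h1).and (f.open_source.mem_nhds hz)
  rw [eventually_orbitMk] at h2
  filter_upwards [h2] with y hy using ⟨hy.2, hy.1⟩

/-- The power of `φ` and the projection to `H` are the local invariants of the cyclic stabilizer at
a generic point. Their transport along `f` produces the local model. -/
theorem IsRoot.exists_descends_pow [Finite G₁] (r : IsRoot G₁ H φ e) (hz : IsGenericPt G₁ H z₀) :
    ∃ k : OrbitSpace G₁ → ℂ, AnalyticAt ℂ (fun y => k (orbitMk G₁ y)) z₀ ∧
      ∀ᶠ y in 𝓝 z₀, k (orbitMk G₁ y) = φ y ^ Nat.card (pointwiseStab G₁ H) :=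
  exists_descends ((φ.analyticAt z₀).pow _) fun g hg hgz =>
    Eventually.of_forall fun y => r.map_pow (hz.stab g hg hgz) y

theorem IsRoot.exists_descends_projection [Finite G₁] (r : IsRoot G₁ H φ e)
    (hz : IsGenericPt G₁ H z₀) :
    ∃ k : OrbitSpace G₁ → V₁, AnalyticAt ℂ (fun y => k (orbitMk G₁ y)) z₀ ∧
      ∀ᶠ y in 𝓝 z₀, k (orbitMk G₁ y) = y - φ y • e :=
  exists_descends (analyticAt_id.sub ((φ.analyticAt z₀).smul analyticAt_const)) fun g hg hgz =>
    Eventually.of_forall fun y => r.projection_map (hz.stab g hg hgz) y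

/-- The transported equation of the second discriminant is invariant and vanishes on `H`, because
`f` respects the discriminants. Hence it is divisible by the full power of `φ`. -/
theorem IsLocalDiscIso.exists_pow_factor [Finite G₁] [Finite G₂] (hf : IsLocalDiscIso G₁ G₂ f)
    (r₁ : IsRoot G₁ H φ e) (r₂ : IsRoot G₂ H' φ' e') (hz : orbitMk G₁ z₀ ∈ f.source)
    (hw : f (orbitMk G₁ z₀) = orbitMk G₂ w₀) (hz₀ : IsGenericPt G₁ H z₀)
    (hw₀ : IsGenericPt G₂ H' w₀) {k : OrbitSpace G₂ → ℂ}
    (hk : AnalyticAt ℂ (fun y => k (orbitMk G₂ y)) w₀)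
    (hkφ : ∀ᶠ y in 𝓝 w₀, k (orbitMk G₂ y) = φ' y ^ Nat.card (pointwiseStab G₂ H')) :
    ∃ C, AnalyticAt ℂ C z₀ ∧
      ∀ᶠ y in 𝓝 z₀, k (f (orbitMk G₁ y)) = φ y ^ Nat.card (pointwiseStab G₁ H) * C y := by
  refine r₁.exists_eq_pow_mul hz₀.mem (hf.analyticAt_comp hz hw hk)
    (fun g hg => Eventually.of_forall fun y => by rw [orbitMk_map hg.1]) ?_
  filter_upwards [eventually_exists_target hz hw (hkφ.and (hw₀.eventually_mem_iff r₂.mem))] with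
    y ⟨hys, w, hyw, hkw, hwm⟩ hyH
  have hd : w ∈ H' := by
    by_contra hwH
    exact ((hf.mem_arrComplement hys hyw).2 (hwm.2 hwH)) H r₁.mem hyH
  rw [hyw, hkw, (r₂.ker w).2 hd, zero_pow (by have := r₂.two_le_card; omega)]

/-- `B` is the pull-back of the projection to `H'`, and `φ ^ m * C` that of the power of `φ'`. The
nondegeneracy conditions come from the same construction for the inverse of `f`. -/
theorem IsLocalDiscIso.exists_localModel [Finite G₁] [Finite G₂] (hf : IsLocalDiscIso G₁ G₂ f)
    (hG₂ : FreeOnComplement G₂) (r₁ : IsRoot G₁ H φ e) (r₂ : IsRoot G₂ H' φ' e')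
    (hz : orbitMk G₁ z₀ ∈ f.source) (hw : f (orbitMk G₁ z₀) = orbitMk G₂ w₀)
    (hz₀ : IsGenericPt G₁ H z₀) (hw₀ : IsGenericPt G₂ H' w₀) :
    ∃ C B, IsLocalModel f φ e (Nat.card (pointwiseStab G₁ H)) φ' e'
      (Nat.card (pointwiseStab G₂ H')) z₀ C B := by
  have hwt : orbitMk G₂ w₀ ∈ f.symm.source := by rw [← hw]; exact f.map_source hz
  have hsw : f.symm (orbitMk G₂ w₀) = orbitMk G₁ z₀ := by rw [← hw, f.left_inv hz]
  obtain ⟨k, hk, hkφ⟩ := r₁.exists_descends_pow hz₀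
  obtain ⟨k', hk', hkφ'⟩ := r₂.exists_descends_pow hw₀
  obtain ⟨kP, hkP, hkPφ⟩ := r₁.exists_descends_projection hz₀
  obtain ⟨kB, hkB, hkBφ⟩ := r₂.exists_descends_projection hw₀
  obtain ⟨C, hC, hAC⟩ := hf.exists_pow_factor r₁ r₂ hz hw hz₀ hw₀ hk' hkφ'
  obtain ⟨C', hC', hAC'⟩ := hf.symm.exists_pow_factor r₂ r₁ hwt hsw hw₀ hz₀ hk hkφ
  have hB := hf.analyticAt_comp hz hw hkB
  have hB₁ := hf.symm.analyticAt_comp hwt hsw hkP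
  set B : V₁ → V₂ := fun y => kB (f (orbitMk G₁ y))
  set B₁ : V₂ → V₁ := fun y => kP (f.symm (orbitMk G₂ y))
  have hBz : B z₀ = w₀ := by
    change kB (f (orbitMk G₁ z₀)) = w₀
    rw [hw, hkBφ.self_of_nhds, (r₂.ker w₀).2 hw₀.mem, zero_smul, sub_zero]
  have hdisc : ∀ {y w}, orbitMk G₁ y ∈ f.source → f (orbitMk G₁ y) = orbitMk G₂ w →
      (y ∈ arrComplement (reflHyperplanes G₁) ↔ y ∉ H) →
      (w ∈ arrComplement (reflHyperplanes G₂) ↔ w ∉ H') → (y ∈ H ↔ w ∈ H') := by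
    intro y w hys hyw h1 h2
    have h3 := hf.mem_arrComplement hys hyw
    rw [h1, h2] at h3
    exact not_iff_not.1 h3
  refine ⟨C, B, hC, hB, ?_, ?_, ?_, ?_⟩
  -- At points off the hyperplane, the factorizations for `f` and for its inverse give `C y * C' w =
  -- 1`. As `C'` is bounded near `w₀`, the function `C` cannot tend to zero.
  · intro hC0
    have hdense : ∃ᶠ y in 𝓝 z₀, y ∈ arrComplement (reflHyperplanes G₁) :=
      mem_closure_iff_frequently.1 (dense_arrComplement z₀)
    have h1 : ∀ᶠ w in 𝓝 w₀, ‖C' w‖ < ‖C' w₀‖ + 1 :=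
      hC'.continuousAt.norm.eventually (gt_mem_nhds (lt_add_one _))
    have h2 : ∀ᶠ y in 𝓝 z₀, ‖C y‖ * (‖C' w₀‖ + 1) < 1 := by
      have : Tendsto (fun y => ‖C y‖ * (‖C' w₀‖ + 1)) (𝓝 z₀) (𝓝 (‖C z₀‖ * (‖C' w₀‖ + 1))) :=
        hC.continuousAt.norm.mul continuousAt_const
      refine this.eventually (gt_mem_nhds ?_)
      rw [hC0, norm_zero, zero_mul]; exact one_pos
    obtain ⟨y, hyc, ⟨⟨hys, w, hyw, hw1, hw2, hw3⟩, hyA⟩, hyk, hyC⟩ := (hdense.and_eventually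
      (((eventually_exists_target hz hw (h1.and (hkφ'.and hAC'))).and hAC).and (hkφ.and h2))).exists
    have hy0 : φ y ≠ 0 := fun h0 => hyc H r₁.mem ((r₁.ker y).1 h0)
    rw [← hyw, f.left_inv hys, hyk] at hw3
    rw [hyw, hw2] at hyA
    have h4 : φ y ^ Nat.card (pointwiseStab G₁ H) * (C y * C' w - 1) = 0 := by
      rw [hyA] at hw3
      linear_combination -hw3
    have h5 : C y * C' w = 1 := sub_eq_zero.1 ((mul_eq_zero.1 h4).resolve_left (pow_ne_zero _ hy0))
    have h6 : ‖C y‖ * ‖C' w‖ = 1 := by rw [← norm_mul, h5, norm_one]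
    have := mul_le_mul_of_nonneg_left hw1.le (norm_nonneg (C y))
    linarith
  -- `B` is invariant under `g`, which multiplies the normal vector `e` by a root of unity different
  -- from `1`.
  · obtain ⟨g, hg⟩ := r₁.exists_primitive
    have hgz : (g : V₁ ≃ₗ[ℂ] V₁) z₀ = z₀ := g.2.2 z₀ hz₀.mem
    have h1 : HasFDerivAt (fun y => B ((g : V₁ ≃ₗ[ℂ] V₁) y))
        ((fderiv ℂ B z₀).comp (toCLM (g : V₁ ≃ₗ[ℂ] V₁))) z₀ :=
      HasFDerivAt.comp z₀ (g := B) (g' := fderiv ℂ B z₀) (f := toCLM (g : V₁ ≃ₗ[ℂ] V₁))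
        (by rw [toCLM_apply, hgz]; exact hB.differentiableAt.hasFDerivAt) (toCLM _).hasFDerivAt
    have h2 : (fun y => B ((g : V₁ ≃ₗ[ℂ] V₁) y)) = B := by
      funext y
      change kB (f (orbitMk G₁ ((g : V₁ ≃ₗ[ℂ] V₁) y))) = _
      rw [orbitMk_map g.2.1]
    rw [h2] at h1
    have h3 := DFunLike.congr_fun h1.fderiv e
    rw [ContinuousLinearMap.comp_apply, toCLM_apply, r₁.eigen g g.2, map_smul, ← r₁.character_apply g] at h3
    have h4 : (1 - r₁.character g) • fderiv ℂ B z₀ e = 0 := by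
      rw [sub_smul, one_smul, ← h3, sub_self]
    refine (smul_eq_zero.1 h4).resolve_left fun h5 => ?_
    have h6 := hg.pow_ne_one_of_pos_of_lt one_ne_zero (by have := r₁.two_le_card; omega)
    exact h6 (by rw [pow_one]; exact (sub_eq_zero.1 h5).symm)
  -- On `H` the map `B` is inverted by `B₁`, its analogue for the inverse of `f`. So no tangent
  -- vector of `H` is killed.
  · intro x hx hBx
    have hBB : ∀ᶠ y in 𝓝 z₀, y ∈ H → B₁ (B y) = y := by
      filter_upwards [eventually_exists_target hz hw (hkBφ.and (hw₀.eventually_mem_iff r₂.mem)),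
        hkPφ, hz₀.eventually_mem_iff r₁.mem] with y ⟨hys, w, hyw, hw1, hw2⟩ hyP hym hyH
      have hwH := (hdisc hys hyw hym hw2).1 hyH
      have h1 : B y = w := by
        change kB (f (orbitMk G₁ y)) = w
        rw [hyw, hw1, (r₂.ker w).2 hwH, zero_smul, sub_zero]
      rw [h1]
      change kP (f.symm (orbitMk G₂ w)) = y
      rw [← hyw, f.left_inv hys, hyP, (r₁.ker y).2 hyH, zero_smul, sub_zero]
    let l : ℂ → V₁ := fun t => z₀ + t • x
    have hl : HasDerivAt l x 0 := by
      have := ((hasDerivAt_id (0 : ℂ)).smul_const x).const_add z₀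
      rw [one_smul] at this
      exact this
    have hl0 : l 0 = z₀ := by simp [l]
    have hd1 : HasDerivAt (fun t => B (l t)) 0 0 := by
      have h1 : HasFDerivAt B (fderiv ℂ B z₀) (l 0) := by
        rw [hl0]; exact hB.differentiableAt.hasFDerivAt
      have := h1.comp_hasDerivAt (0 : ℂ) hl
      rwa [hBx] at this
    have hd2 : HasDerivAt (fun t => B₁ (B (l t))) 0 0 := by
      have h1 : HasFDerivAt B₁ (fderiv ℂ B₁ w₀) (B (l 0)) := by
        rw [hl0, hBz]; exact hB₁.differentiableAt.hasFDerivAt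
      have := h1.comp_hasDerivAt (0 : ℂ) hd1
      rwa [map_zero] at this
    have heq : l =ᶠ[𝓝 0] fun t => B₁ (B (l t)) := by
      have h1 : Tendsto l (𝓝 0) (𝓝 z₀) := by
        have := hl.continuousAt.tendsto; rwa [hl0] at this
      filter_upwards [h1.eventually hBB] with t ht
      refine (ht ?_).symm
      exact H.add_mem hz₀.mem (H.smul_mem t ((r₁.ker x).1 hx))
    exact hl.unique (hd2.congr_of_eventuallyEq heq)
  · filter_upwards [eventually_exists_target hz hw (hkφ'.eventually_nhds.and
      (hkBφ.eventually_nhds.and (hw₀.eventually_mem_iff r₂.mem))), hz₀.eventually_mem_iff r₁.mem,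
      hAC.eventually_nhds] with y ⟨hys, w, hyw, hw1, hw2, hw3⟩ hym hyA hy0
    have hyH : y ∉ H := fun h => hy0 ((r₁.ker y).2 h)
    obtain ⟨W, hW, hWy⟩ := hf.exists_lift hG₂ hys (hym.2 hyH) hyw
    refine ⟨W, hW, ?_, ?_⟩
    · rw [hWy]
      exact fun h => hyH ((hdisc hys hyw hym hw3).2 ((r₂.ker w).1 h))
    · have hc := hW.analyticAt.continuousAt
      rw [ContinuousAt, hWy] at hc
      filter_upwards [hc.eventually hw1, hc.eventually hw2, hyA, hW.lift] with y' h1 h2 h3 h4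
      constructor
      · rw [← h3, h4, h1]
      · rw [← h2, ← h4]

/-! ### Solving for vector fields -/

/-- The linear system that determines a vector field from its components in the local model. -/
def modelSystem (φ : V₁ →L[ℂ] ℂ) (m : ℕ) (C : V₁ → ℂ) (B : V₁ → V₂) (z : V₁) : V₁ →L[ℂ] ℂ × V₂ :=
  ((m * C z) • φ + φ z • fderiv ℂ C z).prod (fderiv ℂ B z)

theorem modelSystem_apply (m : ℕ) (C : V₁ → ℂ) (B : V₁ → V₂) (z x : V₁) :
    modelSystem φ m C B z x = (m * C z * φ x + φ z * fderiv ℂ C z x, fderiv ℂ B z x) := by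
  simp [modelSystem]

theorem continuousAt_modelSystem {C : V₁ → ℂ} {B : V₁ → V₂} (m : ℕ) (hC : AnalyticAt ℂ C z₀)
    (hB : AnalyticAt ℂ B z₀) : ContinuousAt (modelSystem φ m C B) z₀ := by
  have h1 : ContinuousAt (fun z => ((m * C z) • φ + φ z • fderiv ℂ C z : V₁ →L[ℂ] ℂ)) z₀ :=
    ((continuousAt_const.mul hC.continuousAt).smul continuousAt_const).add
      (φ.continuous.continuousAt.smul hC.fderiv.continuousAt)
  have h2 := hB.fderiv.continuousAt
  exact (ContinuousLinearMap.prodₗᵢ (E := V₁) (F := ℂ) (G := V₂) ℂ).continuous.continuousAt.comp (h1.prodMk h2)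

/-- An injective operator is bounded below, uniformly for nearby operators. -/
theorem exists_bound_below {E F : Type*} [NormedAddCommGroup E] [NormedSpace ℂ E]
    [FiniteDimensional ℂ E] [NormedAddCommGroup F] [NormedSpace ℂ F] {M : V₁ → E →L[ℂ] F} {z₀ : V₁}
    (hM : ContinuousAt M z₀) (hinj : ∀ x, M z₀ x = 0 → x = 0) :
    ∃ ε > 0, ∀ᶠ z in 𝓝 z₀, ∀ x, ε * ‖x‖ ≤ ‖M z x‖ := by
  obtain ⟨K, hK, hanti⟩ := (M z₀ : E →ₗ[ℂ] F).exists_antilipschitzWith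
    (LinearMap.ker_eq_bot'.2 fun x hx => hinj x hx)
  have hK' : (0 : ℝ) < K := hK
  refine ⟨(2 * K : ℝ)⁻¹, by positivity, ?_⟩
  have h1 : ∀ᶠ z in 𝓝 z₀, ‖M z - M z₀‖ < (2 * K : ℝ)⁻¹ := by
    have : Tendsto (fun z => ‖M z - M z₀‖) (𝓝 z₀) (𝓝 ‖M z₀ - M z₀‖) :=
      (hM.sub continuousAt_const).norm
    refine this.eventually (gt_mem_nhds ?_)
    rw [sub_self, norm_zero]; positivity
  filter_upwards [h1] with z hz x
  have h2 : ‖x‖ ≤ K * ‖M z₀ x‖ := by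
    have := hanti.le_mul_dist x 0
    simpa using this
  have h3 : ‖M z₀ x‖ ≤ ‖M z x‖ + ‖M z - M z₀‖ * ‖x‖ := by
    have h4 := (M z - M z₀).le_opNorm x
    have h5 : M z₀ x = M z x - (M z - M z₀) x := by simp
    rw [h5]
    exact (norm_sub_le _ _).trans (by gcongr)
  have h4 : ‖M z - M z₀‖ * ‖x‖ ≤ (2 * K : ℝ)⁻¹ * ‖x‖ := by gcongr
  have h5 : (K : ℝ)⁻¹ * ‖x‖ ≤ ‖M z₀ x‖ := by
    rw [inv_mul_le_iff₀ hK']; exact h2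
  have h6 : (2 * K : ℝ)⁻¹ * ‖x‖ + (2 * K : ℝ)⁻¹ * ‖x‖ = (K : ℝ)⁻¹ * ‖x‖ := by
    field_simp; ring
  linarith

variable {m m' : ℕ} {C : V₁ → ℂ} {B : V₁ → V₂}

theorem IsLocalModel.bound_below {f : OrbitSpace G₁ → OrbitSpace G₂}
    (hM : IsLocalModel f φ e m φ' e' m' z₀ C B) (hz : φ z₀ = 0) (hm : m ≠ 0) :
    ∃ ε > 0, ∀ᶠ z in 𝓝 z₀, ∀ x, ε * ‖x‖ ≤ ‖modelSystem φ m C B z x‖ := by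
  refine exists_bound_below (continuousAt_modelSystem m hM.analyticAt_C hM.analyticAt_B) fun x hx => ?_
  rw [modelSystem_apply, Prod.mk_eq_zero, hz, zero_mul, add_zero] at hx
  refine hM.fderiv_tangent x ?_ hx.2
  exact (mul_eq_zero.1 hx.1).resolve_left (mul_ne_zero (Nat.cast_ne_zero.2 hm) hM.ne_zero)

/-- The differential of a lift in the local model. -/
theorem IsLocalModel.fderiv_lift {W : V₁ → V₂} {z : V₁} (hWa : AnalyticAt ℂ W z)
    (hCa : AnalyticAt ℂ C z) (hφ : φ z ≠ 0) (hm : m ≠ 0) (hm' : m' ≠ 0)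
    (hW : ∀ᶠ y in 𝓝 z, φ' (W y) ^ m' = φ y ^ m * C y ∧ W y - φ' (W y) • e' = B y) (x : V₁) :
    m' * φ z * C z * φ' (fderiv ℂ W z x) =
        φ' (W z) * (m * C z * φ x + φ z * fderiv ℂ C z x) ∧
      fderiv ℂ W z x - φ' (fderiv ℂ W z x) • e' = fderiv ℂ B z x := by
  have hWd := hWa.differentiableAt.hasFDerivAt
  have hφW : HasFDerivAt (fun y => φ' (W y)) (φ'.comp (fderiv ℂ W z)) z :=
    φ'.hasFDerivAt.comp z hWd
  constructor
  · have h1 := hφW.pow m'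
    have h2 := (φ.hasFDerivAt (x := z)).pow m |>.mul hCa.differentiableAt.hasFDerivAt
    have h3 := h1.unique (h2.congr_of_eventuallyEq (hW.mono fun y hy => hy.1))
    have h4 := DFunLike.congr_fun h3 x
    have h5 := hW.self_of_nhds.1
    simp only [smul_apply, add_apply, ContinuousLinearMap.comp_apply, smul_eq_mul, nsmul_eq_mul] at h4
    obtain ⟨a, rfl⟩ := Nat.exists_eq_succ_of_ne_zero hm
    obtain ⟨b, rfl⟩ := Nat.exists_eq_succ_of_ne_zero hm'
    simp only [Nat.succ_eq_add_one, Nat.add_sub_cancel, pow_succ] at h4 h5 ⊢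
    refine mul_left_cancel₀ (pow_ne_zero a hφ) ?_
    linear_combination (φ' (W z)) * h4 - ((b + 1 : ℕ) : ℂ) * φ' (fderiv ℂ W z x) * h5
  · have h1 := hWd.sub (hφW.smul_const e')
    have h2 := (h1.congr_of_eventuallyEq (hW.mono fun y hy => hy.2.symm)).fderiv
    rw [h2]; simp

end LocalModel


/-! ### Calculus of operator-valued functions -/

section Bilinear

variable {X : Type*} [NormedAddCommGroup X] [NormedSpace ℂ X]
  {Y : Type*} [NormedAddCommGroup Y] [NormedSpace ℂ Y]
  {Z : Type*} [NormedAddCommGroup Z] [NormedSpace ℂ Z]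
  {T : Type*} [NormedAddCommGroup T] [NormedSpace ℂ T]

theorem analyticAt_clm_apply {L : X → Y →L[ℂ] Z} {g : X → Y} {z : X} (hL : AnalyticAt ℂ L z)
    (hg : AnalyticAt ℂ g z) : AnalyticAt ℂ (fun y => L y (g y)) z :=
  AnalyticAt.comp (g := fun q : (Y →L[ℂ] Z) × Y => q.1 q.2) (f := fun y => (L y, g y))
    ((ContinuousLinearMap.id ℂ (Y →L[ℂ] Z)).analyticAt_bilinear _) (hL.prod hg)

theorem analyticAt_clm_comp {L : X → Z →L[ℂ] T} {M : X → Y →L[ℂ] Z} {z : X}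
    (hL : AnalyticAt ℂ L z) (hM : AnalyticAt ℂ M z) : AnalyticAt ℂ (fun y => (L y).comp (M y)) z :=
  AnalyticAt.comp (g := fun q : (Z →L[ℂ] T) × (Y →L[ℂ] Z) => q.1.comp q.2)
    (f := fun y => (L y, M y))
    ((ContinuousLinearMap.compL ℂ Y Z T).analyticAt_bilinear _) (hL.prod hM)

set_option maxSynthPendingDepth 3 in
theorem analyticAt_clm_compL {L : X → Z →L[ℂ] T} {z : X} (hL : AnalyticAt ℂ L z) :
    AnalyticAt ℂ (fun y => ContinuousLinearMap.compL ℂ Y Z T (L y)) z :=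
  AnalyticAt.comp (g := fun q : Z →L[ℂ] T => ContinuousLinearMap.compL ℂ Y Z T q) (f := L)
    ((ContinuousLinearMap.compL ℂ Y Z T).analyticAt _) hL

theorem hasFDerivAt_apply_apply {F : X → Y →L[ℂ] Z →L[ℂ] T} {F' : X →L[ℂ] Y →L[ℂ] Z →L[ℂ] T}
    {z : X} (h : HasFDerivAt F F' z) (u : Y) (v : Z) :
    HasFDerivAt (fun y => F y u v) ((ContinuousLinearMap.apply ℂ T v).comp
      ((ContinuousLinearMap.apply ℂ (Z →L[ℂ] T) u).comp F')) z := by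
  have h1 : HasFDerivAt (fun y => F y u) ((ContinuousLinearMap.apply ℂ (Z →L[ℂ] T) u).comp F') z :=
    HasFDerivAt.comp (g := fun q : Y →L[ℂ] Z →L[ℂ] T => q u) z
      (ContinuousLinearMap.apply ℂ (Z →L[ℂ] T) u).hasFDerivAt h
  exact HasFDerivAt.comp (g := fun q : Z →L[ℂ] T => q v) z
    (ContinuousLinearMap.apply ℂ T v).hasFDerivAt h1

end Bilinear

/-! ## The flat connection and the Euler field pulled back along an isomorphism -/

section PullBack

open scoped ContDiff

variable {V₁ : Type u} [NormedAddCommGroup V₁] [NormedSpace ℂ V₁] [FiniteDimensional ℂ V₁]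
  {V₂ : Type v} [NormedAddCommGroup V₂] [NormedSpace ℂ V₂] [FiniteDimensional ℂ V₂]
  {G₁ : Subgroup (V₁ ≃ₗ[ℂ] V₁)} {G₂ : Subgroup (V₂ ≃ₗ[ℂ] V₂)}

theorem analyticAt_inverse {L : V₁ → V₁ →L[ℂ] V₂} {z : V₁} (hL : AnalyticAt ℂ L z)
    (hz : ∃ e : V₁ ≃L[ℂ] V₂, L z = e) : AnalyticAt ℂ (fun y => (L y).inverse) z := by
  obtain ⟨e, he⟩ := hz
  have h1 : ContDiffAt ℂ ω (ContinuousLinearMap.inverse : (V₁ →L[ℂ] V₂) → V₂ →L[ℂ] V₁) (L z) := by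
    have : CompleteSpace V₁ := FiniteDimensional.complete ℂ V₁
    rw [he]; exact contDiffAt_map_inverse e
  have : CompleteSpace V₁ := FiniteDimensional.complete ℂ V₁
  exact (h1.comp z hL.contDiffAt).analyticAt

theorem fderiv_linear_comp (g : V₂ ≃ₗ[ℂ] V₂) {W : V₁ → V₂} {z : V₁} (hW : AnalyticAt ℂ W z) :
    fderiv ℂ (fun y => g (W y)) z = (toCLM g).comp (fderiv ℂ W z) :=
  ((toCLM g).hasFDerivAt.comp z hW.differentiableAt.hasFDerivAt).fderiv

variable (f : OrbitSpace G₁ → OrbitSpace G₂)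

open Classical in
/-- A lift of `f` near `z`, if there is one. -/
def someLift (z : V₁) : V₁ → V₂ := if h : ∃ W, IsLift f W z then h.choose else 0

theorem isLift_someLift {W : V₁ → V₂} {z : V₁} (h : IsLift f W z) : IsLift f (someLift f z) z := by
  have hex : ∃ W, IsLift f W z := ⟨W, h⟩
  rw [someLift, dif_pos hex]
  exact hex.choose_spec

/-- The connection form on `V₁` for which the lifts of `f` are affine-linear. -/
def pullForm (z : V₁) : V₁ →L[ℂ] V₁ →L[ℂ] V₁ :=
  -(ContinuousLinearMap.compL ℂ V₁ V₂ V₁ (fderiv ℂ (someLift f z) z).inverse).comp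
    (fderiv ℂ (fderiv ℂ (someLift f z)) z)

/-- The pull-back along `f` of the Euler vector field of `V₂`. -/
def pullEuler (z : V₁) : V₁ := (fderiv ℂ (someLift f z) z).inverse (someLift f z z)

variable {f}

theorem exists_lift_eq [Finite G₂] (hG₂ : FreeOnComplement G₂) {W W' : V₁ → V₂} {z : V₁}
    (h : IsLift f W z) (h' : IsLift f W' z) (hz : W' z ∈ arrComplement (reflHyperplanes G₂)) :
    ∃ g ∈ G₂, ∀ᶠ y in 𝓝 z, W' y = g (W y) := by
  obtain ⟨g, hg, hgz⟩ := orbitMk_eq_iff.1 (h.lift.self_of_nhds.symm.trans h'.lift.self_of_nhds)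
  exact ⟨g, hg, lift_unique hG₂ h h' hz hg hgz⟩

end PullBack

/-! ### The differential equations satisfied by the lifts -/

section PullBackIso

open scoped ContDiff

variable {V₁ : Type u} [NormedAddCommGroup V₁] [NormedSpace ℂ V₁] [FiniteDimensional ℂ V₁]
  {V₂ : Type v} [NormedAddCommGroup V₂] [NormedSpace ℂ V₂] [FiniteDimensional ℂ V₂]
  {G₁ : Subgroup (V₁ ≃ₗ[ℂ] V₁)} {G₂ : Subgroup (V₂ ≃ₗ[ℂ] V₂)} [Finite G₁] [Finite G₂]
  {f : OpenPartialHomeomorph (OrbitSpace G₁) (OrbitSpace G₂)} {z : V₁} {W : V₁ → V₂}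

/-- Standing hypotheses: `z` is a point of the complement at which the isomorphism `f` is defined,
and `W` is a lift of `f` near `z`. -/
structure LiftAt (f : OpenPartialHomeomorph (OrbitSpace G₁) (OrbitSpace G₂)) (W : V₁ → V₂)
    (z : V₁) : Prop where
  iso : IsLocalDiscIso G₁ G₂ f
  free₁ : FreeOnComplement G₁
  free₂ : FreeOnComplement G₂
  source : orbitMk G₁ z ∈ f.source
  mem : z ∈ arrComplement (reflHyperplanes G₁)
  lift : IsLift f W z

theorem LiftAt.mem_target (h : LiftAt f W z) : W z ∈ arrComplement (reflHyperplanes G₂) :=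
  (h.iso.mem_arrComplement h.source h.lift.lift.self_of_nhds).1 h.mem

theorem LiftAt.eventually (h : LiftAt f W z) : ∀ᶠ y in 𝓝 z, LiftAt f W y := by
  filter_upwards [h.lift.eventually, isOpen_arrComplement.mem_nhds h.mem,
    continuous_orbitMk.continuousAt.eventually (f.open_source.mem_nhds h.source)] with y h1 h2 h3
  exact ⟨h.iso, h.free₁, h.free₂, h3, h2, h1⟩

theorem LiftAt.exists_equiv (h : LiftAt f W z) : ∃ e : V₁ ≃L[ℂ] V₂, fderiv ℂ W z = e :=
  h.iso.exists_fderiv_equiv h.free₁ h.free₂ h.source h.mem h.lift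

theorem LiftAt.injective (h : LiftAt f W z) {x y : V₁} (hxy : fderiv ℂ W z x = fderiv ℂ W z y) :
    x = y := by
  obtain ⟨e, he⟩ := h.exists_equiv
  rw [he] at hxy
  exact e.injective hxy

theorem LiftAt.someLift (h : LiftAt f W z) : LiftAt f (someLift f z) z :=
  { h with lift := isLift_someLift f h.lift }

theorem LiftAt.exists_someLift (h : LiftAt f W z) :
    ∃ g ∈ G₂, ∀ᶠ y in 𝓝 z, W y = g (DunklDuality.someLift f z y) :=
  exists_lift_eq h.free₂ (isLift_someLift f h.lift) h.lift h.mem_target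

theorem LiftAt.inverse_apply (h : LiftAt f W z) (x : V₂) :
    fderiv ℂ W z ((fderiv ℂ W z).inverse x) = x := by
  obtain ⟨e, he⟩ := h.exists_equiv
  rw [he, ContinuousLinearMap.inverse_equiv]
  exact e.apply_symm_apply x

/-- The equation that defines `pullForm` for the chosen lift holds for every lift: another one is `g
∘ someLift` with `g` linear, and both sides acquire the factor `g`. As `DW` is injective, all
properties of `pullForm` are derived from this equation. -/
theorem LiftAt.fderiv_pullForm (h : LiftAt f W z) (u v : V₁) :
    fderiv ℂ W z (pullForm f z u v) = -fderiv ℂ (fderiv ℂ W) z u v := by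
  obtain ⟨g, hg, hgW⟩ := h.exists_someLift
  have h0 := h.someLift
  set W₀ := DunklDuality.someLift f z with hW₀
  have h1 : fderiv ℂ W =ᶠ[𝓝 z] fun y => (toCLM g).comp (fderiv ℂ W₀ y) := by
    filter_upwards [hgW.eventually_nhds, h0.lift.eventually] with y hy hy0
    rw [EventuallyEq.fderiv_eq (show W =ᶠ[𝓝 y] fun y => g (W₀ y) from hy),
      fderiv_linear_comp g hy0.analyticAt]
  have h2 : fderiv ℂ (fderiv ℂ W) z u = (toCLM g).comp (fderiv ℂ (fderiv ℂ W₀) z u) := by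
    rw [h1.fderiv_eq]
    have h3 := ((ContinuousLinearMap.compL ℂ V₁ V₂ V₂ (toCLM g)).hasFDerivAt.comp z
      h0.lift.analyticAt.fderiv.differentiableAt.hasFDerivAt).fderiv
    have h4 := DFunLike.congr_fun h3 u
    exact h4
  have h3 : pullForm f z u v = -(fderiv ℂ W₀ z).inverse (fderiv ℂ (fderiv ℂ W₀) z u v) := rfl
  rw [h2, h1.self_of_nhds, h3, ContinuousLinearMap.comp_apply, ContinuousLinearMap.comp_apply,
    map_neg, h0.inverse_apply, map_neg]

/-- Independent of the lift as well, because the Euler field of `V₂` is preserved by linear maps. -/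
theorem LiftAt.fderiv_pullEuler (h : LiftAt f W z) : fderiv ℂ W z (pullEuler f z) = W z := by
  obtain ⟨g, hg, hgW⟩ := h.exists_someLift
  have h0 := h.someLift
  rw [EventuallyEq.fderiv_eq (show W =ᶠ[𝓝 z] fun y => g (DunklDuality.someLift f z y) from hgW),
    fderiv_linear_comp g h0.lift.analyticAt, ContinuousLinearMap.comp_apply, pullEuler,
    h0.inverse_apply, toCLM_apply, ← hgW.self_of_nhds]

theorem LiftAt.pullForm_eq (h : LiftAt f W z) :
    pullForm f z = -(ContinuousLinearMap.compL ℂ V₁ V₂ V₁ (fderiv ℂ W z).inverse).comp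
      (fderiv ℂ (fderiv ℂ W) z) := by
  ext u v
  refine h.injective ?_
  rw [h.fderiv_pullForm]
  change _ = fderiv ℂ W z (-(fderiv ℂ W z).inverse (fderiv ℂ (fderiv ℂ W) z u v))
  rw [map_neg, h.inverse_apply]

theorem LiftAt.pullEuler_eq (h : LiftAt f W z) :
    pullEuler f z = (fderiv ℂ W z).inverse (W z) := by
  refine h.injective ?_
  rw [h.fderiv_pullEuler, h.inverse_apply]

theorem LiftAt.analyticAt_pullForm (h : LiftAt f W z) : AnalyticAt ℂ (pullForm f) z := by
  have hi := analyticAt_inverse h.lift.analyticAt.fderiv h.exists_equiv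
  have h1 : AnalyticAt ℂ (fun y => -((ContinuousLinearMap.compL ℂ V₁ (V₁ →L[ℂ] V₂) (V₁ →L[ℂ] V₁))
      (ContinuousLinearMap.compL ℂ V₁ V₂ V₁ (fderiv ℂ W y).inverse)
      (fderiv ℂ (fderiv ℂ W) y))) z := by
    exact (analyticAt_clm_comp (analyticAt_clm_compL hi) h.lift.analyticAt.fderiv.fderiv).neg
  refine h1.congr ?_
  filter_upwards [h.eventually] with y hy
  rw [hy.pullForm_eq]; rfl

theorem LiftAt.analyticAt_pullEuler (h : LiftAt f W z) : AnalyticAt ℂ (pullEuler f) z := by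
  have hi := analyticAt_inverse h.lift.analyticAt.fderiv h.exists_equiv
  refine (analyticAt_clm_apply hi h.lift.analyticAt).congr ?_
  filter_upwards [h.eventually] with y hy
  rw [hy.pullEuler_eq]

theorem isSymm_sndFDeriv {Y : Type*} [NormedAddCommGroup Y] [NormedSpace ℂ Y] [CompleteSpace Y] {F : V₁ → Y}
    (hF : AnalyticAt ℂ F z) (u v : V₁) :
    fderiv ℂ (fderiv ℂ F) z u v = fderiv ℂ (fderiv ℂ F) z v u :=
  (ContDiffAt.isSymmSndFDerivAt_of_omega hF.contDiffAt) u v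

theorem LiftAt.pullForm_symm (h : LiftAt f W z) (u v : V₁) : pullForm f z u v = pullForm f z v u := by
  refine h.injective ?_
  rw [h.fderiv_pullForm, h.fderiv_pullForm, isSymm_sndFDeriv h.lift.analyticAt]

/-- The second order differential equation of a lift, differentiated. -/
theorem LiftAt.fderiv_fderiv_pullForm (h : LiftAt f W z) (t u v : V₁) :
    fderiv ℂ W z (fderiv ℂ (pullForm f) z t u v) =
      -fderiv ℂ (fderiv ℂ (fderiv ℂ W)) z t u v + fderiv ℂ W z (pullForm f z t (pullForm f z u v)) := by
  have hΩ : HasFDerivAt (fun y => pullForm f y u v)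
      ((ContinuousLinearMap.apply ℂ V₁ v).comp ((ContinuousLinearMap.apply ℂ (V₁ →L[ℂ] V₁) u).comp
        (fderiv ℂ (pullForm f) z))) z :=
    hasFDerivAt_apply_apply h.analyticAt_pullForm.differentiableAt.hasFDerivAt u v
  have h1 := h.lift.analyticAt.fderiv.differentiableAt.hasFDerivAt.clm_apply hΩ
  have hD : HasFDerivAt (fun y => -fderiv ℂ (fderiv ℂ W) y u v)
      (-((ContinuousLinearMap.apply ℂ V₂ v).comp ((ContinuousLinearMap.apply ℂ (V₁ →L[ℂ] V₂) u).comp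
        (fderiv ℂ (fderiv ℂ (fderiv ℂ W)) z)))) z :=
    (hasFDerivAt_apply_apply h.lift.analyticAt.fderiv.fderiv.differentiableAt.hasFDerivAt u v).neg
  have h2 := h1.unique (hD.congr_of_eventuallyEq (by
    filter_upwards [h.eventually] with y hy using hy.fderiv_pullForm u v))
  have h3 := DFunLike.congr_fun h2 t
  simp only [add_apply, ContinuousLinearMap.comp_apply, ContinuousLinearMap.flip_apply,
    ContinuousLinearMap.apply_apply, neg_apply] at h3
  rw [h.fderiv_pullForm t, ← h3]
  abel

/-- After applying `DW`, the terms with third derivatives of `W` cancel by symmetry and only the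
quadratic terms remain. -/
theorem LiftAt.pullForm_flat (h : LiftAt f W z) (u v w : V₁) :
    fderiv ℂ (pullForm f) z u v w - fderiv ℂ (pullForm f) z v u w =
      pullForm f z u (pullForm f z v w) - pullForm f z v (pullForm f z u w) := by
  refine h.injective ?_
  rw [map_sub, map_sub, h.fderiv_fderiv_pullForm, h.fderiv_fderiv_pullForm,
    isSymm_sndFDeriv h.lift.analyticAt.fderiv u v]
  abel

/-- Behaviour under linear maps that commute with `f`. -/
theorem LiftAt.transform (h : LiftAt f W z) (a₁ : V₁ ≃ₗ[ℂ] V₁) (a₂ : V₂ ≃ₗ[ℂ] V₂) {W' : V₁ → V₂}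
    (h' : LiftAt f W' (a₁ z))
    (ha : ∀ᶠ y in 𝓝 z, ∀ w, f (orbitMk G₁ (a₁ y)) = orbitMk G₂ w →
      f (orbitMk G₁ y) = orbitMk G₂ (a₂ w)) :
    (∀ u v, pullForm f (a₁ z) (a₁ u) (a₁ v) = a₁ (pullForm f z u v)) ∧
      pullEuler f (a₁ z) = a₁ (pullEuler f z) := by
  have hW' : AnalyticAt ℂ (fun y => a₂ (W' (a₁ y))) z :=
    (analyticAt_linearEquiv a₂ _).comp
      (AnalyticAt.comp (g := W') (f := a₁) h'.lift.analyticAt (analyticAt_linearEquiv a₁ z))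
  have hev : Tendsto a₁ (𝓝 z) (𝓝 (a₁ z)) := (continuous_linearEquiv a₁).tendsto z
  -- This composite is another lift at `z`, so its equations can be compared with those of `W'` at
  -- `a₁ z`.
  have hL : LiftAt f (fun y => a₂ (W' (a₁ y))) z := by
    refine { h with lift := ⟨hW', ?_⟩ }
    filter_upwards [ha, hev.eventually h'.lift.lift] with y h1 h2 using h1 _ h2
  have hd : ∀ᶠ y in 𝓝 z, fderiv ℂ (fun y => a₂ (W' (a₁ y))) y =
      (toCLM a₂).comp ((fderiv ℂ W' (a₁ y)).comp (toCLM a₁)) := by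
    filter_upwards [hev.eventually h'.lift.eventually] with y hy
    have h1 : HasFDerivAt (fun y => W' (a₁ y)) ((fderiv ℂ W' (a₁ y)).comp (toCLM a₁)) y :=
      HasFDerivAt.comp (g := W') (f := toCLM a₁) y hy.analyticAt.differentiableAt.hasFDerivAt
        (toCLM a₁).hasFDerivAt
    exact ((toCLM a₂).hasFDerivAt.comp y h1).fderiv
  have hd2 : ∀ u v, fderiv ℂ (fderiv ℂ fun y => a₂ (W' (a₁ y))) z u v =
      a₂ (fderiv ℂ (fderiv ℂ W') (a₁ z) (a₁ u) (a₁ v)) := by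
    intro u v
    rw [EventuallyEq.fderiv_eq hd]
    have h1 : HasFDerivAt (fun y => fderiv ℂ W' (a₁ y))
        ((fderiv ℂ (fderiv ℂ W') (a₁ z)).comp (toCLM a₁)) z :=
      HasFDerivAt.comp (g := fderiv ℂ W') (f := toCLM a₁) z
        h'.lift.analyticAt.fderiv.differentiableAt.hasFDerivAt (toCLM a₁).hasFDerivAt
    have h2 := ((ContinuousLinearMap.compL ℂ V₁ V₂ V₂ (toCLM a₂)).hasFDerivAt.comp z
      (((ContinuousLinearMap.compL ℂ V₁ V₁ V₂).flip (toCLM a₁)).hasFDerivAt.comp z h1)).fderiv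
    have h3 := DFunLike.congr_fun (DFunLike.congr_fun h2 u) v
    exact h3
  constructor
  · intro u v
    have h1 := hL.fderiv_pullForm u v
    rw [hd.self_of_nhds, hd2] at h1
    refine h'.injective (a₂.injective ?_)
    rw [h'.fderiv_pullForm, map_neg, ← h1]
    rfl
  · have h1 := hL.fderiv_pullEuler
    rw [hd.self_of_nhds] at h1
    refine h'.injective (a₂.injective ?_)
    rw [h'.fderiv_pullEuler, ← h1]
    rfl

end PullBackIso

/-! ### Behaviour of the Euler field and the connection at a generic point -/

section Asymptotics

variable {V₁ : Type u} [NormedAddCommGroup V₁] [NormedSpace ℂ V₁] [FiniteDimensional ℂ V₁]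
  {V₂ : Type v} [NormedAddCommGroup V₂] [NormedSpace ℂ V₂] [FiniteDimensional ℂ V₂]
  {G₁ : Subgroup (V₁ ≃ₗ[ℂ] V₁)} {G₂ : Subgroup (V₂ ≃ₗ[ℂ] V₂)} [Finite G₁] [Finite G₂]
  {f : OpenPartialHomeomorph (OrbitSpace G₁) (OrbitSpace G₂)} {z₀ : V₁}
  {φ : V₁ →L[ℂ] ℂ} {e : V₁} {φ' : V₂ →L[ℂ] ℂ} {e' : V₂} {m m' : ℕ} {C : V₁ → ℂ} {B : V₁ → V₂}

/-- Near a generic point of the discriminant the pulled back Euler field is bounded. -/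
theorem IsLocalModel.bounded_pullEuler (hM : IsLocalModel f φ e m φ' e' m' z₀ C B)
    (hφ : φ z₀ = 0) (hm : m ≠ 0) (hm' : m' ≠ 0)
    (hL : ∀ᶠ z in 𝓝 z₀, φ z ≠ 0 → ∀ W, IsLift f W z → LiftAt f W z) :
    ∃ M : ℝ, ∀ᶠ z in 𝓝 z₀, φ z ≠ 0 → ‖pullEuler f z‖ ≤ M := by
  obtain ⟨ε, hε, hb⟩ := hM.bound_below hφ hm
  have hcont : ContinuousAt (fun z => ((m' * φ z * C z, B z) : ℂ × V₂)) z₀ :=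
    ((continuousAt_const.mul φ.continuous.continuousAt).mul hM.analyticAt_C.continuousAt).prodMk
      hM.analyticAt_B.continuousAt
  have hbd := hcont.norm.eventually (gt_mem_nhds (lt_add_one _))
  refine ⟨(‖((m' * φ z₀ * C z₀, B z₀) : ℂ × V₂)‖ + 1) / ε, ?_⟩
  filter_upwards [hb, hbd, hM.lift, hL, hM.analyticAt_C.eventually_analyticAt] with z h1 h2 h3 h4 h5 hz
  obtain ⟨W, hW, hW0, hWm⟩ := h3 hz
  have hLW := h4 hz W hW
  obtain ⟨h6, h7⟩ := IsLocalModel.fderiv_lift hW.analyticAt h5 hz hm hm' hWm (pullEuler f z)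
  rw [hLW.fderiv_pullEuler] at h6 h7
  -- The field solves a linear system whose right-hand side is continuous across `H`, with
  -- coefficients uniformly bounded below near `z₀`.
  have h8 : modelSystem φ m C B z (pullEuler f z) = (m' * φ z * C z, B z) := by
    rw [modelSystem_apply, ← h7, hWm.self_of_nhds.2]
    congr 1
    refine mul_left_cancel₀ hW0 ?_
    linear_combination -h6
  have h9 := h1 (pullEuler f z)
  rw [h8] at h9
  rw [le_div_iff₀ hε, mul_comm]
  exact h9.trans h2.le

/-- The polar part of the pulled back connection form. -/
theorem IsLocalModel.tendsto_pullForm (hM : IsLocalModel f φ e m φ' e' m' z₀ C B)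
    (hφ : φ z₀ = 0) (he : φ e = 1) (hm : m ≠ 0) (hm' : m' ≠ 0)
    (hL : ∀ᶠ z in 𝓝 z₀, φ z ≠ 0 → ∀ W, IsLift f W z → LiftAt f W z) (u v : V₁) :
    Tendsto (fun z => φ z • pullForm f z u v) (𝓝[{z | φ z ≠ 0}] z₀)
      (𝓝 (((1 - m / m' : ℂ) * (φ u * φ v)) • e)) := by
  obtain ⟨ε, hε, hb⟩ := hM.bound_below hφ hm
  set y₀ : V₁ := ((1 - m / m' : ℂ) * (φ u * φ v)) • e with hy₀
  -- The first component of the model system applied to `x`.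
  let N : V₁ → V₁ → ℂ := fun x z => m * C z * φ x + φ z * fderiv ℂ C z x
  have hNan : ∀ x, AnalyticAt ℂ (N x) z₀ := fun x =>
    ((analyticAt_const.mul hM.analyticAt_C).mul analyticAt_const).add
      ((φ.analyticAt _).mul (analyticAt_clm_apply hM.analyticAt_C.fderiv analyticAt_const))
  -- This will be the image of `φ z • pullForm f z u v` under the model system. It results from
  -- differentiating along `v` the two equations for the derivative of a lift along `u`, and
  -- eliminating the second derivative of the lift. It is continuous across `H`, so the limit is the
  -- solution of the system at `z₀`.
  let R : V₁ → ℂ × V₂ := fun z =>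
    (((φ v * C z + φ z * fderiv ℂ C z v) * N u z - N u z * N v z / m' -
      φ z * C z * fderiv ℂ (N u) z v) / C z, -(φ z • fderiv ℂ (fderiv ℂ B) z v u))
  have hRc : ContinuousAt R z₀ := by
    have c1 := hM.analyticAt_C.continuousAt
    have c2 : ContinuousAt (fun z => fderiv ℂ C z v) z₀ :=
      (analyticAt_clm_apply hM.analyticAt_C.fderiv analyticAt_const).continuousAt
    have c3 : ContinuousAt (fun z => fderiv ℂ (N u) z v) z₀ :=
      (analyticAt_clm_apply (hNan u).fderiv analyticAt_const).continuousAt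
    have c4 : ContinuousAt (fun z => fderiv ℂ (fderiv ℂ B) z v u) z₀ :=
      (analyticAt_clm_apply (analyticAt_clm_apply hM.analyticAt_B.fderiv.fderiv analyticAt_const) analyticAt_const).continuousAt
    have c0 : ContinuousAt φ z₀ := φ.continuous.continuousAt
    have cu := (hNan u).continuousAt
    have cv := (hNan v).continuousAt
    exact ((((((continuousAt_const.mul c1).add (c0.mul c2)).mul cu).sub
      ((cu.mul cv).div_const _)).sub ((c0.mul c1).mul c3)).div c1 hM.ne_zero).prodMk (c0.smul c4).neg
  have hR0 : R z₀ = modelSystem φ m C B z₀ y₀ := by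
    rw [modelSystem_apply]
    refine Prod.ext ?_ ?_
    · simp only [R, N, hφ, hy₀, map_smul, he, smul_eq_mul]
      have hC := hM.ne_zero
      have h1 : (m' : ℂ) ≠ 0 := Nat.cast_ne_zero.2 hm'
      field_simp
      ring
    · simp only [R, hφ, hy₀, map_smul, hM.fderiv_normal, smul_zero, zero_smul, neg_zero]
  have hev : ∀ᶠ z in 𝓝 z₀, φ z ≠ 0 → modelSystem φ m C B z (φ z • pullForm f z u v) = R z := by
    filter_upwards [hM.lift, hL, hM.analyticAt_C.eventually_analyticAt, (hNan u).eventually_analyticAt,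
      hM.analyticAt_B.eventually_analyticAt,
      hM.analyticAt_C.continuousAt.eventually_ne hM.ne_zero] with z h3 h4 hCz hNz hBz hC0 hz
    obtain ⟨W, hW, hW0, hWm⟩ := h3 hz
    have hLW := h4 hz W hW
    have hfd : ∀ᶠ y in 𝓝 z, m' * φ y * C y * φ' (fderiv ℂ W y u) = φ' (W y) * N u y ∧
        fderiv ℂ W y u - φ' (fderiv ℂ W y u) • e' = fderiv ℂ B y u := by
      filter_upwards [hW.eventually, hCz.eventually_analyticAt, hWm.eventually_nhds,
        φ.continuous.continuousAt.eventually_ne hz] with y h5 h6 h7 h8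
      exact IsLocalModel.fderiv_lift h5.analyticAt h6 h8 hm hm' h7 u
    have hWd := hW.analyticAt.differentiableAt.hasFDerivAt
    have hDu : HasFDerivAt (fun y => fderiv ℂ W y u)
        ((ContinuousLinearMap.apply ℂ V₂ u).comp (fderiv ℂ (fderiv ℂ W) z)) z :=
      (ContinuousLinearMap.apply ℂ V₂ u).hasFDerivAt.comp z
        hW.analyticAt.fderiv.differentiableAt.hasFDerivAt
    have hφDu : HasFDerivAt (fun y => φ' (fderiv ℂ W y u)) _ z := φ'.hasFDerivAt.comp z hDu
    have hφW : HasFDerivAt (fun y => φ' (W y)) (φ'.comp (fderiv ℂ W z)) z :=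
      φ'.hasFDerivAt.comp z hWd
    have hsnd : fderiv ℂ (fderiv ℂ W) z v u = -fderiv ℂ W z (pullForm f z u v) := by
      rw [hLW.fderiv_pullForm, neg_neg, isSymm_sndFDeriv hW.analyticAt]
    have e1 : m' * (φ v * C z + φ z * fderiv ℂ C z v) * φ' (fderiv ℂ W z u) -
        m' * φ z * C z * φ' (fderiv ℂ W z (pullForm f z u v)) =
        φ' (fderiv ℂ W z v) * N u z + φ' (W z) * fderiv ℂ (N u) z v := by
      have h1 := (((φ.hasFDerivAt (x := z)).const_mul (m' : ℂ)).mul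
        hCz.differentiableAt.hasFDerivAt).mul hφDu
      have h2 := hφW.mul hNz.differentiableAt.hasFDerivAt
      have h5 := h1.unique (h2.congr_of_eventuallyEq (hfd.mono fun y hy => hy.1))
      have h6 := DFunLike.congr_fun h5 v
      simp only [add_apply, smul_apply, ContinuousLinearMap.comp_apply, smul_eq_mul,
        ContinuousLinearMap.apply_apply, hsnd, map_neg, Pi.mul_apply] at h6
      linear_combination h6
    have e2 : fderiv ℂ W z (pullForm f z u v) - φ' (fderiv ℂ W z (pullForm f z u v)) • e' =
        -fderiv ℂ (fderiv ℂ B) z v u := by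
      have h1 := hDu.sub (hφDu.smul_const e')
      have h2 : HasFDerivAt (fun y => fderiv ℂ B y u)
          ((ContinuousLinearMap.apply ℂ V₂ u).comp (fderiv ℂ (fderiv ℂ B) z)) z :=
        (ContinuousLinearMap.apply ℂ V₂ u).hasFDerivAt.comp z
          hBz.fderiv.differentiableAt.hasFDerivAt
      have h5 := h1.unique (h2.congr_of_eventuallyEq (hfd.mono fun y hy => hy.2))
      have h6 := DFunLike.congr_fun h5 v
      simp only [sub_apply, ContinuousLinearMap.comp_apply, ContinuousLinearMap.apply_apply, hsnd,
        map_neg, ContinuousLinearMap.smulRight_apply, neg_smul] at h6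
      rw [← h6]; abel
    obtain ⟨hu, -⟩ := hfd.self_of_nhds
    obtain ⟨hv, -⟩ := IsLocalModel.fderiv_lift hW.analyticAt hCz hz hm hm' hWm v
    obtain ⟨hΩ1, hΩ2⟩ := IsLocalModel.fderiv_lift hW.analyticAt hCz hz hm hm' hWm (pullForm f z u v)
    rw [modelSystem_apply]
    refine Prod.ext ?_ ?_
    · change m * C z * φ (φ z • pullForm f z u v) + φ z * fderiv ℂ C z (φ z • pullForm f z u v) =
        ((φ v * C z + φ z * fderiv ℂ C z v) * N u z - N u z * N v z / m' -
          φ z * C z * fderiv ℂ (N u) z v) / C z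
      have h1 : (m' : ℂ) ≠ 0 := Nat.cast_ne_zero.2 hm'
      rw [map_smul, map_smul, smul_eq_mul, smul_eq_mul, eq_div_iff hC0]
      have hv' : m' * φ z * C z * φ' (fderiv ℂ W z v) = φ' (W z) * N v z := hv
      refine mul_left_cancel₀ (mul_ne_zero hW0 h1) ?_
      have h9 : (m' : ℂ) * (N u z * N v z / m') = N u z * N v z := by field_simp
      linear_combination (-(m' * φ z * C z)) * e1 - (m' * φ z * C z) * hΩ1 +
        m' * (φ v * C z + φ z * fderiv ℂ C z v) * hu - N u z * hv' + φ' (W z) * h9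
    · change fderiv ℂ B z (φ z • pullForm f z u v) = -(φ z • fderiv ℂ (fderiv ℂ B) z v u)
      rw [map_smul, ← hΩ2, e2, smul_neg]
  rw [tendsto_iff_norm_sub_tendsto_zero]
  have hlim : Tendsto (fun z => ‖R z - modelSystem φ m C B z y₀‖ / ε) (𝓝 z₀) (𝓝 0) := by
    have h1 : ContinuousAt (fun z => ‖R z - modelSystem φ m C B z y₀‖ / ε) z₀ :=
      ((hRc.sub ((continuousAt_modelSystem m hM.analyticAt_C hM.analyticAt_B).clm_apply
        continuousAt_const)).norm).div_const ε
    have h2 := h1.tendsto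
    rwa [hR0, sub_self, norm_zero, zero_div] at h2
  refine squeeze_zero' (Eventually.of_forall fun z => norm_nonneg _) ?_
    (hlim.mono_left nhdsWithin_le_nhds)
  filter_upwards [self_mem_nhdsWithin, nhdsWithin_le_nhds hev, nhdsWithin_le_nhds hb] with z h1 h2 h3
  rw [le_div_iff₀ hε, mul_comm]
  refine (h3 _).trans ?_
  rw [map_sub, h2 h1]

end Asymptotics


/-! ### Points that are generic for both groups -/

section Bigeneric

variable {V₁ : Type u} [NormedAddCommGroup V₁] [NormedSpace ℂ V₁] [FiniteDimensional ℂ V₁]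
  {V₂ : Type v} [NormedAddCommGroup V₂] [NormedSpace ℂ V₂] [FiniteDimensional ℂ V₂]
  {G₁ : Subgroup (V₁ ≃ₗ[ℂ] V₁)} {G₂ : Subgroup (V₂ ≃ₗ[ℂ] V₂)} [Finite G₁] [Finite G₂]

/-- A generic point of `H` whose image under `f` is represented by a generic point of a reflection
hyperplane of `G₂`. -/
structure IsBigenericPt (f : OpenPartialHomeomorph (OrbitSpace G₁) (OrbitSpace G₂))
    (H : Submodule ℂ V₁) (z : V₁) : Prop where
  source : orbitMk G₁ z ∈ f.source
  generic : IsGenericPt G₁ H z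
  target : ∃ H' ∈ reflHyperplanes G₂, ∃ w, f (orbitMk G₁ z) = orbitMk G₂ w ∧ IsGenericPt G₂ H' w

variable {f : OpenPartialHomeomorph (OrbitSpace G₁) (OrbitSpace G₂)}
  {H : Submodule ℂ V₁} {z₀ : V₁} {φ : V₁ →L[ℂ] ℂ} {e : V₁}

theorem notMem_arrComplement_of_mem {V : Type*} [NormedAddCommGroup V] [NormedSpace ℂ V]
    {ℋ : Set (Submodule ℂ V)} {H : Submodule ℂ V} (hH : H ∈ ℋ) {z : V} (hz : z ∈ H) :
    z ∉ arrComplement ℋ := fun h => h H hH hz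

/-- Near `w₀` the only hyperplane is `H'`. A point of `H` near `z₀` is sent into the discriminant,
hence is represented by a point of `H'` near `w₀`, which is generic since genericity is open in
`H'`. -/
theorem IsLocalDiscIso.exists_target_generic (hf : IsLocalDiscIso G₁ G₂ f)
    (hH : H ∈ reflHyperplanes G₁) {H' : Submodule ℂ V₂} (hH' : H' ∈ reflHyperplanes G₂) {w₀ : V₂}
    (hz : orbitMk G₁ z₀ ∈ f.source) (hw : f (orbitMk G₁ z₀) = orbitMk G₂ w₀)
    (hw₀ : IsGenericPt G₂ H' w₀) :
    ∀ᶠ y in 𝓝 z₀, orbitMk G₁ y ∈ f.source ∧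
      (y ∈ H → ∃ w, f (orbitMk G₁ y) = orbitMk G₂ w ∧ IsGenericPt G₂ H' w) := by
  filter_upwards [eventually_exists_target hz hw
    ((hw₀.eventually_mem_iff hH').and hw₀.eventually)] with y h1
  obtain ⟨hs, w, hw, h2, h3⟩ := h1
  refine ⟨hs, fun hy => ⟨w, hw, h3 ?_⟩⟩
  have h4 := mt (hf.mem_arrComplement hs hw).2 (notMem_arrComplement_of_mem hH hy)
  exact not_not.1 (mt h2.2 h4)

theorem IsBigenericPt.eventually (hf : IsLocalDiscIso G₁ G₂ f) (hH : H ∈ reflHyperplanes G₁)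
    (h : IsBigenericPt f H z₀) : ∀ᶠ y in 𝓝 z₀, y ∈ H → IsBigenericPt f H y := by
  obtain ⟨H', hH', w, hw, hgen⟩ := h.target
  filter_upwards [h.generic.eventually,
    hf.exists_target_generic hH hH' h.source hw hgen] with y h1 h2 hy
  obtain ⟨w', hw', hgen'⟩ := h2.2 hy
  exact ⟨h2.1, h1 hy, H', hH', w', hw', hgen'⟩

/-- Approximate `z₀` by a generic point of `H`, and its image by the class of a generic point of a
hyperplane of `G₂`. The latter lies in the image of a small neighbourhood of the former, and its
preimage there is still generic because genericity is open in `H`. -/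
theorem IsLocalDiscIso.mem_closure_isBigenericPt (hf : IsLocalDiscIso G₁ G₂ f)
    (hH : H ∈ reflHyperplanes G₁) (hz : z₀ ∈ H) (hs : orbitMk G₁ z₀ ∈ f.source) :
    z₀ ∈ closure {y | IsBigenericPt f H y} := by
  rw [mem_closure_iff_nhds]
  intro O hO
  have hsrc : ∀ᶠ y in 𝓝 z₀, orbitMk G₁ y ∈ f.source :=
    continuous_orbitMk.continuousAt.eventually (f.open_source.mem_nhds hs)
  obtain ⟨O', hO', hO'o, hzO'⟩ := mem_nhds_iff.1 (inter_mem hO hsrc)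
  obtain ⟨z₁, hz₁O, hz₁⟩ := mem_closure_iff_nhds.1 (mem_closure_isGenericPt (G := G₁) hz) O'
    (hO'o.mem_nhds hzO')
  obtain ⟨U, hU, hUo, hz₁U⟩ := mem_nhds_iff.1 (inter_mem (hO'o.mem_nhds hz₁O)
    ((IsGenericPt.eventually_mem_iff hz₁ hH).and (IsGenericPt.eventually hz₁)))
  have hsub : orbitMk G₁ '' U ⊆ f.source := by
    rintro _ ⟨y, hy, rfl⟩
    exact (hO' (hU hy).1).2
  have hopen : IsOpen (f '' (orbitMk G₁ '' U)) :=
    f.isOpen_image_of_subset_source (isOpenMap_orbitMk _ hUo) hsub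
  obtain ⟨w₁, hw₁⟩ := orbitMk_surjective (G := G₂) (f (orbitMk G₁ z₁))
  have hz₁s : orbitMk G₁ z₁ ∈ f.source := hsub ⟨z₁, hz₁U, rfl⟩
  have hw₁c : w₁ ∉ arrComplement (reflHyperplanes G₂) :=
    mt (hf.mem_arrComplement hz₁s hw₁.symm).2 (notMem_arrComplement_of_mem hH hz₁.mem)
  obtain ⟨H', hH', hw₁H⟩ : ∃ H' ∈ reflHyperplanes G₂, w₁ ∈ H' := by
    simpa [arrComplement] using hw₁c
  have hnh : orbitMk G₂ ⁻¹' (f '' (orbitMk G₁ '' U)) ∈ 𝓝 w₁ :=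
    (hopen.preimage continuous_orbitMk).mem_nhds
      (by rw [Set.mem_preimage, hw₁]; exact ⟨_, ⟨z₁, hz₁U, rfl⟩, rfl⟩)
  obtain ⟨w₂, ⟨_, ⟨y, hy, rfl⟩, hyw⟩, hw₂⟩ :=
    mem_closure_iff_nhds.1 (mem_closure_isGenericPt (G := G₂) hw₁H) _ hnh
  have hys : orbitMk G₁ y ∈ f.source := hsub ⟨y, hy, rfl⟩
  have hyc : y ∉ arrComplement (reflHyperplanes G₁) :=
    mt (hf.mem_arrComplement hys hyw).1 (notMem_arrComplement_of_mem hH' hw₂.mem)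
  have hyH : y ∈ H := not_not.1 (mt (hU hy).2.1.2 hyc)
  exact ⟨y, (hO' (hU hy).1).1, hys, (hU hy).2.2 hyH, H', hH', w₂, hyw, hw₂⟩

theorem IsLocalDiscIso.eventually_liftAt (hf : IsLocalDiscIso G₁ G₂ f) (hG₁ : FreeOnComplement G₁)
    (hG₂ : FreeOnComplement G₂) (hH : H ∈ reflHyperplanes G₁)
    (hz : orbitMk G₁ z₀ ∈ f.source) (hg : IsGenericPt G₁ H z₀) :
    ∀ᶠ z in 𝓝 z₀, z ∉ H → ∀ W, IsLift f W z → LiftAt f W z := by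
  have hsrc : ∀ᶠ y in 𝓝 z₀, orbitMk G₁ y ∈ f.source :=
    continuous_orbitMk.continuousAt.eventually (f.open_source.mem_nhds hz)
  filter_upwards [hsrc, hg.eventually_mem_iff hH] with z h1 h2 hzH W hW
  exact ⟨hf, hG₁, hG₂, h1, h2.2 hzH, hW⟩

theorem IsLocalDiscIso.exists_liftAt (hf : IsLocalDiscIso G₁ G₂ f) (hG₁ : FreeOnComplement G₁)
    (hG₂ : FreeOnComplement G₂) {z : V₁} (hz : orbitMk G₁ z ∈ f.source)
    (hzc : z ∈ arrComplement (reflHyperplanes G₁)) {w : V₂} (hw : f (orbitMk G₁ z) = orbitMk G₂ w) :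
    ∃ W, LiftAt f W z ∧ W z = w := by
  obtain ⟨W, hW, hWz⟩ := hf.exists_lift hG₂ hz hzc hw
  exact ⟨W, ⟨hf, hG₁, hG₂, hz, hzc, hW⟩, hWz⟩

theorem IsLocalDiscIso.exists_liftAt' (hf : IsLocalDiscIso G₁ G₂ f) (hG₁ : FreeOnComplement G₁)
    (hG₂ : FreeOnComplement G₂) {z : V₁} (hz : orbitMk G₁ z ∈ f.source)
    (hzc : z ∈ arrComplement (reflHyperplanes G₁)) : ∃ W, LiftAt f W z := by
  obtain ⟨w, hw⟩ := orbitMk_surjective (G := G₂) (f (orbitMk G₁ z))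
  obtain ⟨W, hW, -⟩ := hf.exists_liftAt hG₁ hG₂ hz hzc hw.symm
  exact ⟨W, hW⟩

theorem IsLocalDiscIso.tendsto_pullForm (hf : IsLocalDiscIso G₁ G₂ f) (hG₁ : FreeOnComplement G₁)
    (hG₂ : FreeOnComplement G₂) (r : IsRoot G₁ H φ e) (hz : orbitMk G₁ z₀ ∈ f.source)
    (hz₀ : IsGenericPt G₁ H z₀) {H' : Submodule ℂ V₂} (hH' : H' ∈ reflHyperplanes G₂) {w₀ : V₂}
    (hw : f (orbitMk G₁ z₀) = orbitMk G₂ w₀) (hw₀ : IsGenericPt G₂ H' w₀) (u v : V₁) :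
    Tendsto (fun z => φ z • pullForm f z u v) (𝓝[{z | φ z ≠ 0}] z₀)
      (𝓝 (((1 - Nat.card (pointwiseStab G₁ H) / Nat.card (pointwiseStab G₂ H') : ℂ) *
        (φ u * φ v)) • e)) := by
  obtain ⟨c, hc⟩ := exists_invariant_core G₂
  obtain ⟨φ', e', r', -⟩ := exists_isRoot c hc hH'
  obtain ⟨C, B, hM⟩ := hf.exists_localModel hG₂ r r' hz hw hz₀ hw₀
  refine hM.tendsto_pullForm ((r.ker _).2 hz₀.mem) r.apply_self Nat.card_pos.ne' Nat.card_pos.ne'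
    ?_ u v
  filter_upwards [hf.eventually_liftAt hG₁ hG₂ r.mem hz hz₀] with z h1 h2
  exact h1 (mt (r.ker z).2 h2)

theorem IsBigenericPt.bounded_pullEuler (hf : IsLocalDiscIso G₁ G₂ f) (hG₁ : FreeOnComplement G₁)
    (hG₂ : FreeOnComplement G₂) (r : IsRoot G₁ H φ e) (h : IsBigenericPt f H z₀) :
    ∃ M : ℝ, ∀ᶠ z in 𝓝 z₀, φ z ≠ 0 → ‖pullEuler f z‖ ≤ M := by
  obtain ⟨H', hH', w, hw, hw₀⟩ := h.target
  obtain ⟨c, hc⟩ := exists_invariant_core G₂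
  obtain ⟨φ', e', r', -⟩ := exists_isRoot c hc hH'
  obtain ⟨C, B, hM⟩ := hf.exists_localModel hG₂ r r' h.source hw h.generic hw₀
  refine hM.bounded_pullEuler ((r.ker _).2 h.generic.mem) Nat.card_pos.ne' Nat.card_pos.ne' ?_
  filter_upwards [hf.eventually_liftAt hG₁ hG₂ r.mem h.source h.generic] with z h1 h2
  exact h1 (mt (r.ker z).2 h2)

end Bigeneric

/-! ### The order of the target stabilizer along a hyperplane -/

section Constancy

variable {V : Type*} [NormedAddCommGroup V] [NormedSpace ℂ V] [FiniteDimensional ℂ V]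
  {G : Subgroup (V ≃ₗ[ℂ] V)}

theorem card_pointwiseStab_map {g : V ≃ₗ[ℂ] V} (hg : g ∈ G) (H : Submodule ℂ V) :
    Nat.card (pointwiseStab G (H.map (g : V →ₗ[ℂ] V))) = Nat.card (pointwiseStab G H) := by
  refine Nat.card_congr
    { toFun := fun s => ⟨g⁻¹ * s * g, G.mul_mem (G.mul_mem (G.inv_mem hg) s.2.1) hg, ?_⟩
      invFun := fun s => ⟨g * s * g⁻¹, G.mul_mem (G.mul_mem hg s.2.1) (G.inv_mem hg), ?_⟩
      left_inv := fun s => Subtype.ext (by simp [mul_assoc])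
      right_inv := fun s => Subtype.ext (by simp [mul_assoc]) }
  · intro h hh
    have h1 : (s : V ≃ₗ[ℂ] V) (g h) = g h := s.2.2 _ (Submodule.mem_map_of_mem hh)
    rw [mul_linearEquiv_apply, mul_linearEquiv_apply, h1]
    exact inv_linearEquiv_apply_self g h
  · rintro _ ⟨h, hh, rfl⟩
    rw [mul_linearEquiv_apply, mul_linearEquiv_apply]
    change g ((s : V ≃ₗ[ℂ] V) (g⁻¹ (g h))) = g h
    rw [inv_linearEquiv_apply_self, s.2.2 h hh]

theorem IsGenericPt.eq_of_mem {H H' : Submodule ℂ V} (hH : H ∈ reflHyperplanes G)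
    (hH' : H' ∈ reflHyperplanes G) {z : V} (hz : IsGenericPt G H z) (hz' : z ∈ H') : H = H' := by
  refine eq_of_le_reflHyperplanes hH hH' ?_
  obtain ⟨s, hs, -, rfl⟩ := hH'
  have h1 := hz.stab s hs (map_mem_fixedSpace.1 hz')
  exact fun h hh => map_mem_fixedSpace.2 (h1.2 h hh)

theorem IsGenericPt.card_eq {H H' : Submodule ℂ V} (hH : H ∈ reflHyperplanes G)
    (hH' : H' ∈ reflHyperplanes G) {z : V} (hz : IsGenericPt G H z) {g : V ≃ₗ[ℂ] V} (hg : g ∈ G)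
    (hz' : g z ∈ H') : Nat.card (pointwiseStab G H) = Nat.card (pointwiseStab G H') := by
  rw [← (hz.map hg).eq_of_mem (reflHyperplanes_map hg hH) hH' hz', card_pointwiseStab_map hg]

variable {V₁ : Type u} [NormedAddCommGroup V₁] [NormedSpace ℂ V₁] [FiniteDimensional ℂ V₁]
  {V₂ : Type v} [NormedAddCommGroup V₂] [NormedSpace ℂ V₂] [FiniteDimensional ℂ V₂]
  {G₁ : Subgroup (V₁ ≃ₗ[ℂ] V₁)} {G₂ : Subgroup (V₂ ≃ₗ[ℂ] V₂)} [Finite G₁] [Finite G₂]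
  {f : OrbitSpace G₁ ≃ₜ OrbitSpace G₂} {H : Submodule ℂ V₁}

/-- The reflection hyperplanes of `G₂` that correspond to `H` are conjugate. -/
theorem IsLocalDiscIso.card_target_eq (hf : IsLocalDiscIso G₁ G₂ f.toOpenPartialHomeomorph)
    (hH : H ∈ reflHyperplanes G₁) {z₀ z₁ : V₁} (hz₀ : z₀ ∈ H) (hz₁ : z₁ ∈ H)
    {H₀ H₁ : Submodule ℂ V₂} (hH₀ : H₀ ∈ reflHyperplanes G₂) (hH₁ : H₁ ∈ reflHyperplanes G₂)
    {w₀ w₁ : V₂} (hw₀ : f (orbitMk G₁ z₀) = orbitMk G₂ w₀) (hw₁ : f (orbitMk G₁ z₁) = orbitMk G₂ w₁)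
    (hg₀ : IsGenericPt G₂ H₀ w₀) (hg₁ : IsGenericPt G₂ H₁ w₁) :
    Nat.card (pointwiseStab G₂ H₁) = Nat.card (pointwiseStab G₂ H₀) := by
  have := Fintype.ofFinite G₂
  obtain ⟨φ, hφ0, hφ⟩ := exists_equation hH₀
  have hker : ∀ w, φ w = 0 ↔ w ∈ H₀ := fun w => by rw [← hφ]; rfl
  -- The norm of an equation of `H₀` vanishes exactly on the conjugates of `H₀`. Transported by `f`
  -- and restricted to `H` it is analytic and vanishes near `z₀`, hence on all of `H`. So `w₁` lies
  -- on a conjugate of `H₀`, which must be `H₁` as `w₁` is generic.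
  let ν : V₂ → ℂ := fun w => ∏ g : G₂, φ ((g : V₂ ≃ₗ[ℂ] V₂) w)
  have hinv : ∀ g ∈ G₂, ∀ w, ν (g w) = ν w := by
    intro g hg w
    exact Fintype.prod_equiv (Equiv.mulRight (⟨g, hg⟩ : G₂)) _ _ fun x => rfl
  let k : OrbitSpace G₂ → ℂ := fun x => ν (orbitMk_surjective x).choose
  have hk : ∀ w, k (orbitMk G₂ w) = ν w := by
    intro w
    obtain ⟨g, hg, h⟩ := orbitMk_eq_iff.1 (orbitMk_surjective (orbitMk G₂ w)).choose_spec
    have h2 := hinv g hg (orbitMk_surjective (orbitMk G₂ w)).choose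
    rw [← h] at h2
    exact h2.symm
  have hka : ∀ w, AnalyticAt ℂ (fun y => k (orbitMk G₂ y)) w := by
    intro w
    simp only [hk]
    exact Finset.analyticAt_fun_prod _ fun g _ => (φ.analyticAt _).comp (analyticAt_linearEquiv _ _)
  let K : H → ℂ := fun y => k (f (orbitMk G₁ (y : V₁)))
  have hK : AnalyticOnNhd ℂ K Set.univ := by
    intro y _
    obtain ⟨w, hw⟩ := orbitMk_surjective (G := G₂) (f (orbitMk G₁ (y : V₁)))
    have h1 := hf.analyticAt_comp (Set.mem_univ _) hw.symm (hka w)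
    exact AnalyticAt.comp (g := fun y => k (f (orbitMk G₁ y))) (f := H.subtypeL) h1
      (H.subtypeL.analyticAt y)
  have hK0 : K =ᶠ[𝓝 ⟨z₀, hz₀⟩] 0 := by
    have h1 := hf.exists_target_generic hH hH₀ (Set.mem_univ _) hw₀ hg₀
    have h2 : Tendsto (fun y : H => (y : V₁)) (𝓝 ⟨z₀, hz₀⟩) (𝓝 z₀) :=
      continuous_subtype_val.continuousAt
    filter_upwards [h2.eventually h1] with y hy
    obtain ⟨w, hw, hgw⟩ := hy.2 y.2
    have h3 : K y = ν w := by
      change k (f (orbitMk G₁ (y : V₁))) = _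
      rw [← hk]; exact congrArg k hw
    rw [h3]
    exact Finset.prod_eq_zero (Finset.mem_univ (1 : G₂)) ((hker _).2 hgw.mem)
  have hK1 := congrFun (hK.eq_of_eventuallyEq (g := 0) (fun y _ => analyticAt_const) hK0) ⟨z₁, hz₁⟩
  have h4 : ν w₁ = 0 := by
    rw [← hk, ← hw₁]; exact hK1
  obtain ⟨g, -, hg⟩ := Finset.prod_eq_zero_iff.1 h4
  exact hg₁.card_eq hH₁ hH₀ g.2 ((hker _).1 hg)

end Constancy


/-! ### Vanishing of the residue implies boundedness -/

section PolarPart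

variable {V : Type*} [NormedAddCommGroup V] [NormedSpace ℂ V] [FiniteDimensional ℂ V]
  {Y : Type*} [NormedAddCommGroup Y] [NormedSpace ℂ Y] [FiniteDimensional ℂ Y]

theorem dense_ne_zero {φ : V →L[ℂ] ℂ} (hφ : φ ≠ 0) : Dense {z | φ z ≠ 0} := by
  have h := dense_compl_iUnion_submodule (𝒮 := {LinearMap.ker (φ : V →ₗ[ℂ] ℂ)})
    (Set.finite_singleton _) (by
      rintro L rfl hL
      exact hφ (ContinuousLinearMap.ext fun z => LinearMap.congr_fun (LinearMap.ker_eq_top.1 hL) z))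
  simpa using h

/-- The product `φ F` extends across the hyperplane and vanishes on it, so it is divisible by `φ`;
the quotient is an analytic function that equals `F` off the hyperplane. -/
theorem bounded_of_tendsto_smul {φ : V →L[ℂ] ℂ} (hφ : φ ≠ 0) {F : V → Y} {z₀ : V} (h0 : φ z₀ = 0)
    (ha : ∀ᶠ z in 𝓝 z₀, φ z ≠ 0 → AnalyticAt ℂ F z)
    (ht : ∀ᶠ z in 𝓝 z₀, φ z = 0 → Tendsto (fun y => φ y • F y) (𝓝[{y | φ y ≠ 0}] z) (𝓝 0)) :
    ∃ M : ℝ, ∀ᶠ z in 𝓝 z₀, φ z ≠ 0 → ‖F z‖ ≤ M := by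
  obtain ⟨K, hK, hKF⟩ := exists_analyticAt_of_bddNear (ι := Unit) (φ := fun _ => φ)
    (F := fun y => φ y • F y) (z₀ := z₀) (fun _ => hφ) (fun _ => h0)
    (by
      filter_upwards [ha] with z hz h
      exact (φ.analyticAt z).smul (hz (h ())))
    (fun _ => by
      filter_upwards [ht] with z hz h
      refine subset_closure ⟨h, 1, ?_⟩
      have h1 := (hz h).norm
      rw [norm_zero] at h1
      filter_upwards [eventually_nhdsWithin_iff.1 (h1.eventually (ge_mem_nhds one_pos))] with y hy h2
      exact hy (h2 ()))
  have hKz : ∀ᶠ z in 𝓝 z₀, φ z = 0 → K z = 0 := by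
    filter_upwards [ht, hK.eventually_analyticAt, hKF.eventually_nhds] with z h1 h2 h3 hz
    have hne : (𝓝[{y | φ y ≠ 0}] z).NeBot :=
      mem_closure_iff_nhdsWithin_neBot.1 (dense_ne_zero hφ z)
    refine tendsto_nhds_unique (h2.continuousAt.mono_left nhdsWithin_le_nhds) ((h1 hz).congr' ?_)
    exact eventually_nhdsWithin_iff.2 (h3.mono fun y hy hy' => hy fun _ => hy')
  obtain ⟨C, hC, hKC⟩ := exists_analyticAt_eq_mul hφ h0 hK hKz
  refine ⟨‖C z₀‖ + 1, ?_⟩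
  filter_upwards [hKF, hKC, hC.continuousAt.norm.eventually (ge_mem_nhds (lt_add_one _))]
    with z h1 h2 h3 hz
  have h4 := h1 fun _ => hz
  rw [h2] at h4
  rwa [smul_right_injective _ hz h4]

end PolarPart

/-! ### Homogeneity of the pulled back connection and its Dunkl form -/

section Homogeneity

variable {V : Type*} [NormedAddCommGroup V] [NormedSpace ℂ V] [FiniteDimensional ℂ V]

theorem smulOfUnit_apply (c : ℂˣ) (z : V) : LinearEquiv.smulOfUnit c z = (c : ℂ) • z := rfl

theorem scalarOrder_pos [Nontrivial V] (G : Subgroup (V ≃ₗ[ℂ] V)) [Finite G] :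
    0 < scalarOrder G := by
  have h1 : Function.Injective
      (fun c : {c : ℂˣ // (LinearEquiv.smulOfUnit c : V ≃ₗ[ℂ] V) ∈ G} => (⟨_, c.2⟩ : G)) := by
    intro c c' h
    obtain ⟨v, hv⟩ := exists_ne (0 : V)
    have h2 := LinearEquiv.congr_fun (congrArg Subtype.val h) v
    exact Subtype.ext (Units.ext (smul_left_injective ℂ hv h2))
  have := Finite.of_injective _ h1
  have : Nonempty {c : ℂˣ // (LinearEquiv.smulOfUnit c : V ≃ₗ[ℂ] V) ∈ G} :=
    ⟨1, by convert! G.one_mem using 1; ext v; simp [smulOfUnit_apply]⟩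
  exact Nat.card_pos

variable {V₁ : Type u} [NormedAddCommGroup V₁] [NormedSpace ℂ V₁] [FiniteDimensional ℂ V₁]
  {V₂ : Type v} [NormedAddCommGroup V₂] [NormedSpace ℂ V₂] [FiniteDimensional ℂ V₂]
  {G₁ : Subgroup (V₁ ≃ₗ[ℂ] V₁)} {G₂ : Subgroup (V₂ ≃ₗ[ℂ] V₂)} [Finite G₁] [Finite G₂]
  {f : OrbitSpace G₁ ≃ₜ OrbitSpace G₂}

theorem IsDiscriminantIso.isLocalDiscIso (hf : IsDiscriminantIso G₁ G₂ f) :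
    IsLocalDiscIso G₁ G₂ f.toOpenPartialHomeomorph where
  hol x _ h := hf.analytic x h
  disc x _ := by
    change _ ↔ f x ∈ _
    rw [← hf.discriminant, f.injective.mem_set_image]

theorem IsDiscriminantIso.symm (hf : IsDiscriminantIso G₁ G₂ f) :
    IsDiscriminantIso G₂ G₁ f.symm where
  analytic x h := by
    have h1 := hf.analytic (f.symm x) fun y => h (f.symm y)
    simpa using h1.symm
  discriminant := by
    rw [← hf.discriminant, ← Set.image_comp]; simp
  equivariant t c₁ c₂ h₁ h₂ z₁ z₂ h := by
    have h1 := hf.equivariant t c₂ c₁ h₂ h₁ z₂ z₁ (by rw [← h]; simp)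
    rw [← h1]; simp

/-- By equivariance, multiplication by `c` on `V₁` corresponds to multiplication by some `d` on
`V₂`, namely a solution of `d ^ m₂ = c ^ m₁` for the orders of the groups of scalars. Both are
linear, so the connection is preserved. -/
theorem IsDiscriminantIso.pullForm_smul (hf : IsDiscriminantIso G₁ G₂ f)
    (hG₁ : FreeOnComplement G₁) (hG₂ : FreeOnComplement G₂) {z : V₁}
    (hz : z ∈ arrComplement (reflHyperplanes G₁)) {c : ℂ} (hc : c ≠ 0) (u v : V₁) :
    c • pullForm f.toOpenPartialHomeomorph (c • z) u v =
      pullForm f.toOpenPartialHomeomorph z u v := by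
  rcases subsingleton_or_nontrivial V₁ with hV | hV
  · exact Subsingleton.elim _ _
  have hl := hf.isLocalDiscIso
  obtain ⟨W, hW⟩ := hl.exists_liftAt' hG₁ hG₂ (z := z) (Set.mem_univ _) hz
  have hcz : c • z ∈ arrComplement (reflHyperplanes G₁) :=
    fun H hH h => hz H hH (by simpa [hc] using H.smul_mem c⁻¹ h)
  obtain ⟨W', hW'⟩ := hl.exists_liftAt' hG₁ hG₂ (z := c • z) (Set.mem_univ _) hcz
  obtain ⟨e, -⟩ := hW.exists_equiv
  have hV₂ : Nontrivial V₂ := e.injective.nontrivial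
  have hm := (scalarOrder_pos G₂).ne'
  obtain ⟨d, hd⟩ := IsAlgClosed.exists_pow_nat_eq (c ^ scalarOrder G₁) (scalarOrder_pos G₂)
  have hd0 : d ≠ 0 := by
    rintro rfl
    rw [zero_pow hm] at hd
    exact pow_ne_zero _ hc hd.symm
  have hu : Units.mk0 d hd0 ^ scalarOrder G₂ = Units.mk0 c hc ^ scalarOrder G₁ :=
    Units.ext (by simpa using hd)
  have h1 := hW.transform (LinearEquiv.smulOfUnit (Units.mk0 c hc))
    (LinearEquiv.smulOfUnit (Units.mk0 d hd0)⁻¹) (W' := W') hW' (by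
      refine Eventually.of_forall fun y w hw => ?_
      obtain ⟨w₀, hw₀⟩ := orbitMk_surjective (G := G₂) (f (orbitMk G₁ y))
      have h2 := hf.equivariant _ _ _ rfl hu y w₀ hw₀.symm
      obtain ⟨g, hg, h3⟩ := orbitMk_eq_iff.1 (h2.symm.trans hw)
      change f (orbitMk G₁ y) = _
      rw [← hw₀, orbitMk_eq_iff]
      refine ⟨g, hg, ?_⟩
      rw [smulOfUnit_apply, h3, map_smul, smul_smul, Units.inv_mul, one_smul])
  have h2 := h1.1 u v
  simp only [smulOfUnit_apply, Units.val_mk0, map_smul, smul_apply] at h2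
  exact smul_right_injective _ hc h2

theorem IsDiscriminantIso.isInvariantForm (hf : IsDiscriminantIso G₁ G₂ f)
    (hG₁ : FreeOnComplement G₁) (hG₂ : FreeOnComplement G₂) :
    IsInvariantForm G₁ (reflHyperplanes G₁) (pullForm f.toOpenPartialHomeomorph) := by
  intro g hg z hz u w
  have hl := hf.isLocalDiscIso
  obtain ⟨W, hW⟩ := hl.exists_liftAt' hG₁ hG₂ (z := z) (Set.mem_univ _) hz
  obtain ⟨W', hW'⟩ := hl.exists_liftAt' hG₁ hG₂ (z := g z) (Set.mem_univ _)
    ((map_mem_arrComplement hg).2 hz)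
  refine (hW.transform g 1 hW' (Eventually.of_forall fun y w hw => ?_)).1 u w
  rwa [orbitMk_map hg] at hw

theorem IsLocalDiscIso.isFlatTorsionFree (hf : IsLocalDiscIso G₁ G₂ f.toOpenPartialHomeomorph)
    (hG₁ : FreeOnComplement G₁) (hG₂ : FreeOnComplement G₂) :
    IsFlatTorsionFree (arrComplement (reflHyperplanes G₁))
      (pullForm f.toOpenPartialHomeomorph) where
  holomorphic z hz := by
    obtain ⟨W, hW⟩ := hf.exists_liftAt' hG₁ hG₂ (z := z) (Set.mem_univ _) hz
    exact hW.analyticAt_pullForm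
  flat z hz u v w := by
    obtain ⟨W, hW⟩ := hf.exists_liftAt' hG₁ hG₂ (z := z) (Set.mem_univ _) hz
    exact hW.pullForm_flat u v w
  torsion_free z hz u v := by
    obtain ⟨W, hW⟩ := hf.exists_liftAt' hG₁ hG₂ (z := z) (Set.mem_univ _) hz
    exact hW.pullForm_symm u v

theorem IsDiscriminantIso.isDunkl (hf : IsDiscriminantIso G₁ G₂ f)
    (hG₁ : FreeOnComplement G₁) (hG₂ : FreeOnComplement G₂) :
    IsDunkl (reflHyperplanes G₁) (pullForm f.toOpenPartialHomeomorph) := by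
  have hl := hf.isLocalDiscIso
  refine ⟨hl.isFlatTorsionFree hG₁ hG₂, ?_⟩
  obtain ⟨c, hc⟩ := exists_invariant_core G₁
  have hroot := fun H (hH : H ∈ reflHyperplanes G₁) => exists_isRoot c hc hH
  choose! φ e hr horth using hroot
  have hbig : ∀ H ∈ reflHyperplanes G₁, ∃ z, IsBigenericPt f.toOpenPartialHomeomorph H z := by
    intro H hH
    by_contra! hno
    have h1 := hl.mem_closure_isBigenericPt hH (z₀ := 0) H.zero_mem (Set.mem_univ _)
    simp [hno] at h1
  choose! ζ hζ using hbig
  choose! H' hH' ω hω hωg using fun H hH => (hζ H hH).target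
  -- The coefficient of the polar part at one chosen bigeneric point of `H`;
  -- `IsLocalDiscIso.card_target_eq` makes it valid at all of them.
  let κ : Submodule ℂ V₁ → ℂ := fun H =>
    1 - Nat.card (pointwiseStab G₁ H) / Nat.card (pointwiseStab G₂ (H' H))
  refine ⟨c, fun H => (φ H : Module.Dual ℂ V₁), fun H => (φ H).smulRight (e H), κ, ?_, ?_⟩
  · intro H hH
    have hker : LinearMap.ker (φ H : V₁ →ₗ[ℂ] ℂ) = H := Submodule.ext fun z => (hr H hH).ker z
    refine ⟨hker, (hr H hH).projection_mem, fun v h hh => ?_⟩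
    rw [ContinuousLinearMap.smulRight_apply, ← c.conj_inner_symm, c.smul_left, ← c.conj_inner_symm,
      horth H hH h hh, map_zero, mul_zero, map_zero]
  have hfin : (reflHyperplanes G₁).Finite := reflHyperplanes_finite G₁
  intro z hz u
  ext v
  rw [finsum_mem_eq_finite_toFinset_sum _ hfin, sum_apply]
  set Ω := pullForm f.toOpenPartialHomeomorph with hΩ
  let P : V₁ → V₁ := fun y => ∑ H ∈ hfin.toFinset, (φ H u * φ H v * κ H / φ H y) • e H
  -- The difference between the pulled back form and the Dunkl form with these residues. It has no
  -- polar part at bigeneric points, hence is bounded there.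
  let F : V₁ → V₁ := fun y => Ω y u v - P y
  have hterm : ∀ H, ∀ y, φ H y ≠ 0 →
      AnalyticAt ℂ (fun y => (φ H u * φ H v * κ H / φ H y) • e H) y := fun H y h =>
    (analyticAt_const.div ((φ H).analyticAt y) h).smul analyticAt_const
  have hne : ∀ y ∈ arrComplement (reflHyperplanes G₁), ∀ H ∈ reflHyperplanes G₁, φ H y ≠ 0 :=
    fun y hy H hH h => hy H hH (((hr H hH).ker y).1 h)
  have hFa : ∀ y ∈ arrComplement (reflHyperplanes G₁), AnalyticAt ℂ F y := by
    intro y hy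
    have h1 := (hl.isFlatTorsionFree hG₁ hG₂).holomorphic y hy
    refine (analyticAt_clm_apply (analyticAt_clm_apply h1 analyticAt_const) analyticAt_const).sub ?_
    exact Finset.analyticAt_fun_sum _ fun H hH => hterm H y (hne y hy H (hfin.mem_toFinset.1 hH))
  have hlim : ∀ H ∈ reflHyperplanes G₁, ∀ y, IsBigenericPt f.toOpenPartialHomeomorph H y →
      Tendsto (fun x => φ H x • F x) (𝓝[{x | φ H x ≠ 0}] y) (𝓝 0) := by
    intro H hH y hy
    obtain ⟨H₂, hH₂, w, hw, hwg⟩ := hy.target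
    have h1 := hl.tendsto_pullForm hG₁ hG₂ (hr H hH) hy.source hy.generic hH₂ hw hwg u v
    rw [hl.card_target_eq hH (hζ H hH).generic.mem hy.generic.mem (hH' H hH) hH₂ (hω H hH) hw
      (hωg H hH) hwg] at h1
    let Q : V₁ → V₁ := fun x => (φ H u * φ H v * κ H) • e H +
      φ H x • ∑ H ∈ hfin.toFinset.erase H, (φ H u * φ H v * κ H / φ H x) • e H
    have hQ : ContinuousAt Q y := by
      refine continuousAt_const.add ((φ H).continuous.continuousAt.smul ?_)
      refine (Finset.analyticAt_fun_sum _ fun H₃ hH₃ => hterm H₃ y fun h => ?_).continuousAt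
      obtain ⟨h2, h3⟩ := Finset.mem_erase.1 hH₃
      rw [hfin.mem_toFinset] at h3
      exact h2 (hy.generic.eq_of_mem hH h3 (((hr H₃ h3).ker y).1 h)).symm
    have hy0 : φ H y = 0 := ((hr H hH).ker y).2 hy.generic.mem
    have h2 : Tendsto Q (𝓝[{x | φ H x ≠ 0}] y) (𝓝 ((κ H * (φ H u * φ H v)) • e H)) := by
      have h3 : Q y = (κ H * (φ H u * φ H v)) • e H := by
        simp only [Q, hy0, zero_smul, add_zero]
        congr 1; ring
      rw [← h3]
      exact hQ.mono_left nhdsWithin_le_nhds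
    have h3 := h1.sub h2
    rw [sub_self] at h3
    refine h3.congr' (eventually_nhdsWithin_iff.2 (Eventually.of_forall fun x hx => ?_))
    simp only [F, P, Q, smul_sub, ← Finset.add_sum_erase _ _ (hfin.mem_toFinset.2 hH), smul_add,
      smul_smul]
    rw [mul_div_cancel₀ _ (show φ H x ≠ 0 from hx)]
  have hbd : ∀ H ∈ reflHyperplanes G₁, ∀ y, IsBigenericPt f.toOpenPartialHomeomorph H y →
      ∃ M : ℝ, ∀ᶠ x in 𝓝 y, φ H x ≠ 0 → ‖F x‖ ≤ M := by
    intro H hH y hy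
    refine bounded_of_tendsto_smul (hr H hH).ne_zero (((hr H hH).ker y).2 hy.generic.mem) ?_ ?_
    · filter_upwards [hy.generic.eventually_mem_iff hH] with x hx hx0
      exact hFa x (hx.2 (mt ((hr H hH).ker x).2 hx0))
    · filter_upwards [hy.eventually hl hH] with x hx hx0
      exact hlim H hH x (hx (((hr H hH).ker x).1 hx0))
  have : Finite (reflHyperplanes G₁) := hfin
  obtain ⟨K, hK, hKF⟩ := exists_analyticAt_of_bddNear (φ := fun H : reflHyperplanes G₁ => φ H)
    (F := F) (z₀ := 0) (fun H => (hr H H.2).ne_zero) (fun H => map_zero _)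
    (Eventually.of_forall fun y hy =>
      hFa y fun H hH h => hy ⟨H, hH⟩ (((hr H hH).ker y).2 h))
    (fun H => Eventually.of_forall fun y hy => by
      have h1 := hl.mem_closure_isBigenericPt H.2 (((hr H H.2).ker y).1 hy) (Set.mem_univ _)
      refine closure_mono (fun x hx => ?_) h1
      obtain ⟨M, hM⟩ := hbd H H.2 x hx
      exact ⟨((hr H H.2).ker x).2 (IsBigenericPt.generic hx).mem, M, hM.mono fun x' h h' => h (h' H)⟩)
  -- Both parts of `F` are homogeneous of degree `-1`, so `F z = c • F (c • z)`. As `c` tends to `0`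
  -- this tends to `0 • K 0`, where `K` is the extension over the origin.
  have hFz : F z = 0 := by
    have h1 : Tendsto (fun c : ℂ => c • z) (𝓝[≠] 0) (𝓝 0) := by
      have : ContinuousAt (fun c : ℂ => c • z) 0 := by fun_prop
      have h2 := this.tendsto
      rw [zero_smul] at h2
      exact h2.mono_left nhdsWithin_le_nhds
    have h2 : Tendsto (fun c : ℂ => c • K (c • z)) (𝓝[≠] 0) (𝓝 ((0 : ℂ) • K 0)) :=
      (tendsto_id.mono_left nhdsWithin_le_nhds).smul (hK.continuousAt.tendsto.comp h1)
    rw [zero_smul] at h2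
    refine tendsto_nhds_unique (tendsto_const_nhds.congr' ?_) h2
    filter_upwards [h1.eventually hKF, self_mem_nhdsWithin] with c h3 hc
    have hc : c ≠ 0 := hc
    have h4 := h3 fun H => by
      rw [map_smul]; exact mul_ne_zero hc (hne z hz H H.2)
    rw [← h4]
    simp only [F, P, smul_sub, hf.pullForm_smul hG₁ hG₂ hz hc, hΩ, Finset.smul_sum, smul_smul,
      map_smul, smul_eq_mul]
    congr 1
    refine Finset.sum_congr rfl fun H hH => ?_
    have h5 := hne z hz H (hfin.mem_toFinset.1 hH)
    congr 1
    field_simp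
  rw [← sub_eq_zero, ← hFz]
  simp only [F, P]
  congr 1
  refine Finset.sum_congr rfl fun H hH => ?_
  simp only [smul_apply, ContinuousLinearMap.smulRight_apply, smul_smul]
  congr 1
  change φ H u / φ H z * κ H * φ H v = _
  ring

end Homogeneity


/-! ### Connectedness of arrangement complements -/

section Connectedness

variable {V : Type*} [NormedAddCommGroup V] [NormedSpace ℂ V]

/-- The complex line through two points of the complement meets each hyperplane at most once, and
the complement of a countable set in `ℂ` is connected. -/
theorem isPreconnected_arrComplement {ℋ : Set (Submodule ℂ V)} (hfin : ℋ.Finite) :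
    IsPreconnected (arrComplement ℋ) := by
  refine isPreconnected_of_forall_pair fun z hz z' hz' => ?_
  let l : ℂ → V := fun ζ => z + ζ • (z' - z)
  have hl : Continuous l := by fun_prop
  have hT : {ζ | l ζ ∉ arrComplement ℋ}.Countable := by
    have h1 : {ζ | l ζ ∉ arrComplement ℋ} = ⋃ H ∈ ℋ, {ζ | l ζ ∈ H} := by
      ext ζ; simp [arrComplement]
    rw [h1]
    refine (hfin.biUnion fun H hH => Set.Subsingleton.finite ?_).countable
    intro a ha b hb
    by_contra hab
    have h2 : (a - b) • (z' - z) ∈ H := by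
      have h3 := H.sub_mem ha hb
      simpa [l, sub_smul] using h3
    have h4 : z' - z ∈ H := (H.smul_mem_iff (sub_ne_zero.2 hab)).1 h2
    refine hz H hH ?_
    have h5 := H.sub_mem ha (H.smul_mem a h4)
    simpa [l] using h5
  have hc := hT.isPathConnected_compl_of_one_lt_rank (by rw [Complex.rank_real_complex]; norm_num)
  refine ⟨l '' {ζ | l ζ ∉ arrComplement ℋ}ᶜ, ?_, ⟨0, ?_, ?_⟩, ⟨1, ?_, ?_⟩,
    hc.isConnected.isPreconnected.image _ hl.continuousOn⟩
  · rintro _ ⟨ζ, hζ, rfl⟩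
    exact not_not.1 hζ
  all_goals simp [l, hz, hz']

theorem eventually_eq_of_fderiv_eq_zero {Y : Type*} [NormedAddCommGroup Y] [NormedSpace ℂ Y]
    {F : V → Y} {z : V} (hd : ∀ᶠ y in 𝓝 z, DifferentiableAt ℂ F y)
    (h : ∀ᶠ y in 𝓝 z, fderiv ℂ F y = 0) : ∀ᶠ y in 𝓝 z, F y = F z := by
  obtain ⟨r, hr, hb⟩ := Metric.eventually_nhds_iff_ball.1 (hd.and h)
  filter_upwards [Metric.ball_mem_nhds z hr] with y hy
  exact Metric.isOpen_ball.is_const_of_fderiv_eq_zero (convex_ball z r).isPreconnected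
    (fun x hx => (hb x hx).1.differentiableWithinAt) (fun x hx => (hb x hx).2) hy
    (Metric.mem_ball_self hr)

end Connectedness

/-! ### The affine-linear functions of the pulled back connection -/

section AffineFunctions

variable {V₁ : Type u} [NormedAddCommGroup V₁] [NormedSpace ℂ V₁] [FiniteDimensional ℂ V₁]
  {V₂ : Type v} [NormedAddCommGroup V₂] [NormedSpace ℂ V₂] [FiniteDimensional ℂ V₂]
  {G₁ : Subgroup (V₁ ≃ₗ[ℂ] V₁)} {G₂ : Subgroup (V₂ ≃ₗ[ℂ] V₂)} [Finite G₁] [Finite G₂]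
  {f : OpenPartialHomeomorph (OrbitSpace G₁) (OrbitSpace G₂)} {z : V₁} {W : V₁ → V₂}

theorem fderiv_clm_comp_add_const (ℓ : V₂ →L[ℂ] ℂ) (a : ℂ) (hW : AnalyticAt ℂ W z) :
    fderiv ℂ (fun y => ℓ (W y) + a) z = ℓ.comp (fderiv ℂ W z) :=
  ((ℓ.hasFDerivAt.comp z hW.differentiableAt.hasFDerivAt).add_const a).fderiv

theorem LiftAt.isAffineAt (h : LiftAt f W z) (ℓ : V₂ →L[ℂ] ℂ) (a : ℂ) :
    IsAffineAt (pullForm f) (fun y => ℓ (W y) + a) z := by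
  refine ⟨((ℓ.analyticAt _).comp h.lift.analyticAt).add analyticAt_const, ?_⟩
  filter_upwards [h.eventually.eventually_nhds] with y hy u w
  have h1 : fderiv ℂ (fun y => ℓ (W y) + a) =ᶠ[𝓝 y] fun x => ℓ.comp (fderiv ℂ W x) :=
    hy.mono fun x hx => fderiv_clm_comp_add_const ℓ a hx.lift.analyticAt
  have h2 : HasFDerivAt (fun x => ℓ.comp (fderiv ℂ W x))
      ((ContinuousLinearMap.compL ℂ V₁ V₂ ℂ ℓ).comp (fderiv ℂ (fderiv ℂ W) y)) y :=
    (ContinuousLinearMap.compL ℂ V₁ V₂ ℂ ℓ).hasFDerivAt.comp y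
      hy.self_of_nhds.lift.analyticAt.fderiv.differentiableAt.hasFDerivAt
  rw [h1.fderiv_eq, h2.fderiv, h1.self_of_nhds]
  change ℓ (fderiv ℂ (fderiv ℂ W) y u w) + ℓ (fderiv ℂ W y (pullForm f y u w)) = 0
  rw [hy.self_of_nhds.fderiv_pullForm, map_neg, add_neg_cancel]

/-- The affine-linear functions are the affine-linear functions of the lifts of `f`. -/
theorem LiftAt.exists_of_isAffineAt (h : LiftAt f W z) {g : V₁ → ℂ}
    (hg : IsAffineAt (pullForm f) g z) :
    ∃ (ℓ : V₂ →L[ℂ] ℂ) (a : ℂ), ∀ᶠ y in 𝓝 z, g y = ℓ (W y) + a := by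
  -- The differential of `g` in the coordinates given by `W`. That `g` is affine-linear means that
  -- `θ` is locally constant.
  let θ : V₁ → V₂ →L[ℂ] ℂ := fun y => (fderiv ℂ g y).comp (fderiv ℂ W y).inverse
  have hθ : ∀ᶠ y in 𝓝 z, AnalyticAt ℂ θ y := by
    filter_upwards [h.eventually, hg.1.eventually_analyticAt] with y h1 h2
    exact analyticAt_clm_comp h2.fderiv (analyticAt_inverse h1.lift.analyticAt.fderiv h1.exists_equiv)
  have hgθ : ∀ᶠ y in 𝓝 z, ∀ v, fderiv ℂ g y v = θ y (fderiv ℂ W y v) := by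
    filter_upwards [h.eventually] with y h1 v
    change _ = fderiv ℂ g y ((fderiv ℂ W y).inverse (fderiv ℂ W y v))
    congr 1
    exact h1.injective (h1.inverse_apply _).symm
  have hθ0 : ∀ᶠ y in 𝓝 z, fderiv ℂ θ y = 0 := by
    filter_upwards [hθ, hgθ.eventually_nhds, h.eventually, hg.2,
      hg.1.eventually_analyticAt] with y h1 h2 h3 h4 h5
    ext u x
    obtain ⟨v, rfl⟩ : ∃ v, fderiv ℂ W y v = x := ⟨_, h3.inverse_apply x⟩
    have d1 : HasFDerivAt (fun y => fderiv ℂ g y v)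
        ((ContinuousLinearMap.apply ℂ ℂ v).comp (fderiv ℂ (fderiv ℂ g) y)) y :=
      (ContinuousLinearMap.apply ℂ ℂ v).hasFDerivAt.comp y h5.fderiv.differentiableAt.hasFDerivAt
    have d2 : HasFDerivAt (fun y => fderiv ℂ W y v)
        ((ContinuousLinearMap.apply ℂ V₂ v).comp (fderiv ℂ (fderiv ℂ W) y)) y :=
      (ContinuousLinearMap.apply ℂ V₂ v).hasFDerivAt.comp y
        h3.lift.analyticAt.fderiv.differentiableAt.hasFDerivAt
    have d3 := h1.differentiableAt.hasFDerivAt.clm_apply d2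
    have d4 := d1.unique (d3.congr_of_eventuallyEq (h2.mono fun x hx => hx v))
    have d5 := DFunLike.congr_fun d4 u
    simp only [add_apply, ContinuousLinearMap.comp_apply, ContinuousLinearMap.flip_apply,
      ContinuousLinearMap.apply_apply] at d5
    have d6 := h4 u v
    rw [h2.self_of_nhds, h3.fderiv_pullForm, map_neg] at d6
    simp only [zero_apply]
    linear_combination d6 - d5
  have hconst := eventually_eq_of_fderiv_eq_zero (hθ.mono fun y hy => hy.differentiableAt) hθ0
  have hsub : ∀ᶠ y in 𝓝 z, g y - θ z (W y) = g z - θ z (W z) := by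
    refine eventually_eq_of_fderiv_eq_zero (F := fun y => g y - θ z (W y)) ?_ ?_
    · filter_upwards [h.eventually, hg.1.eventually_analyticAt] with y h1 h2
      exact h2.differentiableAt.sub
        ((θ z).differentiableAt.comp y h1.lift.analyticAt.differentiableAt)
    · filter_upwards [h.eventually, hg.1.eventually_analyticAt, hconst, hgθ] with y h1 h2 h3 h4
      have h5 := (h2.differentiableAt.hasFDerivAt.sub
        ((θ z).hasFDerivAt.comp y h1.lift.analyticAt.differentiableAt.hasFDerivAt)).fderiv
      refine h5.trans ?_
      ext v
      simp only [sub_apply, ContinuousLinearMap.comp_apply, zero_apply]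
      rw [h4 v, h3, sub_self]
  refine ⟨θ z, g z - θ z (W z), ?_⟩
  filter_upwards [hsub] with y hy
  rw [← hy]; ring

theorem LiftAt.affine_unique (h : LiftAt f W z) {ℓ ℓ' : V₂ →L[ℂ] ℂ} {a a' : ℂ}
    (he : ∀ᶠ y in 𝓝 z, ℓ (W y) + a = ℓ' (W y) + a') : ℓ = ℓ' ∧ a = a' := by
  have h1 : fderiv ℂ (fun y => ℓ (W y) + a) z = fderiv ℂ (fun y => ℓ' (W y) + a') z :=
    EventuallyEq.fderiv_eq he
  rw [fderiv_clm_comp_add_const ℓ a h.lift.analyticAt,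
    fderiv_clm_comp_add_const ℓ' a' h.lift.analyticAt] at h1
  have h2 : ℓ = ℓ' := by
    ext x
    obtain ⟨v, rfl⟩ : ∃ v, fderiv ℂ W z v = x := ⟨_, h.inverse_apply x⟩
    exact DFunLike.congr_fun h1 v
  subst h2
  exact ⟨rfl, add_left_cancel he.self_of_nhds⟩

end AffineFunctions

/-! ### The holonomy cover and the developing map -/

section HolonomyCover

variable {V₁ : Type u} [NormedAddCommGroup V₁] [NormedSpace ℂ V₁] [FiniteDimensional ℂ V₁]
  {V₂ : Type v} [NormedAddCommGroup V₂] [NormedSpace ℂ V₂] [FiniteDimensional ℂ V₂]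
  {G₁ : Subgroup (V₁ ≃ₗ[ℂ] V₁)} {G₂ : Subgroup (V₂ ≃ₗ[ℂ] V₂)} [Finite G₁] [Finite G₂]

/-- The fibre product of `V₁°` and `V₂` over `G₂ \ V₂`. -/
def liftSpace (f : OrbitSpace G₁ ≃ₜ OrbitSpace G₂) : Set (V₁ × V₂) :=
  {q | q.1 ∈ arrComplement (reflHyperplanes G₁) ∧ f (orbitMk G₁ q.1) = orbitMk G₂ q.2}

variable {f : OrbitSpace G₁ ≃ₜ OrbitSpace G₂}

theorem LiftAt.mem_liftSpace {W : V₁ → V₂} {z : V₁} (h : LiftAt f.toOpenPartialHomeomorph W z) :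
    (z, W z) ∈ liftSpace f := ⟨h.mem, h.lift.lift.self_of_nhds⟩

/-- As `G₂` acts freely near `q.2`, the fibre product is near `q` the graph of a single lift. -/
theorem exists_local_section (hf : IsLocalDiscIso G₁ G₂ f.toOpenPartialHomeomorph)
    (hG₁ : FreeOnComplement G₁) (hG₂ : FreeOnComplement G₂) {q : V₁ × V₂} (hq : q ∈ liftSpace f) :
    ∃ W, LiftAt f.toOpenPartialHomeomorph W q.1 ∧ W q.1 = q.2 ∧
      ∀ᶠ q' in 𝓝 q, q' ∈ liftSpace f → q'.2 = W q'.1 := by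
  obtain ⟨W, hW, hWq⟩ := hf.exists_liftAt hG₁ hG₂ (Set.mem_univ _) hq.1 hq.2
  refine ⟨W, hW, hWq, ?_⟩
  obtain ⟨U, hU, hqU, hsep⟩ := exists_separating_nhds (G := G₂) q.2
  have hfst : Tendsto (Prod.fst : V₁ × V₂ → V₁) (𝓝 q) (𝓝 q.1) := continuous_fst.continuousAt
  have hsnd : Tendsto (Prod.snd : V₁ × V₂ → V₂) (𝓝 q) (𝓝 q.2) := continuous_snd.continuousAt
  have hWU : ∀ᶠ y in 𝓝 q.1, W y ∈ U :=
    hW.lift.analyticAt.continuousAt (hWq.symm ▸ hU.mem_nhds hqU)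
  filter_upwards [hfst.eventually hWU, hfst.eventually hW.lift.lift,
    hsnd.eventually (hU.mem_nhds hqU)] with q' h1 h2 h3 h4
  obtain ⟨g, hg, h5⟩ := orbitMk_eq_iff.1 (h2.symm.trans h4.2)
  have h6 := hsep g hg (W q'.1) h1 (h5 ▸ h3)
  have h7 : g = 1 := hG₂ q.2 (hWq ▸ hW.mem_target) g hg h6
  rw [h5, h7]; rfl

/-- A connected component of the fibre product, together with its local properties. -/
structure IsSheet (f : OrbitSpace G₁ ≃ₜ OrbitSpace G₂) (E : Set (V₁ × V₂)) : Prop where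
  connected : IsConnected E
  subset : E ⊆ liftSpace f
  exists_section : ∀ q ∈ E, ∃ W, LiftAt f.toOpenPartialHomeomorph W q.1 ∧ W q.1 = q.2 ∧
    (∀ᶠ y in 𝓝 q.1, (y, W y) ∈ E) ∧ ∀ᶠ q' in 𝓝 q, q' ∈ E → q'.2 = W q'.1
  closed : ∀ q ∈ liftSpace f, q ∉ E → ∀ᶠ q' in 𝓝 q, q' ∉ E

/-- The graph of a lift over a small ball is connected, so it stays inside one component. Hence the
components of the fibre product are open in it, and therefore closed in it. -/
theorem exists_isSheet (hf : IsLocalDiscIso G₁ G₂ f.toOpenPartialHomeomorph)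
    (hG₁ : FreeOnComplement G₁) (hG₂ : FreeOnComplement G₂) : ∃ E, IsSheet f E := by
  obtain ⟨z₀, hz₀⟩ := (dense_arrComplement (G := G₁)).nonempty
  obtain ⟨w₀, hw₀⟩ := orbitMk_surjective (G := G₂) (f (orbitMk G₁ z₀))
  have hq₀ : (z₀, w₀) ∈ liftSpace f := ⟨hz₀, hw₀.symm⟩
  have hloc : ∀ q ∈ liftSpace f, ∃ W, LiftAt f.toOpenPartialHomeomorph W q.1 ∧ W q.1 = q.2 ∧
      (∀ᶠ y in 𝓝 q.1, (y, W y) ∈ connectedComponentIn (liftSpace f) q) ∧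
      ∀ᶠ q' in 𝓝 q, q' ∈ liftSpace f → q'.2 = W q'.1 := by
    intro q hq
    obtain ⟨W, hW, hWq, hloc⟩ := exists_local_section hf hG₁ hG₂ hq
    refine ⟨W, hW, hWq, ?_, hloc⟩
    obtain ⟨r, hr, hb⟩ := Metric.eventually_nhds_iff_ball.1 hW.eventually
    have hc : IsPreconnected ((fun y => (y, W y)) '' Metric.ball q.1 r) :=
      (convex_ball q.1 r).isPreconnected.image _ (continuousOn_id.prodMk fun y hy =>
        (hb y hy).lift.analyticAt.continuousAt.continuousWithinAt)
    filter_upwards [Metric.ball_mem_nhds q.1 hr] with y hy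
    have hq' : (fun y => (y, W y)) q.1 = q := Prod.ext rfl hWq
    refine hc.subset_connectedComponentIn ⟨q.1, Metric.mem_ball_self hr, hq'⟩ ?_
      ⟨y, hy, rfl⟩
    rintro _ ⟨x, hx, rfl⟩
    exact (hb x hx).mem_liftSpace
  refine ⟨connectedComponentIn (liftSpace f) (z₀, w₀),
    isConnected_connectedComponentIn_iff.2 hq₀, connectedComponentIn_subset _ _, ?_, ?_⟩
  · intro q hq
    obtain ⟨W, hW, hWq, h1, h2⟩ := hloc q (connectedComponentIn_subset _ _ hq)
    rw [← connectedComponentIn_eq hq] at h1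
    exact ⟨W, hW, hWq, h1, h2.mono fun q' h h' => h (connectedComponentIn_subset _ _ h')⟩
  · intro q hq hqE
    obtain ⟨W, hW, hWq, h1, h2⟩ := hloc q hq
    filter_upwards [continuousAt_fst.eventually h1, h2] with q' h3 h4 hq'
    have h5 : q' ∈ connectedComponentIn (liftSpace f) q := by
      have := h4 (connectedComponentIn_subset _ _ hq')
      rwa [← this] at h3
    refine hqE ?_
    rw [connectedComponentIn_eq hq', ← connectedComponentIn_eq h5]
    exact mem_connectedComponentIn hq

variable {E : Set (V₁ × V₂)}

/-- The projection of a sheet to `V₁°`. -/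
def IsSheet.proj (hE : IsSheet f E) (e : E) : arrComplement (reflHyperplanes G₁) :=
  ⟨e.1.1, (hE.subset e.2).1⟩

theorem IsSheet.continuous_proj (hE : IsSheet f E) : Continuous hE.proj :=
  (continuous_fst.comp continuous_subtype_val).subtype_mk _

/-- Transfer of local statements along a local section. -/
theorem IsSheet.eventually_iff (hE : IsSheet f E) (e : E) :
    ∃ W, LiftAt f.toOpenPartialHomeomorph W e.1.1 ∧ W e.1.1 = e.1.2 ∧
      (∀ᶠ e' in 𝓝 e, e'.1.2 = W e'.1.1) ∧
      ∀ P : E → Prop, (∀ᶠ e' in 𝓝 e, P e') →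
        ∀ᶠ y in 𝓝 e.1.1, ∃ h : (y, W y) ∈ E, P ⟨(y, W y), h⟩ := by
  obtain ⟨W, hW, hWe, h1, h2⟩ := hE.exists_section e.1 e.2
  refine ⟨W, hW, hWe, ?_, ?_⟩
  · have h3 : Tendsto (Subtype.val : E → V₁ × V₂) (𝓝 e) (𝓝 e.1) := continuous_subtype_val.continuousAt
    exact (h3.eventually h2).mono fun e' h => h e'.2
  · intro P hP
    rw [nhds_subtype_eq_comap, eventually_comap] at hP
    have h3 : Tendsto (fun y => (y, W y)) (𝓝 e.1.1) (𝓝 e.1) := by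
      have h4 : ContinuousAt (fun y => (y, W y)) e.1.1 :=
        continuousAt_id.prodMk hW.lift.analyticAt.continuousAt
      have h5 := h4.tendsto
      rwa [hWe] at h5
    filter_upwards [h1, h3.eventually hP] with y h6 h7
    exact ⟨h6, h7 _ rfl⟩

theorem IsSheet.isOpenMap_proj (hE : IsSheet f E) : IsOpenMap hE.proj := by
  refine IsOpenMap.of_nhds_le fun e S hS => ?_
  obtain ⟨W, hW, hWe, -, h2⟩ := hE.eventually_iff e
  have h3 := h2 (fun e' => hE.proj e' ∈ S) hS
  have h4 : Tendsto (Subtype.val : arrComplement (reflHyperplanes G₁) → V₁) (𝓝 (hE.proj e))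
    (𝓝 e.1.1) := continuous_subtype_val.continuousAt
  filter_upwards [h4.eventually h3] with y hy
  exact hy.2

theorem IsSheet.isLocalHomeomorph_proj (hE : IsSheet f E) : IsLocalHomeomorph hE.proj := by
  rw [isLocalHomeomorph_iff_isOpenEmbedding_restrict]
  intro e
  obtain ⟨W, hW, hWe, h1, -⟩ := hE.eventually_iff e
  obtain ⟨U, hU, hUo, heU⟩ := mem_nhds_iff.1 h1
  refine ⟨U, hUo.mem_nhds heU, Topology.IsOpenEmbedding.of_continuous_injective_isOpenMap
    (hE.continuous_proj.comp continuous_subtype_val) ?_ (hE.isOpenMap_proj.domRestrict hUo)⟩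
  intro a b hab
  have h3 : a.1.1.1 = b.1.1.1 := congrArg Subtype.val hab
  refine Subtype.ext (Subtype.ext (Prod.ext h3 ?_))
  have h4 : a.1.1.2 = W a.1.1.1 := hU a.2
  have h5 : b.1.1.2 = W b.1.1.1 := hU b.2
  rw [h4, h5, h3]

/-- The points over `y` near `z` are among the `g (W y)` with `g` in the finite group `G₂`, so
avoiding `C` amounts to finitely many local conditions. -/
theorem IsSheet.isClosedMap_proj (hE : IsSheet f E)
    (hf : IsLocalDiscIso G₁ G₂ f.toOpenPartialHomeomorph) (hG₁ : FreeOnComplement G₁)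
    (hG₂ : FreeOnComplement G₂) : IsClosedMap hE.proj := by
  intro C hC
  rw [← isOpen_compl_iff, isOpen_iff_eventually]
  intro z hz
  obtain ⟨W, hW⟩ := hf.exists_liftAt' hG₁ hG₂ (z := z) (Set.mem_univ _) z.2
  have hWz := hW.lift.lift.self_of_nhds
  have h1 : ∀ g : G₂, ∀ᶠ y in 𝓝 (z : V₁), ∀ h : (y, (g : V₂ ≃ₗ[ℂ] V₂) (W y)) ∈ E, ⟨_, h⟩ ∉ C := by
    intro g
    have hq : ((z : V₁), (g : V₂ ≃ₗ[ℂ] V₂) (W z)) ∈ liftSpace f :=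
      ⟨z.2, hWz.trans (orbitMk_map g.2 _).symm⟩
    have h2 : ∀ᶠ q in 𝓝 ((z : V₁), (g : V₂ ≃ₗ[ℂ] V₂) (W z)), ∀ h : q ∈ E, ⟨q, h⟩ ∉ C := by
      by_cases hqE : ((z : V₁), (g : V₂ ≃ₗ[ℂ] V₂) (W z)) ∈ E
      · have h3 : ∀ᶠ e in 𝓝 (⟨_, hqE⟩ : E), e ∉ C :=
          hC.isOpen_compl.mem_nhds fun h => hz ⟨_, h, rfl⟩
        rw [nhds_subtype_eq_comap, eventually_comap] at h3
        exact h3.mono fun q hq h => hq ⟨q, h⟩ rfl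
      · exact (hE.closed _ hq hqE).mono fun q h h' => absurd h' h
    have h3 : ContinuousAt (fun y => (y, (g : V₂ ≃ₗ[ℂ] V₂) (W y))) (z : V₁) :=
      continuousAt_id.prodMk ((continuous_linearEquiv _).continuousAt.comp
        hW.lift.analyticAt.continuousAt)
    exact h3.eventually h2
  have h4 : Tendsto (Subtype.val : arrComplement (reflHyperplanes G₁) → V₁) (𝓝 z) (𝓝 z) :=
    continuous_subtype_val.continuousAt
  filter_upwards [h4.eventually (eventually_all.2 h1), h4.eventually hW.lift.lift] with y h5 h6
  rintro ⟨e, heC, rfl⟩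
  obtain ⟨g, hg, h7⟩ := orbitMk_eq_iff.1 (h6.symm.trans (hE.subset e.2).2)
  have h8 : ((hE.proj e : V₁), g (W (hE.proj e))) = e.1 := Prod.ext rfl h7.symm
  exact h5 ⟨g, hg⟩ (h8 ▸ e.2) (by convert! heC)

/-- A closed local homeomorphism with finite fibres is a covering map. -/
theorem IsSheet.isCoveringMap_proj (hE : IsSheet f E)
    (hf : IsLocalDiscIso G₁ G₂ f.toOpenPartialHomeomorph) (hG₁ : FreeOnComplement G₁)
    (hG₂ : FreeOnComplement G₂) : IsCoveringMap hE.proj := by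
  rw [isCoveringMap_iff_isCoveringMapOn_univ]
  refine (hE.isClosedMap_proj hf hG₁ hG₂).isCoveringMapOn_of_isLocalHomeomorphOn ?_
    (hE.isLocalHomeomorph_proj.isLocalHomeomorphOn)
  intro z _
  obtain ⟨w, hw⟩ := orbitMk_surjective (G := G₂) (f (orbitMk G₁ z))
  have h1 : (Set.range fun g : G₂ => (g : V₂ ≃ₗ[ℂ] V₂) w).Finite := Set.finite_range _
  refine Set.Finite.of_finite_image (f := fun e : E => e.1.2) (h1.subset ?_) ?_
  · rintro _ ⟨e, rfl, rfl⟩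
    obtain ⟨g, hg, h2⟩ := orbitMk_eq_iff.1 (hw.trans (hE.subset e.2).2)
    exact ⟨⟨g, hg⟩, h2.symm⟩
  · intro a ha b hb hab
    have h2 : hE.proj a = hE.proj b := ha.trans hb.symm
    exact Subtype.ext (Prod.ext (congrArg Subtype.val h2) hab)

theorem IsSheet.surjective_proj (hE : IsSheet f E)
    (hf : IsLocalDiscIso G₁ G₂ f.toOpenPartialHomeomorph) (hG₁ : FreeOnComplement G₁)
    (hG₂ : FreeOnComplement G₂) : Function.Surjective hE.proj := by
  have : PreconnectedSpace (arrComplement (reflHyperplanes G₁)) :=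
    isPreconnected_iff_preconnectedSpace.1 (isPreconnected_arrComplement (reflHyperplanes_finite G₁))
  have : Nonempty E := hE.connected.nonempty.to_subtype
  rw [← Set.range_eq_univ]
  exact IsClopen.eq_univ ⟨(hE.isClosedMap_proj hf hG₁ hG₂).isClosed_range,
    hE.isOpenMap_proj.isOpen_range⟩ (Set.range_nonempty _)

theorem IsSheet.mem_affFunctions (hE : IsSheet f E) (ℓ : V₂ →L[ℂ] ℂ) (a : ℂ) :
    (fun e : E => ℓ e.1.2 + a) ∈ affFunctions (pullForm f.toOpenPartialHomeomorph) hE.proj := by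
  intro e
  obtain ⟨W, hW, hWe, h1, -⟩ := hE.eventually_iff e
  refine ⟨_, hW.isAffineAt ℓ a, ?_⟩
  filter_upwards [h1] with e' he'
  rw [he']; rfl

theorem IsSheet.affine_unique (hE : IsSheet f E) {ℓ ℓ' : V₂ →L[ℂ] ℂ} {a a' : ℂ} (e : E)
    (he : ∀ᶠ e' : E in 𝓝 e, ℓ e'.1.2 + a = ℓ' e'.1.2 + a') : ℓ = ℓ' ∧ a = a' := by
  obtain ⟨W, hW, hWe, -, h2⟩ := hE.eventually_iff e
  exact hW.affine_unique ((h2 _ he).mono fun y hy => hy.2)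

/-- Locally an affine-linear function comes from a linear form and a constant on `V₂`. These are
unique, hence locally constant, and a sheet is connected. -/
theorem IsSheet.exists_eq_of_mem_affFunctions (hE : IsSheet f E) {F : E → ℂ}
    (hF : F ∈ affFunctions (pullForm f.toOpenPartialHomeomorph) hE.proj) :
    ∃ (ℓ : V₂ →L[ℂ] ℂ) (a : ℂ), ∀ e : E, F e = ℓ e.1.2 + a := by
  have hloc : ∀ e : E, ∃ L : (V₂ →L[ℂ] ℂ) × ℂ, ∀ᶠ e' in 𝓝 e, F e' = L.1 e'.1.2 + L.2 := by
    intro e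
    obtain ⟨W, hW, hWe, h1, -⟩ := hE.eventually_iff e
    obtain ⟨g, hg, hFg⟩ := hF e
    obtain ⟨ℓ, a, hℓ⟩ := hW.exists_of_isAffineAt hg
    refine ⟨(ℓ, a), ?_⟩
    have h3 : Tendsto (fun e' : E => e'.1.1) (𝓝 e) (𝓝 e.1.1) :=
      (continuous_fst.comp continuous_subtype_val).continuousAt
    filter_upwards [h1, hFg, h3.eventually hℓ] with e' h4 h5 h6
    rw [h5, h4]; exact h6
  choose L hL using hloc
  have hconst : IsLocallyConstant L := by
    rw [IsLocallyConstant.iff_eventually_eq]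
    intro e
    filter_upwards [(hL e).eventually_nhds] with e' he'
    have h1 := hE.affine_unique e' (ℓ := (L e').1) (a := (L e').2) (ℓ' := (L e).1) (a' := (L e).2) (by
      filter_upwards [he', hL e'] with x h1 h2
      rw [← h1, ← h2])
    exact Prod.ext h1.1 h1.2
  have : PreconnectedSpace E := isPreconnected_iff_preconnectedSpace.1 hE.connected.isPreconnected
  obtain ⟨e₀⟩ : Nonempty E := hE.connected.nonempty.to_subtype
  refine ⟨(L e₀).1, (L e₀).2, fun e => ?_⟩
  rw [(hL e).self_of_nhds, hconst.apply_eq_of_preconnectedSpace e e₀]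

/-- The linear forms on `V₂` and the constants generate the local system. The former separate the
points of a fibre, which differ only in their second component; this gives minimality. -/
theorem IsSheet.isHolonomyCover (hE : IsSheet f E)
    (hf : IsLocalDiscIso G₁ G₂ f.toOpenPartialHomeomorph) (hG₁ : FreeOnComplement G₁)
    (hG₂ : FreeOnComplement G₂) :
    IsHolonomyCover (pullForm f.toOpenPartialHomeomorph) hE.proj where
  connected := isConnected_iff_connectedSpace.1 hE.connected
  covering := hE.isCoveringMap_proj hf hG₁ hG₂
  surjective := hE.surjective_proj hf hG₁ hG₂
  trivial e g hg := by
    obtain ⟨W, hW, hWe, h1, -⟩ := hE.eventually_iff e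
    obtain ⟨ℓ, a, hℓ⟩ := hW.exists_of_isAffineAt hg
    refine ⟨_, hE.mem_affFunctions ℓ a, ?_⟩
    have h3 : Tendsto (fun e' : E => e'.1.1) (𝓝 e) (𝓝 e.1.1) :=
      (continuous_fst.comp continuous_subtype_val).continuousAt
    filter_upwards [h1, h3.eventually hℓ] with e' h4 h5
    rw [h4]; exact h5.symm
  minimal e₁ e₂ he h := by
    have he' : e₁.1.1 = e₂.1.1 := congrArg Subtype.val he
    obtain ⟨W, hW, hWe, h1, -⟩ := hE.eventually_iff e₁
    refine Subtype.ext (Prod.ext he' ?_)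
    refine (SeparatingDual.eq_iff_forall_dual_eq (R := ℂ)).2 fun ℓ => ?_
    have h2 := (h _ (hE.mem_affFunctions ℓ 0) _ (hW.isAffineAt ℓ 0) (by
      filter_upwards [h1] with e' he'
      rw [he']; rfl)).self_of_nhds
    have h3 : ℓ e₂.1.2 + 0 = ℓ (W e₂.1.1) + 0 := h2
    rw [← he', hWe, add_zero, add_zero] at h3
    exact h3.symm

/-- The linear forms on `V₂` as affine-linear functions on a sheet. -/
def IsSheet.affOfDual (hE : IsSheet f E) :
    Module.Dual ℂ V₂ →ₗ[ℂ] affFunctions (pullForm f.toOpenPartialHomeomorph) hE.proj where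
  toFun ℓ := ⟨fun e => ℓ e.1.2, by
    simpa using hE.mem_affFunctions (LinearMap.toContinuousLinearMap ℓ) 0⟩
  map_add' _ _ := rfl
  map_smul' _ _ := rfl

theorem IsSheet.bijective_coprod (hE : IsSheet f E) :
    Function.Bijective (hE.affOfDual.coprod (LinearMap.toSpanSingleton ℂ _
      (affOne (pullForm f.toOpenPartialHomeomorph) hE.proj))) := by
  constructor
  · rw [← LinearMap.ker_eq_bot, LinearMap.ker_eq_bot']
    rintro ⟨ℓ, a⟩ h
    obtain ⟨e⟩ : Nonempty E := hE.connected.nonempty.to_subtype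
    have h1 : ∀ e : E, ℓ e.1.2 + a = 0 := fun e => by
      have := congrFun (congrArg Subtype.val h) e
      simpa [affOfDual, affOne] using this
    have h2 := hE.affine_unique (ℓ := LinearMap.toContinuousLinearMap ℓ) (ℓ' := 0) (a := a) (a' := 0)
      e (Eventually.of_forall fun e' => by simpa using h1 e')
    refine Prod.ext ?_ h2.2
    exact LinearMap.toContinuousLinearMap.injective (h2.1.trans (map_zero _).symm)
  · rintro ⟨F, hF⟩
    obtain ⟨ℓ, a, h⟩ := hE.exists_eq_of_mem_affFunctions hF
    refine ⟨((ℓ : Module.Dual ℂ V₂), a), Subtype.ext (funext fun e => ?_)⟩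
    simp [affOfDual, affOne, h e]

/-- The affine-linear functions are the linear forms on `V₂` plus the constants. A linear form on
them with value `1` at `1` is thus determined by its restriction to the dual of `V₂`, which is a
point of `V₂`; evaluation at `e` gives the second component of `e`. -/
theorem IsSheet.exists_affineEquiv (hE : IsSheet f E) [Nonempty E] :
    ∃ ψ : devTarget (pullForm f.toOpenPartialHomeomorph) hE.proj ≃ᵃ[ℂ] V₂,
      ∀ e, ψ (dev (pullForm f.toOpenPartialHomeomorph) hE.proj e) = e.1.2 := by
  set Ω := pullForm f.toOpenPartialHomeomorph
  let T : Module.Dual ℂ (affFunctions Ω hE.proj) →ₗ[ℂ] V₂ :=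
    (Module.evalEquiv ℂ V₂).symm.toLinearMap ∘ₗ hE.affOfDual.dualMap
  have hT : ∀ (l : Module.Dual ℂ (affFunctions Ω hE.proj)) (ℓ : Module.Dual ℂ V₂),
      ℓ (T l) = l (hE.affOfDual ℓ) := fun l ℓ => Module.apply_evalEquiv_symm_apply _ _ _ _
  let ψ₀ : devTarget Ω hE.proj →ᵃ[ℂ] V₂ := T.toAffineMap.comp (devTarget Ω hE.proj).subtype
  let Λ := LinearEquiv.ofBijective _ hE.bijective_coprod
  have hΛ : ∀ ℓ a, Λ (ℓ, a) = hE.affOfDual ℓ + a • affOne Ω hE.proj := fun ℓ a => rfl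
  have hψ : Function.Bijective ψ₀ := by
    constructor
    · intro l l' h
      have h : T l = T l' := h
      refine Subtype.ext (LinearMap.ext fun F => ?_)
      obtain ⟨⟨ℓ, a⟩, rfl⟩ := Λ.surjective F
      have h1 : (l : Module.Dual ℂ _) (affOne Ω hE.proj) = 1 := l.2
      have h2 : (l' : Module.Dual ℂ _) (affOne Ω hE.proj) = 1 := l'.2
      rw [hΛ, map_add, map_add, map_smul, map_smul, h1, h2, ← hT, ← hT, h]
    · intro w
      let l : Module.Dual ℂ (affFunctions Ω hE.proj) :=
        ((Module.Dual.eval ℂ V₂ w).coprod LinearMap.id) ∘ₗ Λ.symm.toLinearMap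
      have hl : ∀ ℓ a, l (Λ (ℓ, a)) = ℓ w + a := fun ℓ a => by
        simp [l]
      refine ⟨⟨l, ?_⟩, ?_⟩
      · have h1 := hl 0 1
        rw [hΛ] at h1
        change l (affOne Ω hE.proj) = 1
        simpa using h1
      · refine Module.forall_dual_apply_eq_zero_iff ℂ _ |>.1 ?_ |> sub_eq_zero.1
        intro ℓ
        have h1 := hl ℓ 0
        rw [hΛ] at h1
        change ℓ (T l - w) = 0
        rw [map_sub, hT, sub_eq_zero]
        simpa using h1
  refine ⟨AffineEquiv.ofBijective hψ, fun e => ?_⟩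
  refine sub_eq_zero.1 ((Module.forall_dual_apply_eq_zero_iff ℂ _).1 fun ℓ => ?_)
  change ℓ (T (dev Ω hE.proj e).1 - e.1.2) = 0
  rw [map_sub, hT, sub_eq_zero]
  rfl

theorem IsDiscriminantIso.fromDevelopingMap (hf : IsDiscriminantIso G₁ G₂ f)
    (hG₁ : FreeOnComplement G₁) (hG₂ : FreeOnComplement G₂) : FromDevelopingMap G₁ G₂ f := by
  refine ⟨pullForm f.toOpenPartialHomeomorph, hf.isDunkl hG₁ hG₂, hf.isInvariantForm hG₁ hG₂, ?_⟩
  obtain ⟨E, hE⟩ := exists_isSheet hf.isLocalDiscIso hG₁ hG₂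
  have hne : Nonempty E := hE.connected.nonempty.to_subtype
  obtain ⟨ψ, hψ⟩ := hE.exists_affineEquiv
  refine ⟨E, inferInstance, hne, hE.proj, hE.isHolonomyCover hf.isLocalDiscIso hG₁ hG₂, ψ,
    fun e => ?_⟩
  rw [hψ]
  exact (hE.subset e.2).2

end HolonomyCover


/-! ### Vector fields on the orbit space and functions vanishing on the discriminant -/

section Coordinates

open Module (finrank)

variable {V : Type*} [NormedAddCommGroup V] [NormedSpace ℂ V] [FiniteDimensional ℂ V]
  {G : Subgroup (V ≃ₗ[ℂ] V)}
  {Y : Type*} [NormedAddCommGroup Y] [NormedSpace ℂ Y] [FiniteDimensional ℂ Y]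

theorem eventually_eq_of_dense {S : Set V} (hS : Dense S) {F F' : V → Y} {z₀ : V}
    (hF : AnalyticAt ℂ F z₀) (hF' : AnalyticAt ℂ F' z₀) (h : ∀ᶠ z in 𝓝 z₀, z ∈ S → F z = F' z) :
    ∀ᶠ z in 𝓝 z₀, F z = F' z := by
  filter_upwards [hF.eventually_analyticAt, hF'.eventually_analyticAt, h.eventually_nhds]
    with y h1 h2 h3
  have : (𝓝[S] y).NeBot := mem_closure_iff_nhdsWithin_neBot.1 (hS y)
  exact tendsto_nhds_unique (h1.continuousAt.mono_left nhdsWithin_le_nhds)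
    ((h2.continuousAt.mono_left nhdsWithin_le_nhds).congr'
      (eventually_nhdsWithin_iff.2 (h3.mono fun x hx hxS => (hx hxS).symm)))

/-- The basic invariants as a map on `V`. -/
def OrbitCoordinates.coord (c : OrbitCoordinates G) (z : V) : Fin (finrank ℂ V) → ℂ :=
  c.toHomeo (orbitMk G z)

/-- The discriminant in the coordinates of the orbit space. -/
def OrbitCoordinates.disc (c : OrbitCoordinates G) : Set (Fin (finrank ℂ V) → ℂ) :=
  c.toHomeo '' discriminant G

variable (c : OrbitCoordinates G)

theorem OrbitCoordinates.coord_map {g : V ≃ₗ[ℂ] V} (hg : g ∈ G) (z : V) :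
    c.coord (g z) = c.coord z := congrArg c.toHomeo (orbitMk_map hg z)

theorem OrbitCoordinates.coord_zero : c.coord 0 = 0 := by
  funext i
  have h := c.homogeneous 0 0 i
  rw [smul_zero, zero_pow (c.deg_pos i).ne', zero_mul] at h
  exact h

theorem OrbitCoordinates.coord_surjective : Function.Surjective c.coord :=
  c.toHomeo.surjective.comp orbitMk_surjective

theorem OrbitCoordinates.eventually_coord {z : V} {P : (Fin (finrank ℂ V) → ℂ) → Prop} :
    (∀ᶠ x in 𝓝 (c.coord z), P x) ↔ ∀ᶠ y in 𝓝 z, P (c.coord y) := by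
  have h : map c.coord (𝓝 z) = 𝓝 (c.coord z) :=
    (c.toHomeo.isOpenMap.comp isOpenMap_orbitMk).map_nhds_eq
      (c.toHomeo.continuous.comp continuous_orbitMk).continuousAt
  rw [← h, eventually_map]

theorem OrbitCoordinates.coord_mem_disc {z : V} :
    c.coord z ∈ c.disc ↔ z ∉ arrComplement (reflHyperplanes G) := by
  rw [coord, disc, c.toHomeo.injective.mem_set_image, ← orbitMk_notMem_discriminant, not_not]

theorem analyticAt_iff_finBasis {X : Type*} [NormedAddCommGroup X] [NormedSpace ℂ X] {F : X → Y}
    {x : X} : AnalyticAt ℂ F x ↔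
      ∀ i, AnalyticAt ℂ (fun y => (Module.finBasis ℂ Y).equivFunL (F y) i) x := by
  set b := (Module.finBasis ℂ Y).equivFunL
  rw [← analyticAt_pi_iff]
  refine ⟨fun h => (b.toContinuousLinearMap.analyticAt _).comp h, fun h => ?_⟩
  have h1 := AnalyticAt.comp (g := b.symm) (f := fun y => b (F y))
    (b.symm.toContinuousLinearMap.analyticAt _) h
  simpa [Function.comp_def] using h1

theorem OrbitCoordinates.analyticAt_iff (k : OrbitSpace G → Y) (z : V) :
    AnalyticAt ℂ (fun y => k (orbitMk G y)) z ↔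
      AnalyticAt ℂ (fun x => k (c.toHomeo.symm x)) (c.coord z) := by
  rw [analyticAt_iff_finBasis, analyticAt_iff_finBasis]
  refine forall_congr' fun i => ?_
  rw [← holAt_orbitMk_iff (fun x => (Module.finBasis ℂ Y).equivFunL (k x) i), c.holAt_iff]
  rfl

theorem OrbitCoordinates.exists_factor [Finite G] {F : V → Y} {z : V} (hF : AnalyticAt ℂ F z)
    (hinv : ∀ g ∈ G, g z = z → ∀ᶠ y in 𝓝 z, F (g y) = F y) :
    ∃ K : (Fin (finrank ℂ V) → ℂ) → Y, AnalyticAt ℂ K (c.coord z) ∧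
      ∀ᶠ y in 𝓝 z, F y = K (c.coord y) := by
  obtain ⟨k, hk, hkF⟩ := exists_descends hF hinv
  refine ⟨_, (c.analyticAt_iff k z).1 hk, hkF.mono fun y hy => ?_⟩
  simp [coord, hy]

theorem OrbitCoordinates.analyticAt_coord (z : V) : AnalyticAt ℂ c.coord z := c.analyticAt z

theorem OrbitCoordinates.fderiv_comp_coord {K : (Fin (finrank ℂ V) → ℂ) → Y} {z : V}
    (hK : AnalyticAt ℂ K (c.coord z)) (x : V) :
    fderiv ℂ (fun y => K (c.coord y)) z x = fderiv ℂ K (c.coord z) (fderiv ℂ c.coord z x) := by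
  have h := (hK.differentiableAt.hasFDerivAt.comp z
    (c.analyticAt_coord z).differentiableAt.hasFDerivAt).fderiv
  exact DFunLike.congr_fun h x

theorem OrbitCoordinates.fderiv_comp_inverse {z : V} (hz : z ∈ arrComplement (reflHyperplanes G))
    (x : Fin (finrank ℂ V) → ℂ) : fderiv ℂ c.coord z ((fderiv ℂ c.coord z).inverse x) = x := by
  obtain ⟨e, he⟩ := c.fderiv_equiv z hz
  change fderiv ℂ c.coord z = e at he
  rw [he, ContinuousLinearMap.inverse_equiv]
  exact e.apply_symm_apply x

theorem OrbitCoordinates.fderiv_injective {z : V} (hz : z ∈ arrComplement (reflHyperplanes G)) :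
    Function.Injective (fderiv ℂ c.coord z) := by
  obtain ⟨e, he⟩ := c.fderiv_equiv z hz
  change fderiv ℂ c.coord z = e at he
  rw [he]
  exact e.injective

theorem OrbitCoordinates.fderiv_coord_map {g : V ≃ₗ[ℂ] V} (hg : g ∈ G) (z x : V) :
    fderiv ℂ c.coord (g z) (g x) = fderiv ℂ c.coord z x := by
  have h1 : HasFDerivAt (fun y => c.coord (g y)) ((fderiv ℂ c.coord (g z)).comp (toCLM g)) z :=
    HasFDerivAt.comp (g := c.coord) (f := toCLM g) z
      (c.analyticAt_coord _).differentiableAt.hasFDerivAt (toCLM g).hasFDerivAt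
  have h2 : (fun y => c.coord (g y)) = c.coord := funext fun y => c.coord_map hg y
  rw [h2] at h1
  exact (DFunLike.congr_fun h1.fderiv x).symm

variable {H : Submodule ℂ V} {φ : V →L[ℂ] ℂ} {e z₀ : V}

/-- A vector field that is lifted from a holomorphic vector field on the orbit space tangent to the
level sets of an equation `K` of the discriminant is bounded near the generic points. -/
theorem OrbitCoordinates.bounded_of_tangent [Finite G] (r : IsRoot G H φ e)
    (hz : IsGenericPt G H z₀)
    {K : (Fin (finrank ℂ V) → ℂ) → ℂ} {ξ : (Fin (finrank ℂ V) → ℂ) → Fin (finrank ℂ V) → ℂ}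
    (hK : AnalyticAt ℂ K (c.coord z₀)) (hv : ∀ᶠ x in 𝓝 (c.coord z₀), x ∈ c.disc → K x = 0)
    (hD : fderiv ℂ K (c.coord z₀) ≠ 0) (hξ : ContinuousAt ξ (c.coord z₀))
    (hKξ : ∀ᶠ x in 𝓝 (c.coord z₀), fderiv ℂ K x (ξ x) = 0) {X : V → V}
    (hX : ∀ᶠ z in 𝓝 z₀, φ z ≠ 0 → fderiv ℂ c.coord z (X z) = ξ (c.coord z)) :
    ∃ M : ℝ, ∀ᶠ z in 𝓝 z₀, φ z ≠ 0 → ‖X z‖ ≤ M := by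
  set m := Nat.card (pointwiseStab G H) with hm
  have hm0 : m ≠ 0 := Nat.card_pos.ne'
  have hφ0 : φ z₀ = 0 := (r.ker _).2 hz.mem
  have hA : AnalyticAt ℂ (fun y => K (c.coord y)) z₀ :=
    AnalyticAt.comp (g := K) (f := c.coord) hK (c.analyticAt_coord z₀)
  -- `K` vanishes on the discriminant, so its pull-back is divisible by `φ ^ m`. The cofactor `C`
  -- inherits the invariance under the stabilizer.
  obtain ⟨C, hC, hAC⟩ := r.exists_eq_pow_mul hz.mem hA
    (fun g hg => Eventually.of_forall fun y => by rw [c.coord_map hg.1])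
    ((c.eventually_coord.1 hv).mono fun y h hy =>
      h (c.coord_mem_disc.2 (notMem_arrComplement_of_mem r.mem hy)))
  have hφm : AnalyticAt ℂ (fun y => φ y ^ m) z₀ := (φ.analyticAt z₀).pow m
  obtain ⟨Kφ, hKφ, hKφe⟩ := c.exists_factor hφm fun g hg hgz =>
    Eventually.of_forall fun y => r.map_pow (hz.stab g hg hgz) y
  obtain ⟨R, hR, hRC⟩ := c.exists_factor hC fun g hg hgz => by
    have ht : Tendsto g (𝓝 z₀) (𝓝 z₀) := by
      have := (continuous_linearEquiv g).tendsto z₀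
      rwa [hgz] at this
    refine eventually_eq_of_dense (dense_ne_zero r.ne_zero)
      (AnalyticAt.comp (g := C) (f := g) (by rwa [hgz]) (analyticAt_linearEquiv g z₀)) hC ?_
    filter_upwards [hAC, ht.eventually hAC] with y h1 h2 hy
    rw [c.coord_map hg, r.map_pow (hz.stab g hg hgz), h1] at h2
    exact (mul_left_cancel₀ (pow_ne_zero _ hy) h2).symm
  -- Otherwise `K` would be a product of two functions vanishing at the point, and its differential
  -- there would be zero.
  have hC0 : C z₀ ≠ 0 := by
    intro h0
    have h1 : K =ᶠ[𝓝 (c.coord z₀)] fun x => Kφ x * R x := by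
      refine c.eventually_coord.2 ?_
      filter_upwards [hAC, hKφe, hRC] with y h1 h2 h3
      rw [h1, h2, h3]
    refine hD ?_
    rw [h1.fderiv_eq, fderiv_fun_mul hKφ.differentiableAt hR.differentiableAt,
      ← hKφe.self_of_nhds, ← hRC.self_of_nhds, h0, hφ0, zero_pow hm0]
    ext; simp
  have hBl : ∀ z, HasFDerivAt (fun y => y - φ y • e)
      (ContinuousLinearMap.id ℂ V - φ.smulRight e) z := fun z =>
    (hasFDerivAt_id z).sub (φ.hasFDerivAt.smul_const e)
  have hB : AnalyticAt ℂ (fun y => y - φ y • e) z₀ :=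
    analyticAt_id.sub ((φ.analyticAt z₀).smul analyticAt_const)
  obtain ⟨B₁, hB₁, hBB⟩ := c.exists_factor hB fun g hg hgz =>
    Eventually.of_forall fun y => r.projection_map (hz.stab g hg hgz) y
  obtain ⟨ε, hε, hb⟩ := exists_bound_below (M := modelSystem φ m C fun y => y - φ y • e)
    (continuousAt_modelSystem m hC hB) (by
      intro x hx
      rw [modelSystem_apply, hφ0, zero_mul, add_zero, (hBl z₀).fderiv] at hx
      have h1 := (Prod.ext_iff.1 hx).1
      have h2 : x - φ x • e = 0 := (Prod.ext_iff.1 hx).2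
      have h3 : φ x = 0 := by
        have : (m : ℂ) ≠ 0 := Nat.cast_ne_zero.2 hm0
        simpa [this, hC0] using h1
      simpa [h3] using h2)
  have hcont : ContinuousAt (fun z => fderiv ℂ B₁ (c.coord z) (ξ (c.coord z))) z₀ := by
    have h1 : ContinuousAt (fun x => fderiv ℂ B₁ x (ξ x)) (c.coord z₀) :=
      hB₁.fderiv.continuousAt.clm_apply hξ
    exact ContinuousAt.comp (f := c.coord) h1 (c.analyticAt_coord z₀).continuousAt
  refine ⟨(‖fderiv ℂ B₁ (c.coord z₀) (ξ (c.coord z₀))‖ + 1) / ε, ?_⟩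
  filter_upwards [hb, hcont.norm.eventually (gt_mem_nhds (lt_add_one _)), hX,
    hAC.eventually_nhds, hBB.eventually_nhds, hC.eventually_analyticAt,
    c.eventually_coord.1 hB₁.eventually_analyticAt, c.eventually_coord.1 hK.eventually_analyticAt,
    c.eventually_coord.1 hKξ] with z h1 h2 h3 h4 h5 h6 h7 h8 h9 hz0
  -- The derivative of `φ ^ m * C` along `X` vanishes, and `φ ^ (m - 1)` can be cancelled.
  have e1 : m * C z * φ (X z) + φ z * fderiv ℂ C z (X z) = 0 := by
    have d1 := c.fderiv_comp_coord h8 (X z)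
    rw [h3 hz0, h9] at d1
    have d2 := (φ.hasFDerivAt (x := z)).pow m |>.mul h6.differentiableAt.hasFDerivAt
    have d3 : fderiv ℂ (fun x => φ x ^ m * C x) z (X z) =
        fderiv ℂ (fun y => K (c.coord y)) z (X z) :=
      DFunLike.congr_fun (EventuallyEq.fderiv_eq (h4.mono fun y hy => hy.symm)) (X z)
    rw [d1, show (fun x => φ x ^ m * C x) = (fun x => φ x ^ m) * C from rfl, d2.fderiv] at d3
    simp only [add_apply, smul_apply, smul_eq_mul] at d3
    obtain ⟨k, hk⟩ := Nat.exists_eq_succ_of_ne_zero hm0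
    rw [hk] at d3 ⊢
    refine (mul_eq_zero.1 (?_ : φ z ^ k * _ = 0)).resolve_left (pow_ne_zero _ hz0)
    simp only [Nat.succ_eq_add_one, Nat.add_sub_cancel, nsmul_eq_mul] at d3
    push_cast at d3 ⊢
    linear_combination d3
  have e2 : fderiv ℂ (fun y => y - φ y • e) z (X z) = fderiv ℂ B₁ (c.coord z) (ξ (c.coord z)) := by
    rw [← h3 hz0, ← c.fderiv_comp_coord h7]
    exact DFunLike.congr_fun (EventuallyEq.fderiv_eq h5) _
  have h10 := h1 (X z)
  rw [modelSystem_apply, e1, e2, Prod.norm_mk, norm_zero, max_eq_right (norm_nonneg _)] at h10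
  rw [le_div_iff₀ hε, mul_comm]
  exact h10.trans h2.le

/-- Extension over the reflection hyperplanes of an invariant vector field. -/
theorem exists_equivariant_extension [Finite G] (hfix : ∀ v : V, (∀ g ∈ G, g v = v) → v = 0)
    {X : V → V} (hA : ∀ᶠ z in 𝓝 0, z ∈ arrComplement (reflHyperplanes G) → AnalyticAt ℂ X z)
    (hE : ∀ g ∈ G, ∀ᶠ z in 𝓝 0, z ∈ arrComplement (reflHyperplanes G) → X (g z) = g (X z))
    (hB : ∀ H ∈ reflHyperplanes G, ∀ᶠ z in 𝓝 0, z ∈ H → z ∈ closure {y | y ∈ H ∧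
      ∃ M : ℝ, ∀ᶠ x in 𝓝 y, x ∈ arrComplement (reflHyperplanes G) → ‖X x‖ ≤ M}) :
    ∃ X' : V → V, AnalyticAt ℂ X' 0 ∧
      (∀ᶠ z in 𝓝 0, z ∈ arrComplement (reflHyperplanes G) → X z = X' z) ∧ X' 0 = 0 ∧
      ∀ g ∈ G, ∀ᶠ z in 𝓝 0, X' (g z) = g (X' z) := by
  have : Finite (reflHyperplanes G) := reflHyperplanes_finite G
  choose φ hφ0 hφ using fun H : reflHyperplanes G => exists_equation H.2
  have hker : ∀ H z, φ H z = 0 ↔ z ∈ H.1 := fun H z => by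
    conv_rhs => rw [← hφ H]
    rfl
  have hmem : ∀ z, (∀ H, φ H z ≠ 0) ↔ z ∈ arrComplement (reflHyperplanes G) := fun z =>
    ⟨fun h H hH hz => h ⟨H, hH⟩ ((hker _ z).2 hz), fun h H hz => h H H.2 ((hker _ z).1 hz)⟩
  obtain ⟨X', hX', hXX⟩ := exists_analyticAt_of_bddNear (φ := φ) (F := X) (z₀ := 0) hφ0
    (fun H => map_zero _) (by simpa only [hmem] using hA) (fun H => by
      filter_upwards [hB H H.2] with z h1 h2
      refine closure_mono ?_ (h1 ((hker H z).1 h2))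
      rintro y ⟨h3, M, h4⟩
      refine ⟨(hker H y).2 h3, M, ?_⟩
      simpa only [hmem] using h4)
  simp only [hmem] at hXX
  have heq : ∀ g ∈ G, ∀ᶠ z in 𝓝 0, X' (g z) = g (X' z) := by
    intro g hg
    have ht : Tendsto g (𝓝 0) (𝓝 0) := by
      have := (continuous_linearEquiv g).tendsto 0
      rwa [map_zero] at this
    refine eventually_eq_of_dense (dense_arrComplement (G := G))
      (AnalyticAt.comp (g := X') (f := g) (by rwa [map_zero]) (analyticAt_linearEquiv g 0))
      ((analyticAt_linearEquiv g _).comp hX') ?_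
    filter_upwards [hE g hg, hXX, ht.eventually hXX] with z h1 h2 h3 hz
    rw [← h3 ((map_mem_arrComplement hg).2 hz), h1 hz, h2 hz]
  refine ⟨X', hX', hXX, hfix _ fun g hg => ?_, heq⟩
  have h1 := (heq g hg).self_of_nhds
  rw [map_zero] at h1
  exact h1.symm

/-- A function vanishing on the discriminant has no linear part. -/
theorem OrbitCoordinates.fderiv_eq_zero_of_vanishing [Finite G]
    (hfix : ∀ v : V, (∀ g ∈ G, g v = v) → v = 0) (hn : 2 ≤ finrank ℂ V)
    {K : (Fin (finrank ℂ V) → ℂ) → ℂ} (hK : AnalyticAt ℂ K 0)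
    (hv : ∀ᶠ x in 𝓝 0, x ∈ c.disc → K x = 0) : fderiv ℂ K 0 = 0 := by
  by_contra hD
  obtain ⟨i, hi⟩ : ∃ i, fderiv ℂ K 0 (Pi.single i 1) ≠ 0 := by
    by_contra! h
    exact hD (ContinuousLinearMap.coe_injective (LinearMap.pi_ext' fun i =>
      LinearMap.ext_ring (h i)))
  have : Nontrivial (Fin (finrank ℂ V)) := Fin.nontrivial_iff_two_le.2 hn
  obtain ⟨j, hj⟩ := exists_ne i
  let D : Fin (finrank ℂ V) → (Fin (finrank ℂ V) → ℂ) → ℂ := fun l x => fderiv ℂ K x (Pi.single l 1)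
  -- If `K` had a nonzero derivative in the direction `i`, this field would be holomorphic near `0`
  -- and annihilate `K`. Its lift to `V` is equivariant and bounded near generic points, hence
  -- extends over `0` and vanishes there for lack of invariant vectors. Then `ξ 0 = 0`, although its
  -- component at `j ≠ i` is `1`.
  let ξ : (Fin (finrank ℂ V) → ℂ) → Fin (finrank ℂ V) → ℂ := fun x =>
    Pi.single j 1 - (D j x / D i x) • Pi.single i 1
  have hgood : ∀ᶠ x in 𝓝 0, AnalyticAt ℂ K x ∧ D i x ≠ 0 := by
    have h1 : AnalyticAt ℂ (D i) 0 := analyticAt_clm_apply hK.fderiv analyticAt_const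
    exact hK.eventually_analyticAt.and (h1.continuousAt.eventually_ne hi)
  have hξ : ∀ x, AnalyticAt ℂ K x ∧ D i x ≠ 0 → AnalyticAt ℂ ξ x := fun x hx =>
    analyticAt_const.sub (((analyticAt_clm_apply hx.1.fderiv analyticAt_const).div
      (analyticAt_clm_apply hx.1.fderiv analyticAt_const) hx.2).smul analyticAt_const)
  have hKξ : ∀ x, D i x ≠ 0 → fderiv ℂ K x (ξ x) = 0 := fun x hx => by
    change fderiv ℂ K x (_ - _ • _) = 0
    rw [map_sub, map_smul, smul_eq_mul]
    change D j x - D j x / D i x * D i x = 0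
    rw [div_mul_cancel₀ _ hx, sub_self]
  let X : V → V := fun z => (fderiv ℂ c.coord z).inverse (ξ (c.coord z))
  have hXξ : ∀ z ∈ arrComplement (reflHyperplanes G),
      fderiv ℂ c.coord z (X z) = ξ (c.coord z) := fun z hz => c.fderiv_comp_inverse hz _
  have h0 : ∀ {P : (Fin (finrank ℂ V) → ℂ) → Prop}, (∀ᶠ x in 𝓝 0, P x) →
      ∀ᶠ z in 𝓝 0, P (c.coord z) := fun h => c.eventually_coord.1 (by rwa [c.coord_zero])
  obtain ⟨X', hX', hXX, hX'0, -⟩ := exists_equivariant_extension hfix (X := X) (by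
      filter_upwards [h0 hgood] with z h1 hz
      exact analyticAt_clm_apply (analyticAt_inverse (c.analyticAt_coord z).fderiv
        (c.fderiv_equiv z hz)) (AnalyticAt.comp (g := ξ) (f := c.coord) (hξ _ h1)
          (c.analyticAt_coord z)))
    (fun g hg => Eventually.of_forall fun z hz => by
      refine c.fderiv_injective ((map_mem_arrComplement hg).2 hz) ?_
      rw [hXξ _ ((map_mem_arrComplement hg).2 hz), c.fderiv_coord_map hg, hXξ z hz, c.coord_map hg])
    (fun H hH => by
      obtain ⟨co, hco⟩ := exists_invariant_core G
      obtain ⟨φ, e, r, -⟩ := exists_isRoot co hco hH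
      have hev : ∀ᶠ y in 𝓝 (0 : V), IsGenericPt G H y →
          ∃ M : ℝ, ∀ᶠ x in 𝓝 y, x ∈ arrComplement (reflHyperplanes G) → ‖X x‖ ≤ M := by
        filter_upwards [h0 hgood, h0 hgood.eventually_nhds, h0 hv.eventually_nhds] with y h1 h2 h3 hy
        obtain ⟨M, hM⟩ := c.bounded_of_tangent r hy h1.1 h3 (fun h => h1.2 (by simp [D, h]))
          (hξ _ h1).continuousAt (h2.mono fun x hx => hKξ x hx.2) (X := X) (by
            filter_upwards [hy.eventually_mem_iff hH] with z h4 h5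
            exact hXξ z (h4.2 (mt (r.ker z).2 h5)))
        exact ⟨M, hM.mono fun x hx hxc => hx fun h => hxc H hH ((r.ker x).1 h)⟩
      obtain ⟨U, hU, hUo, h0U⟩ := mem_nhds_iff.1 hev
      filter_upwards [hUo.mem_nhds h0U] with z hzU hzH
      refine closure_mono ?_ (hUo.inter_closure ⟨hzU, mem_closure_isGenericPt (G := G) hzH⟩)
      rintro y ⟨hyU, hy⟩
      exact ⟨IsGenericPt.mem hy, hU hyU hy⟩)
  have hfin := eventually_eq_of_dense (dense_arrComplement (G := G))
    (F := fun z => fderiv ℂ c.coord z (X' z)) (F' := fun z => ξ (c.coord z)) (z₀ := 0)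
    (analyticAt_clm_apply (c.analyticAt_coord 0).fderiv hX')
    (AnalyticAt.comp (g := ξ) (f := c.coord)
      (hξ _ (by rw [c.coord_zero]; exact hgood.self_of_nhds)) (c.analyticAt_coord 0))
    (hXX.mono fun z h hz => by rw [← h hz, hXξ z hz])
  have h1 := congrFun hfin.self_of_nhds j
  simp only [hX'0, map_zero, Pi.zero_apply] at h1
  simp [ξ, hj] at h1

end Coordinates


open Module (finrank)

/-! ### Consequences of irreducibility and essentiality -/

section Essential

variable {V : Type*} [NormedAddCommGroup V] [NormedSpace ℂ V] [FiniteDimensional ℂ V]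
  {G : Subgroup (V ≃ₗ[ℂ] V)}

theorem eq_zero_of_forall_map_eq (h : IsIrreducibleEssential (reflHyperplanes G)) (v : V)
    (hv : ∀ g ∈ G, g v = v) : v = 0 := by
  have h1 : v ∈ sInf (reflHyperplanes G) := by
    rw [Submodule.mem_sInf]
    rintro H ⟨g, hg, -, rfl⟩
    exact map_mem_fixedSpace.2 (hv g hg)
  rwa [h.2.1, Submodule.mem_bot] at h1

theorem finrank_reflHyperplanes {H : Submodule ℂ V} (hH : H ∈ reflHyperplanes G) :
    finrank ℂ H + 1 = finrank ℂ V := by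
  obtain ⟨g, -, hg, rfl⟩ := hH
  rw [← Submodule.finrank_quotient_add_finrank (fixedSpace g), hg.2, add_comm]

theorem orbitMk_zero_mem_discriminant (h : IsIrreducibleEssential (reflHyperplanes G)) :
    orbitMk G 0 ∈ discriminant G := by
  obtain ⟨H, hH⟩ := h.1
  exact orbitMk_mem_discriminant.2 ⟨H, hH, H.zero_mem⟩

theorem mem_discriminant_iff_of_finrank_eq_one (h : IsIrreducibleEssential (reflHyperplanes G))
    (hn : finrank ℂ V = 1) {x : OrbitSpace G} : x ∈ discriminant G ↔ x = orbitMk G 0 := by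
  refine ⟨fun hx => ?_, fun hx => hx ▸ orbitMk_zero_mem_discriminant h⟩
  obtain ⟨z, rfl⟩ := orbitMk_surjective x
  obtain ⟨H, hH, hz⟩ := orbitMk_mem_discriminant.1 hx
  have h1 := finrank_reflHyperplanes hH
  have h2 : H = ⊥ := Submodule.finrank_eq_zero.1 (by omega)
  rw [h2, Submodule.mem_bot] at hz
  rw [hz]

/-- In dimension at least two the origin is not isolated in the discriminant. -/
theorem finrank_eq_one_of_isolated (h : IsIrreducibleEssential (reflHyperplanes G))
    {o : discriminant G} (ho : (o : OrbitSpace G) = orbitMk G 0) (hiso : ∀ᶠ y in 𝓝 o, y = o) :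
    finrank ℂ V = 1 := by
  obtain ⟨H, hH⟩ := h.1
  have h1 := finrank_reflHyperplanes hH
  suffices H = ⊥ by rw [this, finrank_bot] at h1; exact h1.symm
  rw [Submodule.eq_bot_iff]
  intro v hv
  by_contra hv0
  let γ : ℂ → discriminant G := fun t =>
    ⟨orbitMk G (t • v), orbitMk_mem_discriminant.2 ⟨H, hH, H.smul_mem t hv⟩⟩
  have hγ : ContinuousAt γ 0 :=
    ((continuous_orbitMk.comp (by fun_prop : Continuous fun t : ℂ => t • v)).subtype_mk _).continuousAt
  have hγ0 : γ 0 = o := Subtype.ext (by simp [γ, ho])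
  have h2 : ∀ᶠ t in 𝓝 (0 : ℂ), t = 0 := by
    have h3 : Tendsto γ (𝓝 0) (𝓝 o) := hγ0 ▸ hγ
    filter_upwards [h3.eventually hiso] with t ht
    have h4 : orbitMk G (t • v) = orbitMk G 0 := (congrArg Subtype.val ht).trans ho
    exact (smul_eq_zero.1 (orbitMk_eq_zero_iff.1 h4)).resolve_right hv0
  obtain ⟨t, ht, ht0⟩ := ((h2.filter_mono nhdsWithin_le_nhds).and
    (self_mem_nhdsWithin : ∀ᶠ t in 𝓝[≠] (0 : ℂ), t ∈ ({0}ᶜ : Set ℂ))).exists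
  exact ht0 ht

end Essential

/-! ### From germs of discriminants to germs of orbit spaces -/

section CoordIso

variable {V₁ : Type u} [NormedAddCommGroup V₁] [NormedSpace ℂ V₁] [FiniteDimensional ℂ V₁]
  {V₂ : Type v} [NormedAddCommGroup V₂] [NormedSpace ℂ V₂] [FiniteDimensional ℂ V₂]
  {G₁ : Subgroup (V₁ ≃ₗ[ℂ] V₁)} {G₂ : Subgroup (V₂ ≃ₗ[ℂ] V₂)}

/-- A biholomorphic map between open subsets of the orbit spaces, expressed in coordinates, that
respects the discriminants. -/
structure IsCoordIso (c₁ : OrbitCoordinates G₁) (c₂ : OrbitCoordinates G₂)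
    (Φ : OpenPartialHomeomorph (Fin (finrank ℂ V₁) → ℂ) (Fin (finrank ℂ V₂) → ℂ)) : Prop where
  analyticAt : ∀ x ∈ Φ.source, AnalyticAt ℂ Φ x
  analyticAt_symm : ∀ y ∈ Φ.target, AnalyticAt ℂ Φ.symm y
  disc : ∀ x ∈ Φ.source, x ∈ c₁.disc ↔ Φ x ∈ c₂.disc

variable {c₁ : OrbitCoordinates G₁} {c₂ : OrbitCoordinates G₂}
  {Φ : OpenPartialHomeomorph (Fin (finrank ℂ V₁) → ℂ) (Fin (finrank ℂ V₂) → ℂ)}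

theorem IsCoordIso.symm (h : IsCoordIso c₁ c₂ Φ) : IsCoordIso c₂ c₁ Φ.symm where
  analyticAt := h.analyticAt_symm
  analyticAt_symm := h.analyticAt
  disc y hy := by
    have h1 := h.disc _ (Φ.map_target hy)
    rw [Φ.right_inv hy] at h1
    exact h1.symm

variable (c₁ c₂ Φ) in
/-- The map between orbit spaces with a given expression in coordinates. -/
def orbitIso : OpenPartialHomeomorph (OrbitSpace G₁) (OrbitSpace G₂) :=
  (c₁.toHomeo.transOpenPartialHomeomorph Φ).transHomeomorph c₂.toHomeo.symm

theorem orbitIso_apply (x : OrbitSpace G₁) :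
    orbitIso c₁ c₂ Φ x = c₂.toHomeo.symm (Φ (c₁.toHomeo x)) := rfl

theorem mem_orbitIso_source {x : OrbitSpace G₁} :
    x ∈ (orbitIso c₁ c₂ Φ).source ↔ c₁.toHomeo x ∈ Φ.source := Iff.rfl

theorem IsCoordIso.isLocalDiscIso (h : IsCoordIso c₁ c₂ Φ) :
    IsLocalDiscIso G₁ G₂ (orbitIso c₁ c₂ Φ) where
  hol x hx k := by
    have hx : c₁.toHomeo x ∈ Φ.source := hx
    rw [c₁.holAt_iff, c₂.holAt_iff, orbitIso_apply, Homeomorph.apply_symm_apply]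
    simp only [orbitIso_apply, Homeomorph.apply_symm_apply]
    refine ⟨fun h1 => AnalyticAt.comp (g := fun y => k (c₂.toHomeo.symm y)) h1 (h.analyticAt _ hx),
      fun h1 => ?_⟩
    have h2 := AnalyticAt.comp (g := fun y => k (c₂.toHomeo.symm (Φ y))) (f := Φ.symm)
      (x := Φ (c₁.toHomeo x)) (by rwa [Φ.left_inv hx]) (h.analyticAt_symm _ (Φ.map_source hx))
    refine h2.congr ?_
    filter_upwards [Φ.open_target.mem_nhds (Φ.map_source hx)] with y hy
    rw [Function.comp_apply, Φ.right_inv hy]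
  disc x hx := by
    have h1 := h.disc _ (mem_orbitIso_source.1 hx)
    rw [OrbitCoordinates.disc, OrbitCoordinates.disc, c₁.toHomeo.injective.mem_set_image] at h1
    rw [h1, orbitIso_apply]
    refine ⟨fun ⟨y, hy, h2⟩ => by rwa [← h2, Homeomorph.symm_apply_apply], fun h2 => ⟨_, h2, ?_⟩⟩
    exact c₂.toHomeo.apply_symm_apply _

theorem DiscriminantGermsIso.symm (h : DiscriminantGermsIso G₁ G₂) : DiscriminantGermsIso G₂ G₁ := by
  obtain ⟨φ, o, ho, h1, h2, h3⟩ := h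
  refine ⟨φ.symm, φ o, φ.map_source ho, h2, by rwa [φ.left_inv ho], fun y hy k => ?_⟩
  obtain ⟨x, hx, rfl⟩ : ∃ x ∈ φ.source, φ x = y := ⟨_, φ.map_target hy, φ.right_inv hy⟩
  rw [h3 x hx, φ.left_inv hx]
  have hev : ∀ᶠ x' in 𝓝 x, k (φ.symm (φ x')) = k x' := by
    filter_upwards [φ.open_source.mem_nhds hx] with x' hx'
    rw [φ.left_inv hx']
  refine exists_congr fun k' => and_congr_right fun _ => eventually_congr ?_
  exact hev.mono fun x' hx' => by simp only [hx']

variable (c₁ c₂) in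
/-- The coordinates of an isomorphism of germs of discriminants extend holomorphically. -/
theorem exists_coord_extension {φ : discriminant G₁ → discriminant G₂} {o : discriminant G₁}
    (ho : (o : OrbitSpace G₁) = orbitMk G₁ 0)
    (h : ∀ k : discriminant G₂ → ℂ, DiscrHolAt G₂ k (φ o) → DiscrHolAt G₁ (fun y => k (φ y)) o) :
    ∃ F : (Fin (finrank ℂ V₁) → ℂ) → Fin (finrank ℂ V₂) → ℂ, AnalyticAt ℂ F 0 ∧
      ∀ᶠ y : discriminant G₁ in 𝓝 o, F (c₁.toHomeo y) = c₂.toHomeo (φ y) := by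
  have hj : ∀ j, DiscrHolAt G₁ (fun y => c₂.toHomeo (φ y) j) o := fun j =>
    h (fun y => c₂.toHomeo y j) ⟨fun x => c₂.toHomeo x j, by
      rw [c₂.holAt_iff]
      simp only [Homeomorph.apply_symm_apply]
      exact (ContinuousLinearMap.proj j : (Fin (finrank ℂ V₂) → ℂ) →L[ℂ] ℂ).analyticAt _,
      Eventually.of_forall fun _ => rfl⟩
  choose k hk hke using hj
  have h0 : c₁.toHomeo o = 0 := by rw [ho]; exact c₁.coord_zero
  refine ⟨fun x j => k j (c₁.toHomeo.symm x), analyticAt_pi_iff.2 fun j => ?_, ?_⟩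
  · rw [← h0]
    exact (c₁.holAt_iff _ _).1 (hk j)
  · filter_upwards [eventually_all.2 hke] with y hy
    funext j
    rw [Homeomorph.symm_apply_apply, hy j]

theorem OrbitCoordinates.eventually_disc (c₁ : OrbitCoordinates G₁) {o : discriminant G₁}
    (ho : (o : OrbitSpace G₁) = orbitMk G₁ 0) {P : discriminant G₁ → Prop} (hP : ∀ᶠ y in 𝓝 o, P y) :
    ∀ᶠ x in 𝓝 0, x ∈ c₁.disc → ∃ y : discriminant G₁, x = c₁.toHomeo y ∧ P y := by
  have h0 : c₁.toHomeo.symm 0 = o := by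
    rw [ho, ← c₁.coord_zero]; exact c₁.toHomeo.symm_apply_apply _
  have h1 : Tendsto c₁.toHomeo.symm (𝓝 0) (𝓝 o) := h0 ▸ c₁.toHomeo.symm.continuous.tendsto 0
  rw [nhds_subtype_eq_comap, eventually_comap] at hP
  filter_upwards [h1.eventually hP] with x hx
  rintro ⟨y, hy, rfl⟩
  rw [Homeomorph.symm_apply_apply] at hx
  exact ⟨⟨y, hy⟩, rfl, hx _ rfl⟩

/-- The components of `F x - x` vanish on the discriminant, so they have no linear part. -/
theorem OrbitCoordinates.fderiv_eq_id [Finite G₁] (hfix : ∀ v : V₁, (∀ g ∈ G₁, g v = v) → v = 0)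
    (hn : 2 ≤ finrank ℂ V₁) {F : (Fin (finrank ℂ V₁) → ℂ) → Fin (finrank ℂ V₁) → ℂ}
    (hF : AnalyticAt ℂ F 0) (h : ∀ᶠ x in 𝓝 0, x ∈ c₁.disc → F x = x) :
    fderiv ℂ F 0 = ContinuousLinearMap.id ℂ _ := by
  have h1 : ∀ i, fderiv ℂ (fun x => F x i - x i) 0 = 0 := fun i =>
    c₁.fderiv_eq_zero_of_vanishing hfix hn
      ((analyticAt_pi_iff.1 hF i).sub ((ContinuousLinearMap.proj (R := ℂ) (φ := fun _ => ℂ) i).analyticAt 0))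
      (h.mono fun x hx hxd => by rw [hx hxd, sub_self])
  have h2 := hasFDerivAt_pi'.1 hF.differentiableAt.hasFDerivAt
  ext u i
  have h3 := ((h2 i).sub (ContinuousLinearMap.proj (R := ℂ) (φ := fun _ => ℂ) i).hasFDerivAt).fderiv
  have h4 := DFunLike.congr_fun ((h1 i).symm.trans h3) u
  simp only [zero_apply, sub_apply, ContinuousLinearMap.comp_apply,
    ContinuousLinearMap.proj_apply] at h4
  exact (sub_eq_zero.1 h4.symm)

/-- Dimension one is the case in which the origin is isolated in the discriminant, a property that
the homeomorphism of germs preserves. -/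
theorem DiscriminantGermsIso.finrank_eq_one (h₁ : IsIrreducibleEssential (reflHyperplanes G₁))
    (h₂ : IsIrreducibleEssential (reflHyperplanes G₂)) (h : DiscriminantGermsIso G₁ G₂)
    (hn : finrank ℂ V₁ = 1) : finrank ℂ V₂ = 1 := by
  obtain ⟨φ, o, ho, h1, h2, -⟩ := h
  refine finrank_eq_one_of_isolated h₂ h2 ?_
  filter_upwards [φ.open_target.mem_nhds (φ.map_source ho)] with y hy
  rw [← φ.right_inv hy]
  congr 1
  refine Subtype.ext ?_
  rw [h1, ← mem_discriminant_iff_of_finrank_eq_one h₁ hn]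
  exact (φ.symm y).2

theorem OrbitCoordinates.mem_disc_iff_of_finrank_eq_one (c₁ : OrbitCoordinates G₁)
    (h : IsIrreducibleEssential (reflHyperplanes G₁)) (hn : finrank ℂ V₁ = 1)
    {x : Fin (finrank ℂ V₁) → ℂ} : x ∈ c₁.disc ↔ x = 0 := by
  rw [disc]
  constructor
  · rintro ⟨y, hy, rfl⟩
    rw [(mem_discriminant_iff_of_finrank_eq_one h hn).1 hy]
    exact c₁.coord_zero
  · rintro rfl
    exact ⟨_, orbitMk_zero_mem_discriminant h, c₁.coord_zero⟩

theorem one_le_finrank (h : IsIrreducibleEssential (reflHyperplanes G₁)) : 1 ≤ finrank ℂ V₁ := by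
  obtain ⟨H, hH⟩ := h.1
  have := finrank_reflHyperplanes hH
  omega

variable (c₁ c₂) in
/-- An isomorphism of the germs of the discriminants extends to the orbit spaces. -/
theorem exists_isCoordIso [Finite G₁] [Finite G₂]
    (h₁ : IsIrreducibleEssential (reflHyperplanes G₁))
    (h₂ : IsIrreducibleEssential (reflHyperplanes G₂)) (h : DiscriminantGermsIso G₁ G₂) :
    ∃ Φ, IsCoordIso c₁ c₂ Φ ∧ 0 ∈ Φ.source ∧ Φ 0 = 0 := by
  rcases (one_le_finrank h₁).eq_or_lt with hn | hn
  · have hn₁ := hn.symm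
    have hn₂ := h.finrank_eq_one h₁ h₂ hn₁
    let e : (Fin (finrank ℂ V₁) → ℂ) ≃L[ℂ] (Fin (finrank ℂ V₂) → ℂ) :=
      ContinuousLinearEquiv.ofFinrankEq (by simp [hn₁, hn₂])
    refine ⟨e.toHomeomorph.toOpenPartialHomeomorph, ⟨fun x _ => ?_, fun y _ => ?_, fun x _ => ?_⟩,
      Set.mem_univ _, map_zero e⟩
    · exact e.toContinuousLinearMap.analyticAt x
    · exact e.symm.toContinuousLinearMap.analyticAt y
    · rw [c₁.mem_disc_iff_of_finrank_eq_one h₁ hn₁, c₂.mem_disc_iff_of_finrank_eq_one h₂ hn₂]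
      exact (map_eq_zero_iff e e.injective).symm
  have hn₁ : 2 ≤ finrank ℂ V₁ := hn
  have hn₂ : 2 ≤ finrank ℂ V₂ := by
    rcases (one_le_finrank h₂).eq_or_lt with hn' | hn'
    · have := h.symm.finrank_eq_one h₂ h₁ hn'.symm
      omega
    · exact hn'
  obtain ⟨φ, o, ho, hoo, hφo, hφ⟩ := h
  obtain ⟨F, hF, hFe⟩ := exists_coord_extension c₁ c₂ (φ := φ) hoo fun k hk => (hφ o ho k).1 hk
  obtain ⟨F', hF', hFe'⟩ := exists_coord_extension c₂ c₁ (φ := φ.symm) (o := φ o) hφo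
    (fun k hk => by
      rw [φ.left_inv ho] at hk
      refine (hφ o ho _).2 ?_
      obtain ⟨k', hk', he⟩ := hk
      refine ⟨k', hk', ?_⟩
      filter_upwards [he, φ.open_source.mem_nhds ho] with y h1 h2
      rw [← h1, φ.left_inv h2])
  have ho0 : c₁.toHomeo o = 0 := by rw [hoo]; exact c₁.coord_zero
  have hφo0 : c₂.toHomeo (φ o) = 0 := by rw [hφo]; exact c₂.coord_zero
  have hF0 : F 0 = 0 := by
    have := hFe.self_of_nhds
    rwa [ho0, hφo0] at this
  have hF'0 : F' 0 = 0 := by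
    have := hFe'.self_of_nhds
    rwa [φ.left_inv ho, ho0, hφo0] at this
  have hd1 : ∀ᶠ y : discriminant G₁ in 𝓝 o, F (c₁.toHomeo y) = c₂.toHomeo (φ y) ∧
      F' (F (c₁.toHomeo y)) = c₁.toHomeo y := by
    filter_upwards [hFe, (φ.continuousAt ho).eventually hFe', φ.open_source.mem_nhds ho]
      with y h1 h2 h3
    rw [h1, h2, φ.left_inv h3]
    exact ⟨rfl, rfl⟩
  have hd2 : ∀ᶠ y : discriminant G₂ in 𝓝 (φ o), F (F' (c₂.toHomeo y)) = c₂.toHomeo y ∧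
      F' (c₂.toHomeo y) ∈ c₁.disc := by
    have ht : Tendsto φ.symm (𝓝 (φ o)) (𝓝 o) := φ.tendsto_symm ho
    filter_upwards [hFe', ht.eventually hFe, φ.open_target.mem_nhds (φ.map_source ho)]
      with y h1 h2 h3
    rw [h1, h2, φ.right_inv h3]
    exact ⟨rfl, ⟨_, (φ.symm y).2, rfl⟩⟩
  have hx1 := c₁.eventually_disc hoo hd1
  have hx2 := c₂.eventually_disc hφo hd2
  have hFF : AnalyticAt ℂ (fun x => F' (F x)) 0 :=
    AnalyticAt.comp (g := F') (f := F) (by rwa [hF0]) hF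
  have hFF' : AnalyticAt ℂ (fun x => F (F' x)) 0 :=
    AnalyticAt.comp (g := F) (f := F') (by rwa [hF'0]) hF'
  -- Both composites of the two extensions are the identity on the discriminants, so their
  -- derivatives at `0` are the identity. The inverse function theorem then applies to `F`.
  have hL1 := c₁.fderiv_eq_id (eq_zero_of_forall_map_eq h₁) hn₁ hFF (by
    filter_upwards [hx1] with x h1 h2
    obtain ⟨y, rfl, -, h3⟩ := h1 h2
    exact h3)
  have hL2 := c₂.fderiv_eq_id (eq_zero_of_forall_map_eq h₂) hn₂ hFF' (by
    filter_upwards [hx2] with x h1 h2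
    obtain ⟨y, rfl, h3, -⟩ := h1 h2
    exact h3)
  have hF'F : HasFDerivAt F' (fderiv ℂ F' 0) (F 0) := by
    rw [hF0]; exact hF'.differentiableAt.hasFDerivAt
  have hFF0 : HasFDerivAt F (fderiv ℂ F 0) (F' 0) := by
    rw [hF'0]; exact hF.differentiableAt.hasFDerivAt
  have hc1 := (hF'F.comp 0 hF.differentiableAt.hasFDerivAt).fderiv.symm.trans hL1
  have hc2 := (hFF0.comp 0 hF'.differentiableAt.hasFDerivAt).fderiv.symm.trans hL2
  let L : (Fin (finrank ℂ V₁) → ℂ) ≃L[ℂ] (Fin (finrank ℂ V₂) → ℂ) :=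
    ContinuousLinearEquiv.equivOfInverse (fderiv ℂ F 0) (fderiv ℂ F' 0)
      (fun x => DFunLike.congr_fun hc1 x) (fun x => DFunLike.congr_fun hc2 x)
  have hstrict : HasStrictFDerivAt F (L : _ →L[ℂ] _) 0 := hF.hasStrictFDerivAt
  let Ψ := hstrict.toOpenPartialHomeomorph F
  have hΨ : ⇑Ψ = F := rfl
  have h0Ψ : (0 : Fin (finrank ℂ V₁) → ℂ) ∈ Ψ.source := hstrict.mem_toOpenPartialHomeomorph_source
  have hΨs : AnalyticAt ℂ Ψ.symm (F 0) := Ψ.analyticAt_symm' (i := L) h0Ψ hF rfl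
  have hgood : ∀ᶠ x in 𝓝 0, AnalyticAt ℂ F x ∧ AnalyticAt ℂ Ψ.symm (F x) ∧
      (x ∈ c₁.disc ↔ F x ∈ c₂.disc) := by
    refine hF.eventually_analyticAt.and
      ((hF.continuousAt.eventually hΨs.eventually_analyticAt).and ?_)
    have htF : Tendsto F (𝓝 0) (𝓝 0) := by
      have := hF.continuousAt.tendsto
      rwa [hF0] at this
    have htFF : Tendsto (fun x => F' (F x)) (𝓝 0) (𝓝 0) := by
      have := hFF.continuousAt.tendsto
      rwa [hF0, hF'0] at this
    filter_upwards [hx1, htF.eventually hx2, Ψ.open_source.mem_nhds h0Ψ,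
      htFF.eventually (Ψ.open_source.mem_nhds h0Ψ)] with x h1 h2 h3 h4
    constructor
    · intro hx
      obtain ⟨y, rfl, h5, -⟩ := h1 hx
      rw [h5]
      exact ⟨_, (φ y).2, rfl⟩
    · intro hx
      -- If `F x` lies in the discriminant, then so does `F' (F x)`, and `F` takes it to `F x`. By
      -- injectivity of `F` near `0` it equals `x`.
      obtain ⟨y, h5, h6, h7⟩ := h2 hx
      rw [← h5] at h6 h7
      rwa [Ψ.injOn h4 h3 h6] at h7
  obtain ⟨U, hU, hUo, h0U⟩ := mem_nhds_iff.1 hgood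
  refine ⟨Ψ.restrOpen U hUo, ⟨fun x hx => (hU hx.2).1, fun y hy => ?_, fun x hx => (hU hx.2).2.2⟩,
    ⟨h0Ψ, h0U⟩, hF0⟩
  have h1 := (Ψ.restrOpen U hUo).map_target hy
  have h2 := (hU h1.2).2.1
  have h3 : F ((Ψ.restrOpen U hUo).symm y) = y := (Ψ.restrOpen U hUo).right_inv hy
  rw [h3] at h2
  exact h2

end CoordIso


open Module (finrank)

/-! ### Endomorphisms commuting with an irreducible reflection group -/

section Schur

variable {V : Type*} [NormedAddCommGroup V] [NormedSpace ℂ V] [FiniteDimensional ℂ V]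
  {G : Subgroup (V ≃ₗ[ℂ] V)}

/-- A reflection has the form `v ↦ v + (ζ - 1) φ(v) e` with `ζ ≠ 1`. Commuting with it forces `φ(v)
T e = φ(T v) e`, so the equation `φ` is an eigenvector of the transpose of `T`. -/
theorem IsRoot.exists_eigenvalue {H : Submodule ℂ V} {φ : V →L[ℂ] ℂ} {e : V} (r : IsRoot G H φ e)
    {T : V →ₗ[ℂ] V} (hT : ∀ g ∈ G, ∀ v, T (g v) = g (T v)) : ∃ μ : ℂ, ∀ v, φ (T v) = μ * φ v := by
  obtain ⟨g, hg, hrefl, hH⟩ := r.mem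
  have hgs : g ∈ pointwiseStab G H :=
    ⟨hg, fun h hh => map_mem_fixedSpace.1 (by rwa [hH])⟩
  have hζ : φ (g e) - 1 ≠ 0 := by
    intro h0
    have h1 : e ∈ H := by
      rw [← hH, map_mem_fixedSpace, r.apply_eq hgs, h0, zero_mul, zero_smul, add_zero]
    exact one_ne_zero (r.apply_self.symm.trans ((r.ker e).2 h1))
  refine ⟨φ (T e), fun v => ?_⟩
  have h1 := hT g hg v
  rw [r.apply_eq hgs v, r.apply_eq hgs (T v), map_add, map_smul] at h1
  have h2 := congrArg φ (add_left_cancel h1)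
  rw [map_smul, map_smul, r.apply_self, smul_eq_mul, smul_eq_mul, mul_one, mul_assoc] at h2
  have h3 := mul_left_cancel₀ hζ h2
  rw [← h3, mul_comm]

/-- Schur's lemma for an irreducible reflection group. -/
theorem exists_scalar_of_commute [Finite G] (h : IsIrreducibleEssential (reflHyperplanes G))
    {T : V →ₗ[ℂ] V} (hT : ∀ g ∈ G, ∀ v, T (g v) = g (T v)) : ∃ a : ℂ, ∀ v, T v = a • v := by
  obtain ⟨co, hco⟩ := exists_invariant_core G
  choose! φ e hr _ using fun H (hH : H ∈ reflHyperplanes G) => exists_isRoot co hco hH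
  choose! μ hμ using fun H hH => (hr H hH).exists_eigenvalue hT
  obtain ⟨H₀, hH₀⟩ := h.1
  have hpoly : ∀ H ∈ reflHyperplanes G, ∀ (p : Polynomial ℂ) (v : V),
      φ H (Polynomial.aeval T p v) = p.eval (μ H) * φ H v := by
    intro H hH p v
    induction p using Polynomial.induction_on' with
    | add p q hp hq => simp [hp, hq, add_mul]
    | monomial n a =>
      rw [Polynomial.aeval_monomial, Polynomial.eval_monomial]
      have h1 : φ H ((T ^ n) v) = μ H ^ n * φ H v := by
        induction n with
        | zero => simp
        | succ n ih => rw [pow_succ', Module.End.mul_apply, hμ H hH, ih]; ring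
      change φ H (a • (T ^ n) v) = _
      rw [map_smul, h1, smul_eq_mul]; ring
  have hall : ∀ H ∈ reflHyperplanes G, μ H = μ H₀ := by
    by_contra! hne
    obtain ⟨H₁, hH₁, hne₁⟩ := hne
    set 𝒜 := {H ∈ reflHyperplanes G | μ H = μ H₀} with h𝒜
    set ℬ := {H ∈ reflHyperplanes G | μ H ≠ μ H₀} with hℬ
    have hfin : (μ '' ℬ).Finite :=
      (((reflHyperplanes_finite G).subset fun H hH => hH.1).image _)
    refine h.2.2 𝒜 ℬ ⟨H₀, hH₀, rfl⟩ ⟨H₁, hH₁, hne₁⟩ ?_ ?_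
    · ext H
      by_cases h1 : μ H = μ H₀ <;> simp [h𝒜, hℬ, h1]
    -- The polynomial takes the value `1` at `μ H₀` and `0` at the other eigenvalues. Thus `v - q(T)
    -- v` lies in all members of `𝒜` and `q(T) v` in all members of `ℬ`, a splitting that
    -- irreducibility forbids.
    · let q : Polynomial ℂ := ∏ t ∈ hfin.toFinset,
        (Polynomial.C ((μ H₀ - t)⁻¹) * (Polynomial.X - Polynomial.C t))
      have hq0 : q.eval (μ H₀) = 1 := by
        rw [Polynomial.eval_prod]
        refine Finset.prod_eq_one fun t ht => ?_
        obtain ⟨H, hH, rfl⟩ := hfin.mem_toFinset.1 ht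
        simp [inv_mul_cancel₀ (sub_ne_zero.2 (Ne.symm hH.2))]
      have hq1 : ∀ H ∈ ℬ, q.eval (μ H) = 0 := by
        intro H hH
        rw [Polynomial.eval_prod]
        exact Finset.prod_eq_zero (hfin.mem_toFinset.2 ⟨H, hH, rfl⟩) (by simp)
      rw [eq_top_iff]
      intro v _
      rw [← sub_add_cancel v (Polynomial.aeval T q v)]
      refine Submodule.add_mem_sup ?_ ?_
      · rw [Submodule.mem_sInf]
        intro H hH
        rw [← (hr H hH.1).ker, map_sub, hpoly H hH.1, hH.2, hq0, one_mul, sub_self]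
      · rw [Submodule.mem_sInf]
        intro H hH
        rw [← (hr H hH.1).ker, hpoly H hH.1, hq1 H hH, zero_mul]
  refine ⟨μ H₀, fun v => sub_eq_zero.1 ?_⟩
  have h1 : T v - μ H₀ • v ∈ sInf (reflHyperplanes G) := by
    rw [Submodule.mem_sInf]
    intro H hH
    rw [← (hr H hH).ker, map_sub, hμ H hH, hall H hH, map_smul, smul_eq_mul, sub_self]
  rwa [h.2.1, Submodule.mem_bot] at h1

end Schur

/-! ### The Euler field on the orbit space -/

section Euler

variable {V : Type*} [NormedAddCommGroup V] [NormedSpace ℂ V] [FiniteDimensional ℂ V]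
  {G : Subgroup (V ≃ₗ[ℂ] V)} (c : OrbitCoordinates G)

/-- The Euler field in the coordinates of the orbit space. -/
def OrbitCoordinates.euler : (Fin (finrank ℂ V) → ℂ) →L[ℂ] (Fin (finrank ℂ V) → ℂ) :=
  ContinuousLinearMap.pi fun j => (c.deg j : ℂ) • ContinuousLinearMap.proj j

theorem OrbitCoordinates.euler_apply (x : Fin (finrank ℂ V) → ℂ) (j) :
    c.euler x j = c.deg j * x j := rfl

theorem OrbitCoordinates.coord_smul (s : ℂ) (z : V) (i) :
    c.coord (s • z) i = s ^ c.deg i * c.coord z i := c.homogeneous s z i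

theorem OrbitCoordinates.fderiv_coord_self (z : V) :
    fderiv ℂ c.coord z z = c.euler (c.coord z) := by
  funext i
  have h1 : HasDerivAt (fun s : ℂ => s • z) z 1 := by
    simpa using (hasDerivAt_id (1 : ℂ)).smul_const z
  have h2 : HasFDerivAt c.coord (fderiv ℂ c.coord z) ((1 : ℂ) • z) := by
    rw [one_smul]; exact (c.analyticAt_coord z).differentiableAt.hasFDerivAt
  have h3 := hasDerivAt_pi.1 (h2.comp_hasDerivAt (1 : ℂ) h1) i
  have h4 : HasDerivAt (fun s : ℂ => s ^ c.deg i * c.coord z i)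
      (c.deg i * (1 : ℂ) ^ (c.deg i - 1) * c.coord z i) 1 :=
    (hasDerivAt_pow (c.deg i) (1 : ℂ)).mul_const _
  have h5 : (fun s : ℂ => (c.coord ∘ fun s : ℂ => s • z) s i) =
      fun s => s ^ c.deg i * c.coord z i := funext fun s => c.coord_smul s z i
  rw [h5] at h3
  rw [h3.unique h4, euler_apply, one_pow, mul_one]

theorem OrbitCoordinates.fderiv_coord_smul (s : ℂ) (z u : V) (i) :
    s * fderiv ℂ c.coord (s • z) u i = s ^ c.deg i * fderiv ℂ c.coord z u i := by
  have h1 : HasFDerivAt (fun y : V => s • y) (s • ContinuousLinearMap.id ℂ V) z :=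
    (hasFDerivAt_id z).const_smul s
  have h2 : HasFDerivAt (fun y => c.coord (s • y))
      ((fderiv ℂ c.coord (s • z)).comp (s • ContinuousLinearMap.id ℂ V)) z :=
    HasFDerivAt.comp (g := c.coord) (f := fun y : V => s • y) z
      (c.analyticAt_coord _).differentiableAt.hasFDerivAt h1
  have h3 := (hasFDerivAt_pi'.1 h2 i)
  have h4 := (hasFDerivAt_pi'.1 (c.analyticAt_coord z).differentiableAt.hasFDerivAt i).const_mul
    (s ^ c.deg i)
  have h5 : (fun y => c.coord (s • y) i) = fun y => s ^ c.deg i * c.coord y i :=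
    funext fun y => c.coord_smul s y i
  rw [h5] at h3
  have h6 := DFunLike.congr_fun (h3.unique h4) u
  simpa using h6

/-- The diagonal entries of the linear part of a vector field on the orbit space. -/
theorem OrbitCoordinates.fderiv_field_diag {X : V → V} {a : ℂ} (hX : AnalyticAt ℂ X 0)
    (hX0 : X 0 = 0) (hDX : ∀ v, fderiv ℂ X 0 v = a • v)
    {ξ : (Fin (finrank ℂ V) → ℂ) → Fin (finrank ℂ V) → ℂ} (hξ : AnalyticAt ℂ ξ 0) (hξ0 : ξ 0 = 0)
    (hξX : ∀ᶠ z in 𝓝 0, fderiv ℂ c.coord z (X z) = ξ (c.coord z)) (i) :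
    fderiv ℂ ξ 0 (Pi.single i 1) i = a * c.deg i := by
  -- Over the `i`-th coordinate axis, `s • z` has the single coordinate `s ^ deg i`. The slope of
  -- `ξ` along the axis is compared with that of `X` along the line of `z`, whose limit is `a • z`.
  obtain ⟨z, hz⟩ := c.coord_surjective (Pi.single i 1)
  have hzs : ∀ s : ℂ, c.coord (s • z) = s ^ c.deg i • Pi.single i 1 := by
    intro s
    funext j
    rw [c.coord_smul, hz, Pi.smul_apply, smul_eq_mul]
    rcases eq_or_ne j i with rfl | hj
    · rfl
    · rw [Pi.single_eq_of_ne hj, mul_zero, mul_zero]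
  have hA : Tendsto (fun t : ℂ => t⁻¹ * ξ (t • Pi.single i 1) i) (𝓝[≠] 0)
      (𝓝 (fderiv ℂ ξ 0 (Pi.single i 1) i)) := by
    have h1 : HasDerivAt (fun t : ℂ => t • (Pi.single i 1 : Fin (finrank ℂ V) → ℂ)) (Pi.single i 1) 0 := by
      simpa using (hasDerivAt_id (0 : ℂ)).smul_const (Pi.single i 1 : Fin (finrank ℂ V) → ℂ)
    have h2 : HasFDerivAt ξ (fderiv ℂ ξ 0) ((0 : ℂ) • Pi.single i 1) := by
      rw [zero_smul]; exact hξ.differentiableAt.hasFDerivAt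
    have h3 := hasDerivAt_pi.1 (h2.comp_hasDerivAt (0 : ℂ) h1) i
    simpa [hξ0] using h3.tendsto_slope_zero
  have hB : Tendsto (fun s : ℂ => s⁻¹ • X (s • z)) (𝓝[≠] 0) (𝓝 (a • z)) := by
    have h1 : HasDerivAt (fun s : ℂ => s • z) z 0 := by
      simpa using (hasDerivAt_id (0 : ℂ)).smul_const z
    have h2 : HasFDerivAt X (fderiv ℂ X 0) ((0 : ℂ) • z) := by
      rw [zero_smul]; exact hX.differentiableAt.hasFDerivAt
    have h3 := (h2.comp_hasDerivAt (0 : ℂ) h1).tendsto_slope_zero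
    simpa [hX0, hDX] using h3
  have hpow : Tendsto (fun s : ℂ => s ^ c.deg i) (𝓝[≠] 0) (𝓝[≠] 0) := by
    refine tendsto_nhdsWithin_iff.2 ⟨?_, ?_⟩
    · have h1 := (continuous_pow (M := ℂ) (c.deg i)).tendsto 0
      rw [zero_pow (c.deg_pos i).ne'] at h1
      exact h1.mono_left nhdsWithin_le_nhds
    · filter_upwards [self_mem_nhdsWithin] with s hs using pow_ne_zero _ hs
  have hC : Tendsto (fun s : ℂ => fderiv ℂ c.coord z (s⁻¹ • X (s • z)) i) (𝓝[≠] 0)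
      (𝓝 (a * c.deg i)) := by
    have h1 := ((continuous_apply i).comp (fderiv ℂ c.coord z).continuous).tendsto (a • z)
    have h2 : ((fun x => x i) ∘ fderiv ℂ c.coord z) (a • z) = a * c.deg i := by
      simp [c.fderiv_coord_self, c.euler_apply, hz]
    rw [h2] at h1
    exact h1.comp hB
  refine tendsto_nhds_unique (hA.comp hpow) (hC.congr' ?_)
  have ht : Tendsto (fun s : ℂ => s • z) (𝓝[≠] 0) (𝓝 0) := by
    have h1 : Continuous fun s : ℂ => s • z := by fun_prop
    have h2 := h1.tendsto 0
    rw [zero_smul] at h2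
    exact h2.mono_left nhdsWithin_le_nhds
  filter_upwards [ht.eventually hξX, self_mem_nhdsWithin] with s h1 hs
  have hs : s ≠ 0 := hs
  rw [Function.comp_apply, ← hzs, ← h1, map_smul, Pi.smul_apply, smul_eq_mul]
  have h2 := c.fderiv_coord_smul s z (X (s • z)) i
  have h3 : s ^ c.deg i ≠ 0 := pow_ne_zero _ hs
  field_simp
  linear_combination -h2

end Euler

/-! ### The Euler field of the second group on the first space -/

section EulerField

variable {V₁ : Type u} [NormedAddCommGroup V₁] [NormedSpace ℂ V₁] [FiniteDimensional ℂ V₁]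
  {V₂ : Type v} [NormedAddCommGroup V₂] [NormedSpace ℂ V₂] [FiniteDimensional ℂ V₂]
  {G₁ : Subgroup (V₁ ≃ₗ[ℂ] V₁)} {G₂ : Subgroup (V₂ ≃ₗ[ℂ] V₂)} [Finite G₁] [Finite G₂]
  {c₁ : OrbitCoordinates G₁} {c₂ : OrbitCoordinates G₂}
  {Φ : OpenPartialHomeomorph (Fin (finrank ℂ V₁) → ℂ) (Fin (finrank ℂ V₂) → ℂ)}

/-- The field `pullEuler` is equivariant, and bounded near the bigeneric points, which are dense in
the hyperplanes. So it extends over the origin, and its relation to the Euler field of the target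
extends by density. -/
theorem IsCoordIso.exists_euler (h : IsCoordIso c₁ c₂ Φ) (h0 : 0 ∈ Φ.source)
    (hG₁ : FreeOnComplement G₁) (hG₂ : FreeOnComplement G₂)
    (hfix : ∀ v : V₁, (∀ g ∈ G₁, g v = v) → v = 0) :
    ∃ X : V₁ → V₁, AnalyticAt ℂ X 0 ∧ X 0 = 0 ∧ (∀ g ∈ G₁, ∀ᶠ z in 𝓝 0, X (g z) = g (X z)) ∧
      ∀ᶠ z in 𝓝 0, fderiv ℂ (fun y => Φ (c₁.coord y)) z (X z) = c₂.euler (Φ (c₁.coord z)) := by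
  have hf := h.isLocalDiscIso
  set f := orbitIso c₁ c₂ Φ with hfdef
  have hs0 : orbitMk G₁ 0 ∈ f.source := by
    rw [mem_orbitIso_source]; rwa [← c₁.coord_zero] at h0
  have hs : ∀ᶠ z in 𝓝 (0 : V₁), orbitMk G₁ z ∈ f.source :=
    continuous_orbitMk.continuousAt.eventually (f.open_source.mem_nhds hs0)
  have hΦa : AnalyticAt ℂ (fun y => Φ (c₁.coord y)) 0 :=
    AnalyticAt.comp (g := Φ) (f := c₁.coord) (h.analyticAt _ (by rwa [c₁.coord_zero]))
      (c₁.analyticAt_coord 0)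
  obtain ⟨X, hX, hXX, hX0, hXe⟩ := exists_equivariant_extension hfix (X := pullEuler f) (by
      filter_upwards [hs] with z hz hzc
      obtain ⟨W, hW⟩ := hf.exists_liftAt' hG₁ hG₂ hz hzc
      exact hW.analyticAt_pullEuler)
    (fun g hg => by
      filter_upwards [hs] with z hz hzc
      obtain ⟨W, hW⟩ := hf.exists_liftAt' hG₁ hG₂ hz hzc
      obtain ⟨W', hW'⟩ := hf.exists_liftAt' hG₁ hG₂ (z := g z) (by rwa [orbitMk_map hg])
        ((map_mem_arrComplement hg).2 hzc)
      refine (hW.transform g 1 hW' (Eventually.of_forall fun y w hw => ?_)).2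
      rwa [orbitMk_map hg] at hw)
    (fun H hH => by
      obtain ⟨co, hco⟩ := exists_invariant_core G₁
      obtain ⟨φ, e, r, -⟩ := exists_isRoot co hco hH
      filter_upwards [hs] with z hz hzH
      refine closure_mono (fun y hy => ?_) (hf.mem_closure_isBigenericPt hH hzH hz)
      obtain ⟨M, hM⟩ := IsBigenericPt.bounded_pullEuler hf hG₁ hG₂ r hy
      exact ⟨(IsBigenericPt.generic hy).mem, M, hM.mono fun x hx hxc =>
        hx fun h => hxc H hH ((r.ker x).1 h)⟩)
  refine ⟨X, hX, hX0, hXe, eventually_eq_of_dense (dense_arrComplement (G := G₁))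
    (analyticAt_clm_apply hΦa.fderiv hX)
    (AnalyticAt.comp (g := c₂.euler) (f := fun y => Φ (c₁.coord y)) (c₂.euler.analyticAt _) hΦa) ?_⟩
  filter_upwards [hs, hXX] with z hz h1 hzc
  obtain ⟨W, hW⟩ := hf.exists_liftAt' hG₁ hG₂ hz hzc
  have h2 : ∀ᶠ y in 𝓝 z, Φ (c₁.coord y) = c₂.coord (W y) := by
    filter_upwards [hW.lift.lift] with y hy
    have h3 := congrArg c₂.toHomeo hy
    rwa [hfdef, orbitIso_apply, Homeomorph.apply_symm_apply] at h3
  rw [← h1 hzc, EventuallyEq.fderiv_eq h2, h2.self_of_nhds, ← c₂.fderiv_coord_self]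
  have h3 := DFunLike.congr_fun ((c₂.analyticAt_coord (W z)).differentiableAt.hasFDerivAt.comp z
    hW.lift.analyticAt.differentiableAt.hasFDerivAt).fderiv (pullEuler f z)
  refine h3.trans ?_
  rw [ContinuousLinearMap.comp_apply, hW.fderiv_pullEuler]

theorem IsCoordIso.exists_fderiv_equiv (h : IsCoordIso c₁ c₂ Φ) {x : Fin (finrank ℂ V₁) → ℂ}
    (hx : x ∈ Φ.source) :
    ∃ e : (Fin (finrank ℂ V₁) → ℂ) ≃L[ℂ] (Fin (finrank ℂ V₂) → ℂ), fderiv ℂ Φ x = e := by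
  have h1 := (h.analyticAt x hx).differentiableAt.hasFDerivAt
  have h2 := (h.analyticAt_symm _ (Φ.map_source hx)).differentiableAt.hasFDerivAt
  have h1' : HasFDerivAt Φ (fderiv ℂ Φ x) (Φ.symm (Φ x)) := by rwa [Φ.left_inv hx]
  have e1 := (h2.comp x h1).unique ((hasFDerivAt_id x).congr_of_eventuallyEq
    (Φ.eventually_left_inverse hx))
  have e2 := (h1'.comp (Φ x) h2).unique ((hasFDerivAt_id (Φ x)).congr_of_eventuallyEq
    (Φ.eventually_right_inverse (Φ.map_source hx)))
  exact ⟨ContinuousLinearEquiv.equivOfInverse _ _ (fun x => DFunLike.congr_fun e1 x)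
    (fun x => DFunLike.congr_fun e2 x), rfl⟩

/-- The linear part of the Euler field of `G₂ \ V₂` on `V₁` is determined by the degrees. -/
theorem IsCoordIso.mul_sum_deg (h : IsCoordIso c₁ c₂ Φ) (h0 : 0 ∈ Φ.source) {X : V₁ → V₁}
    {a : ℂ} (hX : AnalyticAt ℂ X 0) (hX0 : X 0 = 0) (hDX : ∀ v, fderiv ℂ X 0 v = a • v)
    (hXe : ∀ g ∈ G₁, ∀ᶠ z in 𝓝 0, X (g z) = g (X z))
    (hXΦ : ∀ᶠ z in 𝓝 0,
      fderiv ℂ (fun y => Φ (c₁.coord y)) z (X z) = c₂.euler (Φ (c₁.coord z))) :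
    a * ∑ i, (c₁.deg i : ℂ) = ∑ j, (c₂.deg j : ℂ) := by
  obtain ⟨ξ, hξ, hξX⟩ := c₁.exists_factor (F := fun z => fderiv ℂ c₁.coord z (X z)) (z := 0)
    (analyticAt_clm_apply (c₁.analyticAt_coord 0).fderiv hX) fun g hg _ => by
      filter_upwards [hXe g hg] with z hz
      rw [hz, c₁.fderiv_coord_map hg]
  rw [c₁.coord_zero] at hξ
  have hξ0 : ξ 0 = 0 := by
    have := hξX.self_of_nhds
    rw [hX0, map_zero, c₁.coord_zero] at this
    exact this.symm
  have hΦ := h.analyticAt 0 h0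
  have hrel : ∀ᶠ x in 𝓝 0, fderiv ℂ Φ x (ξ x) = c₂.euler (Φ x) := by
    rw [← c₁.coord_zero, c₁.eventually_coord]
    have h1 : ∀ᶠ z in 𝓝 (0 : V₁), c₁.coord z ∈ Φ.source :=
      c₁.eventually_coord.1 (by rw [c₁.coord_zero]; exact Φ.open_source.mem_nhds h0)
    filter_upwards [h1, hξX, hXΦ] with z h2 h3 h4
    rw [← h3, ← h4, c₁.fderiv_comp_coord (h.analyticAt _ h2)]
  obtain ⟨e, he⟩ := h.exists_fderiv_equiv h0
  have hlin : ∀ u, e (fderiv ℂ ξ 0 u) = c₂.euler (e u) := by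
    intro u
    have h1 := hΦ.fderiv.differentiableAt.hasFDerivAt.clm_apply hξ.differentiableAt.hasFDerivAt
    have h2 : HasFDerivAt (fun x => c₂.euler (Φ x)) (c₂.euler.comp (fderiv ℂ Φ 0)) 0 :=
      c₂.euler.hasFDerivAt.comp 0 hΦ.differentiableAt.hasFDerivAt
    have h3 := DFunLike.congr_fun (h1.unique (h2.congr_of_eventuallyEq hrel)) u
    simpa [hξ0, he] using h3
  have htr : ∀ {n : ℕ} (A : (Fin n → ℂ) →ₗ[ℂ] (Fin n → ℂ)),
      LinearMap.trace ℂ _ A = ∑ i, A (Pi.single i 1) i := by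
    intro n A
    rw [LinearMap.trace_eq_matrix_trace ℂ (Pi.basisFun ℂ (Fin n)), Matrix.trace]
    refine Finset.sum_congr rfl fun i _ => ?_
    simp
  -- The derivative of `Φ` conjugates the linear part of `ξ` to the Euler field of the target.
  -- Equality of traces is the assertion, since the diagonal entries of the former are `a * deg i`.
  have hconj : e.toLinearEquiv.conj (fderiv ℂ ξ 0 : _ →ₗ[ℂ] _) = (c₂.euler : _ →ₗ[ℂ] _) := by
    refine LinearMap.ext fun x => ?_
    rw [LinearEquiv.conj_apply_apply]
    change e (fderiv ℂ ξ 0 (e.symm x)) = c₂.euler x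
    rw [hlin, e.apply_symm_apply]
  have h1 := LinearMap.trace_conj' (fderiv ℂ ξ 0 : _ →ₗ[ℂ] _) e.toLinearEquiv
  rw [hconj, htr, htr] at h1
  rw [Finset.mul_sum, ← Finset.sum_congr rfl fun i _ => c₁.fderiv_field_diag hX hX0 hDX hξ hξ0 hξX i]
  refine h1.symm.trans ?_
  exact Finset.sum_congr rfl fun j _ => by simp [c₂.euler_apply]

end EulerField

/-! ### Leading parts of analytic functions -/

section LeadingPart

open Asymptotics

variable {V : Type*} [NormedAddCommGroup V] [NormedSpace ℂ V]

/-- The part of lowest degree in the power series expansion of a function. -/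
theorem exists_leadingPart {k : V → ℂ} (hk : AnalyticAt ℂ k 0) (h0 : k 0 = 0)
    (hne : ∃ᶠ z in 𝓝 0, k z ≠ 0) : ∃ (r : ℕ) (P : V → ℂ), 0 < r ∧ (∀ z, AnalyticAt ℂ P z) ∧
      (∀ (s : ℂ) z, P (s • z) = s ^ r * P z) ∧ (∃ z, P z ≠ 0) ∧
      P =O[𝓝 0] (fun z => ‖z‖ ^ r) ∧ (fun z => k z - P z) =O[𝓝 0] fun z => ‖z‖ ^ (r + 1) := by
  obtain ⟨p, hp⟩ := hk
  have hex : ∃ n, ∃ y : V, p n (fun _ => y) ≠ 0 := by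
    by_contra! hall
    obtain ⟨ρ, hρ⟩ := hp
    refine hne ?_
    filter_upwards [Metric.eball_mem_nhds 0 hρ.r_pos] with z hz
    rw [not_not]
    have h1 := hρ.hasSum hz
    simp only [hall, zero_add] at h1
    exact h1.unique hasSum_zero
  classical
  refine ⟨Nat.find hex, fun y => p (Nat.find hex) fun _ => y, ?_, ?_, ?_, Nat.find_spec hex, ?_, ?_⟩
  · rw [Nat.find_pos]
    rintro ⟨y, hy⟩
    exact hy ((hp.coeff_zero _).trans h0)
  · intro z
    exact AnalyticAt.comp (g := p (Nat.find hex)) (f := fun y => fun _ => y)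
      (p (Nat.find hex)).cpolynomialAt.analyticAt
      (analyticAt_pi_iff.2 fun _ => analyticAt_id)
  · intro s z
    have := (p (Nat.find hex)).map_smul_univ (fun _ => s) (fun _ => z)
    simpa using this
  · refine IsBigO.of_bound ‖p (Nat.find hex)‖ (Eventually.of_forall fun z => ?_)
    refine ((p (Nat.find hex)).le_opNorm _).trans (le_of_eq ?_)
    rw [Finset.prod_const, Finset.card_fin, norm_pow, norm_norm]
  · refine (hp.isBigO_sub_partialSum_pow (Nat.find hex + 1)).congr_left fun z => ?_
    rw [zero_add, FormalMultilinearSeries.partialSum, Finset.sum_range_succ,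
      Finset.sum_eq_zero, zero_add]
    intro i hi
    by_contra h
    exact Nat.find_min hex (Finset.mem_range.1 hi) ⟨z, h⟩

/-- Cauchy's estimate in the direction `v` on the disc of radius `‖z‖ / ‖v‖`, which keeps the
argument within `2 * ‖z‖` of the origin. -/
theorem isBigO_fderiv {f : V → ℂ} (hf : AnalyticAt ℂ f 0) {n : ℕ}
    (h : f =O[𝓝 0] fun z => ‖z‖ ^ (n + 1)) :
    fderiv ℂ f =O[𝓝[≠] 0] fun z => ‖z‖ ^ n := by
  obtain ⟨C, hC, hb⟩ := h.exists_pos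
  obtain ⟨ρ, hρ, hball⟩ := Metric.eventually_nhds_iff_ball.1
    (hb.bound.and hf.eventually_analyticAt)
  refine IsBigO.of_bound (C * 2 ^ (n + 1)) ?_
  filter_upwards [self_mem_nhdsWithin, mem_nhdsWithin_of_mem_nhds
    (Metric.ball_mem_nhds (0 : V) (half_pos hρ))] with z hz hzρ
  have hz : z ≠ 0 := hz
  have hz0 : 0 < ‖z‖ := norm_pos_iff.2 hz
  rw [mem_ball_zero_iff] at hzρ
  rw [norm_pow, norm_norm]
  refine ContinuousLinearMap.opNorm_le_bound _ (by positivity) fun v => ?_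
  rcases eq_or_ne v 0 with rfl | hv
  · simp
  have hv0 : 0 < ‖v‖ := norm_pos_iff.2 hv
  have hmem : ∀ ζ : ℂ, ‖ζ‖ ≤ ‖z‖ / ‖v‖ → ‖z + ζ • v‖ ≤ 2 * ‖z‖ := by
    intro ζ hζ
    have h1 := norm_add_le z (ζ • v)
    rw [norm_smul] at h1
    have h2 := (le_div_iff₀ hv0).1 hζ
    linarith
  have hd : ∀ ζ ∈ Metric.closedBall (0 : ℂ) (‖z‖ / ‖v‖),
      HasDerivAt (fun ζ : ℂ => f (z + ζ • v)) (fderiv ℂ f (z + ζ • v) v) ζ := by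
    intro ζ hζ
    have h1 : HasDerivAt (fun ζ : ℂ => z + ζ • v) v ζ := by
      simpa using ((hasDerivAt_id ζ).smul_const v).const_add z
    have h2 : z + ζ • v ∈ Metric.ball (0 : V) ρ := by
      rw [mem_ball_zero_iff]
      linarith [hmem ζ (mem_closedBall_zero_iff.1 hζ)]
    exact (hball _ h2).2.differentiableAt.hasFDerivAt.comp_hasDerivAt ζ h1
  have hR : 0 < ‖z‖ / ‖v‖ := div_pos hz0 hv0
  have h1 := Complex.norm_deriv_le_of_forall_mem_sphere_norm_le (c := 0)
    (f := fun ζ : ℂ => f (z + ζ • v)) (C := C * (2 * ‖z‖) ^ (n + 1)) hR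
    (DifferentiableOn.diffContOnCl_ball (U := Metric.closedBall 0 (‖z‖ / ‖v‖))
      (fun ζ hζ => (hd ζ hζ).differentiableAt.differentiableWithinAt) subset_rfl) (by
      intro ζ hζ
      have h2 := hmem ζ (mem_sphere_zero_iff_norm.1 hζ).le
      have h3 := (hball (z + ζ • v) (by rw [mem_ball_zero_iff]; linarith)).1
      rw [norm_pow, norm_norm] at h3
      exact h3.trans (by gcongr))
  rw [(hd 0 (by simp [hR.le])).deriv, zero_smul, add_zero] at h1
  refine h1.trans (le_of_eq ?_)
  field_simp
  ring

/-- In lowest order the equation `X k = d k` says that `a` times the Euler field multiplies the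
leading part `P` by `d`; on degree `r` it multiplies by `a * r`. The proof compares terms of order
`t ^ r` along a line on which `P` does not vanish. -/
theorem mul_degree_eq {k P : V → ℂ} {X : V → V} {a d : ℂ} {r : ℕ} (hk : AnalyticAt ℂ k 0)
    (hX : AnalyticAt ℂ X 0) (hX0 : X 0 = 0) (hDX : ∀ v, fderiv ℂ X 0 v = a • v)
    (hkX : ∀ᶠ z in 𝓝 0, fderiv ℂ k z (X z) = d * k z) (hr : 0 < r) (hP : ∀ z, AnalyticAt ℂ P z)
    (hPr : ∀ (s : ℂ) z, P (s • z) = s ^ r * P z) (hP0 : ∃ z, P z ≠ 0)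
    (hPO : P =O[𝓝 0] fun z => ‖z‖ ^ r) (hkP : (fun z => k z - P z) =O[𝓝 0] fun z => ‖z‖ ^ (r + 1)) : a * r = d := by
  obtain ⟨z, hz⟩ := hP0
  have hline : HasDerivAt (fun t : ℂ => t • z) z 0 := by
    simpa using (hasDerivAt_id (0 : ℂ)).smul_const z
  have hz0 : z ≠ 0 := by
    rintro rfl
    refine hz ?_
    have := hPr 0 0
    rwa [zero_pow hr.ne', zero_mul, smul_zero] at this
  have ht : Tendsto (fun t : ℂ => t • z) (𝓝[≠] 0) (𝓝[≠] 0) := by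
    refine tendsto_nhdsWithin_iff.2 ⟨?_, ?_⟩
    · have := hline.continuousAt.tendsto
      rw [zero_smul] at this
      exact this.mono_left nhdsWithin_le_nhds
    · filter_upwards [self_mem_nhdsWithin] with t ht using smul_ne_zero ht hz0
  have hnorm : ∀ n : ℕ, (fun t : ℂ => ‖t • z‖ ^ n) =O[𝓝[≠] 0] fun t : ℂ => t ^ n := fun n => by
    refine IsBigO.pow (IsBigO.of_bound ‖z‖ (Eventually.of_forall fun t => ?_)) n
    rw [norm_norm, norm_smul, mul_comm]
  have hR : AnalyticAt ℂ (fun z => k z - P z) 0 := hk.sub (hP 0)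
  have hdR := isBigO_fderiv hR hkP
  have hdP : fderiv ℂ P =O[𝓝[≠] 0] fun z => ‖z‖ ^ (r - 1) :=
    isBigO_fderiv (hP 0) (by rwa [Nat.sub_add_cancel hr])
  have hXd : HasDerivAt (fun t : ℂ => X (t • z)) (a • z) 0 := by
    have h1 : HasFDerivAt X (fderiv ℂ X 0) ((0 : ℂ) • z) := by
      rw [zero_smul]; exact hX.differentiableAt.hasFDerivAt
    rw [← hDX]
    exact h1.comp_hasDerivAt (0 : ℂ) hline
  have e1 : (fun t : ℂ => X (t • z) - t • a • z) =o[𝓝[≠] 0] fun t : ℂ => t := by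
    have := (hasDerivAt_iff_isLittleO.1 hXd).mono (nhdsWithin_le_nhds (s := {0}ᶜ))
    simpa [hX0] using this
  have e2 : (fun t : ℂ => X (t • z)) =O[𝓝[≠] 0] fun t : ℂ => t := by
    have := hXd.isBigO_sub.mono (nhdsWithin_le_nhds (s := {0}ᶜ))
    simpa [hX0] using this
  have hsmall : (fun t : ℂ => t ^ (r + 1)) =o[𝓝[≠] 0] fun t : ℂ => t ^ r :=
    (isLittleO_pow_pow (𝕜 := ℂ) (Nat.lt_succ_self r)).mono nhdsWithin_le_nhds
  have e3 : (fun t : ℂ => d * (k (t • z) - P (t • z))) =o[𝓝[≠] 0] fun t : ℂ => t ^ r :=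
    ((((hkP.mono nhdsWithin_le_nhds).comp_tendsto ht).trans (hnorm (r + 1))).const_mul_left
      d).trans_isLittleO hsmall
  have e4 : (fun t : ℂ => fderiv ℂ (fun z => k z - P z) (t • z) (X (t • z))) =o[𝓝[≠] 0]
      fun t : ℂ => t ^ r := by
    refine IsBigO.trans_isLittleO (IsBigO.trans (IsBigO.of_bound 1 (Eventually.of_forall
      fun t => ?_)) (((hdR.comp_tendsto ht).trans (hnorm r)).norm_left.mul e2.norm_left)) ?_
    · rw [one_mul, norm_mul, norm_norm, norm_norm]
      exact ContinuousLinearMap.le_opNorm _ _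
    · simpa only [pow_succ] using hsmall
  have e5 : (fun t : ℂ => fderiv ℂ P (t • z) (X (t • z) - t • a • z)) =o[𝓝[≠] 0]
      fun t : ℂ => t ^ r := by
    refine IsBigO.trans_isLittleO (IsBigO.of_bound 1 (Eventually.of_forall fun t => ?_))
      ((((hdP.comp_tendsto ht).trans (hnorm (r - 1))).norm_left.mul_isLittleO
        e1.norm_left).congr_right fun t => ?_)
    · rw [one_mul, norm_mul, norm_norm, norm_norm]
      exact ContinuousLinearMap.le_opNorm _ _
    · rw [← pow_succ, Nat.sub_add_cancel hr]
  have hEuler : ∀ y, fderiv ℂ P y y = r * P y := by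
    intro y
    have h1 : HasDerivAt (fun s : ℂ => s • y) y 1 := by
      simpa using (hasDerivAt_id (1 : ℂ)).smul_const y
    have h2 : HasFDerivAt P (fderiv ℂ P y) ((1 : ℂ) • y) := by
      rw [one_smul]; exact (hP y).differentiableAt.hasFDerivAt
    have h3 := h2.comp_hasDerivAt (1 : ℂ) h1
    have h4 := (hasDerivAt_pow r (1 : ℂ)).mul_const (P y)
    have h5 : (P ∘ fun s : ℂ => s • y) = fun s => s ^ r * P y := funext fun s => hPr s y
    rw [h5] at h3
    simpa using h3.unique h4
  have e6 : (fun t : ℂ => (a * r - d) * P z * t ^ r) =o[𝓝[≠] 0] fun t : ℂ => t ^ r := by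
    refine ((e3.sub e4).sub e5).congr' ?_ EventuallyEq.rfl
    have ht' := ht.mono_right nhdsWithin_le_nhds
    filter_upwards [ht'.eventually hkX, ht'.eventually hk.eventually_analyticAt] with t h1 h2
    have h3 : fderiv ℂ (fun z => k z - P z) (t • z) = fderiv ℂ k (t • z) - fderiv ℂ P (t • z) :=
      fderiv_fun_sub h2.differentiableAt (hP _).differentiableAt
    have h4 := hEuler (t • z)
    have h5 : t • a • z = a • t • z := smul_comm _ _ _
    rw [h3, h5, map_sub, map_smul, h4, sub_apply, h1, hPr, smul_eq_mul]
    ring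
  have e7 : (fun _ : ℂ => (a * r - d) * P z) =o[𝓝[≠] (0 : ℂ)] fun _ : ℂ => (1 : ℂ) := by
    refine IsLittleO.of_bound fun c hc => ?_
    filter_upwards [e6.bound hc, self_mem_nhdsWithin] with t h1 ht0
    have h2 : 0 < ‖t ^ r‖ := norm_pos_iff.2 (pow_ne_zero _ ht0)
    rw [norm_mul] at h1
    rw [norm_one, mul_one]
    exact le_of_mul_le_mul_right h1 h2
  rw [isLittleO_const_const_iff] at e7
  exact sub_eq_zero.1 ((mul_eq_zero.1 e7).resolve_right hz)

/-- The convergence is joint in the parameter and the point, because the rescaled inverse will be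
evaluated at moving points. -/
theorem tendsto_leadingPart {k P : V → ℂ} {r : ℕ} (hP : ∀ z, AnalyticAt ℂ P z)
    (hPr : ∀ (s : ℂ) z, P (s • z) = s ^ r * P z)
    (hkP : (fun z => k z - P z) =O[𝓝 0] fun z => ‖z‖ ^ (r + 1)) (z : V) :
    Tendsto (fun q : ℝ × V => ((q.1 : ℂ) ^ r)⁻¹ * k ((q.1 : ℂ) • q.2)) (𝓝[>] 0 ×ˢ 𝓝 z)
      (𝓝 (P z)) := by
  have hsnd : Tendsto (fun q : ℝ × V => P q.2) (𝓝[>] 0 ×ˢ 𝓝 z) (𝓝 (P z)) :=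
    (hP z).continuousAt.tendsto.comp tendsto_snd
  have hfst : Tendsto (fun q : ℝ × V => q.1) (𝓝[>] 0 ×ˢ 𝓝 z) (𝓝 0) :=
    tendsto_fst.mono_right nhdsWithin_le_nhds
  have hsm : Tendsto (fun q : ℝ × V => (q.1 : ℂ) • q.2) (𝓝[>] 0 ×ˢ 𝓝 z) (𝓝 0) := by
    have := ((Complex.continuous_ofReal.tendsto 0).comp hfst).smul
      (tendsto_snd (f := 𝓝[>] (0 : ℝ)) (g := 𝓝 z))
    simpa using this
  have h1 := hkP.comp_tendsto hsm
  obtain ⟨C, hC⟩ := h1.bound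
  have h2 : Tendsto (fun q : ℝ × V => ((q.1 : ℂ) ^ r)⁻¹ * k ((q.1 : ℂ) • q.2) - P q.2)
      (𝓝[>] 0 ×ˢ 𝓝 z) (𝓝 0) := by
    have hlim : Tendsto (fun q : ℝ × V => C * (q.1 * ‖q.2‖ ^ (r + 1))) (𝓝[>] 0 ×ˢ 𝓝 z) (𝓝 0) := by
      have := (hfst.mul ((tendsto_snd (f := 𝓝[>] (0 : ℝ)) (g := 𝓝 z)).norm.pow (r + 1))).const_mul C
      simpa using this
    refine squeeze_zero_norm' ?_ hlim
    have hpos : ∀ᶠ q : ℝ × V in 𝓝[>] 0 ×ˢ 𝓝 z, 0 < q.1 :=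
      tendsto_fst.eventually (self_mem_nhdsWithin (s := Set.Ioi (0 : ℝ)))
    filter_upwards [hC, hpos] with q hq hq0
    have hq0' : (q.1 : ℂ) ^ r ≠ 0 := pow_ne_zero _ (Complex.ofReal_ne_zero.2 hq0.ne')
    have h3 : ((q.1 : ℂ) ^ r)⁻¹ * k ((q.1 : ℂ) • q.2) - P q.2 =
        ((q.1 : ℂ) ^ r)⁻¹ * (k ((q.1 : ℂ) • q.2) - P ((q.1 : ℂ) • q.2)) := by
      rw [hPr]; field_simp
    rw [Function.comp_apply, Function.comp_apply, norm_pow, norm_norm, norm_smul,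
      Complex.norm_of_nonneg hq0.le] at hq
    rw [h3, norm_mul, norm_inv, norm_pow, Complex.norm_of_nonneg hq0.le,
      inv_mul_le_iff₀ (by positivity)]
    refine hq.trans (le_of_eq ?_)
    ring
  simpa using h2.add hsnd

end LeadingPart


open Module (finrank)

/-! ### Rescaling a local isomorphism to a homogeneous one -/

section TangentMap

variable {V₁ : Type u} [NormedAddCommGroup V₁] [NormedSpace ℂ V₁] [FiniteDimensional ℂ V₁]
  {V₂ : Type v} [NormedAddCommGroup V₂] [NormedSpace ℂ V₂] [FiniteDimensional ℂ V₂]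
  {G₁ : Subgroup (V₁ ≃ₗ[ℂ] V₁)} {G₂ : Subgroup (V₂ ≃ₗ[ℂ] V₂)} [Finite G₁] [Finite G₂]
  {c₁ : OrbitCoordinates G₁} {c₂ : OrbitCoordinates G₂}
  {Φ : OpenPartialHomeomorph (Fin (finrank ℂ V₁) → ℂ) (Fin (finrank ℂ V₂) → ℂ)}

/-- Scalar multiplication in the coordinates of the orbit space. -/
def OrbitCoordinates.scale (c : OrbitCoordinates G₁) (s : ℂ) (x : Fin (finrank ℂ V₁) → ℂ) :
    Fin (finrank ℂ V₁) → ℂ := fun i => s ^ c.deg i * x i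

theorem OrbitCoordinates.coord_smul_eq (c : OrbitCoordinates G₁) (s : ℂ) (z : V₁) :
    c.coord (s • z) = c.scale s (c.coord z) := funext fun i => c.coord_smul s z i

theorem OrbitCoordinates.scale_mem_disc (c : OrbitCoordinates G₁) (s : ℂ)
    {x : Fin (finrank ℂ V₁) → ℂ} (hx : x ∈ c.disc) : c.scale s x ∈ c.disc := by
  obtain ⟨z, rfl⟩ := c.coord_surjective x
  rw [← c.coord_smul_eq]
  rw [c.coord_mem_disc] at hx ⊢
  refine fun h => hx fun H hH hz => h H hH (H.smul_mem s hz)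

theorem OrbitCoordinates.isClosed_disc (c : OrbitCoordinates G₁) : IsClosed c.disc := by
  rw [← isOpen_compl_iff, isOpen_iff_mem_nhds]
  intro x hx
  obtain ⟨z, rfl⟩ := c.coord_surjective x
  have hz : z ∈ arrComplement (reflHyperplanes G₁) := by
    by_contra h
    exact hx (c.coord_mem_disc.2 h)
  refine c.eventually_coord.2 ?_
  filter_upwards [isOpen_arrComplement.mem_nhds hz] with y hy h
  exact c.coord_mem_disc.1 h hy

theorem OrbitCoordinates.map_coord_nhds (c : OrbitCoordinates G₁) (z : V₁) :
    map c.coord (𝓝 z) = 𝓝 (c.coord z) :=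
  Filter.ext fun _ => c.eventually_coord.symm

theorem OrbitCoordinates.tendsto_scale (c : OrbitCoordinates G₁) (x : Fin (finrank ℂ V₁) → ℂ) :
    Tendsto (fun t : ℝ => c.scale (t : ℂ) x) (𝓝[>] 0) (𝓝 0) := by
  have h : Continuous fun t : ℝ => c.scale (t : ℂ) x :=
    continuous_pi fun i => by unfold OrbitCoordinates.scale; fun_prop
  have h0 := h.tendsto 0
  have h1 : c.scale ((0 : ℝ) : ℂ) x = 0 := funext fun i => by
    simp [OrbitCoordinates.scale, (c.deg_pos i).ne']
  rw [h1] at h0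
  exact h0.mono_left nhdsWithin_le_nhds

/-- `p` is the limit of `Φ` under the scalings of source and target; `γ` is the ratio of their
rates. -/
structure IsTangentMap (c₁ : OrbitCoordinates G₁) (c₂ : OrbitCoordinates G₂)
    (Φ : (Fin (finrank ℂ V₁) → ℂ) → (Fin (finrank ℂ V₂) → ℂ)) (γ : ℝ)
    (p : (Fin (finrank ℂ V₁) → ℂ) → (Fin (finrank ℂ V₂) → ℂ)) (r : Fin (finrank ℂ V₂) → ℕ) :
    Prop where
  analyticAt : ∀ x, AnalyticAt ℂ p x
  weight : ∀ j, γ * r j = c₂.deg j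
  homogeneous : ∀ (s : ℂ) x j, p (c₁.scale s x) j = s ^ r j * p x j
  tendsto : ∀ x j, Tendsto
    (fun q : ℝ × (Fin (finrank ℂ V₁) → ℂ) => ((q.1 : ℂ) ^ r j)⁻¹ * Φ (c₁.scale q.1 q.2) j)
    (𝓝[>] 0 ×ˢ 𝓝 x) (𝓝 (p x j))

/-- If a coordinate of `Φ` vanished near the origin, it would vanish on an open subset of the
target, since `Φ` is open. So every component of `Φ` has a leading part. -/
theorem IsCoordIso.frequently_ne_zero (h0 : 0 ∈ Φ.source) (h00 : Φ 0 = 0)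
    (j : Fin (finrank ℂ V₂)) : ∃ᶠ z in 𝓝 (0 : V₁), Φ (c₁.coord z) j ≠ 0 := by
  intro hev
  simp only [not_not] at hev
  have h1 : ∀ᶠ x in 𝓝 (0 : Fin (finrank ℂ V₁) → ℂ), Φ x j = 0 := by
    rw [← c₁.coord_zero]; exact c₁.eventually_coord.2 hev
  have h2 : Tendsto Φ.symm (𝓝 0) (𝓝 0) := by
    have := Φ.symm.continuousAt (x := Φ 0) (Φ.map_source h0)
    rw [ContinuousAt, Φ.left_inv h0, h00] at this
    exact this
  have h3 : ∀ᶠ y in 𝓝 (0 : Fin (finrank ℂ V₂) → ℂ), y j = 0 := by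
    have h4 : ∀ᶠ y in 𝓝 (0 : Fin (finrank ℂ V₂) → ℂ), y ∈ Φ.target :=
      Φ.open_target.mem_nhds (by rw [← h00]; exact Φ.map_source h0)
    filter_upwards [h2.eventually h1, h4] with y hy hy'
    rwa [Φ.right_inv hy'] at hy
  have h5 : Tendsto (fun t : ℂ => t • (Pi.single j 1 : Fin (finrank ℂ V₂) → ℂ)) (𝓝[≠] 0) (𝓝 0) := by
    have h6 : Continuous fun t : ℂ => t • (Pi.single j 1 : Fin (finrank ℂ V₂) → ℂ) := by fun_prop
    have h7 := h6.tendsto 0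
    rw [zero_smul] at h7
    exact h7.mono_left nhdsWithin_le_nhds
  obtain ⟨t, ht, ht0⟩ := ((h5.eventually h3).and self_mem_nhdsWithin).exists
  refine ht0 ?_
  simpa using ht

/-- The components of `Φ` on `V₁` are eigenfunctions of `X` with the degrees of the second group as
eigenvalues; this fixes the degrees of their leading parts. As limits of rescaled invariant
functions the leading parts are invariant, and so they descend to `p`. -/
theorem IsCoordIso.exists_isTangentMap (h : IsCoordIso c₁ c₂ Φ) (h0 : 0 ∈ Φ.source)
    (h00 : Φ 0 = 0) {X : V₁ → V₁} {γ : ℝ} (hX : AnalyticAt ℂ X 0) (hX0 : X 0 = 0)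
    (hDX : ∀ v, fderiv ℂ X 0 v = (γ : ℂ) • v)
    (hXΦ : ∀ᶠ z in 𝓝 0,
      fderiv ℂ (fun y => Φ (c₁.coord y)) z (X z) = c₂.euler (Φ (c₁.coord z))) :
    ∃ p r, IsTangentMap c₁ c₂ Φ γ p r := by
  have hΦ0 : AnalyticAt ℂ (fun y => Φ (c₁.coord y)) 0 :=
    AnalyticAt.comp (g := Φ) (f := c₁.coord) (h.analyticAt _ (by rwa [c₁.coord_zero]))
      (c₁.analyticAt_coord 0)
  have hΦa : ∀ j, AnalyticAt ℂ (fun y => Φ (c₁.coord y) j) 0 := fun j =>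
    analyticAt_pi_iff.1 hΦ0 j
  choose r P hr hP hPr hP0 hPO hkP using fun j => exists_leadingPart (hΦa j)
    (by simp [c₁.coord_zero, h00]) (IsCoordIso.frequently_ne_zero (c₁ := c₁) h0 h00 j)
  have hlim := fun j z => tendsto_leadingPart (hP j) (hPr j) (hkP j) z
  have hinv : ∀ j, ∀ g ∈ G₁, ∀ z, P j (g z) = P j z := by
    intro j g hg z
    have hz : ∀ z : V₁, Tendsto (fun t : ℝ => (t, z)) (𝓝[>] 0) (𝓝[>] 0 ×ˢ 𝓝 z) := fun z =>
      tendsto_id.prodMk tendsto_const_nhds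
    refine tendsto_nhds_unique ((hlim j (g z)).comp (hz (g z))) (((hlim j z).comp (hz z)).congr
      fun t => ?_)
    simp only [Function.comp_apply]
    rw [← map_smul, c₁.coord_map hg]
  let p : (Fin (finrank ℂ V₁) → ℂ) → (Fin (finrank ℂ V₂) → ℂ) := fun x j =>
    P j (Function.surjInv c₁.coord_surjective x)
  have hp : ∀ z j, p (c₁.coord z) j = P j z := by
    intro z j
    have h1 : orbitMk G₁ (Function.surjInv c₁.coord_surjective (c₁.coord z)) = orbitMk G₁ z :=
      c₁.toHomeo.injective (Function.surjInv_eq c₁.coord_surjective (c₁.coord z))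
    obtain ⟨g, hg, hgz⟩ := orbitMk_eq_iff.1 h1
    change P j _ = _
    conv_rhs => rw [hgz, hinv j g hg]
  refine ⟨p, r, ⟨fun x => ?_, fun j => ?_, fun s x j => ?_, fun x j => ?_⟩⟩
  · obtain ⟨z, rfl⟩ := c₁.coord_surjective x
    have h1 := (c₁.analyticAt_iff (fun o => p (c₁.toHomeo o)) z).1 (by
      refine analyticAt_pi_iff.2 fun j => ?_
      exact (hP j z).congr (Eventually.of_forall fun y => (hp y j).symm))
    simpa using h1
  · have h1 : (γ : ℂ) * r j = c₂.deg j := by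
      refine mul_degree_eq (hΦa j) hX hX0 hDX ?_ (hr j) (hP j) (hPr j) (hP0 j) (hPO j) (hkP j)
      filter_upwards [hXΦ, hΦ0.eventually_analyticAt] with z hz hz'
      have h2 := congrFun hz j
      rw [c₂.euler_apply] at h2
      rw [← h2]
      have h3 := hasFDerivAt_pi'.1 hz'.differentiableAt.hasFDerivAt j
      rw [h3.fderiv]
      rfl
    exact_mod_cast h1
  · obtain ⟨z, rfl⟩ := c₁.coord_surjective x
    rw [← c₁.coord_smul_eq, hp, hp, hPr]
  · obtain ⟨z, rfl⟩ := c₁.coord_surjective x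
    rw [hp, ← c₁.map_coord_nhds, ← map_id (f := 𝓝[>] (0 : ℝ)), prod_map_map_eq, tendsto_map'_iff]
    refine (hlim j z).congr fun q => ?_
    simp only [Function.comp_apply, id_eq]
    rw [c₁.coord_smul_eq]

/-- Scaling the source by `t` corresponds to scaling the target by `t ^ (1 / γ)`, because `γ * r j`
is the degree of the `j`-th coordinate. -/
theorem IsTangentMap.tendsto_scale {γ : ℝ} {p r} (hp : IsTangentMap c₁ c₂ Φ γ p r) (hγ : 0 < γ)
    (x : Fin (finrank ℂ V₁) → ℂ) :
    Tendsto (fun t : ℝ => c₂.scale ((t ^ γ⁻¹ : ℝ) : ℂ)⁻¹ (Φ (c₁.scale t x))) (𝓝[>] 0)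
      (𝓝 (p x)) := by
  refine tendsto_pi_nhds.2 fun j => ?_
  refine ((hp.tendsto x j).comp (tendsto_id.prodMk tendsto_const_nhds)).congr' ?_
  filter_upwards [self_mem_nhdsWithin] with t ht
  have ht : (0 : ℝ) < t := ht
  change ((t : ℂ) ^ r j)⁻¹ * _ = (((t ^ γ⁻¹ : ℝ) : ℂ)⁻¹) ^ c₂.deg j * _
  congr 1
  rw [inv_pow]
  congr 1
  norm_cast
  rw [← Real.rpow_natCast (t ^ γ⁻¹), ← Real.rpow_mul ht.le, ← hp.weight, inv_mul_cancel_left₀ hγ.ne',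
    Real.rpow_natCast]

/-- The discriminants are closed and stable under scaling, so the property passes to the limit. -/
theorem IsTangentMap.mem_disc {γ : ℝ} {p r} (hp : IsTangentMap c₁ c₂ Φ γ p r) (hγ : 0 < γ)
    (h : IsCoordIso c₁ c₂ Φ) (h0 : 0 ∈ Φ.source) {x : Fin (finrank ℂ V₁) → ℂ} (hx : x ∈ c₁.disc) :
    p x ∈ c₂.disc := by
  refine c₂.isClosed_disc.mem_of_tendsto (hp.tendsto_scale hγ x) ?_
  filter_upwards [(c₁.tendsto_scale x).eventually (Φ.open_source.mem_nhds h0)] with t ht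
  exact c₂.scale_mem_disc _ ((h.disc _ ht).1 (c₁.scale_mem_disc _ hx))

/-- For every small `t > 0` the rescalings of `Φ` at a point and of `Φ.symm` at its image are
inverse to each other, and joint convergence allows the passage to the limit. The rates match
because the two exponents are reciprocal. -/
theorem IsTangentMap.leftInverse {γ : ℝ} {p p' r r'} (hp : IsTangentMap c₁ c₂ Φ γ p r) (hγ : 0 < γ)
    (hp' : IsTangentMap c₂ c₁ Φ.symm γ⁻¹ p' r') (h0 : 0 ∈ Φ.source) (x) : p' (p x) = x := by
  have hs : Tendsto (fun t : ℝ => t ^ γ⁻¹) (𝓝[>] 0) (𝓝[>] 0) := by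
    refine tendsto_nhdsWithin_iff.2 ⟨?_, ?_⟩
    · have h1 := (Real.continuous_rpow_const (inv_pos.2 hγ).le).tendsto 0
      rw [Real.zero_rpow (inv_ne_zero hγ.ne')] at h1
      exact h1.mono_left nhdsWithin_le_nhds
    · filter_upwards [self_mem_nhdsWithin] with t ht using Real.rpow_pos_of_pos ht _
  funext i
  refine tendsto_nhds_unique ((hp'.tendsto (p x) i).comp (hs.prodMk (hp.tendsto_scale hγ x)))
    (tendsto_const_nhds.congr' ?_)
  filter_upwards [(c₁.tendsto_scale x).eventually (Φ.open_source.mem_nhds h0),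
    self_mem_nhdsWithin] with t ht ht0
  have ht0 : (0 : ℝ) < t := ht0
  have hs0 : ((t ^ γ⁻¹ : ℝ) : ℂ) ≠ 0 := Complex.ofReal_ne_zero.2 (Real.rpow_pos_of_pos ht0 _).ne'
  have h1 : ∀ y, c₂.scale ((t ^ γ⁻¹ : ℝ) : ℂ) (c₂.scale ((t ^ γ⁻¹ : ℝ) : ℂ)⁻¹ y) = y := by
    intro y
    funext j
    simp only [OrbitCoordinates.scale]
    rw [← mul_assoc, ← mul_pow, mul_inv_cancel₀ hs0, one_pow, one_mul]
  have h2 : ((t ^ γ⁻¹ : ℝ) : ℂ) ^ r' i = (t : ℂ) ^ c₁.deg i := by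
    norm_cast
    rw [← Real.rpow_natCast (t ^ γ⁻¹), ← Real.rpow_mul ht0.le, hp'.weight, Real.rpow_natCast]
  simp only [Function.comp_apply]
  rw [h1, Φ.left_inv ht, h2]
  change x i = _ * (_ * x i)
  rw [inv_mul_cancel_left₀ (pow_ne_zero _ (Complex.ofReal_ne_zero.2 ht0.ne'))]

end TangentMap


open Module (finrank)

/-! ### The scalars in a finite linear group -/

section Scalars

variable {V : Type*} [NormedAddCommGroup V] [NormedSpace ℂ V] [FiniteDimensional ℂ V]

/-- The group of scalars in `G`. -/
def scalarSubgroup (G : Subgroup (V ≃ₗ[ℂ] V)) : Subgroup ℂˣ where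
  carrier := {c | (LinearEquiv.smulOfUnit c : V ≃ₗ[ℂ] V) ∈ G}
  one_mem' := by
    change _ ∈ G
    convert! G.one_mem using 1
    ext v; simp [smulOfUnit_apply]
  mul_mem' {a b} ha hb := by
    change _ ∈ G
    convert! G.mul_mem ha hb using 1
    ext v; exact mul_smul (a : ℂ) (b : ℂ) v
  inv_mem' {a} ha := by
    change _ ∈ G
    convert! G.inv_mem ha using 1

/-- Lagrange's theorem gives one inclusion, and there are at most as many roots of unity as the
order. -/
theorem scalarSubgroup_eq_rootsOfUnity [Nontrivial V] (G : Subgroup (V ≃ₗ[ℂ] V)) [Finite G] :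
    scalarSubgroup G = rootsOfUnity (scalarOrder G) ℂ := by
  have hm : NeZero (scalarOrder G) := ⟨(scalarOrder_pos G).ne'⟩
  refine Subgroup.eq_of_le_of_card_ge (fun c hc => ?_) (card_rootsOfUnity ℂ (scalarOrder G))
  rw [mem_rootsOfUnity]
  exact congrArg Subtype.val (pow_card_eq_one' (x := (⟨c, hc⟩ : scalarSubgroup G)))

/-- The kernel of the action of the scalars on the orbit space. -/
theorem forall_orbitMk_smul_iff [Nontrivial V] (G : Subgroup (V ≃ₗ[ℂ] V)) [Finite G] (μ : ℂˣ) :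
    (∀ z, orbitMk G ((μ : ℂ) • z) = orbitMk G z) ↔ μ ^ scalarOrder G = 1 := by
  rw [← mem_rootsOfUnity, ← scalarSubgroup_eq_rootsOfUnity]
  constructor
  · intro h
    by_contra hμ
    -- A vector `z` such that `g z ≠ μ z` for all `g` in `G`: if `μ` is not a scalar in `G`, each of
    -- these eigenspaces is proper.
    have hd := dense_compl_iUnion_submodule (E := V)
      (𝒮 := (fun g : V ≃ₗ[ℂ] V => LinearMap.ker ((g : V →ₗ[ℂ] V) - (μ : ℂ) • LinearMap.id)) ''
        (G : Set (V ≃ₗ[ℂ] V))) ((Set.toFinite (G : Set (V ≃ₗ[ℂ] V))).image _) (by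
        rintro _ ⟨g, hg, rfl⟩ htop
        refine hμ ?_
        change _ ∈ G
        convert! (show g ∈ G from hg) using 1
        ext v
        have h1 := LinearMap.congr_fun (LinearMap.ker_eq_top.1 htop) v
        exact (sub_eq_zero.1 h1).symm)
    obtain ⟨z, hz⟩ := hd.nonempty
    obtain ⟨g, hg, hgz⟩ := orbitMk_eq_iff.1 (h z).symm
    refine hz _ ⟨g, hg, rfl⟩ ?_
    rw [LinearMap.mem_ker]
    exact sub_eq_zero.2 hgz.symm
  · intro h z
    exact orbitMk_map h z

end Scalars

/-! ### The equivariant isomorphism of orbit spaces -/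

section GermIso

variable {V₁ : Type u} [NormedAddCommGroup V₁] [NormedSpace ℂ V₁] [FiniteDimensional ℂ V₁]
  {V₂ : Type v} [NormedAddCommGroup V₂] [NormedSpace ℂ V₂] [FiniteDimensional ℂ V₂]
  {G₁ : Subgroup (V₁ ≃ₗ[ℂ] V₁)} {G₂ : Subgroup (V₂ ≃ₗ[ℂ] V₂)} [Finite G₁] [Finite G₂]
  {c₁ : OrbitCoordinates G₁} {c₂ : OrbitCoordinates G₂}
  {Φ : OpenPartialHomeomorph (Fin (finrank ℂ V₁) → ℂ) (Fin (finrank ℂ V₂) → ℂ)}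

/-- A bijection between orbit spaces that multiplies the logarithm of scalars by a constant is
equivariant for the effective actions. -/
theorem isEffEquivariant_of_exp [Nontrivial V₁] [Nontrivial V₂]
    {f : OrbitSpace G₁ ≃ OrbitSpace G₂} {γ : ℝ} (hγ : 0 < γ)
    (hf : ∀ (σ : ℂ) z₁ z₂, f (orbitMk G₁ z₁) = orbitMk G₂ z₂ →
      f (orbitMk G₁ (Complex.exp σ • z₁)) = orbitMk G₂ (Complex.exp (σ / γ) • z₂)) :
    IsEffEquivariant G₁ G₂ f := by
  set m₁ := scalarOrder G₁ with hm₁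
  set m₂ := scalarOrder G₂ with hm₂
  have hp₁ : 0 < m₁ := scalarOrder_pos G₁
  have hp₂ : 0 < m₂ := scalarOrder_pos G₂
  have hγ' : (γ : ℂ) ≠ 0 := Complex.ofReal_ne_zero.2 hγ.ne'
  have hm₁' : (m₁ : ℂ) ≠ 0 := Nat.cast_ne_zero.2 hp₁.ne'
  have hm₂' : (m₂ : ℂ) ≠ 0 := Nat.cast_ne_zero.2 hp₂.ne'
  -- The bijection matches the logarithms of scalars acting trivially on either side: `m₁ σ` is in
  -- `2πiℤ` exactly if `m₂ σ / γ` is. Hence `m₂` and `m₁ γ` are integral multiples of each other,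
  -- and being positive they are equal.
  have hker : ∀ σ : ℂ, Complex.exp (m₁ * σ) = 1 ↔ Complex.exp (m₂ * (σ / γ)) = 1 := by
    intro σ
    have h1 := forall_orbitMk_smul_iff G₁ (Units.mk0 _ (Complex.exp_ne_zero σ))
    have h2 := forall_orbitMk_smul_iff G₂ (Units.mk0 _ (Complex.exp_ne_zero (σ / γ)))
    rw [← Units.val_inj, Units.val_pow_eq_pow_val, Units.val_mk0, Units.val_one,
      ← Complex.exp_nat_mul] at h1 h2
    rw [← h1, ← h2]
    constructor
    · intro h z₂
      obtain ⟨z₁, hz₁⟩ := orbitMk_surjective (G := G₁) (f.symm (orbitMk G₂ z₂))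
      have h3 : f (orbitMk G₁ z₁) = orbitMk G₂ z₂ := by rw [hz₁, f.apply_symm_apply]
      rw [← hf σ z₁ z₂ h3, h z₁, h3]
    · intro h z₁
      obtain ⟨z₂, hz₂⟩ := orbitMk_surjective (G := G₂) (f (orbitMk G₁ z₁))
      refine f.injective ?_
      rw [hf σ z₁ z₂ hz₂.symm, h z₂, hz₂]
  have hpi : (2 * Real.pi * Complex.I : ℂ) ≠ 0 := Complex.two_pi_I_ne_zero
  obtain ⟨n, hn⟩ := Complex.exp_eq_one_iff.1 ((hker (2 * Real.pi * Complex.I / m₁)).1 (by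
    rw [mul_div_cancel₀ _ hm₁', Complex.exp_two_pi_mul_I]))
  obtain ⟨n', hn'⟩ := Complex.exp_eq_one_iff.1 ((hker (γ * (2 * Real.pi * Complex.I) / m₂)).2 (by
    rw [mul_div_assoc, mul_div_cancel_left₀ _ hγ', mul_div_cancel₀ _ hm₂',
      Complex.exp_two_pi_mul_I]))
  have hn1 : (m₂ : ℂ) = n * (m₁ * γ) := by
    field_simp at hn
    linear_combination hn
  have hn2 : (m₁ : ℂ) * γ = n' * m₂ := by
    field_simp at hn'
    linear_combination hn'
  have hn3 : n * n' = 1 := by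
    have h1 : (m₂ : ℂ) * (n * n') = m₂ * 1 := by rw [hn2] at hn1; linear_combination -hn1
    exact_mod_cast mul_left_cancel₀ hm₂' h1
  have hn0 : 0 < n := by
    have h1 : (m₂ : ℝ) = n * (m₁ * γ) := by exact_mod_cast hn1
    have h2 : (0 : ℝ) < n := pos_of_mul_pos_left (by rw [← h1]; positivity) (by positivity)
    exact_mod_cast h2
  have hn4 : n = 1 := by
    rcases Int.eq_one_or_neg_one_of_mul_eq_one hn3 with h | h <;> omega
  rw [hn4, Int.cast_one, one_mul] at hn1
  intro t a b ha hb z₁ z₂ hz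
  have h1 : (Complex.exp (Complex.log a / γ)) ^ m₂ = (t : ℂ) := by
    rw [← Complex.exp_nat_mul, hn1, mul_assoc, mul_div_cancel₀ _ hγ', Complex.exp_nat_mul,
      Complex.exp_log a.ne_zero, ← ha, Units.val_pow_eq_pow_val]
  have h2 := hf (Complex.log a) z₁ z₂ hz
  rw [Complex.exp_log a.ne_zero] at h2
  -- The given root `b` and the one obtained from the logarithm of `a` differ by an `m₂`-th root of
  -- unity, which acts trivially on the second orbit space.
  set e := Units.mk0 _ (Complex.exp_ne_zero (Complex.log a / γ)) with he
  have h3 : (b * e⁻¹) ^ m₂ = 1 := by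
    have h4 : e ^ m₂ = t := Units.ext (by rw [Units.val_pow_eq_pow_val]; exact h1)
    rw [mul_pow, inv_pow, h4, hb, mul_inv_cancel]
  have h4 := (forall_orbitMk_smul_iff G₂ (b * e⁻¹)).2 h3 ((e : ℂ) • z₂)
  rw [smul_smul, ← Units.val_mul, inv_mul_cancel_right] at h4
  rw [h2, h4]
  rfl

/-- The homeomorphism defined by a tangent map with inverse. -/
theorem IsTangentMap.exists_isDiscriminantIso [Nontrivial V₁] [Nontrivial V₂] {γ : ℝ} {p p' r r'}
    (hγ : 0 < γ) (hp : IsTangentMap c₁ c₂ Φ γ p r) (hp' : IsTangentMap c₂ c₁ Φ.symm γ⁻¹ p' r')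
    (h : IsCoordIso c₁ c₂ Φ) (h0 : 0 ∈ Φ.source) (h00 : Φ 0 = 0) :
    ∃ f : OrbitSpace G₁ ≃ₜ OrbitSpace G₂, IsDiscriminantIso G₁ G₂ f := by
  have h0' : 0 ∈ Φ.symm.source := by
    have := Φ.map_source h0
    rwa [h00] at this
  have hl := hp.leftInverse hγ hp' h0
  have hr : ∀ y, p (p' y) = y := hp'.leftInverse (inv_pos.2 hγ)
    (by rw [inv_inv]; exact hp) h0'
  let P : (Fin (finrank ℂ V₁) → ℂ) ≃ₜ (Fin (finrank ℂ V₂) → ℂ) :=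
    { toFun := p
      invFun := p'
      left_inv := hl
      right_inv := hr
      continuous_toFun := continuous_iff_continuousAt.2 fun x => (hp.analyticAt x).continuousAt
      continuous_invFun := continuous_iff_continuousAt.2 fun x => (hp'.analyticAt x).continuousAt }
  have hdisc : ∀ x, x ∈ c₁.disc ↔ p x ∈ c₂.disc := fun x =>
    ⟨hp.mem_disc hγ h h0, fun hx => by
      have := hp'.mem_disc (inv_pos.2 hγ) h.symm h0' hx
      rwa [hl] at this⟩
  have hP : IsCoordIso c₁ c₂ P.toOpenPartialHomeomorph :=
    ⟨fun x _ => hp.analyticAt x, fun y _ => hp'.analyticAt y, fun x _ => hdisc x⟩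
  have hloc := hP.isLocalDiscIso
  let f : OrbitSpace G₁ ≃ₜ OrbitSpace G₂ := (c₁.toHomeo.trans P).trans c₂.toHomeo.symm
  have hfapp : ∀ x, orbitIso c₁ c₂ P.toOpenPartialHomeomorph x = f x := fun x => rfl
  refine ⟨f, ⟨fun x k => ?_, ?_, ?_⟩⟩
  · exact hloc.hol x (mem_orbitIso_source.2 (Set.mem_univ _)) k
  · have hd : ∀ x, x ∈ discriminant G₁ ↔ f x ∈ discriminant G₂ := fun x =>
      hloc.disc x (mem_orbitIso_source.2 (Set.mem_univ _))
    ext y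
    constructor
    · rintro ⟨x, hx, rfl⟩
      exact (hd x).1 hx
    · intro hy
      exact ⟨f.symm y, (hd _).2 (by rwa [f.apply_symm_apply]), f.apply_symm_apply y⟩
  · refine isEffEquivariant_of_exp (f := f.toEquiv) hγ fun σ z₁ z₂ hz => ?_
    have hf : ∀ z w, f (orbitMk G₁ z) = orbitMk G₂ w ↔ p (c₁.coord z) = c₂.coord w := fun z w =>
      c₂.toHomeo.symm_apply_eq
    have hz' := (hf z₁ z₂).1 hz
    refine (hf _ _).2 (funext fun j => ?_)
    rw [c₁.coord_smul_eq, hp.homogeneous, hz', c₂.coord_smul, ← Complex.exp_nat_mul,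
      ← Complex.exp_nat_mul]
    congr 2
    have h1 : (γ : ℂ) * r j = c₂.deg j := by exact_mod_cast hp.weight j
    have hγ' : (γ : ℂ) ≠ 0 := Complex.ofReal_ne_zero.2 hγ.ne'
    rw [← h1]
    field_simp

/-- The linear part of the equivariant Euler field commutes with `G₁`, so it is a scalar. The trace
formula identifies it with the quotient of the degree sums, which is what makes it a real number and
inverts it when the two groups are exchanged. -/
theorem IsCoordIso.exists_isTangentMap_of_irreducible (h : IsCoordIso c₁ c₂ Φ)
    (h0 : 0 ∈ Φ.source) (h00 : Φ 0 = 0)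
    (h₁ : IsIrreducibleEssential (reflHyperplanes G₁)) (hG₁ : FreeOnComplement G₁)
    (hG₂ : FreeOnComplement G₂) (hS : 0 < ∑ i, c₁.deg i) :
    ∃ p r, IsTangentMap c₁ c₂ Φ ((∑ j, c₂.deg j : ℕ) / (∑ i, c₁.deg i : ℕ)) p r := by
  obtain ⟨X, hX, hX0, hXe, hXΦ⟩ := h.exists_euler h0 hG₁ hG₂ (eq_zero_of_forall_map_eq h₁)
  obtain ⟨a, ha⟩ := exists_scalar_of_commute h₁ (T := (fderiv ℂ X 0 : V₁ →ₗ[ℂ] V₁))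
    (fun g hg v => by
      have e1 : HasFDerivAt X (fderiv ℂ X 0) (toCLM g 0) := by
        rw [map_zero]; exact hX.differentiableAt.hasFDerivAt
      have e2 := e1.comp 0 (toCLM g).hasFDerivAt
      have e3 := (toCLM g).hasFDerivAt.comp 0 hX.differentiableAt.hasFDerivAt
      exact DFunLike.congr_fun (e2.unique (e3.congr_of_eventuallyEq (hXe g hg))) v)
  have hsum := h.mul_sum_deg h0 hX hX0 ha hXe hXΦ
  have hS' : ((∑ i, c₁.deg i : ℕ) : ℂ) ≠ 0 := Nat.cast_ne_zero.2 hS.ne'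
  refine h.exists_isTangentMap h0 h00 hX hX0 (fun v => ?_) hXΦ
  rw [← ContinuousLinearMap.coe_coe, ha]
  congr 1
  push_cast at hS' ⊢
  rw [eq_div_iff hS', hsum]

theorem exists_isDiscriminantIso_of_germs (hG₁ : IsReflectionGroup G₁)
    (hG₂ : IsReflectionGroup G₂) (h₁ : IsIrreducibleEssential (reflHyperplanes G₁))
    (h₂ : IsIrreducibleEssential (reflHyperplanes G₂)) (h : DiscriminantGermsIso G₁ G₂) :
    ∃ f : OrbitSpace G₁ ≃ₜ OrbitSpace G₂, IsDiscriminantIso G₁ G₂ f := by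
  obtain ⟨c₁⟩ := exists_orbitCoordinates hG₁
  obtain ⟨c₂⟩ := exists_orbitCoordinates hG₂
  obtain ⟨Φ, hΦ, h0, h00⟩ := exists_isCoordIso c₁ c₂ h₁ h₂ h
  have hn₁ := one_le_finrank h₁
  have hn₂ := one_le_finrank h₂
  have : Nontrivial V₁ := Module.nontrivial_of_finrank_pos (R := ℂ) hn₁
  have : Nontrivial V₂ := Module.nontrivial_of_finrank_pos (R := ℂ) hn₂
  have : Nonempty (Fin (finrank ℂ V₁)) := ⟨⟨0, hn₁⟩⟩
  have : Nonempty (Fin (finrank ℂ V₂)) := ⟨⟨0, hn₂⟩⟩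
  have hS₁ : 0 < ∑ i, c₁.deg i := Finset.sum_pos (fun i _ => c₁.deg_pos i) Finset.univ_nonempty
  have hS₂ : 0 < ∑ i, c₂.deg i := Finset.sum_pos (fun i _ => c₂.deg_pos i) Finset.univ_nonempty
  obtain ⟨p, r, hp⟩ := hΦ.exists_isTangentMap_of_irreducible h0 h00 h₁ (freeOnComplement hG₁)
    (freeOnComplement hG₂) hS₁
  have h0' : 0 ∈ Φ.symm.source := by
    have := Φ.map_source h0
    rwa [h00] at this
  have h00' : Φ.symm 0 = 0 := by
    have := Φ.left_inv h0
    rwa [h00] at this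
  obtain ⟨p', r', hp'⟩ := hΦ.symm.exists_isTangentMap_of_irreducible h0' h00' h₂
    (freeOnComplement hG₂) (freeOnComplement hG₁) hS₂
  refine hp.exists_isDiscriminantIso (div_pos (Nat.cast_pos.2 hS₂) (Nat.cast_pos.2 hS₁)) ?_ hΦ h0
    h00 (p' := p') (r' := r')
  rwa [inv_div]

end GermIso

end DunklDuality

end

/-! ### The duality theorem and its corollary -/

theorem theorem5p4 {V₁ : Type u} [NormedAddCommGroup V₁] [NormedSpace ℂ V₁]
    [FiniteDimensional ℂ V₁] {V₂ : Type v} [NormedAddCommGroup V₂] [NormedSpace ℂ V₂]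
    [FiniteDimensional ℂ V₂] (G₁ : Subgroup (V₁ ≃ₗ[ℂ] V₁)) (G₂ : Subgroup (V₂ ≃ₗ[ℂ] V₂))
    [Finite G₁] [Finite G₂] (hG₁ : DunklDuality.IsReflectionGroup G₁)
    (hG₂ : DunklDuality.IsReflectionGroup G₂) :
    (∀ f : DunklDuality.OrbitSpace G₁ ≃ₜ DunklDuality.OrbitSpace G₂,
      DunklDuality.IsDiscriminantIso G₁ G₂ f →
        DunklDuality.FromDevelopingMap G₁ G₂ f ∧ DunklDuality.FromDevelopingMap G₂ G₁ f.symm) ∧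
    (DunklDuality.IsIrreducibleEssential (DunklDuality.reflHyperplanes G₁) →
      DunklDuality.IsIrreducibleEssential (DunklDuality.reflHyperplanes G₂) →
      DunklDuality.DiscriminantGermsIso G₁ G₂ →
        ∃ f : DunklDuality.OrbitSpace G₁ ≃ₜ DunklDuality.OrbitSpace G₂,
          DunklDuality.IsDiscriminantIso G₁ G₂ f ∧
          DunklDuality.FromDevelopingMap G₁ G₂ f ∧
          DunklDuality.FromDevelopingMap G₂ G₁ f.symm) := by
  have hF₁ := DunklDuality.freeOnComplement hG₁
  have hF₂ := DunklDuality.freeOnComplement hG₂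
  have hdev : ∀ f : DunklDuality.OrbitSpace G₁ ≃ₜ DunklDuality.OrbitSpace G₂,
      DunklDuality.IsDiscriminantIso G₁ G₂ f →
        DunklDuality.FromDevelopingMap G₁ G₂ f ∧ DunklDuality.FromDevelopingMap G₂ G₁ f.symm :=
    fun f hf => ⟨hf.fromDevelopingMap hF₁ hF₂, hf.symm.fromDevelopingMap hF₂ hF₁⟩
  refine ⟨hdev, fun h₁ h₂ h => ?_⟩
  obtain ⟨f, hf⟩ := DunklDuality.exists_isDiscriminantIso_of_germs hG₁ hG₂ h₁ h₂ h
  exact ⟨f, hf, hdev f hf⟩
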